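/- Let $1<\alpha<2$, let $\lambda_1,\lambda_2\in\mathbb R$, let $N\ge 0$ be an integer, $\Omega=(a,b)$ a bounded interval and $T>0$. For $0<\mu<1$ let $$\Delta_{-\mu/2}f(x)=\frac{1}{2\cos(\pi\mu/2)\,\Gamma(\mu)}\Big(\int_{-\infty}^x (x-s)^{\mu-1}f(s)\,ds+\int_x^\infty (s-x)^{\mu-1}f(s)\,ds\Big),$$ and let $(-\Delta)^{\alpha/2}$ be the negative of the Riesz derivative, $$(-\Delta)^{\alpha/2}u(x)=\frac{1}{2\cos(\pi\alpha/2)\,\Gamma(2-\alpha)}\Big(\int_{-\infty}^x (x-s)^{1-\alpha}u''(s)\,ds+\int_x^\infty (s-x)^{1-\alpha}u''(s)\,ds\Big)=-\Delta_{(\alpha-2)/2}(u'')(x).$$ Consider the linear fractional Schrödinger equation $$iu_t-\lambda_1(-\Delta)^{\alpha/2}u+\lambda_2u=g\quad\text{in }\Omega\times[0,T]$$ (the case $g=0$ is the homogeneous equation) with homogeneous boundary conditions: $u(\cdot,t)=0$ outside $\Omega$ and $u(\cdot,t)\in C^1(\mathbb R)$. Let $u$ be a solution of class $C^{N+4}$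 on $[0,T]\times\overline\Omega$. *Scheme.* Let $a=x_{1/2}<x_{3/2}<\dots<x_{K+1/2}=b$, $D^k=[x_{k-1/2},x_{k+1/2}]$, $h=\max_k|D^k|$, and let $V_h$ be the space of functions on $\Omega_h=\bigcup_kD^k$ that are polynomials of degree at most $N$ on each $D^k$, extended by zero outside $\Omega$ (so the traces from outside $\Omega$ are zero). Write $(\cdot,\cdot)_{D^k}$ for the $L^2(D^k)$ inner product, $v^-$ and $v^+$ for the left and right traces at a node, and $[c\,\phi]_{\partial D^k}=c_{k+1/2}\,\phi(x_{k+1/2}^-)-c_{k-1/2}\,\phi(x_{k-1/2}^+)$. The semidiscrete LDG solution $u_h=p_h+iq_h$ is given by real $p_h,q_h,e_h,l_h,r_h,s_h,w_h,z_h$ with values in $V_h$ such that for all $t\in[0,T]$, all $k$ and all polynomials $\phi$ of degree at most $N$, $$\begin{aligned} &((p_h)_t,\phi)_{D^k}+\lambda_1(e_h,\phi)_{D^k}+\lambda_2(q_h,\phi)_{D^k}=(\operatorname{Im}g,\phi)_{D^k},\\ &((q_h)_t,\phi)_{D^k}-\lambda_1(l_h,\phi)_{D^k}-\lambda_2(p_h,\phi)_{D^k}=-(\operatorname{Re}g,\phi)_{D^k},\\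 &(e_h,\phi)_{D^k}=(\Delta_{(\alpha-2)/2}r_h,\phi)_{D^k},\qquad (l_h,\phi)_{D^k}=(\Delta_{(\alpha-2)/2}w_h,\phi)_{D^k},\\ &(r_h,\phi)_{D^k}=-(s_h,\phi_x)_{D^k}+[s_h^+\phi]_{\partial D^k},\qquad (s_h,\phi)_{D^k}=-(q_h,\phi_x)_{D^k}+[q_h^-\phi]_{\partial D^k},\\ &(w_h,\phi)_{D^k}=-(z_h,\phi_x)_{D^k}+[z_h^+\phi]_{\partial D^k},\qquad (z_h,\phi)_{D^k}=-(p_h,\phi_x)_{D^k}+[p_h^-\phi]_{\partial D^k}, \end{aligned}$$ with initial data $p_h(0)=\mathcal P^-\operatorname{Re}u(\cdot,0)$ and $q_h(0)=\mathcal P^-\operatorname{Im}u(\cdot,0)$. Here $\mathcal P^-f\in V_h$ is the Gauss–Radau projection: on each $D^k$, $\mathcal P^-f-f$ is orthogonal to the polynomials of degree less than $N$, and $\mathcal P^-f(x_{k+1/2}^-)=f(x_{k+1/2})$. **Theorem.** For every $R$ there are constants $C>0$ and $h_0>0$, depending only on $N,\alpha,\lambda_1,\lambda_2,a,b,T,R$,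 such that if all derivatives of $u$ of order at most $N+4$ are bounded by $R$ on $[0,T]\times\overline\Omega$, then for every mesh with $h\le h_0$ and every $t\in[0,T]$, $$\|u(\cdot,t)-u_h(\cdot,t)\|_{L^2(\Omega_h)}\le C\,h^{N+1}.$$ -/

import Mathlib

open MeasureTheory Set

noncomputable section

namespace FracLDG

/-! ### Fractional operators on the real line -/

/-- Left-sided Riemann-Liouville integral of order `μ > 0` on `(-∞, x)`. -/
def leftRL {E : Type*} [NormedAddCommGroup E] [NormedSpace ℝ E]
    (μ : ℝ) (f : ℝ → E) (x : ℝ) : E :=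
  (Real.Gamma μ)⁻¹ • ∫ s in Iio x, ((x - s) ^ (μ - 1)) • f s

/-- Right-sided Riemann-Liouville integral of order `μ > 0` on `(x, ∞)`. -/
def rightRL {E : Type*} [NormedAddCommGroup E] [NormedSpace ℝ E]
    (μ : ℝ) (f : ℝ → E) (x : ℝ) : E :=
  (Real.Gamma μ)⁻¹ • ∫ s in Ioi x, ((s - x) ^ (μ - 1)) • f s

/-- The fractional integral operator `Δ_{-μ/2}` for `0 < μ < 1`: the sum of the two
Riemann-Liouville integrals of order `μ`, divided by `2 cos (π μ / 2)`. -/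
def fracIntegral {E : Type*} [NormedAddCommGroup E] [NormedSpace ℝ E]
    (μ : ℝ) (f : ℝ → E) (x : ℝ) : E :=
  (2 * Real.cos (Real.pi * μ / 2))⁻¹ • (leftRL μ f x + rightRL μ f x)

/-- Left Caputo derivative of order `α`, for `1 < α < 2`. -/
def caputoLeft {E : Type*} [NormedAddCommGroup E] [NormedSpace ℝ E]
    (α : ℝ) (f : ℝ → E) (x : ℝ) : E :=
  leftRL (2 - α) (iteratedDeriv 2 f) x

/-- Right Caputo derivative of order `α`, for `1 < α < 2` (here `(-1)² = 1`). -/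
def caputoRight {E : Type*} [NormedAddCommGroup E] [NormedSpace ℝ E]
    (α : ℝ) (f : ℝ → E) (x : ℝ) : E :=
  rightRL (2 - α) (iteratedDeriv 2 f) x

/-- The fractional Laplacian `(-Δ)^{α/2}`, `1 < α < 2`, as the negative of the Riesz derivative,
`(D_left^α + D_right^α) / (2 cos (π α / 2))`. -/
def fracLaplacian {E : Type*} [NormedAddCommGroup E] [NormedSpace ℝ E]
    (α : ℝ) (f : ℝ → E) (x : ℝ) : E :=
  (2 * Real.cos (Real.pi * α / 2))⁻¹ • (caputoLeft α f x + caputoRight α f x)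

/-! ### The exact problem -/

/-- `u` solves `i u_t - λ₁ (-Δ)^{α/2} u + λ₂ u = g` on `(a, b)` for `t ∈ [0, T]`, with homogeneous
(exterior) boundary conditions: `u(·, t)` vanishes outside `(a, b)` and is of class `C¹` on the
line, so that its second derivative is a function and `-(-Δ)^{α/2} u = Δ_{(α-2)/2} u_xx`. -/
structure IsExactSolution (α lam1 lam2 a b T : ℝ) (g u : ℝ → ℝ → ℂ) : Prop where
  zero_outside : ∀ t ∈ Icc 0 T, ∀ x ∉ Ioo a b, u t x = 0
  contDiff_one : ∀ t ∈ Icc 0 T, ContDiff ℝ 1 (u t)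
  equation : ∀ t ∈ Icc 0 T, ∀ x ∈ Ioo a b,
    Complex.I * derivWithin (fun τ => u τ x) (Icc 0 T) t
      - (lam1 : ℂ) * fracLaplacian α (u t) x + (lam2 : ℂ) * u t x = g t x

/-- `u` is of class `C^m` on the closed space-time cylinder `[0, T] × [a, b]`, with all derivatives
up to order `m` bounded by `R` there. -/
def BoundedSmooth (m : ℕ) (a b T R : ℝ) (u : ℝ → ℝ → ℂ) : Prop :=
  ContDiffOn ℝ m (fun y : ℝ × ℝ => u y.1 y.2) (Icc 0 T ×ˢ Icc a b) ∧
  ∀ k ≤ m, ∀ y ∈ Icc 0 T ×ˢ Icc a b,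
    ‖iteratedFDerivWithin ℝ k (fun y : ℝ × ℝ => u y.1 y.2) (Icc 0 T ×ˢ Icc a b) y‖ ≤ R

/-! ### Meshes and piecewise polynomials -/

/-- A partition of `[a, b]` into `K` elements `D^k = [node k, node (k+1)]`. -/
structure Mesh (a b : ℝ) (K : ℕ) where
  node : Fin (K + 1) → ℝ
  strictMono : StrictMono node
  node_zero : node 0 = a
  node_last : node (Fin.last K) = b

/-- A piecewise polynomial on `K` elements: one (global) polynomial for each element. -/
abbrev PWPoly (K : ℕ) : Type := Fin K → Polynomial ℝ

/-- Membership in the approximation space: degree at most `N` on each element. -/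
def PWPoly.DegLE {K : ℕ} (N : ℕ) (v : PWPoly K) : Prop := ∀ k, (v k).natDegree ≤ N

namespace Mesh

variable {a b : ℝ} {K : ℕ}

/-- Left end point of the element `D^k`. -/
def lo (m : Mesh a b K) (k : Fin K) : ℝ := m.node k.castSucc

/-- Right end point of the element `D^k`. -/
def hi (m : Mesh a b K) (k : Fin K) : ℝ := m.node k.succ

/-- The mesh size `h`: the largest length of an element. -/
def size (m : Mesh a b K) : ℝ := ⨆ k, (m.hi k - m.lo k)

/-- The local inner product `(f, g)_{D^k}`. -/
def inner (m : Mesh a b K) (k : Fin K) (f g : ℝ → ℝ) : ℝ :=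
  ∫ x in (m.lo k)..(m.hi k), f x * g x

/-- The function on the line given by a piecewise polynomial, extended by zero. -/
def toFun (m : Mesh a b K) (v : PWPoly K) (x : ℝ) : ℝ :=
  ∑ k, (Ioo (m.lo k) (m.hi k)).indicator (fun y => (v k).eval y) x

/-- The traces `v⁻` at the nodes, taken from the element on the left; the exterior value at the
left end of the domain is zero. -/
def traceMinus (m : Mesh a b K) (v : PWPoly K) (j : Fin (K + 1)) : ℝ :=
  Fin.cases (motive := fun _ => ℝ) 0 (fun k => (v k).eval (m.hi k)) j

/-- The traces `v⁺` at the nodes, taken from the element on the right; the exterior value at the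
right end of the domain is zero. -/
def tracePlus (m : Mesh a b K) (v : PWPoly K) (j : Fin (K + 1)) : ℝ :=
  Fin.lastCases (motive := fun _ => ℝ) 0 (fun k => (v k).eval (m.lo k)) j

/-- The boundary term `(n.c, φ)_{∂D^k}` for a numerical trace `c` given at the nodes. -/
def bdry (m : Mesh a b K) (k : Fin K) (c : Fin (K + 1) → ℝ) (φ : Polynomial ℝ) : ℝ :=
  c k.succ * φ.eval (m.hi k) - c k.castSucc * φ.eval (m.lo k)

/-- `w` is the Gauss-Radau projection `P⁻ f` of degree `N`: on each element, `w - f` is orthogonal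
to the polynomials of degree less than `N`, and `w` equals `f` at the right end point. -/
def IsProjMinus (m : Mesh a b K) (N : ℕ) (f : ℝ → ℝ) (w : PWPoly K) : Prop :=
  w.DegLE N ∧
  (∀ k, ∀ φ : Polynomial ℝ, φ.degree < N →
    m.inner k (fun x => (w k).eval x - f x) (fun x => φ.eval x) = 0) ∧
  ∀ k, (w k).eval (m.hi k) = f (m.hi k)

/-- The broken norm of `L²(Ω_h)` of a complex function. -/
def normL2 (m : Mesh a b K) (f : Fin K → ℝ → ℂ) : ℝ :=
  Real.sqrt (∑ k, ∫ x in (m.lo k)..(m.hi k), ‖f k x‖ ^ 2)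

end Mesh

/-! ### The semidiscrete local discontinuous Galerkin scheme -/

/-- The eight discrete unknowns at one time, `u_h = p + i q`. -/
structure State (K : ℕ) where
  p : PWPoly K
  q : PWPoly K
  e : PWPoly K
  l : PWPoly K
  r : PWPoly K
  s : PWPoly K
  w : PWPoly K
  z : PWPoly K

/-- All components belong to the approximation space of degree `N`. -/
def State.DegLE {K : ℕ} (N : ℕ) (U : State K) : Prop :=
  U.p.DegLE N ∧ U.q.DegLE N ∧ U.e.DegLE N ∧ U.l.DegLE N ∧
  U.r.DegLE N ∧ U.s.DegLE N ∧ U.w.DegLE N ∧ U.z.DegLE N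

/-- The auxiliary equations of the scheme on every element, with the alternating fluxes
`p* = p⁻`, `q* = q⁻`, `s* = s⁺`, `z* = z⁺`. -/
structure AuxEquations {a b : ℝ} {K : ℕ} (α : ℝ) (N : ℕ) (m : Mesh a b K) (U : State K) :
    Prop where
  e_eq : ∀ k, ∀ β : Polynomial ℝ, β.natDegree ≤ N →
    m.inner k (fun x => (U.e k).eval x) (fun x => β.eval x)
      = m.inner k (fracIntegral (2 - α) (m.toFun U.r)) (fun x => β.eval x)
  r_eq : ∀ k, ∀ φ : Polynomial ℝ, φ.natDegree ≤ N →
    m.inner k (fun x => (U.r k).eval x) (fun x => φ.eval x)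
      = - m.inner k (fun x => (U.s k).eval x) (fun x => φ.derivative.eval x)
        + m.bdry k (m.tracePlus U.s) φ
  s_eq : ∀ k, ∀ φ : Polynomial ℝ, φ.natDegree ≤ N →
    m.inner k (fun x => (U.s k).eval x) (fun x => φ.eval x)
      = - m.inner k (fun x => (U.q k).eval x) (fun x => φ.derivative.eval x)
        + m.bdry k (m.traceMinus U.q) φ
  l_eq : ∀ k, ∀ β : Polynomial ℝ, β.natDegree ≤ N →
    m.inner k (fun x => (U.l k).eval x) (fun x => β.eval x)
      = m.inner k (fracIntegral (2 - α) (m.toFun U.w)) (fun x => β.eval x)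
  w_eq : ∀ k, ∀ ψ : Polynomial ℝ, ψ.natDegree ≤ N →
    m.inner k (fun x => (U.w k).eval x) (fun x => ψ.eval x)
      = - m.inner k (fun x => (U.z k).eval x) (fun x => ψ.derivative.eval x)
        + m.bdry k (m.tracePlus U.z) ψ
  z_eq : ∀ k, ∀ ζ : Polynomial ℝ, ζ.natDegree ≤ N →
    m.inner k (fun x => (U.z k).eval x) (fun x => ζ.eval x)
      = - m.inner k (fun x => (U.p k).eval x) (fun x => ζ.derivative.eval x)
        + m.bdry k (m.traceMinus U.p) ζ

/-- `U` is a solution on `[0, T]` of the semidiscrete scheme for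
`i u_t - λ₁ (-Δ)^{α/2} u + λ₂ u = g`. -/
structure IsLDGSolution {a b : ℝ} {K : ℕ} (α lam1 lam2 T : ℝ) (N : ℕ) (m : Mesh a b K)
    (g : ℝ → ℝ → ℂ) (U : ℝ → State K) : Prop where
  degLE : ∀ t ∈ Icc 0 T, (U t).DegLE N
  diff_p : ∀ k x, DifferentiableOn ℝ (fun τ => ((U τ).p k).eval x) (Icc 0 T)
  diff_q : ∀ k x, DifferentiableOn ℝ (fun τ => ((U τ).q k).eval x) (Icc 0 T)
  aux : ∀ t ∈ Icc 0 T, AuxEquations α N m (U t)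
  p_eq : ∀ t ∈ Icc 0 T, ∀ k, ∀ θ : Polynomial ℝ, θ.natDegree ≤ N →
    m.inner k (fun x => derivWithin (fun τ => ((U τ).p k).eval x) (Icc 0 T) t)
        (fun x => θ.eval x)
      + lam1 * m.inner k (fun x => ((U t).e k).eval x) (fun x => θ.eval x)
      + lam2 * m.inner k (fun x => ((U t).q k).eval x) (fun x => θ.eval x)
      = m.inner k (fun x => (g t x).im) (fun x => θ.eval x)
  q_eq : ∀ t ∈ Icc 0 T, ∀ k, ∀ χ : Polynomial ℝ, χ.natDegree ≤ N →
    m.inner k (fun x => derivWithin (fun τ => ((U τ).q k).eval x) (Icc 0 T) t)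
        (fun x => χ.eval x)
      - lam1 * m.inner k (fun x => ((U t).l k).eval x) (fun x => χ.eval x)
      - lam2 * m.inner k (fun x => ((U t).p k).eval x) (fun x => χ.eval x)
      = - m.inner k (fun x => (g t x).re) (fun x => χ.eval x)

end FracLDG

end

noncomputable section

open Filter Topology

namespace FracLDG

section

/-- Bounded measurable functions on the line that vanish outside `[a, b]`. -/
structure Adm (a b : ℝ) (v : ℝ → ℝ) : Prop where
  meas : Measurable v
  bdd : ∃ M, ∀ x, |v x| ≤ M
  supp : ∀ x, x ∉ Icc a b → v x = 0

namespace Adm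

variable {a b : ℝ} {v w : ℝ → ℝ}

theorem exists_pos_bound (hv : Adm a b v) : ∃ M, 0 < M ∧ ∀ x, |v x| ≤ M := by
  obtain ⟨M, hM⟩ := hv.bdd
  exact ⟨|M| + 1, by positivity, fun x => (hM x).trans ((le_abs_self M).trans (by linarith))⟩

theorem add (hv : Adm a b v) (hw : Adm a b w) : Adm a b (fun x => v x + w x) := by
  obtain ⟨M, hM⟩ := hv.bdd
  obtain ⟨M', hM'⟩ := hw.bdd
  exact ⟨hv.meas.add hw.meas, ⟨M + M', fun x => (abs_add_le _ _).trans (add_le_add (hM x) (hM' x))⟩,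
    fun x hx => by simp [hv.supp x hx, hw.supp x hx]⟩

theorem const_mul (hv : Adm a b v) (c : ℝ) : Adm a b (fun x => c * v x) := by
  obtain ⟨M, hM⟩ := hv.bdd
  exact ⟨hv.meas.const_mul c, ⟨|c| * M, fun x => by
    rw [abs_mul]; exact mul_le_mul_of_nonneg_left (hM x) (abs_nonneg c)⟩,
    fun x hx => by simp [hv.supp x hx]⟩

theorem sub (hv : Adm a b v) (hw : Adm a b w) : Adm a b (fun x => v x - w x) := by
  have := hv.add (hw.const_mul (-1))
  simpa [sub_eq_add_neg] using this

theorem mul (hv : Adm a b v) (hw : Adm a b w) : Adm a b (fun x => v x * w x) := by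
  obtain ⟨M, hM⟩ := hv.bdd
  obtain ⟨M', hM'⟩ := hw.bdd
  exact ⟨hv.meas.mul hw.meas, ⟨M * M', fun x => by
    rw [abs_mul]
    exact mul_le_mul (hM x) (hM' x) (abs_nonneg _) ((abs_nonneg _).trans (hM x))⟩,
    fun x hx => by simp [hv.supp x hx]⟩

theorem sq (hv : Adm a b v) : Adm a b (fun x => v x ^ 2) := by
  simpa [pow_two] using hv.mul hv

theorem abs (hv : Adm a b v) : Adm a b (fun x => |v x|) := by
  obtain ⟨M, hM⟩ := hv.bdd
  refine ⟨hv.meas.abs, ⟨M, fun x => ?_⟩, fun x hx => by simp [hv.supp x hx]⟩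
  rw [abs_abs]; exact hM x

theorem mono {a' b' : ℝ} (hv : Adm a b v) (ha : a' ≤ a) (hb : b ≤ b') : Adm a' b' v :=
  ⟨hv.meas, hv.bdd, fun x hx => hv.supp x fun h => hx ⟨ha.trans h.1, h.2.trans hb⟩⟩

theorem integrable_const_ind : Integrable ((Icc a b).indicator fun _ => (1 : ℝ)) := by
  rw [integrable_indicator_iff measurableSet_Icc]
  exact integrableOn_const (by simp)

theorem integrable (hv : Adm a b v) : Integrable v := by
  obtain ⟨M, hM0, hM⟩ := hv.exists_pos_bound
  refine (integrable_const_ind (a := a) (b := b)).const_mul M |>.mono' hv.meas.aestronglyMeasurable ?_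
  refine .of_forall fun x => ?_
  by_cases hx : x ∈ Icc a b
  · simpa [hx] using hM x
  · simp [hx, hv.supp x hx]

theorem integral_eq (hv : Adm a b v) : ∫ x, v x = ∫ x in Icc a b, v x := by
  rw [← integral_indicator measurableSet_Icc]
  congr 1; ext x
  by_cases hx : x ∈ Icc a b
  · simp [hx]
  · simp [hx, hv.supp x hx]

end Adm

/-- The bilinear form with convolution kernel `k`. -/
def bil (k v w : ℝ → ℝ) : ℝ := ∫ z : ℝ × ℝ, v z.1 * w z.2 * k (z.1 - z.2)

/-- Only differences up to `b - a` matter for functions supported in `[a, b]`. -/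
theorem mul_kernel_indicator {a b : ℝ} {v w k : ℝ → ℝ} (hv : Adm a b v) (hw : Adm a b w)
    (z : ℝ × ℝ) :
    v z.1 * w z.2 * k (z.1 - z.2)
      = v z.1 * w z.2 * (Icc (-(b - a)) (b - a)).indicator k (z.1 - z.2) := by
  by_cases h1 : z.1 ∈ Icc a b
  · by_cases h2 : z.2 ∈ Icc a b
    · rw [indicator_of_mem]
      exact ⟨by linarith [h1.1, h2.2], by linarith [h1.2, h2.1]⟩
    · simp [hw.supp _ h2]
  · simp [hv.supp _ h1]

theorem integrable_bil {a b : ℝ} {v w k : ℝ → ℝ} (hv : Adm a b v) (hw : Adm a b w)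
    (hk : IntegrableOn k (Icc (-(b - a)) (b - a))) :
    Integrable (fun z : ℝ × ℝ => v z.1 * w z.2 * k (z.1 - z.2)) := by
  have hk' : Integrable ((Icc (-(b - a)) (b - a)).indicator k) :=
    (integrable_indicator_iff measurableSet_Icc).2 hk
  have h := hw.integrable.convolution_integrand (ContinuousLinearMap.mul ℝ ℝ) hk'
  obtain ⟨M, hM0, hM⟩ := hv.exists_pos_bound
  have h2 := Integrable.bdd_mul (c := M) (f := fun z : ℝ × ℝ => v z.1) h
    (hv.meas.comp measurable_fst).aestronglyMeasurable (.of_forall fun z => hM z.1)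
  rw [Measure.volume_eq_prod]
  refine h2.congr (.of_forall fun z => ?_)
  change v z.1 * (w z.2 * _) = v z.1 * w z.2 * k (z.1 - z.2)
  rw [mul_kernel_indicator hv hw z, mul_assoc]

theorem ae_ne_fst_snd : ∀ᵐ z : ℝ × ℝ, z.1 - z.2 ≠ 0 := by
  rw [ae_iff, Measure.volume_eq_prod]
  have : {z : ℝ × ℝ | ¬ (z.1 - z.2 ≠ 0)} = {z : ℝ × ℝ | z.1 - z.2 = 0} := by ext; simp
  rw [this]
  refine Measure.measure_prod_null_of_ae_null
    (measurableSet_eq_fun (measurable_fst.sub measurable_snd) measurable_const) ?_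
  refine .of_forall fun x => ?_
  have : Prod.mk x ⁻¹' {z : ℝ × ℝ | z.1 - z.2 = 0} = {x} := by
    ext y; simp [sub_eq_zero, eq_comm]
  simp [this]

theorem bil_congr_kernel {v w k k' : ℝ → ℝ} (h : ∀ d, d ≠ 0 → k d = k' d) :
    bil k v w = bil k' v w := by
  unfold bil
  refine integral_congr_ae ?_
  filter_upwards [ae_ne_fst_snd] with z hz
  rw [h _ hz]

theorem bil_add_left {a b : ℝ} {k : ℝ → ℝ} (hk : IntegrableOn k (Icc (-(b - a)) (b - a)))
    {v₁ v₂ w : ℝ → ℝ} (h₁ : Adm a b v₁) (h₂ : Adm a b v₂) (hw : Adm a b w) :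
    bil k (fun x => v₁ x + v₂ x) w = bil k v₁ w + bil k v₂ w := by
  unfold bil
  rw [← integral_add (integrable_bil h₁ hw hk) (integrable_bil h₂ hw hk)]
  congr 1; ext z; ring

theorem bil_const_mul_left {v w k : ℝ → ℝ} (c : ℝ) :
    bil k (fun x => c * v x) w = c * bil k v w := by
  unfold bil
  rw [← integral_const_mul]
  congr 1; ext z; ring

theorem bil_symm {v w k : ℝ → ℝ} (hk : ∀ d, k (-d) = k d) : bil k v w = bil k w v := by
  unfold bil
  rw [Measure.volume_eq_prod, ← integral_prod_swap]
  congr 1; ext z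
  simp only [Prod.fst_swap, Prod.snd_swap]
  rw [← hk (z.2 - z.1), neg_sub]; ring

theorem bil_eq_iterated {a b : ℝ} {v w k : ℝ → ℝ} (hv : Adm a b v) (hw : Adm a b w)
    (hk : IntegrableOn k (Icc (-(b - a)) (b - a))) :
    bil k v w = ∫ x, v x * ∫ s, k (x - s) * w s := by
  unfold bil
  have := integrable_bil hv hw hk
  rw [Measure.volume_eq_prod] at this ⊢
  rw [integral_prod _ this]
  congr 1; ext x
  rw [← integral_const_mul]
  congr 1; ext s; simp only; ring

/-- Superposition of kernels: the form commutes with an integral over a parameter. -/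
theorem bil_integral {a b : ℝ} {v w : ℝ → ℝ} (hv : Adm a b v) (hw : Adm a b w)
    {I : Set ℝ} {K : ℝ → ℝ → ℝ} (hK : Measurable (Function.uncurry K)) {B : ℝ → ℝ}
    (hB : IntegrableOn B (Icc (-(b - a)) (b - a)))
    (hKi : ∀ d, d ≠ 0 → IntegrableOn (fun r => K r d) I)
    (hKB : ∀ d, d ≠ 0 → ∫ r in I, |K r d| ≤ B d) :
    IntegrableOn (fun r => bil (K r) v w) I ∧
      bil (fun d => ∫ r in I, K r d) v w = ∫ r in I, bil (K r) v w := by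
  set F : ℝ × ℝ → ℝ → ℝ := fun z r => v z.1 * w z.2 * K r (z.1 - z.2) with hF
  have hmeas : Measurable (Function.uncurry F) := by
    have h1 : Measurable fun q : (ℝ × ℝ) × ℝ => (q.2, q.1.1 - q.1.2) := by fun_prop
    have h2 := hK.comp h1
    have h3 : Measurable fun q : (ℝ × ℝ) × ℝ => v q.1.1 * w q.1.2 :=
      (hv.meas.comp (by fun_prop)).mul (hw.meas.comp (by fun_prop))
    exact h3.mul h2
  have hint : Integrable (Function.uncurry F) ((volume : Measure (ℝ × ℝ)).prod (volume.restrict I)) := by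
    rw [integrable_prod_iff hmeas.aestronglyMeasurable]
    constructor
    · filter_upwards [ae_ne_fst_snd] with z hz
      exact (hKi _ hz).const_mul (v z.1 * w z.2)
    · have hb := (integrable_bil hv hw hB).norm
      refine hb.mono' (hmeas.norm.aestronglyMeasurable.integral_prod_right') ?_
      filter_upwards [ae_ne_fst_snd] with z hz
      have e : ∀ r, ‖Function.uncurry F (z, r)‖ = |v z.1 * w z.2| * |K r (z.1 - z.2)| := fun r => by
        simp [hF, Function.uncurry, abs_mul]
      simp only [e]
      rw [integral_const_mul, Real.norm_eq_abs, abs_of_nonneg (by positivity), norm_mul,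
        Real.norm_eq_abs (v z.1 * w z.2)]
      refine mul_le_mul_of_nonneg_left ((hKB _ hz).trans ?_) (abs_nonneg _)
      exact le_abs_self _
  refine ⟨hint.integral_prod_right, ?_⟩
  have h := integral_integral_swap hint
  simp only [bil]
  rw [← h]
  congr 1; ext z
  rw [← integral_const_mul]

end

section

theorem bil_add_kernel {a b : ℝ} {v w k k' : ℝ → ℝ} (hv : Adm a b v) (hw : Adm a b w)
    (hk : IntegrableOn k (Icc (-(b - a)) (b - a)))
    (hk' : IntegrableOn k' (Icc (-(b - a)) (b - a))) :
    bil (fun d => k d + k' d) v w = bil k v w + bil k' v w := by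
  unfold bil
  rw [← integral_add (integrable_bil hv hw hk) (integrable_bil hv hw hk')]
  congr 1; ext z; ring

theorem bil_const_mul_kernel {v w k : ℝ → ℝ} (c : ℝ) :
    bil (fun d => c * k d) v w = c * bil k v w := by
  unfold bil
  rw [← integral_const_mul]
  congr 1; ext z; ring

/-- The tent of width `r`. -/
def tent (r d : ℝ) : ℝ := max (r - |d|) 0

theorem continuous_tent : Continuous (Function.uncurry tent) := by
  unfold tent Function.uncurry; fun_prop

theorem integrableOn_tent (r : ℝ) (l : ℝ) : IntegrableOn (tent r) (Icc (-l) l) := by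
  have : Continuous (tent r) := by unfold tent; fun_prop
  exact this.continuousOn.integrableOn_compact isCompact_Icc

theorem tent_nonneg (r d : ℝ) : 0 ≤ tent r d := le_max_right _ _

/-- Indicator of the window `(t, t + r)`. -/
def box (r t s : ℝ) : ℝ := if t < s ∧ s < t + r then 1 else 0

theorem measurable_box (r : ℝ) : Measurable (Function.uncurry (box r)) := by
  unfold box Function.uncurry
  refine Measurable.ite ?_ measurable_const measurable_const
  exact (measurableSet_lt measurable_fst measurable_snd).inter
    (measurableSet_lt measurable_snd (measurable_fst.add_const r))

theorem box_nonneg (r t s : ℝ) : 0 ≤ box r t s := by unfold box; split_ifs <;> norm_num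

theorem box_le_one (r t s : ℝ) : box r t s ≤ 1 := by unfold box; split_ifs <;> norm_num

theorem integral_box_mul_box {r : ℝ} (x s : ℝ) :
    Integrable (fun t => box r t x * box r t s) ∧ ∫ t, box r t x * box r t s = tent r (x - s) := by
  have e : (fun t => box r t x * box r t s)
      = (Ioo (max x s - r) (min x s)).indicator fun _ => (1 : ℝ) := by
    ext t
    unfold box
    by_cases h : t ∈ Ioo (max x s - r) (min x s)
    · have h1 := h.1
      have h2 := h.2
      rw [lt_min_iff] at h2
      have h3 : x < t + r := by linarith [le_max_left x s]
      have h4 : s < t + r := by linarith [le_max_right x s]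
      simp [h, h2.1, h2.2, h3, h4]
    · rw [indicator_of_notMem h]
      by_contra hne
      rw [mul_eq_zero, not_or] at hne
      simp only [ite_eq_right_iff, not_forall] at hne
      obtain ⟨⟨⟨p1, p2⟩, -⟩, ⟨⟨p3, p4⟩, -⟩⟩ := hne
      refine h ⟨?_, lt_min p1 p3⟩
      rcases max_choice x s with h | h <;> rw [h] <;> linarith
  rw [e]
  constructor
  · rw [integrable_indicator_iff measurableSet_Ioo]
    exact integrableOn_const (by simp)
  · rw [integral_indicator measurableSet_Ioo, setIntegral_const, smul_eq_mul, mul_one,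
      Measure.real, Real.volume_Ioo, ENNReal.toReal_ofReal', tent]
    congr 1
    rw [abs_sub_comm, ← max_sub_min_eq_abs x s]; ring

/-- The integral of `w` over the window `(t, t + r)`. -/
def win (r : ℝ) (w : ℝ → ℝ) (t : ℝ) : ℝ := ∫ s, box r t s * w s

variable {a b : ℝ} {v w : ℝ → ℝ}

theorem integrable_box_mul (hw : Adm a b w) (r t : ℝ) : Integrable fun s => box r t s * w s := by
  refine Integrable.bdd_mul (c := 1) hw.integrable
    ((measurable_box r).comp (measurable_prodMk_left (x := t))).aestronglyMeasurable
    (.of_forall fun s => ?_)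
  rw [Real.norm_eq_abs, abs_of_nonneg (box_nonneg _ _ _)]
  exact box_le_one _ _ _

theorem adm_win (hw : Adm a b w) (r : ℝ) : Adm (a - r) b (win r w) := by
  refine ⟨?_, ⟨∫ s, |w s|, fun t => ?_⟩, fun t ht => ?_⟩
  · have h : Measurable fun p : ℝ × ℝ => box r p.1 p.2 * w p.2 :=
      (measurable_box r).mul (hw.meas.comp measurable_snd)
    exact h.stronglyMeasurable.integral_prod_right'.measurable
  · refine (abs_integral_le_integral_abs).trans ?_
    refine integral_mono (integrable_box_mul hw r t).abs hw.integrable.abs fun s => ?_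
    rw [abs_mul, abs_of_nonneg (box_nonneg _ _ _)]
    exact mul_le_of_le_one_left (abs_nonneg _) (box_le_one _ _ _)
  · unfold win
    rw [← integral_zero ℝ ℝ]
    congr 1; ext s
    by_cases hs : s ∈ Icc a b
    · have : ¬ (t < s ∧ s < t + r) := by
        rintro ⟨h1, h2⟩
        exact ht ⟨by linarith [hs.1], by linarith [hs.2]⟩
      simp [box, this]
    · simp [hw.supp s hs]

theorem integral_win_mul_win (hv : Adm a b v) (hw : Adm a b w) (r : ℝ) :
    ∫ t, win r v t * win r w t = bil (tent r) v w := by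
  set F : ℝ × ℝ → ℝ → ℝ := fun z t => (box r t z.1 * v z.1) * (box r t z.2 * w z.2) with hF
  have hFe : ∀ z t, F z t = v z.1 * w z.2 * (box r t z.1 * box r t z.2) := fun z t => by
    simp only [hF]; ring
  have hmeas : Measurable (Function.uncurry F) := by
    have h1 : Measurable fun q : (ℝ × ℝ) × ℝ => box r q.2 q.1.1 :=
      (measurable_box r).comp (f := fun q : (ℝ × ℝ) × ℝ => (q.2, q.1.1)) (by fun_prop)
    have h2 : Measurable fun q : (ℝ × ℝ) × ℝ => box r q.2 q.1.2 :=
      (measurable_box r).comp (f := fun q : (ℝ × ℝ) × ℝ => (q.2, q.1.2)) (by fun_prop)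
    exact (h1.mul (hv.meas.comp (by fun_prop))).mul (h2.mul (hw.meas.comp (by fun_prop)))
  have hint : Integrable (Function.uncurry F) ((volume : Measure (ℝ × ℝ)).prod volume) := by
    rw [integrable_prod_iff hmeas.aestronglyMeasurable]
    constructor
    · refine .of_forall fun z => ?_
      have := (integral_box_mul_box (r := r) z.1 z.2).1.const_mul (v z.1 * w z.2)
      refine this.congr (.of_forall fun t => (hFe z t).symm)
    · have hb := (integrable_bil hv hw (integrableOn_tent r _)).norm
      refine hb.congr (.of_forall fun z => ?_)
      have e : ∀ t, ‖Function.uncurry F (z, t)‖ = |v z.1 * w z.2| * (box r t z.1 * box r t z.2) :=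
        fun t => by
          change ‖F z t‖ = _
          rw [hFe, norm_mul, Real.norm_eq_abs, Real.norm_eq_abs,
            abs_of_nonneg (mul_nonneg (box_nonneg _ _ _) (box_nonneg _ _ _))]
      simp only [e]
      rw [integral_const_mul, (integral_box_mul_box z.1 z.2).2, norm_mul, Real.norm_eq_abs,
        Real.norm_eq_abs, abs_of_nonneg (tent_nonneg _ _)]
  have h := integral_integral_swap hint
  have e1 : ∀ z : ℝ × ℝ, ∫ t, F z t = v z.1 * w z.2 * tent r (z.1 - z.2) := fun z => by
    simp only [hFe]
    rw [integral_const_mul, (integral_box_mul_box z.1 z.2).2]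
  have e2 : ∀ t, ∫ z, F z t = win r v t * win r w t := fun t => by
    simp only [hF]
    rw [Measure.volume_eq_prod]
    exact integral_prod_mul (fun x => box r t x * v x) (fun s => box r t s * w s)
  simp only [e1, e2] at h
  exact h.symm

theorem bil_tent_nonneg (hv : Adm a b v) (r : ℝ) : 0 ≤ bil (tent r) v v := by
  rw [← integral_win_mul_win hv hv]
  exact integral_nonneg fun t => mul_self_nonneg _

/-- The weakly singular kernel `|d|^(μ-1)`. -/
def ker (μ d : ℝ) : ℝ := |d| ^ (μ - 1)

theorem ker_neg (μ d : ℝ) : ker μ (-d) = ker μ d := by simp [ker]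

theorem integrableOn_abs_rpow {ν : ℝ} (hν : -1 < ν) (l : ℝ) :
    IntegrableOn (fun d : ℝ => |d| ^ ν) (Icc (-l) l) := by
  have h1 : IntegrableOn (fun d : ℝ => |d| ^ ν) (Icc 0 l) := by
    have := (intervalIntegral.intervalIntegrable_rpow' hν (a := 0) (b := l)).1
    rw [← integrableOn_Icc_iff_integrableOn_Ioc] at this
    exact this.congr_fun (fun x hx => by simp only [abs_of_nonneg hx.1]) measurableSet_Icc
  have h2 : IntegrableOn (fun d : ℝ => |d| ^ ν) (Icc (-l) 0) := by
    have := h1.comp_neg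
    simpa using this
  exact (h2.union h1).mono_set fun x hx => by
    rcases le_total x 0 with h | h
    · exact Or.inl ⟨hx.1, h⟩
    · exact Or.inr ⟨h, hx.2⟩

theorem integrableOn_ker {μ : ℝ} (hμ : 0 < μ) (l : ℝ) : IntegrableOn (ker μ) (Icc (-l) l) :=
  integrableOn_abs_rpow (by linarith) l

theorem scale_integral {μ d : ℝ} (hμ1 : μ < 1) (hd : d ≠ 0) :
    IntegrableOn (fun r => r ^ (μ - 3) * tent r d) (Ioi 0) ∧
      ∫ r in Ioi 0, r ^ (μ - 3) * tent r d = ((1 - μ) * (2 - μ))⁻¹ * ker μ d := by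
  have hd' : 0 < |d| := abs_pos.2 hd
  have e : ∀ r ∈ Ioi (0:ℝ), r ^ (μ - 3) * tent r d
      = (Ioi |d|).indicator (fun r => r ^ (μ - 2) - |d| * r ^ (μ - 3)) r := by
    intro r hr
    have hr0 : 0 < r := hr
    by_cases h : r ∈ Ioi |d|
    · rw [indicator_of_mem h, tent, max_eq_left (by linarith [mem_Ioi.1 h]), mul_sub]
      have : r ^ (μ - 3) * r = r ^ (μ - 2) := by
        rw [← Real.rpow_add_one hr0.ne']; congr 1; ring
      rw [this]; ring
    · rw [indicator_of_notMem h, tent, max_eq_right (by linarith [not_lt.1 (fun h' => h (mem_Ioi.2 h'))]),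
        mul_zero]
  have hsub : Ioi (0:ℝ) ∩ Ioi |d| = Ioi |d| := by
    rw [Ioi_inter_Ioi, sup_eq_right.2 hd'.le]
  have i1 := integrableOn_Ioi_rpow_of_lt (a := μ - 2) (by linarith) hd'
  have i2 := (integrableOn_Ioi_rpow_of_lt (a := μ - 3) (by linarith) hd').const_mul |d|
  constructor
  · refine IntegrableOn.congr_fun ?_ (fun r hr => (e r hr).symm) measurableSet_Ioi
    rw [IntegrableOn, integrable_indicator_iff measurableSet_Ioi, IntegrableOn,
      Measure.restrict_restrict measurableSet_Ioi, inter_comm, hsub]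
    exact i1.sub i2
  · rw [setIntegral_congr_fun measurableSet_Ioi e, setIntegral_indicator measurableSet_Ioi, hsub,
      integral_sub i1 i2, integral_const_mul, integral_Ioi_rpow_of_lt (by linarith) hd',
      integral_Ioi_rpow_of_lt (by linarith) hd', ker]
    have e1 : μ - 2 + 1 = μ - 1 := by ring
    have e2 : |d| ^ (μ - 3 + 1) = |d| ^ (μ - 1) / |d| := by
      rw [← Real.rpow_sub_one hd'.ne']; congr 1; ring
    rw [e1, e2]
    have : μ - 3 + 1 ≠ 0 := by linarith
    have : μ - 1 ≠ 0 := by linarith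
    have : 1 - μ ≠ 0 := by linarith
    have : 2 - μ ≠ 0 := by linarith
    have : μ - 3 + 1 = -(2 - μ) := by ring
    rw [this]
    have : μ - 1 = -(1 - μ) := by ring
    rw [div_eq_mul_inv _ (μ - 1), this, neg_div_neg_eq]
    field_simp
    ring

/-- The energy form of the Riesz potential. -/
def en (μ : ℝ) (v w : ℝ → ℝ) : ℝ := bil (ker μ) v w

theorem measurable_scale (μ : ℝ) :
    Measurable (Function.uncurry fun r d : ℝ => r ^ (μ - 3) * tent r d) := by
  have := continuous_tent.measurable
  have h2 : Measurable fun q : ℝ × ℝ => q.1 ^ (μ - 3) := by fun_prop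
  exact h2.mul this

/-- Multi-scale representation of the energy. -/
theorem en_eq_scale {μ : ℝ} (hμ : 0 < μ) (hμ1 : μ < 1) (hv : Adm a b v) (hw : Adm a b w) :
    IntegrableOn (fun r => r ^ (μ - 3) * bil (tent r) v w) (Ioi 0) ∧
      ((1 - μ) * (2 - μ))⁻¹ * en μ v w = ∫ r in Ioi 0, r ^ (μ - 3) * bil (tent r) v w := by
  have h := bil_integral hv hw (measurable_scale μ)
    (B := fun d => ((1 - μ) * (2 - μ))⁻¹ * ker μ d) (I := Ioi 0)
    ((integrableOn_ker hμ _).const_mul _) (fun d hd => (scale_integral hμ1 hd).1)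
    (fun d hd => by
      rw [← (scale_integral hμ1 hd).2]
      refine le_of_eq (setIntegral_congr_fun measurableSet_Ioi fun r hr => ?_)
      exact abs_of_nonneg (mul_nonneg (Real.rpow_nonneg (le_of_lt hr) _) (tent_nonneg _ _)))
  simp only [bil_const_mul_kernel] at h
  refine ⟨h.1, ?_⟩
  rw [← h.2, en, ← bil_const_mul_kernel]
  exact bil_congr_kernel fun d hd => (scale_integral hμ1 hd).2.symm

theorem en_nonneg {μ : ℝ} (hμ : 0 < μ) (hμ1 : μ < 1) (hv : Adm a b v) : 0 ≤ en μ v v := by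
  have h := (en_eq_scale hμ hμ1 hv hv).2
  have hc : 0 < (1 - μ) * (2 - μ) := mul_pos (by linarith) (by linarith)
  have h2 : 0 ≤ ∫ r in Ioi 0, r ^ (μ - 3) * bil (tent r) v v :=
    setIntegral_nonneg measurableSet_Ioi fun r hr =>
      mul_nonneg (Real.rpow_nonneg (le_of_lt hr) _) (bil_tent_nonneg hv r)
  rw [← h] at h2
  exact nonneg_of_mul_nonneg_right h2 (inv_pos.2 hc)

theorem en_symm (μ : ℝ) : en μ v w = en μ w v := bil_symm (ker_neg μ)

theorem en_add_left {μ : ℝ} (hμ : 0 < μ) {v' : ℝ → ℝ} (hv : Adm a b v) (hv' : Adm a b v')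
    (hw : Adm a b w) : en μ (fun x => v x + v' x) w = en μ v w + en μ v' w :=
  bil_add_left (integrableOn_ker hμ _) hv hv' hw

theorem en_const_mul_left {μ : ℝ} (c : ℝ) : en μ (fun x => c * v x) w = c * en μ v w :=
  bil_const_mul_left c

/-- Cauchy-Schwarz inequality for the energy form. -/
theorem en_sq_le {μ : ℝ} (hμ : 0 < μ) (hμ1 : μ < 1) (hv : Adm a b v) (hw : Adm a b w) :
    en μ v w ^ 2 ≤ en μ v v * en μ w w := by
  have key : ∀ t : ℝ, 0 ≤ en μ w w * (t * t) + 2 * en μ v w * t + en μ v v := by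
    intro t
    have h := en_nonneg hμ hμ1 (hv.add (hw.const_mul t))
    rw [en_add_left hμ hv (hw.const_mul t) (hv.add (hw.const_mul t)), en_const_mul_left,
      en_symm, en_symm (v := w), en_add_left hμ hv (hw.const_mul t) hv,
      en_add_left hμ hv (hw.const_mul t) hw, en_const_mul_left, en_const_mul_left,
      en_symm (v := w) (w := v)] at h
    linarith
  have := discrim_le_zero key
  rw [discrim] at this
  nlinarith

end

section

namespace Mesh

variable {a b : ℝ} {K : ℕ} (m : Mesh a b K)

theorem lo_lt_hi (k : Fin K) : m.lo k < m.hi k := m.strictMono Fin.castSucc_lt_succ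

theorem len_pos (k : Fin K) : 0 < m.hi k - m.lo k := sub_pos.2 (m.lo_lt_hi k)

theorem le_node (j : Fin (K + 1)) : a ≤ m.node j := by
  exact m.node_zero.symm.trans_le (m.strictMono.monotone (Fin.zero_le _))

theorem node_le (j : Fin (K + 1)) : m.node j ≤ b := by
  exact (m.strictMono.monotone (Fin.le_last _)).trans_eq m.node_last

theorem le_lo (k : Fin K) : a ≤ m.lo k := m.le_node _

theorem hi_le (k : Fin K) : m.hi k ≤ b := m.node_le _

theorem len_le_size (k : Fin K) : m.hi k - m.lo k ≤ m.size :=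
  le_ciSup (f := fun k => m.hi k - m.lo k) (Set.finite_range _).bddAbove k

theorem exists_cell (m : Mesh a b K) (hab : a < b) : 0 < K := by
  rcases Nat.eq_zero_or_pos K with h | h
  · subst h
    have h1 := m.node_zero
    have h2 := m.node_last
    have : (0 : Fin 1) = Fin.last 0 := rfl
    rw [this, h2] at h1
    linarith
  · exact h

theorem size_pos (hab : a < b) : 0 < m.size := by
  have hK := m.exists_cell hab
  have := m.len_le_size ⟨0, hK⟩
  have := m.lo_lt_hi ⟨0, hK⟩
  linarith

theorem Ioo_subset (k : Fin K) : Ioo (m.lo k) (m.hi k) ⊆ Ioo a b :=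
  Ioo_subset_Ioo (m.le_lo k) (m.hi_le k)

theorem size_le (hab : a < b) : m.size ≤ b - a := by
  have hK := m.exists_cell hab
  have : Nonempty (Fin K) := ⟨⟨0, hK⟩⟩
  refine ciSup_le fun k => ?_
  linarith [m.le_lo k, m.hi_le k]

theorem disjoint_cells {k j : Fin K} (h : k ≠ j) :
    Disjoint (Ioo (m.lo k) (m.hi k)) (Ioo (m.lo j) (m.hi j)) := by
  rw [Set.disjoint_left]
  intro x hx hy
  rcases lt_or_gt_of_ne h with h | h
  · have : m.hi k ≤ m.lo j := m.strictMono.monotone (by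
      rw [Fin.le_def]; simpa using h)
    linarith [hx.2, hy.1]
  · have : m.hi j ≤ m.lo k := m.strictMono.monotone (by
      rw [Fin.le_def]; simpa using h)
    linarith [hx.1, hy.2]

theorem sum_integral (f : ℝ → ℝ) (hf : ∀ k, IntervalIntegrable f volume (m.lo k) (m.hi k)) :
    ∑ k, ∫ x in (m.lo k)..(m.hi k), f x = ∫ x in a..b, f x := by
  set nd : ℕ → ℝ := fun n => if h : n < K + 1 then m.node ⟨n, h⟩ else b with hnd
  have hlo : ∀ k : Fin K, m.lo k = nd k := fun k => by
    simp only [hnd]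
    rw [dif_pos (by omega)]
    rfl
  have hhi : ∀ k : Fin K, m.hi k = nd (k + 1) := fun k => by
    simp only [hnd]
    rw [dif_pos (by omega)]
    rfl
  have h := intervalIntegral.sum_integral_adjacent_intervals (f := f) (μ := volume) (a := nd) (n := K)
    (fun k hk => by
      have := hf ⟨k, hk⟩
      rwa [hlo, hhi] at this)
  have h0 : nd 0 = a := by simp only [hnd]; rw [dif_pos (by omega)]; exact m.node_zero
  have hK : nd K = b := by simp only [hnd]; rw [dif_pos (by omega)]; exact m.node_last
  rw [h0, hK] at h
  rw [← h, ← Fin.sum_univ_eq_sum_range (fun k => ∫ x in (nd k)..(nd (k + 1)), f x)]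
  exact Finset.sum_congr rfl fun k _ => by rw [hlo, hhi]

theorem sum_len : ∑ k, (m.hi k - m.lo k) = b - a := by
  have := m.sum_integral (fun _ => 1) (fun k => intervalIntegrable_const)
  simpa using this

/-- Induction along the nodes. -/
theorem node_induction {p : ℝ → Prop} (h0 : p a) (h : ∀ k, p (m.lo k) → p (m.hi k))
    (j : Fin (K + 1)) : p (m.node j) := by
  induction j using Fin.induction with
  | zero => rw [m.node_zero]; exact h0
  | succ k ih => exact h k ih

end Mesh

variable {a b : ℝ} {v w : ℝ → ℝ}

theorem Adm.intervalIntegrable (hv : Adm a b v) (x y : ℝ) : IntervalIntegrable v volume x y :=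
  hv.integrable.intervalIntegrable

theorem Adm.integral_eq_interval (hv : Adm a b v) (hab : a ≤ b) : ∫ x, v x = ∫ x in a..b, v x := by
  rw [hv.integral_eq, intervalIntegral.integral_of_le hab, integral_Icc_eq_integral_Ioc]

theorem Adm.integral_eq_sum {K : ℕ} (m : Mesh a b K) (hab : a < b) (hv : Adm a b v) :
    ∫ x, v x = ∑ k, ∫ x in (m.lo k)..(m.hi k), v x := by
  rw [m.sum_integral v fun k => hv.intervalIntegrable _ _, hv.integral_eq_interval hab.le]

theorem integral_box {r : ℝ} (hr : 0 ≤ r) (s : ℝ) :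
    Integrable (fun t => box r t s) ∧ ∫ t, box r t s = r := by
  have h := integral_box_mul_box (r := r) s s
  have e : ∀ t, box r t s * box r t s = box r t s := fun t => by
    unfold box; split_ifs <;> simp
  simp only [e] at h
  refine ⟨h.1, ?_⟩
  rw [h.2, tent, sub_self, abs_zero, sub_zero, max_eq_left hr]

theorem integral_box' {r : ℝ} (hr : 0 ≤ r) (t : ℝ) :
    Integrable (fun s => box r t s) ∧ ∫ s, box r t s = r := by
  have e : (fun s => box r t s) = (Ioo t (t + r)).indicator fun _ => (1 : ℝ) := by
    ext s; simp [box, indicator, mem_Ioo]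
  rw [e]
  constructor
  · rw [integrable_indicator_iff measurableSet_Ioo]
    exact integrableOn_const (by simp)
  · rw [integral_indicator measurableSet_Ioo, setIntegral_const, smul_eq_mul, mul_one,
      Measure.real, Real.volume_Ioo, ENNReal.toReal_ofReal', max_eq_left (by linarith)]
    ring

/-- The integral of a product with a window average is the form with a step kernel. -/
theorem integral_mul_win {a' b' : ℝ} (hw : Adm a b w) (hv : Adm a' b' v) (r : ℝ) :
    ∫ t, v t * win r w t = bil (fun d => box r d 0) v w := by
  have h1 : Adm (min a a') (max b b') v := hv.mono (min_le_right _ _) (le_max_right _ _)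
  have h2 : Adm (min a a') (max b b') w := hw.mono (min_le_left _ _) (le_max_left _ _)
  rw [bil_eq_iterated h1 h2]
  · congr 1; ext t
    unfold win
    congr 2; ext s
    congr 1
    unfold box
    have : (t < s ∧ s < t + r) ↔ (t - s < 0 ∧ 0 < t - s + r) := by
      constructor <;> rintro ⟨h1, h2⟩ <;> constructor <;> linarith
    simp only [this]
  · refine Integrable.mono' (integrableOn_const (C := (1:ℝ)) (by simp)) ?_ ?_
    · exact ((measurable_box r).comp (measurable_prodMk_right (y := (0:ℝ)))).aestronglyMeasurable
    · refine .of_forall fun d => ?_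
      rw [Real.norm_eq_abs, abs_of_nonneg (box_nonneg _ _ _)]
      exact box_le_one _ _ _

theorem integral_win (hw : Adm a b w) {r : ℝ} (hr : 0 ≤ r) : ∫ t, win r w t = r * ∫ s, w s := by
  have hI : Integrable (fun p : ℝ × ℝ => box r p.2 p.1 * w p.1) := by
    rw [Measure.volume_eq_prod, integrable_prod_iff]
    · constructor
      · exact .of_forall fun s => (integral_box hr s).1.mul_const (w s)
      · have : ∀ s, ∫ t, ‖box r t s * w s‖ = r * |w s| := fun s => by
          have e : ∀ t, ‖box r t s * w s‖ = box r t s * |w s| := fun t => by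
            rw [norm_mul, Real.norm_eq_abs, Real.norm_eq_abs, abs_of_nonneg (box_nonneg _ _ _)]
          simp only [e]
          rw [integral_mul_const, (integral_box hr s).2]
        simp only [this]
        exact hw.integrable.abs.const_mul r
    · have h1 : Measurable fun p : ℝ × ℝ => box r p.2 p.1 :=
        (measurable_box r).comp (f := fun p : ℝ × ℝ => (p.2, p.1)) (by fun_prop)
      exact (h1.mul (hw.meas.comp measurable_fst)).aestronglyMeasurable
  have := integral_integral_swap (f := fun s t => box r t s * w s) hI
  unfold win
  rw [← this, ← integral_const_mul]
  congr 1; ext s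
  rw [integral_mul_const, (integral_box hr s).2]

/-- Jensen's inequality on a window. -/
theorem win_sq_le (hw : Adm a b w) {r : ℝ} (hr : 0 < r) (t : ℝ) :
    win r w t ^ 2 ≤ r * win r (fun s => w s ^ 2) t := by
  have h1 := integrable_box_mul hw r t
  have h2 := integrable_box_mul hw.sq r t
  have h3 := (integral_box' hr.le t)
  set c := win r w t / r with hc
  have : 0 ≤ ∫ s, (box r t s * w s ^ 2 - 2 * c * (box r t s * w s) + c ^ 2 * box r t s) := by
    refine integral_nonneg fun s => ?_
    have : box r t s * w s ^ 2 - 2 * c * (box r t s * w s) + c ^ 2 * box r t s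
        = box r t s * (w s - c) ^ 2 := by ring
    simp only [Pi.zero_apply]
    rw [this]
    exact mul_nonneg (box_nonneg _ _ _) (sq_nonneg _)
  rw [integral_add (f := fun s => box r t s * w s ^ 2 - 2 * c * (box r t s * w s))
      (h2.sub (h1.const_mul _)) (h3.1.const_mul _), integral_sub h2 (h1.const_mul _),
    integral_const_mul, integral_const_mul, h3.2] at this
  change 0 ≤ win r (fun s => w s ^ 2) t - 2 * c * win r w t + c ^ 2 * r at this
  have e : win r w t = c * r := by rw [hc]; field_simp
  rw [e] at this ⊢
  nlinarith

theorem bil_tent_le_sq (hv : Adm a b v) {r : ℝ} (hr : 0 < r) :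
    bil (tent r) v v ≤ r ^ 2 * ∫ x, v x ^ 2 := by
  rw [← integral_win_mul_win hv hv]
  calc ∫ t, win r v t * win r v t ≤ ∫ t, r * win r (fun s => v s ^ 2) t := by
        refine integral_mono ((adm_win hv r).mul (adm_win hv r)).integrable
          ((adm_win hv.sq r).integrable.const_mul r) fun t => ?_
        simp only
        rw [← pow_two]; exact win_sq_le hv hr t
    _ = r ^ 2 * ∫ x, v x ^ 2 := by
        rw [integral_const_mul, integral_win hv.sq hr.le]; ring

theorem integral_abs_sq_le (hab : a < b) (hv : Adm a b v) :
    (∫ x, |v x|) ^ 2 ≤ (b - a) * ∫ x, v x ^ 2 := by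
  have h := win_sq_le hv.abs (r := b - a) (by linarith) a
  have e : ∀ {u : ℝ → ℝ}, Adm a b u → win (b - a) u a = ∫ x, u x := fun {u} hu => by
    unfold win
    refine integral_congr_ae ?_
    have h1 : ∀ᵐ x : ℝ, x ≠ a := by simp [ae_iff]
    have h2 : ∀ᵐ x : ℝ, x ≠ b := by simp [ae_iff]
    filter_upwards [h1, h2] with x hx hx'
    by_cases h : x ∈ Icc a b
    · have : a < x ∧ x < a + (b - a) :=
        ⟨lt_of_le_of_ne h.1 (Ne.symm hx), by
          have := lt_of_le_of_ne h.2 hx'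
          linarith⟩
      rw [box, if_pos this, one_mul]
    · simp [hu.supp x h]
  simp only [sq_abs] at h
  rwa [e hv.abs, e hv.sq] at h

theorem bil_tent_le (hab : a < b) (hv : Adm a b v) {r : ℝ} (hr : 0 < r) :
    bil (tent r) v v ≤ (b - a) * (∫ x, v x ^ 2) * r := by
  rw [← integral_win_mul_win hv hv]
  have h1 : ∀ t, |win r v t| ≤ win r (fun s => |v s|) t := fun t => by
    refine (abs_integral_le_integral_abs).trans (le_of_eq ?_)
    unfold win
    congr 1; ext s
    rw [abs_mul, abs_of_nonneg (box_nonneg _ _ _)]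
  have h2 : ∀ t, |win r v t| ≤ ∫ s, |v s| := fun t => by
    refine (abs_integral_le_integral_abs).trans ?_
    refine integral_mono (integrable_box_mul hv r t).abs hv.integrable.abs fun s => ?_
    rw [abs_mul, abs_of_nonneg (box_nonneg _ _ _)]
    exact mul_le_of_le_one_left (abs_nonneg _) (box_le_one _ _ _)
  calc ∫ t, win r v t * win r v t ≤ ∫ t, (∫ s, |v s|) * win r (fun s => |v s|) t := by
        refine integral_mono ((adm_win hv r).mul (adm_win hv r)).integrable
          ((adm_win hv.abs r).integrable.const_mul _) fun t => ?_
        simp only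
        rw [← abs_mul_abs_self]
        exact mul_le_mul (h2 t) (h1 t) (abs_nonneg _) (integral_nonneg fun _ => abs_nonneg _)
    _ = (∫ x, |v x|) ^ 2 * r := by
        rw [integral_const_mul, integral_win hv.abs hr.le]; ring
    _ ≤ _ := mul_le_mul_of_nonneg_right (integral_abs_sq_le hab hv) hr.le

/-- Two-regime bound of the energy through its scales. -/
theorem en_le_of_scales {μ : ℝ} (hμ : 0 < μ) (hμ1 : μ < 1) (hv : Adm a b v) {A X Y σ : ℝ}
    (hA : 0 < A) (hσ : σ < 2 - μ) (h1 : ∀ r, 0 < r → bil (tent r) v v ≤ r ^ 2 * X)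
    (h2 : ∀ r, 0 < r → bil (tent r) v v ≤ Y * r ^ σ) :
    en μ v v ≤ ((1 - μ) * (2 - μ)) * (A ^ μ / μ * X + A ^ (μ - 2 + σ) / (2 - μ - σ) * Y) := by
  have h := en_eq_scale hμ hμ1 hv hv
  have hc : 0 < (1 - μ) * (2 - μ) := mul_pos (by linarith) (by linarith)
  rw [inv_mul_eq_iff_eq_mul₀ hc.ne'] at h
  rw [h.2]
  refine mul_le_mul_of_nonneg_left ?_ hc.le
  rw [← Ioc_union_Ioi_eq_Ioi hA.le, setIntegral_union (by
      rw [Set.disjoint_left]; intro x hx hx'; exact absurd hx.2 (not_le.2 hx')) measurableSet_Ioi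
    (h.1.mono_set Ioc_subset_Ioi_self) (h.1.mono_set (Ioi_subset_Ioi hA.le))]
  refine add_le_add ?_ ?_
  · have hi := (intervalIntegral.intervalIntegrable_rpow' (r := μ - 1) (by linarith) (a := 0) (b := A)).1
    calc _ ≤ ∫ r in Ioc 0 A, r ^ (μ - 1) * X := by
          refine setIntegral_mono_on (h.1.mono_set Ioc_subset_Ioi_self) (hi.mul_const X)
            measurableSet_Ioc fun r hr => ?_
          have hr0 : 0 < r := hr.1
          have e : r ^ (μ - 1) = r ^ (μ - 3) * r ^ 2 := by
            rw [← Real.rpow_natCast r 2, ← Real.rpow_add hr0]; congr 1; push_cast; ring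
          rw [e, mul_assoc]
          exact mul_le_mul_of_nonneg_left (h1 r hr0) (Real.rpow_nonneg hr0.le _)
      _ = A ^ μ / μ * X := by
          rw [integral_mul_const, ← intervalIntegral.integral_of_le hA.le,
            integral_rpow (Or.inl (by linarith))]
          simp [Real.zero_rpow hμ.ne']
  · have hi := integrableOn_Ioi_rpow_of_lt (a := μ - 3 + σ) (by linarith) hA
    calc _ ≤ ∫ r in Ioi A, r ^ (μ - 3 + σ) * Y := by
          refine setIntegral_mono_on (h.1.mono_set (Ioi_subset_Ioi hA.le)) (hi.mul_const Y)
            measurableSet_Ioi fun r hr => ?_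
          have hr0 : 0 < r := hA.trans hr
          rw [Real.rpow_add hr0, mul_assoc, mul_comm (r ^ σ)]
          exact mul_le_mul_of_nonneg_left (h2 r hr0) (Real.rpow_nonneg hr0.le _)
      _ = A ^ (μ - 2 + σ) / (2 - μ - σ) * Y := by
          rw [integral_mul_const, integral_Ioi_rpow_of_lt (by linarith) hA]
          have : μ - 3 + σ + 1 = μ - 2 + σ := by ring
          have e2 : 2 - μ - σ = -(μ - 2 + σ) := by ring
          rw [this, e2, neg_div, div_neg]

/-- The energy is bounded by the norm of `L²`. -/
theorem en_le_integral_sq {μ : ℝ} (hμ : 0 < μ) (hμ1 : μ < 1) (hab : a < b) :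
    ∃ C, 0 < C ∧ ∀ v, Adm a b v → en μ v v ≤ C * ∫ x, v x ^ 2 := by
  have hl : 0 < b - a := by linarith
  refine ⟨((1 - μ) * (2 - μ)) * ((b - a) ^ μ / μ + (b - a) ^ (μ - 2 + 1) / (2 - μ - 1) * (b - a)),
    ?_, fun v hv => ?_⟩
  · have : 0 < 1 - μ := by linarith
    have : 0 < 2 - μ := by linarith
    have : 0 < 2 - μ - 1 := by linarith
    positivity
  · refine (en_le_of_scales hμ hμ1 hv hl (σ := 1) (by linarith) (fun r hr => bil_tent_le_sq hv hr)
      (fun r hr => by rw [Real.rpow_one]; exact bil_tent_le hab hv hr)).trans (le_of_eq ?_)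
    ring

end

section

variable {a b : ℝ} {v w : ℝ → ℝ}

theorem win_eq_sub (hw : Adm a b w) {r : ℝ} (hr : 0 < r) (c t : ℝ) :
    win r w t = (∫ s in c..(t + r), w s) - ∫ s in c..t, w s := by
  rw [intervalIntegral.integral_interval_sub_left (hw.intervalIntegrable _ _)
    (hw.intervalIntegrable _ _), intervalIntegral.integral_of_le (by linarith),
    integral_Ioc_eq_integral_Ioo, ← integral_indicator measurableSet_Ioo]
  unfold win
  congr 1; ext s
  by_cases h : s ∈ Ioo t (t + r)
  · rw [indicator_of_mem h, box, if_pos ⟨h.1, h.2⟩, one_mul]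
  · rw [indicator_of_notMem h, box, if_neg (fun h' => h ⟨h'.1, h'.2⟩), zero_mul]

theorem sq_integral_interval_le (hv : Adm a b v) {x y : ℝ} (hxy : x ≤ y) :
    (∫ s in x..y, v s) ^ 2 ≤ (y - x) * ∫ s in x..y, v s ^ 2 := by
  rcases hxy.eq_or_lt with h | h
  · simp [h]
  · have hr : 0 < y - x := by linarith
    have h1 := win_sq_le hv hr x
    rw [win_eq_sub hv hr x, win_eq_sub hv.sq hr x] at h1
    simpa using h1

/-- Functions with vanishing means on the elements have small energy. -/
theorem en_le_of_mean_zero {μ : ℝ} (hμ : 0 < μ) (hμ1 : μ < 1) (hab : a < b) {K : ℕ}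
    (m : Mesh a b K) (hv : Adm a b v)
    (h0 : ∀ k, ∫ x in (m.lo k)..(m.hi k), v x = 0) :
    en μ v v ≤ ((1 - μ) * (2 - μ)) * (1 / μ + 4 / (2 - μ)) * m.size ^ μ * ∫ x, v x ^ 2 := by
  set h := m.size with hh
  have hpos : 0 < h := m.size_pos hab
  set Γ : ℝ → ℝ := fun t => ∫ s in a..t, v s with hΓ
  have hnode : ∀ j, Γ (m.node j) = 0 := by
    refine m.node_induction (p := fun y => Γ y = 0) (by simp [hΓ]) fun k hk => ?_
    have := intervalIntegral.integral_add_adjacent_intervals (μ := volume)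
      (hv.intervalIntegrable a (m.lo k)) (hv.intervalIntegrable (m.lo k) (m.hi k))
    simp only [hΓ] at hk ⊢
    rw [← this, hk, h0, add_zero]
  have hsub : ∀ x y, Γ y - Γ x = ∫ s in x..y, v s := fun x y =>
    intervalIntegral.integral_interval_sub_left (hv.intervalIntegrable _ _)
      (hv.intervalIntegrable _ _)
  have hcont : Continuous Γ := intervalIntegral.continuous_primitive (fun x y => hv.intervalIntegrable x y) a
  have hzero : ∀ x, x ∉ Icc a b → Γ x = 0 := by
    intro x hx
    rcases lt_or_ge x a with hxa | hxa
    · simp only [hΓ]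
      rw [intervalIntegral.integral_symm, intervalIntegral.integral_of_le hxa.le,
        integral_Ioc_eq_integral_Ioo, neg_eq_zero]
      exact setIntegral_eq_zero_of_forall_eq_zero fun s hs => hv.supp s fun h' => by
        linarith [h'.1, hs.2]
    · have hxb : b < x := not_le.1 fun h' => hx ⟨hxa, h'⟩
      have h1 : Γ b = 0 := by
        have := hnode (Fin.last K)
        rwa [m.node_last] at this
      have h2 := hsub b x
      rw [h1, sub_zero] at h2
      rw [h2, intervalIntegral.integral_of_le hxb.le]
      exact setIntegral_eq_zero_of_forall_eq_zero fun s hs => hv.supp s fun h' => by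
        linarith [h'.2, hs.1]
  have hΓA : Adm a b Γ := by
    refine ⟨hcont.measurable, ?_, hzero⟩
    obtain ⟨C, hC⟩ := (isCompact_Icc (a := a) (b := b)).exists_bound_of_continuousOn hcont.continuousOn
    refine ⟨|C|, fun x => ?_⟩
    by_cases hx : x ∈ Icc a b
    · exact (hC x hx).trans (le_abs_self C)
    · rw [hzero x hx, abs_zero]; exact abs_nonneg C
  have hΓ2 : ∫ t, Γ t ^ 2 ≤ h ^ 2 * ∫ x, v x ^ 2 := by
    rw [hΓA.sq.integral_eq_sum m hab, hv.sq.integral_eq_sum m hab, Finset.mul_sum]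
    refine Finset.sum_le_sum fun k _ => ?_
    have hl := (m.lo_lt_hi k).le
    have hlen := m.len_le_size k
    have hI : 0 ≤ ∫ x in (m.lo k)..(m.hi k), v x ^ 2 :=
      intervalIntegral.integral_nonneg hl fun x _ => sq_nonneg _
    have hpt : ∀ t ∈ Icc (m.lo k) (m.hi k), Γ t ^ 2 ≤ h * ∫ x in (m.lo k)..(m.hi k), v x ^ 2 := by
      intro t ht
      have e : Γ t = ∫ s in (m.lo k)..t, v s := by
        have h1 := hsub (m.lo k) t
        have h2 : Γ (m.lo k) = 0 := hnode _
        rwa [h2, sub_zero] at h1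
      rw [e]
      refine (sq_integral_interval_le hv ht.1).trans ?_
      refine mul_le_mul (by linarith [ht.2]) ?_ (intervalIntegral.integral_nonneg ht.1 fun x _ =>
        sq_nonneg _) hpos.le
      exact intervalIntegral.integral_mono_interval le_rfl ht.1 ht.2
        (.of_forall fun x => sq_nonneg _) (hv.sq.intervalIntegrable _ _)
    calc ∫ t in (m.lo k)..(m.hi k), Γ t ^ 2
        ≤ ∫ t in (m.lo k)..(m.hi k), h * ∫ x in (m.lo k)..(m.hi k), v x ^ 2 :=
          intervalIntegral.integral_mono_on hl (hΓA.sq.intervalIntegrable _ _)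
            intervalIntegrable_const hpt
      _ = (m.hi k - m.lo k) * (h * ∫ x in (m.lo k)..(m.hi k), v x ^ 2) := by
          rw [intervalIntegral.integral_const, smul_eq_mul]
      _ ≤ h ^ 2 * ∫ x in (m.lo k)..(m.hi k), v x ^ 2 := by
          rw [pow_two, mul_assoc]
          exact mul_le_mul_of_nonneg_right hlen (mul_nonneg hpos.le hI)
  have hscale : ∀ r, 0 < r → bil (tent r) v v ≤ (4 * h ^ 2 * ∫ x, v x ^ 2) * r ^ (0:ℝ) := by
    intro r hr
    rw [Real.rpow_zero, mul_one, ← integral_win_mul_win hv hv]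
    have i1 : Integrable fun t => Γ (t + r) ^ 2 := hΓA.sq.integrable.comp_add_right r
    calc ∫ t, win r v t * win r v t ≤ ∫ t, (2 * Γ (t + r) ^ 2 + 2 * Γ t ^ 2) := by
          refine integral_mono ((adm_win hv r).mul (adm_win hv r)).integrable
            ((i1.const_mul 2).add (hΓA.sq.integrable.const_mul 2)) fun t => ?_
          simp only
          rw [win_eq_sub hv hr a]
          change (Γ (t + r) - Γ t) * (Γ (t + r) - Γ t) ≤ _
          nlinarith [sq_nonneg (Γ (t + r) + Γ t)]
      _ = 4 * ∫ t, Γ t ^ 2 := by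
          rw [integral_add (i1.const_mul 2) (hΓA.sq.integrable.const_mul 2), integral_const_mul,
            integral_const_mul, integral_add_right_eq_self (fun t => Γ t ^ 2) r]
          ring
      _ ≤ _ := by linarith
  refine (en_le_of_scales hμ hμ1 hv hpos (by linarith) (fun r hr => bil_tent_le_sq hv hr)
    hscale).trans (le_of_eq ?_)
  have e : h ^ (μ - 2 + 0) = h ^ μ / h ^ 2 := by
    rw [add_zero, Real.rpow_sub hpos, Real.rpow_two]
  rw [e]
  have : 2 - μ ≠ 0 := by linarith
  rw [sub_zero]
  field_simp

end

section

variable {a b : ℝ} {E w : ℝ → ℝ}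

theorem Adm.comp_add (hw : Adm a b w) (r : ℝ) : Adm (a - r) (b - r) (fun t => w (t + r)) :=
  ⟨hw.meas.comp (measurable_add_const r), hw.bdd.imp fun _ h x => h _, fun x hx =>
    hw.supp _ fun h => hx ⟨by linarith [h.1], by linarith [h.2]⟩⟩

theorem integrableOn_box (r l : ℝ) : IntegrableOn (fun d => box r d 0) (Icc (-l) l) := by
  refine Integrable.mono' (integrableOn_const (C := (1:ℝ)) (by simp)) ?_ ?_
  · exact ((measurable_box r).comp (measurable_prodMk_right (y := (0:ℝ)))).aestronglyMeasurable
  · refine .of_forall fun d => ?_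
    rw [Real.norm_eq_abs, abs_of_nonneg (box_nonneg _ _ _)]
    exact box_le_one _ _ _

theorem integrableOn_box_neg (r l : ℝ) : IntegrableOn (fun d => box r (-d) 0) (Icc (-l) l) := by
  have := (integrableOn_box r l).comp_neg
  simpa using this

theorem integral_shift_mul_win (hE : Adm a b E) (hw : Adm a b w) (r : ℝ) :
    ∫ t, E (t + r) * win r w t = bil (fun d => box r (-d) 0) E w := by
  rw [bil_eq_iterated hE hw (integrableOn_box_neg r _),
    ← integral_sub_right_eq_self (fun t => E (t + r) * win r w t) r]
  congr 1; ext t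
  rw [sub_add_cancel]
  congr 1
  unfold win
  congr 1; ext s
  congr 1
  unfold box
  have : (t - r < s ∧ s < t - r + r) ↔ (-(t - s) < 0 ∧ 0 < -(t - s) + r) := by
    constructor <;> rintro ⟨h1, h2⟩ <;> constructor <;> linarith
  simp only [this]

theorem bil_box_neg_self (r : ℝ) :
    bil (fun d => box r (-d) 0) E E = bil (fun d => box r d 0) E E := by
  unfold bil
  rw [Measure.volume_eq_prod, ← integral_prod_swap]
  congr 1; ext z
  simp only [Prod.fst_swap, Prod.snd_swap, neg_sub]
  ring

/-- The error of the trapezoidal rule on the window `(t, t + r)`. -/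
def trap (r : ℝ) (E : ℝ → ℝ) (t : ℝ) : ℝ := win r E t - r / 2 * (E t + E (t + r))

theorem adm_trap (hE : Adm a b E) {r : ℝ} (hr : 0 ≤ r) : Adm (a - r) b (trap r E) := by
  have h1 : Adm (a - r) b E := hE.mono (by linarith) le_rfl
  have h2 : Adm (a - r) b (fun t => E (t + r)) := (hE.comp_add r).mono le_rfl (by linarith)
  exact (adm_win hE r).sub ((h1.add h2).const_mul (r / 2))

/-- The kernel of the pairing of window integrals with trapezoidal errors. -/
def trapKer (r d : ℝ) : ℝ := tent r d + (-(r / 2)) * (box r d 0 + box r (-d) 0)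

theorem integral_win_mul_trap (hE : Adm a b E) (hw : Adm a b w) {r : ℝ} (hr : 0 ≤ r) :
    ∫ t, trap r E t * win r w t = bil (trapKer r) E w := by
  have h1 : Adm (a - r) b E := hE.mono (by linarith) le_rfl
  have h2 : Adm (a - r) b (fun t => E (t + r)) := (hE.comp_add r).mono le_rfl (by linarith)
  have hW := adm_win hw r
  have hB : IntegrableOn (fun d => -(r / 2) * (box r d 0 + box r (-d) 0))
      (Icc (-(b - a)) (b - a)) :=
    ((integrableOn_box r (b - a)).add (integrableOn_box_neg r (b - a))).const_mul _
  unfold trapKer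
  rw [bil_add_kernel hE hw (integrableOn_tent r _) hB, bil_const_mul_kernel,
    bil_add_kernel hE hw (integrableOn_box r _) (integrableOn_box_neg r _),
    ← integral_win_mul_win hE hw, ← integral_mul_win hw hE, ← integral_shift_mul_win hE hw,
    ← integral_add (h1.mul hW).integrable (h2.mul hW).integrable, ← integral_const_mul,
    ← integral_add (g := fun t => -(r / 2) * (E t * win r w t + E (t + r) * win r w t))
      ((adm_win hE r).mul hW).integrable
      (((h1.mul hW).integrable.add (h2.mul hW).integrable).const_mul _)]
  congr 1; ext t
  unfold trap; ring

theorem trapKer_eq {r d : ℝ} (hd : d ≠ 0) :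
    trapKer r d = if |d| < r then (r - 2 * |d|) / 2 else 0 := by
  unfold trapKer tent box
  rcases lt_or_gt_of_ne hd with h | h
  · rw [abs_of_neg h]
    have h1 : ¬ (-d < 0 ∧ 0 < -d + r) := fun h' => by linarith [h'.1]
    rw [if_neg h1]
    by_cases h2 : -d < r
    · rw [if_pos ⟨h, by linarith⟩, if_pos h2, max_eq_left (by linarith)]; ring
    · rw [if_neg (fun h' => h2 (by linarith [h'.2])), if_neg h2, max_eq_right (by linarith)]; ring
  · rw [abs_of_pos h]
    have h1 : ¬ (d < 0 ∧ 0 < d + r) := fun h' => by linarith [h'.1]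
    rw [if_neg h1]
    by_cases h2 : d < r
    · rw [if_pos ⟨by linarith, by linarith⟩, if_pos h2, max_eq_left (by linarith)]; ring
    · rw [if_neg (fun h' => h2 (by linarith [h'.2])), if_neg h2, max_eq_right (by linarith)]; ring

theorem integral_trapKer {δ R d : ℝ} (hδ : 0 < δ) (hR : δ < R) (hd : d ≠ 0) :
    IntegrableOn (fun r => 2 * (r ^ 3)⁻¹ * trapKer r d) (Ioc δ R) ∧
      ∫ r in Ioc δ R, 2 * (r ^ 3)⁻¹ * trapKer r d
        = (δ ^ 2)⁻¹ * tent δ d - (R ^ 2)⁻¹ * tent R d := by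
  have hd' : 0 < |d| := abs_pos.2 hd
  set A := max δ |d| with hA
  have hA0 : 0 < A := hδ.trans_le (le_max_left _ _)
  have e : ∀ r ∈ Ioc δ R, 2 * (r ^ 3)⁻¹ * trapKer r d
      = (Ioi |d|).indicator (fun r => (r - 2 * |d|) / r ^ 3) r := by
    intro r hr
    have hr0 : 0 < r := hδ.trans hr.1
    rw [trapKer_eq hd]
    by_cases h : |d| < r
    · rw [if_pos h, indicator_of_mem (mem_Ioi.2 h)]; field_simp
    · rw [if_neg h, indicator_of_notMem (fun h' => h (mem_Ioi.1 h')), mul_zero]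
  have hset : Ioc δ R ∩ Ioi |d| = Ioc A R := by
    ext r; simp only [hA, mem_inter_iff, mem_Ioc, mem_Ioi, max_lt_iff]; tauto
  have hcont : ContinuousOn (fun r : ℝ => (r - 2 * |d|) / r ^ 3) (Icc A R) := by
    refine ContinuousOn.div (by fun_prop) (by fun_prop) fun r hr => ?_
    have : 0 < r := hA0.trans_le hr.1
    positivity
  constructor
  · refine IntegrableOn.congr_fun ?_ (fun r hr => (e r hr).symm) measurableSet_Ioc
    rw [IntegrableOn, integrable_indicator_iff measurableSet_Ioi, IntegrableOn,
      Measure.restrict_restrict measurableSet_Ioi, inter_comm, hset]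
    exact (hcont.integrableOn_compact isCompact_Icc).mono_set Ioc_subset_Icc_self
  · rw [setIntegral_congr_fun measurableSet_Ioc e, setIntegral_indicator measurableSet_Ioi, hset]
    by_cases hdR : |d| < R
    · have hAR : A < R := max_lt hR hdR
      rw [← intervalIntegral.integral_of_le hAR.le,
        intervalIntegral.integral_eq_sub_of_hasDerivAt (f := fun r => -((r - |d|) / r ^ 2))]
      · have h1 : (A - |d|) / A ^ 2 = (δ ^ 2)⁻¹ * tent δ d := by
          unfold tent
          rcases le_total δ |d| with h | h
          · rw [hA, max_eq_right h, max_eq_right (by linarith)]; simp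
          · rw [hA, max_eq_left h, max_eq_left (by linarith)]; field_simp
        have h2 : (R ^ 2)⁻¹ * tent R d = (R - |d|) / R ^ 2 := by
          unfold tent; rw [max_eq_left (by linarith)]; field_simp
        rw [h2, h1.symm]; ring
      · intro r hr
        rw [uIcc_of_le hAR.le] at hr
        have hr0 : 0 < r := hA0.trans_le hr.1
        have := ((hasDerivAt_id r).sub_const |d|).div (hasDerivAt_pow 2 r) (by positivity)
        refine this.neg.congr_deriv ?_
        simp only [id_eq]
        field_simp
        ring
      · exact (hcont.mono (by rw [uIcc_of_le hAR.le])).intervalIntegrable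
    · have h1 : Ioc A R = ∅ := Ioc_eq_empty (by
        intro h; exact hdR ((le_max_right _ _).trans_lt h))
      have h2 : tent R d = 0 := max_eq_right (by linarith)
      have h3 : tent δ d = 0 := max_eq_right (by linarith)
      rw [h1, h2, h3]; simp

theorem bil_average_sub (hE : Adm a b E) (hw : Adm a b w) {δ R : ℝ} (hδ : 0 < δ) (hR : δ < R) :
    IntegrableOn (fun r => 2 * (r ^ 3)⁻¹ * bil (trapKer r) E w) (Ioc δ R) ∧
      (δ ^ 2)⁻¹ * bil (tent δ) E w - (R ^ 2)⁻¹ * bil (tent R) E w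
        = ∫ r in Ioc δ R, 2 * (r ^ 3)⁻¹ * bil (trapKer r) E w := by
  have hmeas : Measurable (Function.uncurry fun r d => 2 * (r ^ 3)⁻¹ * trapKer r d) := by
    have h1 := continuous_tent.measurable
    have hb : Measurable fun q : ℝ × ℝ => box q.1 q.2 0 := by
      unfold box
      refine Measurable.ite ?_ measurable_const measurable_const
      exact (measurableSet_lt measurable_snd measurable_const).inter
        (measurableSet_lt measurable_const (measurable_snd.add measurable_fst))
    have hb2 : Measurable fun q : ℝ × ℝ => box q.1 (-q.2) 0 :=
      hb.comp (f := fun q : ℝ × ℝ => (q.1, -q.2)) (by fun_prop)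
    have h2 : Measurable fun q : ℝ × ℝ => 2 * (q.1 ^ 3)⁻¹ := by fun_prop
    have h3 : Measurable fun q : ℝ × ℝ => -(q.1 / 2) := by fun_prop
    exact h2.mul (h1.add (h3.mul (hb.add hb2)))
  have hbound : ∀ r ∈ Ioc δ R, ∀ d, d ≠ 0 → |2 * (r ^ 3)⁻¹ * trapKer r d| ≤ (δ ^ 3)⁻¹ * R := by
    intro r hr d hd
    have hr0 : 0 < r := hδ.trans hr.1
    have h1 : |trapKer r d| ≤ R / 2 := by
      rw [trapKer_eq hd]
      split_ifs with h
      · rw [abs_le]; constructor <;> linarith [abs_nonneg d, hr.2]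
      · rw [abs_zero]; linarith
    rw [abs_mul, abs_of_pos (by positivity : 0 < 2 * (r ^ 3)⁻¹)]
    have h2 : (r ^ 3)⁻¹ ≤ (δ ^ 3)⁻¹ :=
      inv_anti₀ (by positivity) (pow_le_pow_left₀ hδ.le hr.1.le 3)
    have h4 : 0 < (δ ^ 3)⁻¹ := by positivity
    calc 2 * (r ^ 3)⁻¹ * |trapKer r d| ≤ 2 * (δ ^ 3)⁻¹ * (R / 2) :=
          mul_le_mul (by linarith) h1 (abs_nonneg _) (by positivity)
      _ = _ := by ring
  have h := bil_integral hE hw hmeas (I := Ioc δ R) (B := fun _ => (R - δ) * ((δ ^ 3)⁻¹ * R))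
    (integrableOn_const (by simp)) (fun d hd => (integral_trapKer hδ hR hd).1)
    (fun d hd => by
      have hi := (integral_trapKer hδ hR hd).1.abs
      calc _ ≤ ∫ r in Ioc δ R, (δ ^ 3)⁻¹ * R :=
            setIntegral_mono_on hi (integrableOn_const (by simp)) measurableSet_Ioc
              fun r hr => hbound r hr d hd
        _ = _ := by
            rw [setIntegral_const, Measure.real, Real.volume_Ioc, smul_eq_mul,
              ENNReal.toReal_ofReal (by linarith)])
  simp only [bil_const_mul_kernel] at h
  refine ⟨h.1, ?_⟩
  rw [← h.2, ← bil_const_mul_kernel, ← bil_const_mul_kernel, sub_eq_add_neg, ← neg_one_mul,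
    ← bil_const_mul_kernel, ← bil_add_kernel hE hw ((integrableOn_tent δ _).const_mul _)
      (((integrableOn_tent R _).const_mul _).const_mul _)]
  refine bil_congr_kernel fun d hd => ?_
  rw [(integral_trapKer hδ hR hd).2]; ring

/-- The mean square difference over windows. -/
def diffSq (E : ℝ → ℝ) (r : ℝ) : ℝ := 2 * r * (∫ t, E t ^ 2) - 2 * ∫ t, E t * win r E t

theorem integral_trap_sq_le (hE : Adm a b E) {r : ℝ} (hr : 0 < r) :
    ∫ t, trap r E t ^ 2 ≤ r * diffSq E r := by
  have h1 : Adm (a - r) b E := hE.mono (by linarith) le_rfl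
  have h2 : Adm (a - r) b (fun t => E (t + r)) := (hE.comp_add r).mono le_rfl (by linarith)
  have hW := adm_win hE r
  have hW2 := adm_win hE.sq r
  have i1 := hW2.integrable.const_mul r
  have i2 := (h1.mul hW).integrable.const_mul r
  have i3 := (h2.mul hW).integrable.const_mul r
  have i4 := h1.sq.integrable.const_mul (r ^ 2 / 2)
  have i5 := h2.sq.integrable.const_mul (r ^ 2 / 2)
  have hsym : ∫ t, E (t + r) * win r E t = ∫ t, E t * win r E t := by
    rw [integral_shift_mul_win hE hE, integral_mul_win hE hE, bil_box_neg_self]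
  calc ∫ t, trap r E t ^ 2
      ≤ ∫ t, (r * win r (fun s => E s ^ 2) t - r * (E t * win r E t) - r * (E (t + r) * win r E t)
          + r ^ 2 / 2 * E t ^ 2 + r ^ 2 / 2 * E (t + r) ^ 2) := by
        refine integral_mono (adm_trap hE hr.le).sq.integrable
          ((((i1.sub i2).sub i3).add i4).add i5) fun t => ?_
        have := win_sq_le hE hr t
        simp only [trap]
        nlinarith [mul_nonneg (sq_nonneg r) (sq_nonneg (E t - E (t + r)))]
    _ = r * diffSq E r := by
        rw [integral_add (f := fun t => r * win r (fun s => E s ^ 2) t - r * (E t * win r E t) -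
            r * (E (t + r) * win r E t) + r ^ 2 / 2 * E t ^ 2) (((i1.sub i2).sub i3).add i4) i5,
          integral_add (f := fun t => r * win r (fun s => E s ^ 2) t - r * (E t * win r E t) -
            r * (E (t + r) * win r E t)) ((i1.sub i2).sub i3) i4,
          integral_sub (f := fun t => r * win r (fun s => E s ^ 2) t - r * (E t * win r E t))
            (i1.sub i2) i3, integral_sub i1 i2]
        simp only [integral_const_mul]
        rw [hsym, integral_win hE.sq hr.le, integral_add_right_eq_self (fun t => E t ^ 2) r]
        unfold diffSq; ring

end

section

variable {a b : ℝ} {E w : ℝ → ℝ}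

/-- The Gagliardo integrand of order `μ / 2`. -/
def gagF (μ : ℝ) (E : ℝ → ℝ) (z : ℝ × ℝ) : ℝ := (E z.1 - E z.2) ^ 2 * |z.1 - z.2| ^ (-1 - μ)

/-- The squared Gagliardo seminorm of order `μ / 2`. -/
def gag (μ : ℝ) (E : ℝ → ℝ) : ℝ := ∫ z, gagF μ E z

theorem gagF_nonneg (μ : ℝ) (E : ℝ → ℝ) (z : ℝ × ℝ) : 0 ≤ gagF μ E z :=
  mul_nonneg (sq_nonneg _) (Real.rpow_nonneg (abs_nonneg _) _)

theorem box_mul_le_gagF {μ r : ℝ} (hμ : 0 < μ) (hr : 0 < r) (E : ℝ → ℝ) (z : ℝ × ℝ) :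
    box r z.1 z.2 * (E z.2 - E z.1) ^ 2 ≤ r ^ (1 + μ) * gagF μ E z := by
  by_cases h : z.1 < z.2 ∧ z.2 < z.1 + r
  · have hd : 0 < |z.1 - z.2| := abs_pos.2 (by linarith [h.1])
    have hdr : |z.1 - z.2| ≤ r := by rw [abs_sub_comm, abs_of_pos (by linarith [h.1])]; linarith [h.2]
    rw [box, if_pos h, one_mul, gagF]
    have h1 : 1 ≤ r ^ (1 + μ) * |z.1 - z.2| ^ (-1 - μ) := by
      have e : -1 - μ = -(1 + μ) := by ring
      rw [e, Real.rpow_neg hd.le, ← div_eq_mul_inv, one_le_div (Real.rpow_pos_of_pos hd _)]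
      exact Real.rpow_le_rpow hd.le hdr (by linarith)
    nlinarith [sq_nonneg (E z.1 - E z.2)]
  · rw [box, if_neg h, zero_mul]
    exact mul_nonneg (Real.rpow_nonneg hr.le _) (gagF_nonneg _ _ _)

theorem measurable_box_mul (hE : Measurable E) (r : ℝ) :
    Measurable fun z : ℝ × ℝ => box r z.1 z.2 * (E z.2 - E z.1) ^ 2 :=
  (measurable_box r).mul (((hE.comp measurable_snd).sub (hE.comp measurable_fst)).pow_const 2)

theorem integrable_box_diff {μ r : ℝ} (hμ : 0 < μ) (hr : 0 < r) (hE : Measurable E)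
    (hG : Integrable (gagF μ E)) :
    Integrable fun z : ℝ × ℝ => box r z.1 z.2 * (E z.2 - E z.1) ^ 2 := by
  refine (hG.const_mul (r ^ (1 + μ))).mono' (measurable_box_mul hE r).aestronglyMeasurable
    (.of_forall fun z => ?_)
  rw [Real.norm_eq_abs, abs_of_nonneg (mul_nonneg (box_nonneg _ _ _) (sq_nonneg _))]
  exact box_mul_le_gagF hμ hr E z

theorem integral_box_diff_inner (hE : Adm a b E) {r : ℝ} (hr : 0 < r) (t : ℝ) :
    ∫ x, box r t x * (E x - E t) ^ 2
      = win r (fun s => E s ^ 2) t - 2 * (E t * win r E t) + r * E t ^ 2 := by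
  have i1 := integrable_box_mul hE.sq r t
  have i2 := (integrable_box_mul hE r t).const_mul (2 * E t)
  have i3 := (integral_box' hr.le t).1.mul_const (E t ^ 2)
  have e : ∀ x, box r t x * (E x - E t) ^ 2
      = box r t x * E x ^ 2 - 2 * E t * (box r t x * E x) + box r t x * E t ^ 2 := fun x => by ring
  simp only [e]
  rw [integral_add (f := fun x => box r t x * E x ^ 2 - 2 * E t * (box r t x * E x)) (i1.sub i2) i3,
    integral_sub i1 i2, integral_const_mul, integral_mul_const, (integral_box' hr.le t).2]
  unfold win; ring

theorem diffSq_eq {μ : ℝ} (hμ : 0 < μ) (hE : Adm a b E) (hG : Integrable (gagF μ E)) {r : ℝ}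
    (hr : 0 < r) : diffSq E r = ∫ z : ℝ × ℝ, box r z.1 z.2 * (E z.2 - E z.1) ^ 2 := by
  have hi := integrable_box_diff hμ hr hE.meas hG
  rw [Measure.volume_eq_prod] at hi ⊢
  rw [integral_prod _ hi]
  simp only [integral_box_diff_inner hE hr]
  have h1 : Adm (a - r) b E := hE.mono (by linarith) le_rfl
  have i1 := (adm_win hE.sq r).integrable
  have i2 := (h1.mul (adm_win hE r)).integrable.const_mul 2
  have i3 := hE.sq.integrable.const_mul r
  rw [integral_add (f := fun t => win r (fun s => E s ^ 2) t - 2 * (E t * win r E t)) (i1.sub i2) i3,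
    integral_sub i1 i2, integral_const_mul, integral_const_mul, integral_win hE.sq hr.le, diffSq]
  ring

theorem diffSq_le {μ : ℝ} (hμ : 0 < μ) (hE : Adm a b E) (hG : Integrable (gagF μ E)) {r : ℝ}
    (hr : 0 < r) : diffSq E r ≤ r ^ (1 + μ) * gag μ E := by
  rw [diffSq_eq hμ hE hG hr, gag, ← integral_const_mul]
  exact integral_mono (integrable_box_diff hμ hr hE.meas hG) (hG.const_mul _)
    fun z => box_mul_le_gagF hμ hr E z

theorem integral_rpow_box {μ : ℝ} (hμ : 0 < μ) {t x : ℝ} :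
    IntegrableOn (fun r => r ^ (-2 - μ) * box r t x) (Ioi 0) ∧
      ∫ r in Ioi 0, r ^ (-2 - μ) * box r t x ≤ (1 + μ)⁻¹ * |t - x| ^ (-1 - μ) := by
  by_cases h : t < x
  · have hd : 0 < x - t := by linarith
    have e : ∀ r ∈ Ioi (0:ℝ), r ^ (-2 - μ) * box r t x
        = (Ioi (x - t)).indicator (fun r => r ^ (-2 - μ)) r := by
      intro r _
      by_cases h' : r ∈ Ioi (x - t)
      · rw [indicator_of_mem h', box, if_pos ⟨h, by linarith [mem_Ioi.1 h']⟩, mul_one]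
      · rw [indicator_of_notMem h', box, if_neg (fun h2 => h' (mem_Ioi.2 (by linarith [h2.2]))),
          mul_zero]
    have hsub : Ioi (0:ℝ) ∩ Ioi (x - t) = Ioi (x - t) := by
      rw [Ioi_inter_Ioi, sup_eq_right.2 hd.le]
    have hi := integrableOn_Ioi_rpow_of_lt (a := -2 - μ) (by linarith) hd
    constructor
    · refine IntegrableOn.congr_fun ?_ (fun r hr => (e r hr).symm) measurableSet_Ioi
      rw [IntegrableOn, integrable_indicator_iff measurableSet_Ioi, IntegrableOn,
        Measure.restrict_restrict measurableSet_Ioi, inter_comm, hsub]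
      exact hi
    · rw [setIntegral_congr_fun measurableSet_Ioi e, setIntegral_indicator measurableSet_Ioi, hsub,
        integral_Ioi_rpow_of_lt (by linarith) hd, abs_sub_comm, abs_of_pos hd]
      have e1 : -2 - μ + 1 = -1 - μ := by ring
      have e2 : -1 - μ = -(1 + μ) := by ring
      rw [e1, div_eq_mul_inv]
      nth_rewrite 2 [e2]
      rw [inv_neg]
      linarith
  · have e : ∀ r, r ^ (-2 - μ) * box r t x = 0 := fun r => by
      rw [box, if_neg (fun h' => h h'.1), mul_zero]
    simp only [e]
    refine ⟨integrableOn_zero, ?_⟩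
    rw [integral_zero]
    exact mul_nonneg (inv_nonneg.2 (by linarith)) (Real.rpow_nonneg (abs_nonneg _) _)

theorem integral_diffSq_le {μ : ℝ} (hμ : 0 < μ) (hE : Adm a b E) (hG : Integrable (gagF μ E)) :
    IntegrableOn (fun r => r ^ (-2 - μ) * diffSq E r) (Ioi 0) ∧
      ∫ r in Ioi 0, r ^ (-2 - μ) * diffSq E r ≤ (1 + μ)⁻¹ * gag μ E := by
  set F : ℝ × ℝ → ℝ → ℝ := fun z r => r ^ (-2 - μ) * (box r z.1 z.2 * (E z.2 - E z.1) ^ 2) with hF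
  have hFe : ∀ z r, F z r = (r ^ (-2 - μ) * box r z.1 z.2) * (E z.2 - E z.1) ^ 2 := fun z r => by
    simp only [hF]; ring
  have hmeas : Measurable (Function.uncurry F) := by
    have h1 : Measurable fun q : (ℝ × ℝ) × ℝ => box q.2 q.1.1 q.1.2 := by
      unfold box
      refine Measurable.ite ?_ measurable_const measurable_const
      exact (measurableSet_lt (f := fun q : (ℝ × ℝ) × ℝ => q.1.1) (g := fun q => q.1.2)
        (by fun_prop) (by fun_prop)).inter (measurableSet_lt (f := fun q : (ℝ × ℝ) × ℝ => q.1.2)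
        (g := fun q => q.1.1 + q.2) (by fun_prop) (by fun_prop))
    have h2 : Measurable fun q : (ℝ × ℝ) × ℝ => q.2 ^ (-2 - μ) := by fun_prop
    have h3 : Measurable fun q : (ℝ × ℝ) × ℝ => (E q.1.2 - E q.1.1) ^ 2 :=
      ((hE.meas.comp (by fun_prop)).sub (hE.meas.comp (by fun_prop))).pow_const 2
    exact h2.mul (h1.mul h3)
  have hb : ∀ z : ℝ × ℝ, ∫ r in Ioi 0, F z r ≤ (1 + μ)⁻¹ * gagF μ E z := fun z => by
    simp only [hFe]
    rw [integral_mul_const, gagF]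
    have := mul_le_mul_of_nonneg_right (integral_rpow_box hμ (t := z.1) (x := z.2)).2
      (sq_nonneg (E z.2 - E z.1))
    refine this.trans (le_of_eq ?_)
    ring
  have hpos : ∀ z : ℝ × ℝ, ∀ r ∈ Ioi (0:ℝ), 0 ≤ F z r := fun z r hr =>
    mul_nonneg (Real.rpow_nonneg (le_of_lt hr) _) (mul_nonneg (box_nonneg _ _ _) (sq_nonneg _))
  have hint : Integrable (Function.uncurry F)
      ((volume : Measure (ℝ × ℝ)).prod (volume.restrict (Ioi 0))) := by
    rw [integrable_prod_iff hmeas.aestronglyMeasurable]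
    constructor
    · refine .of_forall fun z => ?_
      refine ((integral_rpow_box hμ (t := z.1) (x := z.2)).1.mul_const ((E z.2 - E z.1) ^ 2)).congr
        (.of_forall fun r => (hFe z r).symm)
    · refine (hG.const_mul (1 + μ)⁻¹).mono' (hmeas.norm.aestronglyMeasurable.integral_prod_right')
        (.of_forall fun z => ?_)
      have e : ∫ r in Ioi 0, ‖Function.uncurry F (z, r)‖ = ∫ r in Ioi 0, F z r :=
        setIntegral_congr_fun measurableSet_Ioi fun r hr => by
          change ‖F z r‖ = F z r
          rw [Real.norm_eq_abs, abs_of_nonneg (hpos z r hr)]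
      rw [e, Real.norm_eq_abs, abs_of_nonneg (setIntegral_nonneg measurableSet_Ioi (hpos z))]
      exact hb z
  have e : ∀ r ∈ Ioi (0:ℝ), ∫ z, F z r = r ^ (-2 - μ) * diffSq E r := fun r hr => by
    simp only [hF]
    rw [integral_const_mul, diffSq_eq hμ hE hG hr]
  constructor
  · refine IntegrableOn.congr_fun (f := fun r => ∫ z, F z r) ?_ e measurableSet_Ioi
    exact hint.integral_prod_right
  · rw [← setIntegral_congr_fun measurableSet_Ioi e, ← integral_integral_swap hint, gag,
      ← integral_const_mul]
    exact integral_mono hint.integral_prod_left (hG.const_mul _) hb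

theorem tendsto_average {μ : ℝ} (hμ : 0 < μ) (hab : a < b) (hE : Adm a b E) (hw : Adm a b w)
    (hG : Integrable (gagF μ E)) :
    ∃ C, ∀ δ, 0 < δ → δ ≤ 1 →
      ((δ ^ 2)⁻¹ * bil (tent δ) E w - ∫ t, E t * w t) ^ 2 ≤ C * δ ^ μ := by
  obtain ⟨M, hM0, hM⟩ := hw.exists_pos_bound
  refine ⟨4 * M ^ 2 * (b - a + 1) * gag μ E, fun δ hδ hδ1 => ?_⟩
  set X : ℝ → ℝ := fun t => δ⁻¹ * win δ E t - E t with hX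
  set Y : ℝ → ℝ := fun t => δ⁻¹ * win δ E t - E (t + δ) with hY
  have h1 : Adm (a - δ) b E := hE.mono (by linarith) le_rfl
  have h2 : Adm (a - δ) b (fun t => E (t + δ)) := (hE.comp_add δ).mono le_rfl (by linarith)
  have hW := adm_win hE δ
  have hWw := adm_win hw δ
  have hXA : Adm (a - δ) b X := (hW.const_mul _).sub h1
  have hYA : Adm (a - δ) b Y := (hW.const_mul _).sub h2
  have hsym : ∫ t, E (t + δ) * win δ E t = ∫ t, E t * win δ E t := by
    rw [integral_shift_mul_win hE hE, integral_mul_win hE hE, bil_box_neg_self]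
  have hsq : ∀ {u : ℝ → ℝ}, Adm (a - δ) b u → (∫ t, u t ^ 2 = ∫ t, E t ^ 2) →
      (∫ t, u t * win δ E t = ∫ t, E t * win δ E t) →
      ∫ t, (δ⁻¹ * win δ E t - u t) ^ 2 ≤ δ ^ μ * gag μ E := by
    intro u hu hu2 huw
    have i1 := (adm_win hE.sq δ).integrable.const_mul δ⁻¹
    have i2 := (hu.mul hW).integrable.const_mul (2 * δ⁻¹)
    have i3 := hu.sq.integrable
    calc ∫ t, (δ⁻¹ * win δ E t - u t) ^ 2
        ≤ ∫ t, (δ⁻¹ * win δ (fun s => E s ^ 2) t - 2 * δ⁻¹ * (u t * win δ E t) + u t ^ 2) := by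
          refine integral_mono ((hW.const_mul δ⁻¹).sub hu).sq.integrable ((i1.sub i2).add i3)
            fun t => ?_
          have h := win_sq_le hE hδ t
          have h' : (δ⁻¹ * win δ E t) ^ 2 ≤ δ⁻¹ * win δ (fun s => E s ^ 2) t := by
            rw [mul_pow, inv_pow, ← div_eq_inv_mul, ← div_eq_inv_mul, div_le_div_iff₀ (by positivity) hδ]
            nlinarith
          simp only
          nlinarith
      _ = δ⁻¹ * diffSq E δ := by
          rw [integral_add (f := fun t => δ⁻¹ * win δ (fun s => E s ^ 2) t - 2 * δ⁻¹ *
            (u t * win δ E t)) (i1.sub i2) i3, integral_sub i1 i2, integral_const_mul,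
            integral_const_mul, integral_win hE.sq hδ.le, huw, hu2, diffSq]
          field_simp
          ring
      _ ≤ δ ^ μ * gag μ E := by
          have h := diffSq_le hμ hE hG hδ
          rw [Real.rpow_add hδ, Real.rpow_one, mul_assoc] at h
          rw [inv_mul_le_iff₀ hδ]
          exact h
  have hX2 := hsq h1 rfl rfl
  have hY2 := hsq h2 (integral_add_right_eq_self (fun t => E t ^ 2) δ) hsym
  have hl : a - δ < b := by linarith
  have hbd : ∀ t, |δ⁻¹ * win δ w t| ≤ M := fun t => by
    have h : |win δ w t| ≤ δ * M := by
      calc |win δ w t| ≤ ∫ s, |box δ t s * w s| := abs_integral_le_integral_abs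
        _ ≤ ∫ s, box δ t s * M := by
            refine integral_mono (integrable_box_mul hw δ t).abs
              ((integral_box' hδ.le t).1.mul_const M) fun s => ?_
            simp only
            rw [abs_mul, abs_of_nonneg (box_nonneg _ _ _)]
            exact mul_le_mul_of_nonneg_left (hM s) (box_nonneg _ _ _)
        _ = δ * M := by rw [integral_mul_const, (integral_box' hδ.le t).2]
    rw [abs_mul, abs_of_pos (inv_pos.2 hδ), inv_mul_le_iff₀ hδ]
    exact h
  have hwδ : Adm (a - δ) b (fun t => w (t + δ)) := (hw.comp_add δ).mono le_rfl (by linarith)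
  have hrep : (δ ^ 2)⁻¹ * bil (tent δ) E w - ∫ t, E t * w t
      = (∫ t, X t * (δ⁻¹ * win δ w t)) + ∫ t, Y t * w (t + δ) := by
    have e1 : ∫ t, X t * (δ⁻¹ * win δ w t)
        = (δ ^ 2)⁻¹ * bil (tent δ) E w - δ⁻¹ * bil (fun d => box δ d 0) E w := by
      rw [← integral_win_mul_win hE hw, ← integral_mul_win hw hE, ← integral_const_mul,
        ← integral_const_mul, ← integral_sub ((hW.mul hWw).integrable.const_mul _)
          ((h1.mul hWw).integrable.const_mul _)]
      congr 1; ext t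
      simp only [hX]
      field_simp
    have e2 : ∫ t, Y t * w (t + δ)
        = δ⁻¹ * bil (fun d => box δ d 0) E w - ∫ t, E t * w t := by
      have e3 : bil (fun d => box δ d 0) E w = bil (fun d => box δ (-d) 0) w E := by
        unfold bil
        rw [Measure.volume_eq_prod, ← integral_prod_swap]
        congr 1; ext z
        simp only [Prod.fst_swap, Prod.snd_swap, neg_sub]
        ring
      rw [e3, ← integral_shift_mul_win hw hE, ← integral_const_mul,
        ← integral_add_right_eq_self (fun t => E t * w t) δ,
        ← integral_sub ((hwδ.mul hW).integrable.const_mul _) (h2.mul hwδ).integrable]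
      congr 1; ext t
      simp only [hY]
      ring
    rw [e1, e2]; ring
  have hsq_le : ∀ {x y : ℝ → ℝ}, Adm (a - δ) b x → Adm (a - δ) b y → (∀ t, |y t| ≤ M) →
      ∫ t, x t ^ 2 ≤ δ ^ μ * gag μ E →
      (∫ t, x t * y t) ^ 2 ≤ M ^ 2 * ((b - a + 1) * (δ ^ μ * gag μ E)) := by
    intro x y hx hy hyM hx2
    have h : |∫ t, x t * y t| ≤ M * ∫ t, |x t| := by
      rw [← integral_const_mul]
      refine abs_integral_le_integral_abs.trans (integral_mono (hx.mul hy).integrable.abs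
        (hx.abs.integrable.const_mul M) fun t => ?_)
      simp only
      rw [abs_mul, mul_comm]
      exact mul_le_mul_of_nonneg_right (hyM t) (abs_nonneg _)
    rw [← sq_abs]
    refine (pow_le_pow_left₀ (abs_nonneg _) h 2).trans ?_
    rw [mul_pow]
    refine mul_le_mul_of_nonneg_left ((integral_abs_sq_le hl hx).trans ?_) (sq_nonneg _)
    exact mul_le_mul (by linarith) hx2 (integral_nonneg fun _ => sq_nonneg _) (by linarith)
  have hA3 := hsq_le hXA (hWw.const_mul δ⁻¹) hbd hX2
  have hB3 := hsq_le hYA hwδ (fun t => hM _) hY2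
  rw [hrep]
  nlinarith [sq_nonneg ((∫ t, X t * (δ⁻¹ * win δ w t)) - ∫ t, Y t * w (t + δ))]

theorem abs_bil_tent_le (hE : Adm a b E) (hw : Adm a b w) {R : ℝ} (hR : 0 < R) :
    |bil (tent R) E w| ≤ R * ((∫ t, |E t|) * ∫ t, |w t|) := by
  rw [← integral_win_mul_win hE hw]
  have h1 : ∀ t, |win R E t| ≤ ∫ s, |E s| := fun t => by
    refine (abs_integral_le_integral_abs).trans ?_
    refine integral_mono (integrable_box_mul hE R t).abs hE.integrable.abs fun s => ?_
    rw [abs_mul, abs_of_nonneg (box_nonneg _ _ _)]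
    exact mul_le_of_le_one_left (abs_nonneg _) (box_le_one _ _ _)
  have h2 : ∀ t, |win R w t| ≤ win R (fun s => |w s|) t := fun t => by
    refine (abs_integral_le_integral_abs).trans (le_of_eq ?_)
    unfold win
    congr 1; ext s
    rw [abs_mul, abs_of_nonneg (box_nonneg _ _ _)]
  calc |∫ t, win R E t * win R w t| ≤ ∫ t, |win R E t * win R w t| := abs_integral_le_integral_abs
    _ ≤ ∫ t, (∫ s, |E s|) * win R (fun s => |w s|) t := by
        refine integral_mono ((adm_win hE R).mul (adm_win hw R)).integrable.abs
          ((adm_win hw.abs R).integrable.const_mul _) fun t => ?_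
        simp only
        rw [abs_mul]
        exact mul_le_mul (h1 t) (h2 t) (abs_nonneg _) (integral_nonneg fun _ => abs_nonneg _)
    _ = _ := by rw [integral_const_mul, integral_win hw.abs hR.le]; ring

end

section

variable {a b : ℝ} {E w : ℝ → ℝ}

theorem pairing_le {μ : ℝ} (hμ : 0 < μ) (hμ1 : μ < 1) (hab : a < b) (hE : Adm a b E)
    (hw : Adm a b w) (hG : Integrable (gagF μ E)) :
    ∫ t, E t * w t ≤ ((1 - μ) * (2 - μ))⁻¹ * en μ w w + (1 + μ)⁻¹ * gag μ E := by
  set Z := ((1 - μ) * (2 - μ))⁻¹ * en μ w w + (1 + μ)⁻¹ * gag μ E with hZ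
  have hs := en_eq_scale hμ hμ1 hw hw
  have hd := integral_diffSq_le hμ hE hG
  have hfin : ∀ δ R, 0 < δ → δ < R →
      (δ ^ 2)⁻¹ * bil (tent δ) E w - (R ^ 2)⁻¹ * bil (tent R) E w ≤ Z := by
    intro δ R hδ hR
    have hsub : Ioc δ R ⊆ Ioi 0 := fun r hr => hδ.trans hr.1
    obtain ⟨hi, he⟩ := bil_average_sub hE hw hδ hR
    rw [he]
    calc ∫ r in Ioc δ R, 2 * (r ^ 3)⁻¹ * bil (trapKer r) E w
        ≤ ∫ r in Ioc δ R, (r ^ (μ - 3) * bil (tent r) w w + r ^ (-2 - μ) * diffSq E r) := by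
          refine setIntegral_mono_on hi ((hs.1.mono_set hsub).add (hd.1.mono_set hsub))
            measurableSet_Ioc fun r hr => ?_
          have hr0 : 0 < r := hδ.trans hr.1
          have hW := adm_win hw r
          have hT := adm_trap hE hr0.le
          have h1 : 2 * (r ^ 3)⁻¹ * bil (trapKer r) E w
              ≤ ∫ t, (r ^ (μ - 3) * (win r w t * win r w t) + r ^ (-3 - μ) * trap r E t ^ 2) := by
            rw [← integral_win_mul_trap hE hw hr0.le, ← integral_const_mul]
            refine integral_mono ((hT.mul hW).integrable.const_mul _)
              (((hW.mul hW).integrable.const_mul _).add (hT.sq.integrable.const_mul _)) fun t => ?_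
            have e1 : (r ^ 3)⁻¹ = r ^ ((μ - 3) / 2) * r ^ ((-3 - μ) / 2) := by
              rw [← Real.rpow_add hr0, ← Real.rpow_natCast r 3, ← Real.rpow_neg hr0.le]
              congr 1; push_cast; ring
            have e2 : r ^ (μ - 3) = (r ^ ((μ - 3) / 2)) ^ 2 := by
              rw [← Real.rpow_natCast, ← Real.rpow_mul hr0.le]; congr 1; push_cast; ring
            have e3 : r ^ (-3 - μ) = (r ^ ((-3 - μ) / 2)) ^ 2 := by
              rw [← Real.rpow_natCast, ← Real.rpow_mul hr0.le]; congr 1; push_cast; ring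
            simp only
            rw [e1, e2, e3]
            nlinarith [sq_nonneg (r ^ ((μ - 3) / 2) * win r w t - r ^ ((-3 - μ) / 2) * trap r E t)]
          refine h1.trans ?_
          rw [integral_add ((hW.mul hW).integrable.const_mul _) (hT.sq.integrable.const_mul _),
            integral_const_mul, integral_const_mul, integral_win_mul_win hw hw]
          refine add_le_add le_rfl ?_
          have h2 := mul_le_mul_of_nonneg_left (integral_trap_sq_le hE hr0)
            (Real.rpow_nonneg hr0.le (-3 - μ))
          refine h2.trans (le_of_eq ?_)
          rw [← mul_assoc, ← Real.rpow_add_one hr0.ne']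
          congr 2; ring
      _ = (∫ r in Ioc δ R, r ^ (μ - 3) * bil (tent r) w w)
          + ∫ r in Ioc δ R, r ^ (-2 - μ) * diffSq E r :=
          integral_add (hs.1.mono_set hsub) (hd.1.mono_set hsub)
      _ ≤ (∫ r in Ioi 0, r ^ (μ - 3) * bil (tent r) w w)
          + ∫ r in Ioi 0, r ^ (-2 - μ) * diffSq E r := by
          refine add_le_add (setIntegral_mono_set hs.1 ?_ (.of_forall hsub))
            (setIntegral_mono_set hd.1 ?_ (.of_forall hsub))
          · refine (ae_restrict_iff' measurableSet_Ioi).2 (.of_forall fun r hr => ?_)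
            exact mul_nonneg (Real.rpow_nonneg (le_of_lt hr) _) (bil_tent_nonneg hw r)
          · refine (ae_restrict_iff' measurableSet_Ioi).2 (.of_forall fun r hr => ?_)
            refine mul_nonneg (Real.rpow_nonneg (le_of_lt hr) _) ?_
            rw [diffSq_eq hμ hE hG hr]
            exact integral_nonneg fun z => mul_nonneg (box_nonneg _ _ _) (sq_nonneg _)
      _ ≤ Z := by rw [← hs.2]; exact add_le_add le_rfl hd.2
  have hlim1 : ∀ δ, 0 < δ → (δ ^ 2)⁻¹ * bil (tent δ) E w ≤ Z := by
    intro δ hδ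
    have ht : Tendsto (fun R : ℝ => (R ^ 2)⁻¹ * bil (tent R) E w) atTop (𝓝 0) := by
      have h0 : Tendsto (fun R : ℝ => R⁻¹ * ((∫ t, |E t|) * ∫ t, |w t|)) atTop (𝓝 0) := by
        have := tendsto_inv_atTop_zero (𝕜 := ℝ) |>.mul_const ((∫ t, |E t|) * ∫ t, |w t|)
        simpa using this
      refine squeeze_zero_norm' ?_ h0
      filter_upwards [eventually_gt_atTop 0] with R hR
      rw [norm_mul, Real.norm_eq_abs, Real.norm_eq_abs, abs_of_pos (by positivity)]
      have := mul_le_mul_of_nonneg_left (abs_bil_tent_le hE hw hR)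
        (by positivity : 0 ≤ (R ^ 2)⁻¹)
      refine this.trans (le_of_eq ?_)
      field_simp
    have h2 := ht.const_sub ((δ ^ 2)⁻¹ * bil (tent δ) E w)
    rw [sub_zero] at h2
    refine le_of_tendsto h2 ?_
    filter_upwards [eventually_gt_atTop δ] with R hR
    exact hfin δ R hδ hR
  obtain ⟨C, hC⟩ := tendsto_average hμ hab hE hw hG
  have ht : Tendsto (fun δ : ℝ => (δ ^ 2)⁻¹ * bil (tent δ) E w) (𝓝[>] 0) (𝓝 (∫ t, E t * w t)) := by
    rw [tendsto_iff_norm_sub_tendsto_zero]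
    have h0 : Tendsto (fun δ : ℝ => √(C * δ ^ μ)) (𝓝[>] 0) (𝓝 0) := by
      have : Tendsto (fun δ : ℝ => √(C * δ ^ μ)) (𝓝 0) (𝓝 (√(C * 0 ^ μ))) :=
        (Real.continuous_sqrt.tendsto _).comp
          ((Real.continuousAt_rpow_const 0 μ (Or.inr hμ.le)).tendsto.const_mul C)
      rw [Real.zero_rpow hμ.ne', mul_zero, Real.sqrt_zero] at this
      exact this.mono_left nhdsWithin_le_nhds
    refine squeeze_zero' (.of_forall fun _ => norm_nonneg _) ?_ h0
    filter_upwards [Ioc_mem_nhdsGT one_pos] with δ hδ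
    rw [Real.norm_eq_abs]
    exact Real.abs_le_sqrt (hC δ hδ.1 hδ.2)
  refine le_of_tendsto ht ?_
  filter_upwards [self_mem_nhdsWithin] with δ hδ
  exact hlim1 δ hδ

/-- Duality between the energy of order `-μ/2` and the Gagliardo seminorm of order `μ/2`. -/
theorem pairing_sq_le {μ : ℝ} (hμ : 0 < μ) (hμ1 : μ < 1) (hab : a < b) (hE : Adm a b E)
    (hw : Adm a b w) (hG : Integrable (gagF μ E)) :
    (∫ t, E t * w t) ^ 2
      ≤ 4 * ((1 - μ) * (2 - μ))⁻¹ * (1 + μ)⁻¹ * gag μ E * en μ w w := by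
  have key : ∀ s : ℝ, 0 ≤ (1 + μ)⁻¹ * gag μ E * (s * s) + (-∫ t, E t * w t) * s
      + ((1 - μ) * (2 - μ))⁻¹ * en μ w w := by
    intro s
    have e1 : ∀ z, gagF μ (fun x => s * E x) z = s ^ 2 * gagF μ E z := fun z => by
      unfold gagF; ring
    have hG' : Integrable (gagF μ fun x => s * E x) :=
      (hG.const_mul (s ^ 2)).congr (.of_forall fun z => (e1 z).symm)
    have h := pairing_le hμ hμ1 hab (hE.const_mul s) hw hG'
    have e2 : gag μ (fun x => s * E x) = s ^ 2 * gag μ E := by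
      unfold gag; simp only [e1]; rw [integral_const_mul]
    have e3 : ∫ t, s * E t * w t = s * ∫ t, E t * w t := by
      rw [← integral_const_mul]; congr 1; ext t; ring
    rw [e2, e3] at h
    nlinarith
  have := discrim_le_zero key
  rw [discrim] at this
  nlinarith

end

section

theorem integral_Ici_rpow_shift {μ c x : ℝ} (hμ : 0 < μ) (hc : x < c) :
    Integrable (fun y => if c ≤ y then (y - x) ^ (-1 - μ) else 0) ∧
      ∫ y, (if c ≤ y then (y - x) ^ (-1 - μ) else 0) = (c - x) ^ (-μ) / μ := by
  set f : ℝ → ℝ := (Ici (c - x)).indicator fun d => d ^ (-1 - μ) with hf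
  have e : (fun y => if c ≤ y then (y - x) ^ (-1 - μ) else 0) = fun y => f (y - x) := by
    ext y
    simp only [hf, indicator, mem_Ici, sub_le_sub_iff_right]
  have hcx : 0 < c - x := by linarith
  have hi : Integrable f := by
    rw [hf, integrable_indicator_iff measurableSet_Ici, integrableOn_Ici_iff_integrableOn_Ioi]
    exact integrableOn_Ioi_rpow_of_lt (by linarith) hcx
  rw [e]
  refine ⟨hi.comp_sub_right x, ?_⟩
  rw [integral_sub_right_eq_self f x, hf, integral_indicator measurableSet_Ici,
    integral_Ici_eq_integral_Ioi, integral_Ioi_rpow_of_lt (by linarith) hcx]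
  have : -1 - μ + 1 = -μ := by ring
  rw [this, neg_div_neg_eq]

theorem integral_Iic_rpow_shift {μ c x : ℝ} (hμ : 0 < μ) (hc : c < x) :
    Integrable (fun y => if y ≤ c then (x - y) ^ (-1 - μ) else 0) ∧
      ∫ y, (if y ≤ c then (x - y) ^ (-1 - μ) else 0) = (x - c) ^ (-μ) / μ := by
  have h := integral_Ici_rpow_shift (c := -c) (x := -x) hμ (by linarith)
  have e : (fun y => if y ≤ c then (x - y) ^ (-1 - μ) else 0)
      = fun y => (fun y => if -c ≤ y then (y - -x) ^ (-1 - μ) else 0) (-y) := by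
    ext y
    have e2 : -y - -x = x - y := by ring
    simp only [neg_le_neg_iff, e2]
  rw [e]
  refine ⟨h.1.comp_neg, ?_⟩
  rw [integral_neg_eq_self (fun y => if -c ≤ y then (y - -x) ^ (-1 - μ) else 0), h.2]
  congr 2; ring

theorem integral_sub_right_rpow {μ : ℝ} (hμ1 : μ < 1) (l r : ℝ) :
    IntervalIntegrable (fun x => (x - l) ^ (-μ)) volume l r ∧
      ∫ x in l..r, (x - l) ^ (-μ) = (r - l) ^ (1 - μ) / (1 - μ) := by
  have h := (intervalIntegral.intervalIntegrable_rpow' (r := -μ) (by linarith)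
    (a := l - l) (b := r - l)).comp_sub_right l
  refine ⟨by simpa using h, ?_⟩
  rw [intervalIntegral.integral_comp_sub_right (fun x => x ^ (-μ)) l, sub_self,
    integral_rpow (Or.inl (by linarith)), neg_add_eq_sub, Real.zero_rpow (by linarith), sub_zero]

theorem integral_sub_left_rpow {μ : ℝ} (hμ1 : μ < 1) (l r : ℝ) :
    IntervalIntegrable (fun x => (r - x) ^ (-μ)) volume l r ∧
      ∫ x in l..r, (r - x) ^ (-μ) = (r - l) ^ (1 - μ) / (1 - μ) := by
  have h := (intervalIntegral.intervalIntegrable_rpow' (r := -μ) (by linarith)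
    (a := r - l) (b := r - r)).comp_sub_left r
  refine ⟨by simpa using h, ?_⟩
  rw [intervalIntegral.integral_comp_sub_left (fun x => x ^ (-μ)) r, sub_self,
    integral_rpow (Or.inl (by linarith)), neg_add_eq_sub, Real.zero_rpow (by linarith), sub_zero]

/-- The part of the Gagliardo kernel that joins the interval `(l, r)` with its complement. -/
def crossKer (μ l r : ℝ) (z : ℝ × ℝ) : ℝ :=
  (Ioo l r).indicator (fun _ => (1:ℝ)) z.1 *
    ((if r ≤ z.2 then (z.2 - z.1) ^ (-1 - μ) else 0) + if z.2 ≤ l then (z.1 - z.2) ^ (-1 - μ) else 0)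

theorem crossKer_nonneg (μ l r : ℝ) (z : ℝ × ℝ) : 0 ≤ crossKer μ l r z := by
  unfold crossKer
  by_cases h : z.1 ∈ Ioo l r
  · rw [indicator_of_mem h, one_mul]
    refine add_nonneg ?_ ?_
    · split_ifs with h'
      · exact Real.rpow_nonneg (by linarith [h.2]) _
      · exact le_rfl
    · split_ifs with h'
      · exact Real.rpow_nonneg (by linarith [h.1]) _
      · exact le_rfl
  · rw [indicator_of_notMem h, zero_mul]

theorem integral_crossKer {μ l r : ℝ} (hμ : 0 < μ) (hμ1 : μ < 1) (hlr : l < r) :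
    Integrable (crossKer μ l r) ∧
      ∫ z, crossKer μ l r z = 2 * (r - l) ^ (1 - μ) / (μ * (1 - μ)) := by
  have hmeas : Measurable (crossKer μ l r) := by
    unfold crossKer
    refine Measurable.mul ?_ (Measurable.add ?_ ?_)
    · exact (measurable_const.indicator measurableSet_Ioo).comp measurable_fst
    · exact Measurable.ite (measurableSet_le measurable_const measurable_snd) (by fun_prop)
        measurable_const
    · exact Measurable.ite (measurableSet_le measurable_snd measurable_const) (by fun_prop)
        measurable_const
  have hinner : ∀ x, ∫ y, crossKer μ l r (x, y)
      = (Ioo l r).indicator (fun x => (r - x) ^ (-μ) / μ + (x - l) ^ (-μ) / μ) x := by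
    intro x
    simp only [crossKer]
    rw [integral_const_mul]
    by_cases h : x ∈ Ioo l r
    · rw [indicator_of_mem h, indicator_of_mem h, one_mul,
        integral_add (integral_Ici_rpow_shift hμ h.2).1 (integral_Iic_rpow_shift hμ h.1).1,
        (integral_Ici_rpow_shift hμ h.2).2, (integral_Iic_rpow_shift hμ h.1).2]
    · rw [indicator_of_notMem h, indicator_of_notMem h, zero_mul]
  obtain ⟨j1, k1⟩ := integral_sub_left_rpow hμ1 l r
  obtain ⟨j2, k2⟩ := integral_sub_right_rpow hμ1 l r
  have hI : Integrable ((Ioo l r).indicator (fun x => (r - x) ^ (-μ) / μ + (x - l) ^ (-μ) / μ)) := by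
    rw [integrable_indicator_iff measurableSet_Ioo]
    exact ((j1.div_const μ).add (j2.div_const μ)).1.mono_set Ioo_subset_Ioc_self
  have hint : Integrable (crossKer μ l r) := by
    rw [Measure.volume_eq_prod, integrable_prod_iff hmeas.aestronglyMeasurable]
    constructor
    · refine .of_forall fun x => ?_
      simp only [crossKer]
      by_cases h : x ∈ Ioo l r
      · exact ((integral_Ici_rpow_shift hμ h.2).1.add (integral_Iic_rpow_shift hμ h.1).1).const_mul
          ((Ioo l r).indicator (fun _ => (1:ℝ)) x)
      · simp only [indicator_of_notMem h, zero_mul]; exact integrable_zero _ _ _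
    · refine hI.congr (.of_forall fun x => ?_)
      simp only
      rw [← hinner x]
      congr 1; ext y
      rw [Real.norm_eq_abs, abs_of_nonneg (crossKer_nonneg _ _ _ _)]
  refine ⟨hint, ?_⟩
  rw [Measure.volume_eq_prod, integral_prod _ (by rwa [← Measure.volume_eq_prod])]
  simp only [hinner]
  rw [integral_indicator measurableSet_Ioo, ← integral_Ioc_eq_integral_Ioo,
    ← intervalIntegral.integral_of_le hlr.le,
    intervalIntegral.integral_add (j1.div_const μ) (j2.div_const μ),
    intervalIntegral.integral_div, intervalIntegral.integral_div, k1, k2]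
  have : 1 - μ ≠ 0 := by linarith
  field_simp
  ring

theorem adm_ind (l r : ℝ) : Adm l r ((Ioo l r).indicator fun _ => (1:ℝ)) := by
  refine ⟨measurable_const.indicator measurableSet_Ioo, ⟨1, fun x => ?_⟩, fun x hx => ?_⟩
  · by_cases h : x ∈ Ioo l r <;> simp [h]
  · exact indicator_of_notMem (fun h => hx (Ioo_subset_Icc_self h)) _

theorem integral_abs_sub_rpow_le {μ l r x : ℝ} (hμ1 : μ < 1) (hx : x ∈ Icc l r) :
    IntegrableOn (fun y => |x - y| ^ (-μ)) (Ioo l r) ∧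
      ∫ y in Ioo l r, |x - y| ^ (-μ) ≤ 2 * (r - l) ^ (1 - μ) / (1 - μ) := by
  have hlr : l ≤ r := hx.1.trans hx.2
  have h1 : EqOn (fun y => (x - y) ^ (-μ)) (fun y => |x - y| ^ (-μ)) (uIcc l x) := fun y hy => by
    rw [uIcc_of_le hx.1] at hy
    simp only [abs_of_nonneg (sub_nonneg.2 hy.2)]
  have h2 : EqOn (fun y => (y - x) ^ (-μ)) (fun y => |x - y| ^ (-μ)) (uIcc x r) := fun y hy => by
    rw [uIcc_of_le hx.2] at hy
    simp only [abs_sub_comm x, abs_of_nonneg (sub_nonneg.2 hy.1)]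
  obtain ⟨j1, e1⟩ := integral_sub_left_rpow hμ1 l x
  obtain ⟨j2, e2⟩ := integral_sub_right_rpow hμ1 x r
  replace j1 := j1.congr (h1.mono uIoc_subset_uIcc)
  replace j2 := j2.congr (h2.mono uIoc_subset_uIcc)
  refine ⟨(j1.trans j2).1.mono_set Ioo_subset_Ioc_self, ?_⟩
  rw [intervalIntegral.integral_congr h1] at e1
  rw [intervalIntegral.integral_congr h2] at e2
  rw [← integral_Ioc_eq_integral_Ioo, ← intervalIntegral.integral_of_le hlr,
    ← intervalIntegral.integral_add_adjacent_intervals j1 j2, e1, e2, ← add_div]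
  have hp : 0 < 1 - μ := by linarith
  have h1 : (x - l) ^ (1 - μ) ≤ (r - l) ^ (1 - μ) :=
    Real.rpow_le_rpow (by linarith [hx.1]) (by linarith [hx.2]) hp.le
  have h2 : (r - x) ^ (1 - μ) ≤ (r - l) ^ (1 - μ) :=
    Real.rpow_le_rpow (by linarith [hx.2]) (by linarith [hx.1]) hp.le
  exact div_le_div_of_nonneg_right (by linarith) hp.le

theorem integral_diagKer {μ l r : ℝ} (hμ1 : μ < 1) (hlr : l < r) :
    Integrable (fun z : ℝ × ℝ => (Ioo l r).indicator (fun _ => (1:ℝ)) z.1 *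
        (Ioo l r).indicator (fun _ => (1:ℝ)) z.2 * |z.1 - z.2| ^ (-μ)) ∧
      ∫ z : ℝ × ℝ, (Ioo l r).indicator (fun _ => (1:ℝ)) z.1 *
        (Ioo l r).indicator (fun _ => (1:ℝ)) z.2 * |z.1 - z.2| ^ (-μ)
        ≤ 2 * (r - l) ^ (2 - μ) / (1 - μ) := by
  have hk := integrableOn_abs_rpow (ν := -μ) (by linarith) (r - l)
  have hA := adm_ind l r
  refine ⟨integrable_bil hA hA hk, ?_⟩
  have h := bil_eq_iterated hA hA hk
  unfold bil at h
  rw [h]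
  have e : ∀ x, (Ioo l r).indicator (fun _ => (1:ℝ)) x * ∫ s, |x - s| ^ (-μ) *
      (Ioo l r).indicator (fun _ => (1:ℝ)) s ≤ (Ioo l r).indicator (fun _ => (1:ℝ)) x *
        (2 * (r - l) ^ (1 - μ) / (1 - μ)) := by
    intro x
    by_cases hx : x ∈ Ioo l r
    · rw [indicator_of_mem hx, one_mul, one_mul]
      refine le_trans (le_of_eq ?_) (integral_abs_sub_rpow_le hμ1 (Ioo_subset_Icc_self hx)).2
      rw [← integral_indicator measurableSet_Ioo]
      congr 1; ext y
      by_cases hy : y ∈ Ioo l r <;> simp [hy]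
    · rw [indicator_of_notMem hx, zero_mul, zero_mul]
  have hpos : 0 ≤ᵐ[volume] fun x => (Ioo l r).indicator (fun _ => (1:ℝ)) x *
      ∫ s, |x - s| ^ (-μ) * (Ioo l r).indicator (fun _ => (1:ℝ)) s := by
    refine .of_forall fun x => mul_nonneg (indicator_nonneg (fun _ _ => zero_le_one) _)
      (integral_nonneg fun s => mul_nonneg (Real.rpow_nonneg (abs_nonneg _) _)
        (indicator_nonneg (fun _ _ => zero_le_one) _))
  refine (integral_mono_of_nonneg hpos (hA.integrable.mul_const _) (.of_forall e)).trans
    (le_of_eq ?_)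
  rw [integral_mul_const, integral_indicator measurableSet_Ioo, setIntegral_const, Measure.real,
    Real.volume_Ioo, ENNReal.toReal_ofReal (by linarith), smul_eq_mul, mul_one]
  have : (r - l) ^ (2 - μ) = (r - l) ^ (1 - μ) * (r - l) := by
    rw [← Real.rpow_add_one (by linarith : r - l ≠ 0)]; congr 1; ring
  rw [this]; ring

/-- The function equal to `F k` on the `k`-th element and zero elsewhere. -/
def glue {a b : ℝ} {K : ℕ} (m : Mesh a b K) (F : Fin K → ℝ → ℝ) (x : ℝ) : ℝ :=
  ∑ k, (Ioo (m.lo k) (m.hi k)).indicator (F k) x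

variable {a b : ℝ} {K : ℕ} {m : Mesh a b K} {F : Fin K → ℝ → ℝ}

theorem glue_of_mem {k : Fin K} {x : ℝ} (hx : x ∈ Ioo (m.lo k) (m.hi k)) : glue m F x = F k x := by
  unfold glue
  rw [Finset.sum_eq_single k]
  · exact indicator_of_mem hx _
  · intro j _ hj
    refine indicator_of_notMem (fun h => ?_) _
    exact Set.disjoint_left.1 (m.disjoint_cells hj) h hx
  · simp

theorem glue_of_notMem {x : ℝ} (hx : ∀ k, x ∉ Ioo (m.lo k) (m.hi k)) : glue m F x = 0 :=
  Finset.sum_eq_zero fun k _ => indicator_of_notMem (hx k) _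

theorem adm_glue (hF : ∀ k, ContinuousOn (F k) (Icc (m.lo k) (m.hi k))) : Adm a b (glue m F) := by
  have hC : ∀ k, ∃ C, 0 ≤ C ∧ ∀ x ∈ Icc (m.lo k) (m.hi k), ‖F k x‖ ≤ C := fun k => by
    obtain ⟨C, hC⟩ := isCompact_Icc.exists_bound_of_continuousOn (hF k)
    exact ⟨|C|, abs_nonneg C, fun x hx => (hC x hx).trans (le_abs_self C)⟩
  choose C hC0 hC using hC
  refine ⟨?_, ⟨∑ k, C k, fun x => ?_⟩, fun x hx => ?_⟩
  · unfold glue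
    refine Finset.measurable_sum _ fun k _ => ?_
    rw [← Set.piecewise_eq_indicator]
    exact ((hF k).mono Ioo_subset_Icc_self).measurable_piecewise continuousOn_const measurableSet_Ioo
  · refine (Finset.abs_sum_le_sum_abs _ _).trans (Finset.sum_le_sum fun k _ => ?_)
    by_cases h : x ∈ Ioo (m.lo k) (m.hi k)
    · rw [indicator_of_mem h]; exact hC k x (Ioo_subset_Icc_self h)
    · rw [indicator_of_notMem h, abs_zero]; exact hC0 k
  · exact glue_of_notMem fun k h => hx (Ioo_subset_Icc_self (m.Ioo_subset k h))

theorem integral_glue_mul (hab : a < b) (hF : ∀ k, ContinuousOn (F k) (Icc (m.lo k) (m.hi k)))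
    {w : ℝ → ℝ} (hw : Adm a b w) :
    ∫ x, glue m F x * w x = ∑ k, ∫ x in (m.lo k)..(m.hi k), F k x * w x := by
  rw [((adm_glue hF).mul hw).integral_eq_sum m hab]
  refine Finset.sum_congr rfl fun k _ => ?_
  rw [intervalIntegral.integral_of_le (m.lo_lt_hi k).le, intervalIntegral.integral_of_le
    (m.lo_lt_hi k).le, integral_Ioc_eq_integral_Ioo, integral_Ioc_eq_integral_Ioo]
  exact setIntegral_congr_fun measurableSet_Ioo fun x hx => by simp only [glue_of_mem hx]

/-- Gagliardo seminorm of a piecewise Hölder function on an arbitrary mesh. -/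
theorem gag_glue_le {μ : ℝ} (hμ : 0 < μ) (hμ1 : μ < 1)
    (hF : ∀ k, ContinuousOn (F k) (Icc (m.lo k) (m.hi k))) {M L : Fin K → ℝ}
    (hM : ∀ k, ∀ x ∈ Icc (m.lo k) (m.hi k), |F k x| ≤ M k)
    (hL : ∀ k, ∀ x ∈ Icc (m.lo k) (m.hi k), ∀ y ∈ Icc (m.lo k) (m.hi k),
      (F k x - F k y) ^ 2 ≤ L k ^ 2 * |x - y|) :
    Integrable (gagF μ (glue m F)) ∧ gag μ (glue m F) ≤
      ∑ k, (L k ^ 2 * (2 * (m.hi k - m.lo k) ^ (2 - μ) / (1 - μ))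
        + 4 * M k ^ 2 * (2 * (m.hi k - m.lo k) ^ (1 - μ) / (μ * (1 - μ)))) := by
  set D : Fin K → ℝ × ℝ → ℝ := fun k z => (Ioo (m.lo k) (m.hi k)).indicator (fun _ => (1:ℝ)) z.1 *
    (Ioo (m.lo k) (m.hi k)).indicator (fun _ => (1:ℝ)) z.2 * |z.1 - z.2| ^ (-μ) with hD
  set T : Fin K → ℝ × ℝ → ℝ := fun k z => crossKer μ (m.lo k) (m.hi k) z with hT
  have hD0 : ∀ k z, 0 ≤ D k z := fun k z => mul_nonneg (mul_nonneg
    (indicator_nonneg (fun _ _ => zero_le_one) _) (indicator_nonneg (fun _ _ => zero_le_one) _))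
    (Real.rpow_nonneg (abs_nonneg _) _)
  have hT0 : ∀ k z, 0 ≤ T k z := fun k z => crossKer_nonneg _ _ _ _
  set G : Fin K → ℝ × ℝ → ℝ :=
    fun k z => L k ^ 2 * D k z + 2 * M k ^ 2 * (T k z + T k z.swap) with hG
  have iD := fun k => integral_diagKer hμ1 (m.lo_lt_hi k)
  have iT := fun k => integral_crossKer hμ hμ1 (m.lo_lt_hi k)
  have iTs : ∀ k, Integrable (fun z : ℝ × ℝ => T k z.swap) := fun k => by
    have := (iT k).1
    rw [Measure.volume_eq_prod] at this ⊢
    exact this.swap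
  have iG : ∀ k, Integrable (G k) := fun k =>
    ((iD k).1.const_mul _).add (((iT k).1.add (iTs k)).const_mul _)
  have hcross : ∀ z : ℝ × ℝ, (∀ k, ¬ (z.1 ∈ Ioo (m.lo k) (m.hi k) ∧ z.2 ∈ Ioo (m.lo k) (m.hi k))) →
      glue m F z.1 ^ 2 * |z.1 - z.2| ^ (-1 - μ) ≤ ∑ k, M k ^ 2 * T k z := by
    intro z hz
    by_cases h : ∃ k, z.1 ∈ Ioo (m.lo k) (m.hi k)
    · obtain ⟨k, hk⟩ := h
      rw [glue_of_mem hk]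
      refine le_trans ?_ (Finset.single_le_sum (f := fun k => M k ^ 2 * T k z)
        (fun j _ => mul_nonneg (sq_nonneg _) (hT0 j z)) (Finset.mem_univ k))
      have h1 : F k z.1 ^ 2 ≤ M k ^ 2 :=
        sq_le_sq' (by linarith [neg_abs_le (F k z.1), hM k _ (Ioo_subset_Icc_self hk)])
          ((le_abs_self _).trans (hM k _ (Ioo_subset_Icc_self hk)))
      refine mul_le_mul h1 ?_ (Real.rpow_nonneg (abs_nonneg _) _) (sq_nonneg _)
      simp only [hT, crossKer]
      rw [indicator_of_mem hk, one_mul]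
      have h2 : z.2 ∉ Ioo (m.lo k) (m.hi k) := fun h' => hz k ⟨hk, h'⟩
      by_cases h3 : z.2 ≤ m.lo k
      · have : ¬ m.hi k ≤ z.2 := by linarith [m.lo_lt_hi k]
        rw [if_neg this, if_pos h3, zero_add, abs_of_pos (by linarith [hk.1])]
      · have : m.hi k ≤ z.2 := by
          by_contra h4
          exact h2 ⟨not_le.1 h3, not_le.1 h4⟩
        rw [if_pos this, if_neg h3, add_zero, abs_sub_comm, abs_of_pos (by linarith [hk.2])]
    · rw [glue_of_notMem fun k hk => h ⟨k, hk⟩]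
      rw [zero_pow two_ne_zero, zero_mul]
      exact Finset.sum_nonneg fun k _ => mul_nonneg (sq_nonneg _) (hT0 k z)
  have hpt : ∀ z, gagF μ (glue m F) z ≤ ∑ k, G k z := by
    intro z
    by_cases h : ∃ k, z.1 ∈ Ioo (m.lo k) (m.hi k) ∧ z.2 ∈ Ioo (m.lo k) (m.hi k)
    · obtain ⟨k, h1, h2⟩ := h
      refine le_trans ?_ (Finset.single_le_sum (f := fun k => G k z) (fun j _ => ?_)
        (Finset.mem_univ k))
      · unfold gagF
        rw [glue_of_mem h1, glue_of_mem h2]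
        have h3 : L k ^ 2 * D k z ≤ G k z := by
          simp only [hG]
          have := mul_nonneg (mul_nonneg zero_le_two (sq_nonneg (M k)))
            (add_nonneg (hT0 k z) (hT0 k z.swap))
          linarith
        refine le_trans ?_ h3
        simp only [hD]
        rw [indicator_of_mem h1, indicator_of_mem h2, one_mul, one_mul]
        rcases eq_or_ne z.1 z.2 with he | he
        · rw [he]; simp only [sub_self]
          rw [zero_pow two_ne_zero, zero_mul]
          exact mul_nonneg (sq_nonneg _) (Real.rpow_nonneg (abs_nonneg _) _)
        · have hd : 0 < |z.1 - z.2| := abs_pos.2 (sub_ne_zero.2 he)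
          have e : |z.1 - z.2| ^ (-μ) = |z.1 - z.2| * |z.1 - z.2| ^ (-1 - μ) := by
            rw [mul_comm, ← Real.rpow_add_one hd.ne']; congr 1; ring
          rw [e, ← mul_assoc]
          exact mul_le_mul_of_nonneg_right
            (hL k _ (Ioo_subset_Icc_self h1) _ (Ioo_subset_Icc_self h2)) (Real.rpow_nonneg hd.le _)
      · exact add_nonneg (mul_nonneg (sq_nonneg _) (hD0 j z))
          (mul_nonneg (mul_nonneg zero_le_two (sq_nonneg _)) (add_nonneg (hT0 j z) (hT0 j _)))
    · push Not at h
      have c1 := hcross z fun k hk => h k hk.1 hk.2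
      have c2 := hcross z.swap fun k hk => h k hk.2 hk.1
      simp only [Prod.fst_swap, Prod.snd_swap] at c2
      rw [abs_sub_comm z.2 z.1] at c2
      have hp : 0 ≤ |z.1 - z.2| ^ (-1 - μ) := Real.rpow_nonneg (abs_nonneg _) _
      have h1 : gagF μ (glue m F) z ≤ 2 * (glue m F z.1 ^ 2 * |z.1 - z.2| ^ (-1 - μ))
          + 2 * (glue m F z.2 ^ 2 * |z.1 - z.2| ^ (-1 - μ)) := by
        unfold gagF
        nlinarith [sq_nonneg (glue m F z.1 + glue m F z.2)]
      have h2 : 2 * (∑ k, M k ^ 2 * T k z) + 2 * (∑ k, M k ^ 2 * T k z.swap) ≤ ∑ k, G k z := by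
        rw [Finset.mul_sum, Finset.mul_sum, ← Finset.sum_add_distrib]
        refine Finset.sum_le_sum fun k _ => ?_
        simp only [hG]
        nlinarith [mul_nonneg (sq_nonneg (L k)) (hD0 k z)]
      linarith
  have hmeas : Measurable (gagF μ (glue m F)) := by
    have hE := (adm_glue hF).meas
    unfold gagF
    exact (((hE.comp measurable_fst).sub (hE.comp measurable_snd)).pow_const 2).mul (by fun_prop)
  have iS : Integrable (fun z => ∑ k, G k z) := integrable_finsetSum _ fun k _ => iG k
  have hint : Integrable (gagF μ (glue m F)) := by
    refine iS.mono' hmeas.aestronglyMeasurable (.of_forall fun z => ?_)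
    rw [Real.norm_eq_abs, abs_of_nonneg (gagF_nonneg _ _ _)]
    exact hpt z
  refine ⟨hint, (integral_mono hint iS hpt).trans ?_⟩
  rw [integral_finsetSum _ fun k _ => iG k]
  refine Finset.sum_le_sum fun k _ => ?_
  have hs : ∫ z : ℝ × ℝ, T k z.swap = ∫ z, T k z := by
    rw [Measure.volume_eq_prod]; exact integral_prod_swap (T k)
  simp only [hG]
  rw [integral_add (f := fun z => L k ^ 2 * D k z) (g := fun z => 2 * M k ^ 2 * (T k z + T k z.swap))
    ((iD k).1.const_mul _) (((iT k).1.add (iTs k)).const_mul _), integral_const_mul,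
    integral_const_mul, integral_add (iT k).1 (iTs k), hs, (iT k).2]
  have := mul_le_mul_of_nonneg_left (iD k).2 (sq_nonneg (L k))
  refine (add_le_add this le_rfl).trans (le_of_eq ?_)
  ring

end

/-- Duality estimate for piecewise Hölder functions. -/
theorem pairing_glue_sq_le {μ : ℝ} (hμ : 0 < μ) (hμ1 : μ < 1) :
    ∃ C : ℝ, 0 < C ∧ ∀ {a b : ℝ} {K : ℕ} (m : Mesh a b K), a < b → ∀ (F : Fin K → ℝ → ℝ)
      (M L : Fin K → ℝ), (∀ k, ContinuousOn (F k) (Icc (m.lo k) (m.hi k))) →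
      (∀ k, ∀ x ∈ Icc (m.lo k) (m.hi k), |F k x| ≤ M k) →
      (∀ k, ∀ x ∈ Icc (m.lo k) (m.hi k), ∀ y ∈ Icc (m.lo k) (m.hi k),
        (F k x - F k y) ^ 2 ≤ L k ^ 2 * |x - y|) →
      ∀ w, Adm a b w →
      (∑ k, ∫ x in (m.lo k)..(m.hi k), F k x * w x) ^ 2 ≤
        C * (∑ k, (L k ^ 2 * (m.hi k - m.lo k) ^ (2 - μ)
          + M k ^ 2 * (m.hi k - m.lo k) ^ (1 - μ))) * en μ w w := by
  have h1 : 0 < 1 - μ := by linarith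
  have h2 : 0 < 2 - μ := by linarith
  refine ⟨4 * ((1 - μ) * (2 - μ))⁻¹ * (1 + μ)⁻¹ * (8 / (μ * (1 - μ))), by positivity, ?_⟩
  intro a b K m hab F M L hF hM hL w hw
  obtain ⟨hi, hle⟩ := gag_glue_le hμ hμ1 hF hM hL
  rw [← integral_glue_mul hab hF hw]
  have h := pairing_sq_le hμ hμ1 hab (adm_glue hF) hw hi
  refine h.trans (mul_le_mul_of_nonneg_right ?_ (en_nonneg hμ hμ1 hw))
  rw [mul_assoc _ (8 / (μ * (1 - μ)))]
  refine mul_le_mul_of_nonneg_left (hle.trans ?_) (by positivity)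
  rw [Finset.mul_sum]
  refine Finset.sum_le_sum fun k _ => ?_
  have hl : 0 < m.hi k - m.lo k := m.len_pos k
  set d := m.hi k - m.lo k
  have e1 : L k ^ 2 * (2 * d ^ (2 - μ) / (1 - μ)) ≤ 8 / (μ * (1 - μ)) * (L k ^ 2 * d ^ (2 - μ)) := by
    have : L k ^ 2 * (2 * d ^ (2 - μ) / (1 - μ)) = 2 * μ / (μ * (1 - μ)) * (L k ^ 2 * d ^ (2 - μ)) := by
      field_simp
    rw [this]
    gcongr
    linarith
  have e2 : 4 * M k ^ 2 * (2 * d ^ (1 - μ) / (μ * (1 - μ)))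
      = 8 / (μ * (1 - μ)) * (M k ^ 2 * d ^ (1 - μ)) := by ring
  rw [e2, mul_add]
  linarith

theorem pairing_glue_le {μ : ℝ} (hμ : 0 < μ) (hμ1 : μ < 1) :
    ∃ C : ℝ, 0 < C ∧ ∀ {a b : ℝ} {K : ℕ} (m : Mesh a b K), a < b → ∀ (F : Fin K → ℝ → ℝ)
      (A σ : ℝ), 0 ≤ A → 1 / 2 ≤ σ → (∀ k, ContinuousOn (F k) (Icc (m.lo k) (m.hi k))) →
      (∀ k, ∀ x ∈ Icc (m.lo k) (m.hi k), |F k x| ≤ A * (m.hi k - m.lo k) ^ σ) →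
      (∀ k, ∀ x ∈ Icc (m.lo k) (m.hi k), ∀ y ∈ Icc (m.lo k) (m.hi k),
        (F k x - F k y) ^ 2 ≤ (A * (m.hi k - m.lo k) ^ (σ - 1 / 2)) ^ 2 * |x - y|) →
      ∀ w, Adm a b w →
      (∑ k, ∫ x in (m.lo k)..(m.hi k), F k x * w x) ^ 2 ≤
        C * (b - a) * A ^ 2 * m.size ^ (2 * σ - μ) * en μ w w := by
  obtain ⟨C, hC, h⟩ := pairing_glue_sq_le hμ hμ1
  refine ⟨2 * C, by positivity, ?_⟩
  intro a b K m hab F A σ hA hσ hF hM hL w hw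
  refine (h m hab F _ _ hF hM hL w hw).trans (mul_le_mul_of_nonneg_right ?_ (en_nonneg hμ hμ1 hw))
  have hs : ∀ k, (A * (m.hi k - m.lo k) ^ (σ - 1 / 2)) ^ 2 * (m.hi k - m.lo k) ^ (2 - μ)
          + (A * (m.hi k - m.lo k) ^ σ) ^ 2 * (m.hi k - m.lo k) ^ (1 - μ)
      ≤ 2 * A ^ 2 * m.size ^ (2 * σ - μ) * (m.hi k - m.lo k) := fun k => by
    have hl : 0 < m.hi k - m.lo k := m.len_pos k
    have hle := m.len_le_size k
    set d := m.hi k - m.lo k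
    have e1 : (d ^ (σ - 1 / 2)) ^ 2 * d ^ (2 - μ) = d ^ (2 * σ - μ) * d := by
      rw [← Real.rpow_natCast, ← Real.rpow_mul hl.le, ← Real.rpow_add hl,
        ← Real.rpow_add_one hl.ne']
      congr 1; push_cast; ring
    have e2 : (d ^ σ) ^ 2 * d ^ (1 - μ) = d ^ (2 * σ - μ) * d := by
      rw [← Real.rpow_natCast, ← Real.rpow_mul hl.le, ← Real.rpow_add hl,
        ← Real.rpow_add_one hl.ne']
      congr 1; push_cast; ring
    rw [mul_pow, mul_pow, mul_assoc, mul_assoc, e1, e2]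
    have : d ^ (2 * σ - μ) ≤ m.size ^ (2 * σ - μ) :=
      Real.rpow_le_rpow hl.le hle (by linarith)
    nlinarith [mul_le_mul_of_nonneg_left (mul_le_mul_of_nonneg_right this hl.le) (sq_nonneg A)]
  have := Finset.sum_le_sum fun k (_ : k ∈ Finset.univ) => hs k
  rw [← Finset.mul_sum, m.sum_len] at this
  nlinarith [mul_le_mul_of_nonneg_left this hC.le]

/-- The mesh with a single element. -/
def Mesh.single {a b : ℝ} (hab : a < b) : Mesh a b 1 where
  node := ![a, b]
  strictMono := by
    intro i j hij
    fin_cases i <;> fin_cases j <;> simp_all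
  node_zero := rfl
  node_last := rfl

theorem pairing_holder_le {μ : ℝ} (hμ : 0 < μ) (hμ1 : μ < 1) {a b : ℝ} (hab : a < b) :
    ∃ C : ℝ, 0 < C ∧ ∀ (F : ℝ → ℝ) (L : ℝ), 0 ≤ L → ContinuousOn F (Icc a b) →
      (∀ x ∈ Icc a b, |F x| ≤ L) →
      (∀ x ∈ Icc a b, ∀ y ∈ Icc a b, (F x - F y) ^ 2 ≤ L ^ 2 * |x - y|) →
      ∀ w, Adm a b w → (∫ x in a..b, F x * w x) ^ 2 ≤ C * L ^ 2 * en μ w w := by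
  obtain ⟨C, hC, h⟩ := pairing_glue_sq_le hμ hμ1
  have hd : 0 < b - a := sub_pos.2 hab
  refine ⟨C * ((b - a) ^ (2 - μ) + (b - a) ^ (1 - μ)), by positivity, ?_⟩
  intro F L hL hF hM hH w hw
  have hlo : ∀ k, (Mesh.single hab).lo k = a := fun k => by fin_cases k; rfl
  have hhi : ∀ k, (Mesh.single hab).hi k = b := fun k => by fin_cases k; rfl
  have := h (Mesh.single hab) hab (fun _ => F) (fun _ => L) (fun _ => L)
    (by simpa only [hlo, hhi] using fun _ => hF) (by simpa only [hlo, hhi] using fun _ => hM)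
    (by simpa only [hlo, hhi] using fun _ => hH) w hw
  simp only [hlo, hhi, Finset.univ_unique, Finset.sum_singleton] at this
  refine this.trans (le_of_eq ?_)
  ring

theorem lintegral_beta_unit {p q : ℝ} (hp : -1 < p) (hq : -1 < q) :
    ∫⁻ x in Ioo (0:ℝ) 1, ENNReal.ofReal (x ^ p * (1 - x) ^ q)
      = ENNReal.ofReal (ProbabilityTheory.beta (p + 1) (q + 1)) := by
  have hB := ProbabilityTheory.beta_pos (α := p + 1) (β := q + 1) (by linarith) (by linarith)
  have h := ProbabilityTheory.lintegral_betaPDF_eq_one (α := p + 1) (β := q + 1) (by linarith)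
    (by linarith)
  rw [ProbabilityTheory.lintegral_betaPDF] at h
  set B := ProbabilityTheory.beta (p + 1) (q + 1)
  have e : ∀ x : ℝ, ENNReal.ofReal (x ^ p * (1 - x) ^ q)
      = ENNReal.ofReal B * ENNReal.ofReal (1 / B * x ^ (p + 1 - 1) * (1 - x) ^ (q + 1 - 1)) := by
    intro x
    rw [← ENNReal.ofReal_mul hB.le]
    congr 1
    rw [add_sub_cancel_right, add_sub_cancel_right]
    field_simp
  simp_rw [e]
  rw [lintegral_const_mul' _ _ ENNReal.ofReal_ne_top, h, mul_one]

theorem lintegral_beta {p q t c : ℝ} (hp : -1 < p) (hq : -1 < q) (htc : t < c) :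
    ∫⁻ x in Ioo t c, ENNReal.ofReal ((x - t) ^ p * (c - x) ^ q)
      = ENNReal.ofReal ((c - t) ^ (p + q + 1) * ProbabilityTheory.beta (p + 1) (q + 1)) := by
  have hd : 0 < c - t := sub_pos.2 htc
  have himg : (fun σ => (c - t) * σ + t) '' Ioo (0:ℝ) 1 = Ioo t c := by
    ext x
    constructor
    · rintro ⟨σ, hσ, rfl⟩
      exact ⟨by nlinarith [hσ.1], by nlinarith [hσ.2]⟩
    · intro hx
      refine ⟨(x - t) / (c - t), ⟨div_pos (by linarith [hx.1]) hd,
        (div_lt_one hd).2 (by linarith [hx.2])⟩, ?_⟩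
      change (c - t) * ((x - t) / (c - t)) + t = x
      field_simp; ring
  rw [← himg, lintegral_image_eq_lintegral_abs_deriv_mul measurableSet_Ioo
    (f := fun σ => (c - t) * σ + t) (f' := fun _ => c - t)
    (fun x _ => (((hasDerivAt_id x).const_mul (c - t)).add_const t).hasDerivWithinAt.congr_deriv
      (by simp))
    (fun x _ y _ hxy => by
      simpa [hd.ne'] using hxy)]
  rw [ENNReal.ofReal_mul (Real.rpow_nonneg hd.le _), ← lintegral_beta_unit hp hq,
    ← lintegral_const_mul' _ _ ENNReal.ofReal_ne_top]
  refine setLIntegral_congr_fun measurableSet_Ioo fun x hx => ?_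
  rw [abs_of_pos hd, ← ENNReal.ofReal_mul hd.le, ← ENNReal.ofReal_mul (Real.rpow_nonneg hd.le _)]
  congr 1
  have e1 : (c - t) * x + t - t = (c - t) * x := by ring
  have e2 : c - ((c - t) * x + t) = (c - t) * (1 - x) := by ring
  rw [e1, e2, Real.mul_rpow hd.le hx.1.le, Real.mul_rpow hd.le (by linarith [hx.2]),
    Real.rpow_add_one hd.ne', Real.rpow_add hd]
  ring

theorem integrableOn_beta {p q t c : ℝ} (hp : -1 < p) (hq : -1 < q) (htc : t < c) :
    IntegrableOn (fun x => (x - t) ^ p * (c - x) ^ q) (Ioo t c) := by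
  refine ⟨by fun_prop, ?_⟩
  rw [hasFiniteIntegral_iff_ofReal, lintegral_beta hp hq htc]
  · exact ENNReal.ofReal_lt_top
  · filter_upwards [ae_restrict_mem measurableSet_Ioo] with x hx
    exact mul_nonneg (Real.rpow_nonneg (by linarith [hx.1]) _)
      (Real.rpow_nonneg (by linarith [hx.2]) _)

theorem integral_beta {p q t c : ℝ} (hp : -1 < p) (hq : -1 < q) (htc : t < c) :
    ∫ x in Ioo t c, (x - t) ^ p * (c - x) ^ q
      = (c - t) ^ (p + q + 1) * ProbabilityTheory.beta (p + 1) (q + 1) := by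
  have hB := ProbabilityTheory.beta_pos (α := p + 1) (β := q + 1) (by linarith) (by linarith)
  rw [integral_eq_lintegral_of_nonneg_ae _ (integrableOn_beta hp hq htc).1, lintegral_beta hp hq htc,
    ENNReal.toReal_ofReal (mul_nonneg (Real.rpow_nonneg (by linarith) _) hB.le)]
  filter_upwards [ae_restrict_mem measurableSet_Ioo] with x hx
  exact mul_nonneg (Real.rpow_nonneg (by linarith [hx.1]) _)
    (Real.rpow_nonneg (by linarith [hx.2]) _)

/-- A Möbius substitution in a product of three power weights. -/
theorem lintegral_three_weights {κ : ℝ} (hκ : 0 < κ) (hκ1 : κ < 1 / 2) :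
    ∃ C : ℝ, 0 < C ∧ ∀ s x : ℝ, 0 < s → s < x →
      ∫⁻ t in Ioo 0 s, ENNReal.ofReal ((s - t) ^ (κ - 1) * (x - t) ^ (κ - 1) * t ^ (-(2 * κ)))
        = ENNReal.ofReal (C * (s ^ (-κ) * x ^ (-κ) * (x - s) ^ (2 * κ - 1))) := by
  set I := ∫⁻ τ in Ioi (0:ℝ), ENNReal.ofReal (τ ^ (κ - 1) * (1 + τ) ^ (κ - 1)) with hI
  have hint : IntegrableOn (fun τ : ℝ => τ ^ (κ - 1) * (1 + τ) ^ (κ - 1)) (Ioi 0) := by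
    rw [← Ioc_union_Ioi_eq_Ioi zero_le_one]
    refine IntegrableOn.union ?_ ?_
    · have h1 : IntegrableOn (fun τ : ℝ => τ ^ (κ - 1)) (Ioc 0 1) :=
        (intervalIntegral.intervalIntegrable_rpow' (by linarith)).1
      refine Integrable.mono' h1 (by fun_prop) ?_
      filter_upwards [ae_restrict_mem measurableSet_Ioc] with τ hτ
      rw [Real.norm_eq_abs, abs_of_nonneg (mul_nonneg (Real.rpow_nonneg hτ.1.le _)
        (Real.rpow_nonneg (by linarith [hτ.1]) _))]
      exact mul_le_of_le_one_right (Real.rpow_nonneg hτ.1.le _)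
        (Real.rpow_le_one_of_one_le_of_nonpos (by linarith [hτ.1]) (by linarith))
    · refine Integrable.mono' (integrableOn_Ioi_rpow_of_lt (a := 2 * κ - 2) (by linarith) one_pos)
        (by fun_prop) ?_
      filter_upwards [ae_restrict_mem measurableSet_Ioi] with τ hτ
      have h0 : (0:ℝ) < τ := lt_trans one_pos hτ
      rw [Real.norm_eq_abs, abs_of_nonneg (mul_nonneg (Real.rpow_nonneg h0.le _)
        (Real.rpow_nonneg (by linarith) _))]
      have : τ ^ (2 * κ - 2) = τ ^ (κ - 1) * τ ^ (κ - 1) := by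
        rw [← Real.rpow_add h0]; congr 1; ring
      rw [this]
      exact mul_le_mul_of_nonneg_left (Real.rpow_le_rpow_of_nonpos h0 (by linarith) (by linarith))
        (Real.rpow_nonneg h0.le _)
  have hnn : ∀ τ ∈ Ioi (0:ℝ), 0 < τ ^ (κ - 1) * (1 + τ) ^ (κ - 1) := fun τ hτ =>
    mul_pos (Real.rpow_pos_of_pos hτ _) (Real.rpow_pos_of_pos (by linarith [mem_Ioi.1 hτ]) _)
  have hIt : I ≠ ⊤ := by
    have := hint.2
    rw [hasFiniteIntegral_iff_ofReal] at this
    · exact this.ne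
    · filter_upwards [ae_restrict_mem measurableSet_Ioi] with τ hτ using (hnn τ hτ).le
  have hI0 : I ≠ 0 := by
    intro h0
    rw [hI, lintegral_eq_zero_iff (by fun_prop)] at h0
    have h1 : ∀ᵐ τ ∂(volume.restrict (Ioi (0:ℝ))), False := by
      filter_upwards [h0, ae_restrict_mem measurableSet_Ioi] with τ h2 hτ
      exact (ENNReal.ofReal_pos.2 (hnn τ hτ)).ne' h2
    rw [eventually_false_iff_eq_bot, ae_eq_bot, Measure.restrict_eq_zero] at h1
    simp at h1
  refine ⟨I.toReal, ENNReal.toReal_pos hI0 hIt, fun s x hs hsx => ?_⟩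
  have hx : 0 < x := hs.trans hsx
  have hd : 0 < x - s := sub_pos.2 hsx
  set D : ℝ → ℝ := fun τ => x + (x - s) * τ with hD
  have hDpos : ∀ τ ∈ Ioi (0:ℝ), 0 < D τ := fun τ hτ =>
    add_pos hx (mul_pos hd hτ)
  have himg : (fun τ => s * x / D τ) '' Ioi 0 = Ioo 0 s := by
    ext t
    constructor
    · rintro ⟨τ, hτ, rfl⟩
      have := hDpos τ hτ
      refine ⟨div_pos (mul_pos hs hx) this, (div_lt_iff₀ this).2 ?_⟩
      simp only [hD]
      nlinarith [mul_pos hs (mul_pos hd (mem_Ioi.1 hτ))]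
    · intro ht
      refine ⟨x * (s - t) / (t * (x - s)),
        div_pos (mul_pos hx (by linarith [ht.2])) (mul_pos ht.1 hd), ?_⟩
      have h1 := ht.1
      have : D (x * (s - t) / (t * (x - s))) = x * s / t := by
        simp only [hD]
        field_simp; ring
      change s * x / D _ = t
      rw [this]; field_simp
  have hder : ∀ τ ∈ Ioi (0:ℝ), HasDerivWithinAt (fun τ => s * x / D τ)
      (-(s * x * (x - s)) / D τ ^ 2) (Ioi 0) τ := fun τ hτ => by
    have h1 : HasDerivAt D (x - s) τ := by
      have := ((hasDerivAt_id' τ).const_mul (x - s)).const_add x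
      rwa [mul_one] at this
    have h2 := ((hasDerivAt_const τ (s * x)).div h1 (hDpos τ hτ).ne').hasDerivWithinAt (s := Ioi 0)
    refine h2.congr_deriv ?_
    ring
  have hinj : InjOn (fun τ => s * x / D τ) (Ioi 0) := fun τ hτ τ' hτ' h => by
    have h1 := hDpos τ hτ
    have h2 := hDpos τ' hτ'
    change s * x / D τ = s * x / D τ' at h
    have h0 : s * x ≠ 0 := (mul_pos hs hx).ne'
    have h3 : D τ = D τ' := by
      field_simp at h; exact h.symm
    simp only [hD, add_right_inj] at h3
    exact mul_left_cancel₀ hd.ne' h3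
  rw [← himg, lintegral_image_eq_lintegral_abs_deriv_mul measurableSet_Ioi hder hinj]
  have hK : 0 ≤ s ^ (-κ) * x ^ (-κ) * (x - s) ^ (2 * κ - 1) := by positivity
  rw [ENNReal.ofReal_mul ENNReal.toReal_nonneg, ENNReal.ofReal_toReal hIt, mul_comm I, hI,
    ← lintegral_const_mul' _ _ ENNReal.ofReal_ne_top]
  refine setLIntegral_congr_fun measurableSet_Ioi fun τ hτ => ?_
  have hDτ := hDpos τ hτ
  have hτ0 : 0 < τ := hτ
  have e1 : s - s * x / D τ = s * ((x - s) * τ) / D τ := by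
    field_simp; simp only [hD]; ring
  have e2 : x - s * x / D τ = x * ((x - s) * (1 + τ)) / D τ := by
    field_simp; simp only [hD]; ring
  rw [e1, e2, abs_div, abs_neg, abs_of_pos (by positivity), abs_of_pos (by positivity),
    ← ENNReal.ofReal_mul (by positivity), ← ENNReal.ofReal_mul hK]
  congr 1
  have h1t : 0 < 1 + τ := by linarith
  rw [Real.div_rpow (by positivity) hDτ.le, Real.div_rpow (by positivity) hDτ.le,
    Real.div_rpow (by positivity) hDτ.le, Real.mul_rpow hs.le (by positivity),
    Real.mul_rpow hd.le hτ0.le, Real.mul_rpow hx.le (by positivity), Real.mul_rpow hd.le h1t.le,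
    Real.mul_rpow hs.le hx.le]
  have a1 : s ^ (-κ) = s * s ^ (κ - 1) * s ^ (-(2 * κ)) := by
    rw [mul_comm s, ← Real.rpow_add_one hs.ne', ← Real.rpow_add hs]; congr 1; ring
  have a2 : x ^ (-κ) = x * x ^ (κ - 1) * x ^ (-(2 * κ)) := by
    rw [mul_comm x, ← Real.rpow_add_one hx.ne', ← Real.rpow_add hx]; congr 1; ring
  have a3 : (x - s) ^ (2 * κ - 1) = (x - s) * (x - s) ^ (κ - 1) * (x - s) ^ (κ - 1) := by
    rw [mul_comm (x - s), ← Real.rpow_add_one hd.ne', ← Real.rpow_add hd]; congr 1; ring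
  have a4 : D τ ^ 2 * (D τ ^ (κ - 1) * D τ ^ (κ - 1) * D τ ^ (-(2 * κ))) = 1 := by
    rw [← Real.rpow_natCast, ← Real.rpow_add hDτ, ← Real.rpow_add hDτ, ← Real.rpow_add hDτ]
    have : ((2:ℕ):ℝ) + (κ - 1 + (κ - 1) + -(2 * κ)) = 0 := by push_cast; ring
    rw [this, Real.rpow_zero]
  have p1 := Real.rpow_pos_of_pos hDτ (κ - 1)
  have p2 := Real.rpow_pos_of_pos hDτ (-(2 * κ))
  rw [a1, a2, a3]
  have : ∀ A B C E F G p q r : ℝ, r ≠ 0 → p ≠ 0 → q ≠ 0 → r ^ 2 * (p * p * q) = 1 →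
      A / r ^ 2 * (B / p * (C / p) * (E / q)) = A * B * C * E := by
    intro A B C E F G p q r hr hp hq h
    have : A / r ^ 2 * (B / p * (C / p) * (E / q)) = A * B * C * E / (r ^ 2 * (p * p * q)) := by
      field_simp
    rw [this, h, div_one]
  rw [this _ _ _ _ 0 0 _ _ _ hDτ.ne' p1.ne' p2.ne' a4]
  ring

/-- Riesz potential of the weight `x ↦ (c - x)^(-κ) x^(-κ)` on `(0, c)`, at the point `s`. -/
def weightPot (κ c s : ℝ) : ℝ :=
  ∫ x in Ioo 0 c, (c - x) ^ (-κ) * x ^ (-κ) * |x - s| ^ (2 * κ - 1)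

/-- The Abel integral of `t^(-2κ)` over `S`. -/
def abelOn (κ : ℝ) (S : Set ℝ) (s : ℝ) : ℝ := ∫ t in S, (s - t) ^ (κ - 1) * t ^ (-(2 * κ))

theorem integrableOn_abel {κ : ℝ} (hκ : 0 < κ) (hκ1 : κ < 1 / 2) {s : ℝ} (hs : 0 < s) :
    IntegrableOn (fun t => (s - t) ^ (κ - 1) * t ^ (-(2 * κ))) (Ioo 0 s) := by
  have := integrableOn_beta (p := -(2 * κ)) (q := κ - 1) (t := 0) (c := s) (by linarith)
    (by linarith) hs
  simpa only [sub_zero, mul_comm] using this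

theorem abelOn_full {κ : ℝ} (hκ : 0 < κ) (hκ1 : κ < 1 / 2) {s : ℝ} (hs : 0 < s) :
    s ^ κ * abelOn κ (Ioo 0 s) s = ProbabilityTheory.beta (1 - 2 * κ) κ := by
  have := integral_beta (p := -(2 * κ)) (q := κ - 1) (t := 0) (c := s) (by linarith)
    (by linarith) hs
  have e : -(2 * κ) + (κ - 1) + 1 = -κ := by ring
  have e2 : -(2 * κ) + 1 = 1 - 2 * κ := by ring
  simp only [sub_zero, e, e2, sub_add_cancel] at this
  unfold abelOn
  simp_rw [mul_comm ((s - _) ^ (κ - 1))]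
  rw [this, ← mul_assoc, ← Real.rpow_add hs, add_neg_cancel, Real.rpow_zero, one_mul]

theorem abel_nonneg {κ s t : ℝ} (ht : 0 < t) (hts : t < s) :
    0 ≤ (s - t) ^ (κ - 1) * t ^ (-(2 * κ)) :=
  mul_nonneg (Real.rpow_nonneg (by linarith) _) (Real.rpow_nonneg ht.le _)

theorem lintegral_weightPot {κ : ℝ} (hκ : 0 < κ) (hκ1 : κ < 1 / 2) :
    ∃ C : ℝ, 0 < C ∧ ∀ c s : ℝ, 0 < c → 0 < s →
      ∫⁻ x in Ioo 0 c, ENNReal.ofReal ((c - x) ^ (-κ) * x ^ (-κ) * |x - s| ^ (2 * κ - 1))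
        = ENNReal.ofReal (C * (s ^ κ * abelOn κ (Ioo 0 (min c s)) s)) := by
  obtain ⟨C1, hC1, h1⟩ := lintegral_three_weights hκ hκ1
  set B := ProbabilityTheory.beta κ (1 - κ) with hB
  have hB0 : 0 < B := ProbabilityTheory.beta_pos hκ (by linarith)
  refine ⟨B / C1, by positivity, fun c s hc hs => ?_⟩
  have hmin : 0 < min c s := lt_min hc hs
  have hab : IntegrableOn (fun t => (s - t) ^ (κ - 1) * t ^ (-(2 * κ))) (Ioo 0 (min c s)) :=
    (integrableOn_abel hκ hκ1 hs).mono_set (Ioo_subset_Ioo_right (min_le_right _ _))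
  have hA : ENNReal.ofReal (abelOn κ (Ioo 0 (min c s)) s)
      = ∫⁻ t in Ioo 0 (min c s), ENNReal.ofReal ((s - t) ^ (κ - 1) * t ^ (-(2 * κ))) := by
    refine ofReal_integral_eq_lintegral_ofReal hab ?_
    filter_upwards [ae_restrict_mem measurableSet_Ioo] with t ht
    exact abel_nonneg ht.1 (ht.2.trans_le (min_le_right _ _))
  set Φ : ℝ → ℝ → ENNReal := fun x t => if 0 < t ∧ t < x ∧ t < s ∧ x < c then
    ENNReal.ofReal ((s - t) ^ (κ - 1) * (x - t) ^ (κ - 1) * t ^ (-(2 * κ)) * (c - x) ^ (-κ))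
    else 0 with hΦ
  have hΦm : Measurable (Function.uncurry Φ) := by
    refine Measurable.ite ?_ (by fun_prop) measurable_const
    exact ((measurableSet_lt measurable_const measurable_snd).inter
      ((measurableSet_lt measurable_snd measurable_fst).inter
      ((measurableSet_lt measurable_snd measurable_const).inter
      (measurableSet_lt measurable_fst measurable_const))))
  have inner1 : ∀ x ∈ Ioo 0 c, x ≠ s → ENNReal.ofReal C1 *
      ENNReal.ofReal ((c - x) ^ (-κ) * x ^ (-κ) * |x - s| ^ (2 * κ - 1))
      = ENNReal.ofReal (s ^ κ) * ∫⁻ t, Φ x t := by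
    intro x hx hxs
    have hxc : 0 < c - x := sub_pos.2 hx.2
    have hms : 0 < min x s := lt_min hx.1 hs
    have e1 : ∫⁻ t, Φ x t = ENNReal.ofReal ((c - x) ^ (-κ)) * ∫⁻ t in Ioo 0 (min x s),
        ENNReal.ofReal ((s - t) ^ (κ - 1) * (x - t) ^ (κ - 1) * t ^ (-(2 * κ))) := by
      rw [← lintegral_const_mul' _ _ ENNReal.ofReal_ne_top, ← lintegral_indicator measurableSet_Ioo]
      refine lintegral_congr fun t => ?_
      by_cases h : t ∈ Ioo 0 (min x s)
      · have h' : 0 < t ∧ t < x ∧ t < s ∧ x < c :=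
          ⟨h.1, h.2.trans_le (min_le_left _ _), h.2.trans_le (min_le_right _ _), hx.2⟩
        rw [indicator_of_mem h]
        simp only [hΦ]
        rw [if_pos h', ← ENNReal.ofReal_mul (Real.rpow_nonneg hxc.le _), mul_comm]
      · have h' : ¬ (0 < t ∧ t < x ∧ t < s ∧ x < c) := fun h' => h ⟨h'.1, lt_min h'.2.1 h'.2.2.1⟩
        rw [indicator_of_notMem h]
        simp only [hΦ]
        rw [if_neg h']
    have e2 : ∫⁻ t in Ioo 0 (min x s),
        ENNReal.ofReal ((s - t) ^ (κ - 1) * (x - t) ^ (κ - 1) * t ^ (-(2 * κ)))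
        = ENNReal.ofReal (C1 * (s ^ (-κ) * x ^ (-κ) * |x - s| ^ (2 * κ - 1))) := by
      rcases lt_or_gt_of_ne hxs with h | h
      · rw [min_eq_left h.le, abs_sub_comm, abs_of_pos (sub_pos.2 h), mul_comm (s ^ (-κ)),
          ← h1 x s hx.1 h]
        refine lintegral_congr fun t => ?_
        rw [mul_comm ((s - t) ^ (κ - 1))]
      · rw [min_eq_right h.le, abs_of_pos (sub_pos.2 h), h1 s x hs h]
    have hs1 : s ^ κ * s ^ (-κ) = 1 := by
      rw [← Real.rpow_add hs, add_neg_cancel, Real.rpow_zero]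
    rw [e1, e2, ← ENNReal.ofReal_mul (Real.rpow_nonneg hxc.le _),
      ← ENNReal.ofReal_mul (Real.rpow_nonneg hs.le _), ← ENNReal.ofReal_mul hC1.le]
    congr 1
    calc _ = C1 * ((c - x) ^ (-κ) * x ^ (-κ) * |x - s| ^ (2 * κ - 1)) * (s ^ κ * s ^ (-κ)) := by
          rw [hs1, mul_one]
      _ = _ := by ring
  have inner2 : ∀ t, ∫⁻ x, Φ x t = (Ioo 0 (min c s)).indicator
      (fun t => ENNReal.ofReal B * ENNReal.ofReal ((s - t) ^ (κ - 1) * t ^ (-(2 * κ)))) t := by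
    intro t
    by_cases h : t ∈ Ioo 0 (min c s)
    · have htc : t < c := h.2.trans_le (min_le_left _ _)
      have hts : t < s := h.2.trans_le (min_le_right _ _)
      rw [indicator_of_mem h]
      have hb := lintegral_beta (p := κ - 1) (q := -κ) (by linarith) (by linarith) htc
      have ee : κ - 1 + -κ + 1 = 0 := by ring
      have ee2 : -κ + 1 = 1 - κ := by ring
      rw [ee, ee2, sub_add_cancel, Real.rpow_zero, one_mul] at hb
      rw [hB, ← hb, mul_comm, ← lintegral_const_mul' _ _ ENNReal.ofReal_ne_top,
        ← lintegral_indicator measurableSet_Ioo]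
      refine lintegral_congr fun x => ?_
      by_cases hx : x ∈ Ioo t c
      · rw [indicator_of_mem hx]
        simp only [hΦ]
        rw [if_pos ⟨h.1, hx.1, hts, hx.2⟩, ← ENNReal.ofReal_mul (abel_nonneg h.1 hts)]
        congr 1; ring
      · rw [indicator_of_notMem hx]
        simp only [hΦ]
        rw [if_neg fun h' => hx ⟨h'.2.1, h'.2.2.2⟩]
    · rw [indicator_of_notMem h]
      refine (lintegral_congr fun x => ?_).trans lintegral_zero
      simp only [hΦ]
      rw [if_neg fun h' => h ⟨h'.1, lt_min (h'.2.1.trans h'.2.2.2) h'.2.2.1⟩]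
  have key : ENNReal.ofReal C1 * ∫⁻ x in Ioo 0 c,
      ENNReal.ofReal ((c - x) ^ (-κ) * x ^ (-κ) * |x - s| ^ (2 * κ - 1))
      = ENNReal.ofReal (s ^ κ * B * abelOn κ (Ioo 0 (min c s)) s) := by
    rw [← lintegral_const_mul' _ _ ENNReal.ofReal_ne_top]
    have hne : ∀ᵐ x ∂(volume.restrict (Ioo 0 c)), x ≠ s :=
      ae_restrict_of_ae (by simp [ae_iff, measure_singleton])
    have : ∫⁻ x in Ioo 0 c, ENNReal.ofReal C1 *
        ENNReal.ofReal ((c - x) ^ (-κ) * x ^ (-κ) * |x - s| ^ (2 * κ - 1))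
        = ∫⁻ x in Ioo 0 c, ENNReal.ofReal (s ^ κ) * ∫⁻ t, Φ x t := by
      refine lintegral_congr_ae ?_
      filter_upwards [hne, ae_restrict_mem measurableSet_Ioo] with x h h' using inner1 x h' h
    rw [this, lintegral_const_mul' _ _ ENNReal.ofReal_ne_top]
    have h3 : ∫⁻ x in Ioo 0 c, ∫⁻ t, Φ x t = ∫⁻ x, ∫⁻ t, Φ x t := by
      rw [← lintegral_indicator measurableSet_Ioo]
      refine lintegral_congr fun x => ?_
      by_cases hx : x ∈ Ioo 0 c
      · rw [indicator_of_mem hx]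
      · rw [indicator_of_notMem hx]
        symm
        refine (lintegral_congr fun t => ?_).trans lintegral_zero
        simp only [hΦ]
        rw [if_neg fun h' => hx ⟨h'.1.trans h'.2.1, h'.2.2.2⟩]
    rw [h3, lintegral_lintegral_swap hΦm.aemeasurable]
    simp_rw [inner2]
    rw [lintegral_indicator measurableSet_Ioo, lintegral_const_mul' _ _ ENNReal.ofReal_ne_top, ← hA,
      ← ENNReal.ofReal_mul hB0.le, ← ENNReal.ofReal_mul (Real.rpow_nonneg hs.le _), mul_assoc]
  have hne0 : ENNReal.ofReal C1 ≠ 0 := (ENNReal.ofReal_pos.2 hC1).ne'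
  refine (ENNReal.mul_right_inj hne0 ENNReal.ofReal_ne_top).1 ?_
  rw [key, ← ENNReal.ofReal_mul hC1.le]
  congr 1
  field_simp

theorem abelOn_nonneg {κ s : ℝ} {S : Set ℝ} (hS : MeasurableSet S) (h : S ⊆ Ioo 0 s) :
    0 ≤ abelOn κ S s :=
  setIntegral_nonneg hS fun _ ht => abel_nonneg (h ht).1 (h ht).2

theorem weightPot_eq {κ : ℝ} (hκ : 0 < κ) (hκ1 : κ < 1 / 2) :
    ∃ C : ℝ, 0 < C ∧ ∀ c s : ℝ, 0 < c → 0 < s →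
      IntegrableOn (fun x => (c - x) ^ (-κ) * x ^ (-κ) * |x - s| ^ (2 * κ - 1)) (Ioo 0 c) ∧
      weightPot κ c s = C * (s ^ κ * abelOn κ (Ioo 0 (min c s)) s) := by
  obtain ⟨C, hC, h⟩ := lintegral_weightPot hκ hκ1
  refine ⟨C, hC, fun c s hc hs => ?_⟩
  have hnn : 0 ≤ᵐ[volume.restrict (Ioo 0 c)]
      fun x => (c - x) ^ (-κ) * x ^ (-κ) * |x - s| ^ (2 * κ - 1) := by
    filter_upwards [ae_restrict_mem measurableSet_Ioo] with x hx
    exact mul_nonneg (mul_nonneg (Real.rpow_nonneg (by linarith [hx.2]) _)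
      (Real.rpow_nonneg hx.1.le _)) (Real.rpow_nonneg (abs_nonneg _) _)
  have hi : IntegrableOn (fun x => (c - x) ^ (-κ) * x ^ (-κ) * |x - s| ^ (2 * κ - 1)) (Ioo 0 c) := by
    refine ⟨by fun_prop, ?_⟩
    rw [hasFiniteIntegral_iff_ofReal hnn, h c s hc hs]
    exact ENNReal.ofReal_lt_top
  refine ⟨hi, ?_⟩
  unfold weightPot
  rw [integral_eq_lintegral_of_nonneg_ae hnn hi.1, h c s hc hs, ENNReal.toReal_ofReal]
  exact mul_nonneg hC.le (mul_nonneg (Real.rpow_nonneg hs.le _)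
    (abelOn_nonneg measurableSet_Ioo (Ioo_subset_Ioo_right (min_le_right _ _))))

/-- The potential of the weight is constant on `(0, c)`, bounded by this constant, and its
dependence on `c` is an Abel integral. -/
theorem weightPot_properties {κ : ℝ} (hκ : 0 < κ) (hκ1 : κ < 1 / 2) :
    ∃ C B : ℝ, 0 < C ∧ 0 < B ∧
      (∀ c s : ℝ, 0 < c → 0 < s → IntegrableOn
        (fun x => (c - x) ^ (-κ) * x ^ (-κ) * |x - s| ^ (2 * κ - 1)) (Ioo 0 c)) ∧
      (∀ c s : ℝ, 0 < c → 0 < s → 0 ≤ weightPot κ c s ∧ weightPot κ c s ≤ B) ∧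
      (∀ c s : ℝ, 0 < s → s ≤ c → weightPot κ c s = B) ∧
      (∀ c s : ℝ, 0 < c → c ≤ s → B - weightPot κ c s = C * (s ^ κ * abelOn κ (Ioo c s) s)) := by
  obtain ⟨C, hC, h⟩ := weightPot_eq hκ hκ1
  set B0 := ProbabilityTheory.beta (1 - 2 * κ) κ with hB0
  have hB0p : 0 < B0 := ProbabilityTheory.beta_pos (by linarith) hκ
  have hdiff : ∀ c s : ℝ, 0 < c → c ≤ s →
      C * B0 - weightPot κ c s = C * (s ^ κ * abelOn κ (Ioo c s) s) := by
    intro c s hc hcs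
    have hs := hc.trans_le hcs
    rw [(h c s hc hs).2, min_eq_left hcs, hB0, ← abelOn_full hκ hκ1 hs, ← mul_sub, ← mul_sub]
    congr 2
    have hi := integrableOn_abel hκ hκ1 hs
    unfold abelOn
    rw [← integral_Ioc_eq_integral_Ioo, ← integral_Ioc_eq_integral_Ioo,
      ← integral_Ioc_eq_integral_Ioo, ← Ioc_union_Ioc_eq_Ioc hc.le hcs]
    rw [← integrableOn_Ioc_iff_integrableOn_Ioo] at hi
    rw [setIntegral_union (Ioc_disjoint_Ioc_of_le le_rfl) measurableSet_Ioc
      (hi.mono_set (Ioc_subset_Ioc_right hcs)) (hi.mono_set (Ioc_subset_Ioc_left hc.le))]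
    ring
  have heq : ∀ c s : ℝ, 0 < s → s ≤ c → weightPot κ c s = C * B0 := by
    intro c s hs hsc
    rw [(h c s (hs.trans_le hsc) hs).2, min_eq_right hsc, abelOn_full hκ hκ1 hs]
  refine ⟨C, C * B0, hC, by positivity, fun c s hc hs => (h c s hc hs).1, fun c s hc hs => ?_,
    heq, hdiff⟩
  constructor
  · rw [(h c s hc hs).2]
    exact mul_nonneg hC.le (mul_nonneg (Real.rpow_nonneg hs.le _)
      (abelOn_nonneg measurableSet_Ioo (Ioo_subset_Ioo_right (min_le_right _ _))))
  · rcases le_total s c with hsc | hcs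
    · rw [heq c s hs hsc]
    · have h1 := hdiff c s hc hcs
      have h2 : 0 ≤ C * (s ^ κ * abelOn κ (Ioo c s) s) :=
        mul_nonneg hC.le (mul_nonneg (Real.rpow_nonneg hs.le _)
          (abelOn_nonneg measurableSet_Ioo (Ioo_subset_Ioo_left hc.le)))
      linarith

section

theorem sq_integral_mul_le {α : Type*} [MeasurableSpace α] {ν : Measure α} {f g : α → ℝ}
    (hf : Integrable (fun x => f x ^ 2) ν) (hg : Integrable (fun x => g x ^ 2) ν)
    (hfg : Integrable (fun x => f x * g x) ν) :
    (∫ x, f x * g x ∂ν) ^ 2 ≤ (∫ x, f x ^ 2 ∂ν) * ∫ x, g x ^ 2 ∂ν := by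
  have h : ∀ t : ℝ, 0 ≤ (∫ x, g x ^ 2 ∂ν) * (t * t) + (2 * ∫ x, f x * g x ∂ν) * t
      + ∫ x, f x ^ 2 ∂ν := by
    intro t
    have e : ∫ x, (f x + t * g x) ^ 2 ∂ν = (∫ x, g x ^ 2 ∂ν) * (t * t)
        + (2 * ∫ x, f x * g x ∂ν) * t + ∫ x, f x ^ 2 ∂ν := by
      have e1 : ∀ x, (f x + t * g x) ^ 2 = f x ^ 2 + (2 * t * (f x * g x) + t ^ 2 * g x ^ 2) :=
        fun x => by ring
      simp_rw [e1]
      rw [integral_add (g := fun x => 2 * t * (f x * g x) + t ^ 2 * g x ^ 2) hf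
          ((hfg.const_mul _).add (hg.const_mul _)),
        integral_add (hfg.const_mul _) (hg.const_mul _), integral_const_mul, integral_const_mul]
      ring
    rw [← e]
    exact integral_nonneg fun x => sq_nonneg _
  have := discrim_le_zero h
  unfold discrim at this
  nlinarith

/-- Riesz potential without its normalising constant. -/
def pot (μ : ℝ) (y : ℝ → ℝ) (x : ℝ) : ℝ := ∫ s, ker μ (x - s) * y s

variable {a b : ℝ} {y : ℝ → ℝ}

theorem measurable_pot {μ : ℝ} (hy : Adm a b y) : Measurable (pot μ y) := by
  have : StronglyMeasurable (Function.uncurry fun x s : ℝ => ker μ (x - s) * y s) := by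
    refine Measurable.stronglyMeasurable (Measurable.mul ?_ (hy.meas.comp measurable_snd))
    unfold ker
    fun_prop
  exact this.integral_prod_right.measurable

theorem pot_bounded {μ : ℝ} (hμ : 0 < μ) (hab : a ≤ b) (hy : Adm a b y) :
    ∃ M, 0 ≤ M ∧ ∀ x ∈ Icc a b, |pot μ y x| ≤ M := by
  obtain ⟨Y, hY0, hY⟩ := hy.exists_pos_bound
  refine ⟨Y * (2 * (b - a) ^ μ / μ), ?_, fun x hx => ?_⟩
  · have : 0 ≤ b - a := by linarith
    positivity
  have h := integral_abs_sub_rpow_le (μ := 1 - μ) (l := a) (r := b) (x := x) (by linarith) hx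
  have e1 : -(1 - μ) = μ - 1 := by ring
  have e2 : 1 - (1 - μ) = μ := by ring
  rw [e1, e2] at h
  have hsupp : ∀ s, ker μ (x - s) * y s = (Icc a b).indicator (fun s => ker μ (x - s) * y s) s := by
    intro s
    by_cases hs : s ∈ Icc a b
    · rw [indicator_of_mem hs]
    · rw [indicator_of_notMem hs, hy.supp s hs, mul_zero]
  unfold pot
  rw [integral_congr_ae (.of_forall hsupp), integral_indicator measurableSet_Icc, integral_Icc_eq_integral_Ioo, ← Real.norm_eq_abs]
  refine (norm_integral_le_of_norm_le (h.1.const_mul Y) (.of_forall fun s => ?_)).trans ?_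
  · rw [norm_mul, Real.norm_eq_abs, Real.norm_eq_abs, mul_comm]
    unfold ker
    rw [abs_of_nonneg (Real.rpow_nonneg (abs_nonneg _) _)]
    exact mul_le_mul_of_nonneg_right (hY s) (Real.rpow_nonneg (abs_nonneg _) _)
  · rw [integral_const_mul]
    exact mul_le_mul_of_nonneg_left h.2 hY0.le

/-- The weighted integral of the potential over `(0, c)`. -/
def weightMean (κ : ℝ) (y : ℝ → ℝ) (c : ℝ) : ℝ :=
  ∫ x in Ioo 0 c, (c - x) ^ (-κ) * x ^ (-κ) * pot (2 * κ) y x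

theorem measurable_weightPot (κ : ℝ) : Measurable fun z : ℝ × ℝ => weightPot κ z.1 z.2 := by
  have : StronglyMeasurable (Function.uncurry fun (z : ℝ × ℝ) (x : ℝ) => if 0 < x ∧ x < z.1 then
      (z.1 - x) ^ (-κ) * x ^ (-κ) * |x - z.2| ^ (2 * κ - 1) else 0) := by
    refine Measurable.stronglyMeasurable (Measurable.ite ?_ (by fun_prop) measurable_const)
    exact (measurableSet_lt measurable_const measurable_snd).inter
      (measurableSet_lt measurable_snd (measurable_fst.comp measurable_fst))
  have h := this.integral_prod_right (ν := volume).measurable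
  convert h using 1
  ext z
  unfold weightPot
  rw [← integral_indicator measurableSet_Ioo]
  refine integral_congr_ae (.of_forall fun x => ?_)
  simp only [indicator, mem_Ioo]

variable {l : ℝ}

theorem weightMean_eq {κ : ℝ} (hκ : 0 < κ) (hκ1 : κ < 1 / 2) (hy : Adm 0 l y) {c : ℝ} (hc : 0 < c) :
    weightMean κ y c = ∫ s, y s * weightPot κ c s := by
  obtain ⟨C, B, hC, hB, hint, hbd, -, -⟩ := weightPot_properties hκ hκ1
  have hmeas : Measurable fun z : ℝ × ℝ =>
      (c - z.1) ^ (-κ) * z.1 ^ (-κ) * (ker (2 * κ) (z.1 - z.2) * y z.2) := by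
    refine Measurable.mul (by fun_prop) (Measurable.mul ?_ (hy.meas.comp measurable_snd))
    unfold ker
    fun_prop
  have hpos : ∀ᵐ s : ℝ, s ∈ Icc 0 l → 0 < s := by
    have : ∀ᵐ s : ℝ, s ≠ 0 := by simp [ae_iff, measure_singleton]
    filter_upwards [this] with s hs h
    exact lt_of_le_of_ne h.1 (Ne.symm hs)
  have hI : Integrable (fun z : ℝ × ℝ =>
      (c - z.1) ^ (-κ) * z.1 ^ (-κ) * (ker (2 * κ) (z.1 - z.2) * y z.2))
      ((volume.restrict (Ioo 0 c)).prod volume) := by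
    rw [integrable_prod_iff' hmeas.aestronglyMeasurable]
    constructor
    · filter_upwards [hpos] with s hs
      by_cases h : s ∈ Icc 0 l
      · refine ((hint c s hc (hs h)).mul_const (y s)).congr (.of_forall fun x => ?_)
        simp only [ker]; ring
      · simp only [hy.supp s h, mul_zero]; exact integrable_zero _ _ _
    · refine Integrable.mono' (hy.abs.integrable.const_mul B)
        hmeas.norm.aestronglyMeasurable.prod_swap.integral_prod_right' ?_
      filter_upwards [hpos] with s hs
      rw [Real.norm_eq_abs, abs_of_nonneg (integral_nonneg fun x => norm_nonneg _)]
      by_cases h : s ∈ Icc 0 l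
      · have e : ∫ x in Ioo 0 c, ‖(c - x) ^ (-κ) * x ^ (-κ) * (ker (2 * κ) (x - s) * y s)‖
            = weightPot κ c s * |y s| := by
          unfold weightPot
          rw [← integral_mul_const]
          refine setIntegral_congr_fun measurableSet_Ioo fun x hx => ?_
          have h1 : 0 ≤ (c - x) ^ (-κ) := Real.rpow_nonneg (by linarith [hx.2]) _
          have h2 : 0 ≤ x ^ (-κ) := Real.rpow_nonneg hx.1.le _
          have h3 : 0 ≤ ker (2 * κ) (x - s) := Real.rpow_nonneg (abs_nonneg _) _
          change ‖(c - x) ^ (-κ) * x ^ (-κ) * (ker (2 * κ) (x - s) * y s)‖ = _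
          rw [Real.norm_eq_abs, abs_mul, abs_mul, abs_mul, abs_of_nonneg h1, abs_of_nonneg h2,
            abs_of_nonneg h3]
          unfold ker; ring
        rw [e]
        exact mul_le_mul_of_nonneg_right (hbd c s hc (hs h)).2 (abs_nonneg _)
      · simp [hy.supp s h]
  unfold weightMean pot
  simp_rw [← integral_const_mul]
  rw [integral_integral_swap hI]
  refine integral_congr_ae (.of_forall fun s => ?_)
  simp only
  unfold weightPot ker
  rw [← integral_const_mul]
  congr 1; ext x; ring

theorem weightMean_sq_le {κ : ℝ} (hκ : 0 < κ) (hκ1 : κ < 1 / 2) (hl : 0 < l) :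
    ∃ C : ℝ, 0 < C ∧ ∀ y, Adm 0 l y → ∀ c ∈ Icc (l / 2) l,
      weightMean κ y c ^ 2 ≤ C * ∫ x in Ioo 0 l, pot (2 * κ) y x ^ 2 := by
  set B := ProbabilityTheory.beta (-(2 * κ) + 1) (-(2 * κ) + 1) with hBdef
  have hB : 0 < B := ProbabilityTheory.beta_pos (by linarith) (by linarith)
  refine ⟨((l / 2) ^ (1 - 4 * κ) + l ^ (1 - 4 * κ)) * B, by positivity, fun y hy c hc => ?_⟩
  have hc0 : 0 < c := by linarith [hc.1]
  obtain ⟨M, hM0, hM⟩ := pot_bounded (μ := 2 * κ) (by linarith) hl.le hy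
  have hpm := measurable_pot (μ := 2 * κ) hy
  have hp2 : ∀ c ≤ l, IntegrableOn (fun x => pot (2 * κ) y x ^ 2) (Ioo 0 c) := fun c hc => by
    refine Integrable.mono' (g := fun _ => M ^ 2) (integrableOn_const (by simp))
      (hpm.pow_const 2).aestronglyMeasurable ?_
    filter_upwards [ae_restrict_mem measurableSet_Ioo] with x hx
    rw [Real.norm_eq_abs, abs_of_nonneg (sq_nonneg _), ← sq_abs]
    have := hM x ⟨hx.1.le, hx.2.le.trans hc⟩
    gcongr
  have hw2 : IntegrableOn (fun x => ((c - x) ^ (-κ) * x ^ (-κ)) ^ 2) (Ioo 0 c) ∧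
      ∫ x in Ioo 0 c, ((c - x) ^ (-κ) * x ^ (-κ)) ^ 2 = c ^ (1 - 4 * κ) * B := by
    have e : ∀ x ∈ Ioo 0 c, ((c - x) ^ (-κ) * x ^ (-κ)) ^ 2
        = (x - 0) ^ (-(2 * κ)) * (c - x) ^ (-(2 * κ)) := by
      intro x hx
      rw [mul_pow, ← Real.rpow_natCast, ← Real.rpow_natCast, ← Real.rpow_mul (by linarith [hx.2]),
        ← Real.rpow_mul hx.1.le, mul_comm, sub_zero]
      congr 2 <;> push_cast <;> ring
    have h1 := integrableOn_beta (p := -(2 * κ)) (q := -(2 * κ)) (t := 0) (c := c) (by linarith)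
      (by linarith) hc0
    have h2 := integral_beta (p := -(2 * κ)) (q := -(2 * κ)) (t := 0) (c := c) (by linarith)
      (by linarith) hc0
    refine ⟨h1.congr_fun (fun x hx => (e x hx).symm) measurableSet_Ioo, ?_⟩
    rw [setIntegral_congr_fun measurableSet_Ioo e, h2, sub_zero]
    congr 2; ring
  have hfg : IntegrableOn (fun x => (c - x) ^ (-κ) * x ^ (-κ) * pot (2 * κ) y x) (Ioo 0 c) := by
    refine Integrable.mono' (hw2.1.add (hp2 c hc.2))
      (Measurable.mul (by fun_prop) hpm).aestronglyMeasurable (.of_forall fun x => ?_)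
    simp only [Pi.add_apply]
    rw [Real.norm_eq_abs, abs_le]
    constructor <;> nlinarith [sq_nonneg ((c - x) ^ (-κ) * x ^ (-κ) - pot (2 * κ) y x),
      sq_nonneg ((c - x) ^ (-κ) * x ^ (-κ) + pot (2 * κ) y x),
      sq_nonneg ((c - x) ^ (-κ) * x ^ (-κ)), sq_nonneg (pot (2 * κ) y x)]
  refine (sq_integral_mul_le hw2.1 (hp2 c hc.2) hfg).trans ?_
  rw [hw2.2]
  have hcle : c ^ (1 - 4 * κ) ≤ (l / 2) ^ (1 - 4 * κ) + l ^ (1 - 4 * κ) := by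
    have p1 : 0 ≤ (l / 2) ^ (1 - 4 * κ) := by positivity
    have p2 : 0 ≤ l ^ (1 - 4 * κ) := by positivity
    rcases le_total 0 (1 - 4 * κ) with h | h
    · have := Real.rpow_le_rpow hc0.le hc.2 h
      linarith
    · have := Real.rpow_le_rpow_of_nonpos (by linarith) hc.1 h
      linarith
  have hmono : ∫ x in Ioo 0 c, pot (2 * κ) y x ^ 2 ≤ ∫ x in Ioo 0 l, pot (2 * κ) y x ^ 2 :=
    setIntegral_mono_set (hp2 l le_rfl) (.of_forall fun x => sq_nonneg _)
      (.of_forall (Ioo_subset_Ioo_right hc.2))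
  have h0 : 0 ≤ ∫ x in Ioo 0 c, pot (2 * κ) y x ^ 2 := integral_nonneg fun x => sq_nonneg _
  gcongr

end

section

/-- The derivative of `t ↦ t^(2κ) (t - x)^(1-κ)`. -/
def rhoDeriv (κ x c : ℝ) : ℝ :=
  2 * κ * c ^ (2 * κ - 1) * (c - x) ^ (1 - κ) + (1 - κ) * (c ^ (2 * κ) * (c - x) ^ (-κ))

theorem measurable_rhoDeriv (κ x : ℝ) : Measurable (rhoDeriv κ x) := by
  unfold rhoDeriv; fun_prop

theorem rhoDeriv_nonneg {κ x c : ℝ} (hκ : 0 < κ) (hκ1 : κ < 1 / 2) (hx : 0 < x) (hc : x < c) :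
    0 ≤ rhoDeriv κ x c := by
  have h1 : 0 ≤ c - x := by linarith
  have h2 : 0 ≤ c := by linarith
  have h3 : 0 ≤ 1 - κ := by linarith
  unfold rhoDeriv; positivity

theorem integral_rhoDeriv {κ x t : ℝ} (hκ : 0 < κ) (hκ1 : κ < 1 / 2) (hx : 0 < x) (ht : x ≤ t) :
    IntegrableOn (rhoDeriv κ x) (Ioc x t) ∧
      ∫ c in Ioc x t, rhoDeriv κ x c = t ^ (2 * κ) * (t - x) ^ (1 - κ) := by
  set g : ℝ → ℝ := fun t => t ^ (2 * κ) * (t - x) ^ (1 - κ) with hg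
  have hcont : ContinuousOn g (Icc x t) := by
    refine Continuous.continuousOn (Continuous.mul ?_ ?_)
    · exact Real.continuous_rpow_const (by linarith)
    · exact (Real.continuous_rpow_const (by linarith)).comp (continuous_id.sub continuous_const)
  have hder : ∀ c ∈ Ioo x t, HasDerivAt g (rhoDeriv κ x c) c := fun c hc => by
    have hc0 : c ≠ 0 := (hx.trans hc.1).ne'
    have hcx : c - x ≠ 0 := (sub_pos.2 hc.1).ne'
    have h1 := Real.hasDerivAt_rpow_const (x := c) (p := 2 * κ) (Or.inl hc0)
    have h2 := ((hasDerivAt_id' c).sub_const x).rpow_const (p := 1 - κ) (Or.inl hcx)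
    refine (h1.mul h2).congr_deriv ?_
    unfold rhoDeriv
    have : 1 - κ - 1 = -κ := by ring
    rw [this]; ring
  have hi := intervalIntegral.integrableOn_deriv_of_nonneg hcont hder
    fun c hc => rhoDeriv_nonneg hκ hκ1 hx hc.1
  refine ⟨hi, ?_⟩
  rw [← intervalIntegral.integral_of_le ht,
    intervalIntegral.integral_eq_sub_of_hasDerivAt_of_le ht hcont hder
      ((intervalIntegrable_iff_integrableOn_Ioc_of_le ht).2 hi)]
  simp only [hg, sub_self]
  rw [Real.zero_rpow (by linarith), mul_zero, sub_zero]

theorem integral_rhoDeriv_abel {κ x s : ℝ} (hκ : 0 < κ) (hκ1 : κ < 1 / 2) (hx : 0 < x)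
    (hs : x < s) :
    ∫ c in Ioo x s, rhoDeriv κ x c * abelOn κ (Ioo c s) s
      = ProbabilityTheory.beta (2 - κ) κ * (s - x) := by
  set h : ℝ → ℝ := fun t => (s - t) ^ (κ - 1) * t ^ (-(2 * κ)) with hh
  have hs0 : 0 < s := hx.trans hs
  have hi : IntegrableOn h (Ioo x s) :=
    (integrableOn_abel hκ hκ1 hs0).mono_set (Ioo_subset_Ioo_left hx.le)
  have hr := integral_rhoDeriv hκ hκ1 hx hs.le
  have hr' : IntegrableOn (rhoDeriv κ x) (Ioo x s) := hr.1.mono_set Ioo_subset_Ioc_self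
  set G : ℝ → ℝ → ℝ := fun c t => {z : ℝ × ℝ | z.1 < z.2}.indicator
    (fun z => rhoDeriv κ x z.1 * h z.2) (c, t) with hG
  have hGi : Integrable (Function.uncurry G) ((volume.restrict (Ioo x s)).prod
      (volume.restrict (Ioo x s))) :=
    (hr'.mul_prod hi).indicator (measurableSet_lt measurable_fst measurable_snd)
  have e1 : ∀ c ∈ Ioo x s, rhoDeriv κ x c * abelOn κ (Ioo c s) s = ∫ t in Ioo x s, G c t := by
    intro c hc
    unfold abelOn
    rw [← integral_const_mul]
    have : Ioo c s = Ioi c ∩ Ioo x s := by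
      ext t; exact ⟨fun h => ⟨h.1, hc.1.trans h.1, h.2⟩, fun h => ⟨h.1, h.2.2⟩⟩
    rw [this, ← Measure.restrict_restrict measurableSet_Ioi, ← integral_indicator measurableSet_Ioi]
    rfl
  have e2 : ∀ t ∈ Ioo x s, ∫ c in Ioo x s, G c t = (t - x) ^ (1 - κ) * (s - t) ^ (κ - 1) := by
    intro t ht
    have : ∫ c in Ioo x s, G c t = ∫ c in Ioo x t, rhoDeriv κ x c * h t := by
      have e : Ioo x t = Iio t ∩ Ioo x s := by
        ext c; exact ⟨fun h => ⟨h.2, h.1, h.2.trans ht.2⟩, fun h => ⟨h.2.1, h.1⟩⟩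
      rw [e, ← Measure.restrict_restrict measurableSet_Iio, ← integral_indicator measurableSet_Iio]
      rfl
    have ht0 : 0 < t := hx.trans ht.1
    rw [this, integral_mul_const, ← integral_Ioc_eq_integral_Ioo,
      (integral_rhoDeriv hκ hκ1 hx ht.1.le).2]
    simp only [hh]
    have : t ^ (2 * κ) * t ^ (-(2 * κ)) = 1 := by
      rw [← Real.rpow_add ht0, add_neg_cancel, Real.rpow_zero]
    linear_combination (t - x) ^ (1 - κ) * (s - t) ^ (κ - 1) * this
  rw [setIntegral_congr_fun measurableSet_Ioo e1, integral_integral_swap hGi,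
    setIntegral_congr_fun measurableSet_Ioo e2, integral_beta (by linarith) (by linarith) hs]
  have a1 : 1 - κ + (κ - 1) + 1 = 1 := by ring
  have a2 : 1 - κ + 1 = 2 - κ := by ring
  rw [a1, a2, sub_add_cancel, Real.rpow_one, mul_comm]

/-- Weighted second antiderivative from the right. -/
def wmom (κ : ℝ) (y : ℝ → ℝ) (x : ℝ) : ℝ := ∫ s, y s * (s ^ κ * max (s - x) 0)

variable {l : ℝ} {y : ℝ → ℝ}

theorem measurable_weightMean (κ : ℝ) (hy : Adm 0 l y) : Measurable (weightMean κ y) := by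
  have hp := measurable_pot (μ := 2 * κ) hy
  have : StronglyMeasurable (Function.uncurry fun (c : ℝ) (x : ℝ) => if 0 < x ∧ x < c then
      (c - x) ^ (-κ) * x ^ (-κ) * pot (2 * κ) y x else 0) := by
    refine Measurable.stronglyMeasurable (Measurable.ite ?_ ?_ measurable_const)
    · exact (measurableSet_lt measurable_const measurable_snd).inter
        (measurableSet_lt measurable_snd measurable_fst)
    · exact Measurable.mul (by fun_prop) (hp.comp measurable_snd)
  have h := this.integral_prod_right (ν := volume).measurable
  convert h using 1
  ext z
  unfold weightMean
  rw [← integral_indicator measurableSet_Ioo]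
  refine integral_congr_ae (.of_forall fun x => ?_)
  simp only [indicator, mem_Ioo]

theorem wmom_eq {κ : ℝ} (hκ : 0 < κ) (hκ1 : κ < 1 / 2) :
    ∃ C : ℝ, 0 < C ∧ ∀ l y, Adm 0 l y → ∀ x, 0 < x → x ≤ l →
      ∫ c in Ioo x l, rhoDeriv κ x c * (weightMean κ y l - weightMean κ y c) = C * wmom κ y x := by
  obtain ⟨C, B, hC, hB, hint, hbd, heq, hdiff⟩ := weightPot_properties hκ hκ1
  have hβ := ProbabilityTheory.beta_pos (α := 2 - κ) (β := κ) (by linarith) hκ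
  refine ⟨C * ProbabilityTheory.beta (2 - κ) κ, by positivity, fun l y hy x hx hxl => ?_⟩
  have hl : 0 < l := hx.trans_le hxl
  have hpos : ∀ᵐ s : ℝ, s ∈ Icc 0 l → 0 < s := by
    have : ∀ᵐ s : ℝ, s ≠ 0 := by simp [ae_iff, measure_singleton]
    filter_upwards [this] with s hs h
    exact lt_of_le_of_ne h.1 (Ne.symm hs)
  have hkernel : ∀ s, 0 < s → s ≤ l → ∫ c in Ioo x l, rhoDeriv κ x c * (B - weightPot κ c s)
      = C * ProbabilityTheory.beta (2 - κ) κ * (s ^ κ * max (s - x) 0) := by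
    intro s hs hsl
    rcases le_or_gt s x with hsx | hxs
    · rw [max_eq_right (by linarith), mul_zero, mul_zero]
      refine setIntegral_eq_zero_of_forall_eq_zero fun c hc => ?_
      rw [heq c s hs (hsx.trans hc.1.le), sub_self, mul_zero]
    · rw [max_eq_left (by linarith)]
      have e : ∫ c in Ioo x l, rhoDeriv κ x c * (B - weightPot κ c s)
          = ∫ c in Ioo x s, rhoDeriv κ x c * (B - weightPot κ c s) := by
        refine setIntegral_eq_of_subset_of_forall_sdiff_eq_zero measurableSet_Ioo
          (Ioo_subset_Ioo_right hsl) fun c hc => ?_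
        have : s ≤ c := by
          by_contra h
          exact hc.2 ⟨hc.1.1, not_le.1 h⟩
        rw [heq c s hs this, sub_self, mul_zero]
      have e2 : ∀ c ∈ Ioo x s, rhoDeriv κ x c * (B - weightPot κ c s)
          = C * s ^ κ * (rhoDeriv κ x c * abelOn κ (Ioo c s) s) := fun c hc => by
        rw [hdiff c s (hx.trans hc.1) hc.2.le]; ring
      rw [e, setIntegral_congr_fun measurableSet_Ioo e2, integral_const_mul,
        integral_rhoDeriv_abel hκ hκ1 hx hxs]
      ring
  have hyB : Integrable (fun s => y s * B) := hy.integrable.mul_const B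
  have hywi : ∀ c, 0 < c → Integrable fun s => y s * weightPot κ c s := fun c hc => by
    refine Integrable.mono' (hy.abs.integrable.mul_const B) (hy.meas.mul
      ((measurable_weightPot κ).comp measurable_prodMk_left)).aestronglyMeasurable ?_
    filter_upwards [hpos] with s hs
    by_cases h : s ∈ Icc 0 l
    · rw [norm_mul, Real.norm_eq_abs, Real.norm_eq_abs, abs_of_nonneg (hbd c s hc (hs h)).1]
      exact mul_le_mul_of_nonneg_left (hbd c s hc (hs h)).2 (abs_nonneg _)
    · simp [hy.supp s h]
  have hwl : weightMean κ y l = ∫ s, y s * B := by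
    rw [weightMean_eq hκ hκ1 hy hl]
    refine integral_congr_ae ?_
    filter_upwards [hpos] with s hs
    by_cases h : s ∈ Icc 0 l
    · simp only [heq l s (hs h) h.2]
    · simp only [hy.supp s h, zero_mul]
  have hD : ∀ c ∈ Ioo x l, rhoDeriv κ x c * (weightMean κ y l - weightMean κ y c)
      = ∫ s, rhoDeriv κ x c * (y s * (B - weightPot κ c s)) := fun c hc => by
    have hc0 : 0 < c := hx.trans hc.1
    rw [hwl, weightMean_eq hκ hκ1 hy hc0, ← integral_sub hyB (hywi c hc0), integral_const_mul]
    simp_rw [mul_sub]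
  have hr := (integral_rhoDeriv hκ hκ1 hx hxl).1.mono_set Ioo_subset_Ioc_self
  have hI : Integrable (Function.uncurry fun c s => rhoDeriv κ x c * (y s * (B - weightPot κ c s)))
      ((volume.restrict (Ioo x l)).prod volume) := by
    refine Integrable.mono' (hr.mul_prod (hy.abs.integrable.mul_const B)) ?_ ?_
    · refine Measurable.aestronglyMeasurable (Measurable.mul
        ((measurable_rhoDeriv κ x).comp measurable_fst) (Measurable.mul
        (hy.meas.comp measurable_snd) (measurable_const.sub (measurable_weightPot κ))))
    · have h1 : ∀ᵐ z : ℝ × ℝ ∂((volume.restrict (Ioo x l)).prod volume), z.1 ∈ Ioo x l :=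
        Measure.quasiMeasurePreserving_fst.ae (ae_restrict_mem measurableSet_Ioo)
      have h2 : ∀ᵐ z : ℝ × ℝ ∂((volume.restrict (Ioo x l)).prod volume),
          z.2 ∈ Icc 0 l → 0 < z.2 := Measure.quasiMeasurePreserving_snd.ae hpos
      filter_upwards [h1, h2] with z hz hz2
      simp only [Function.uncurry]
      have hz0 : 0 < z.1 := hx.trans hz.1
      rw [norm_mul, Real.norm_eq_abs, abs_of_nonneg (rhoDeriv_nonneg hκ hκ1 hx hz.1)]
      refine mul_le_mul_of_nonneg_left ?_ (rhoDeriv_nonneg hκ hκ1 hx hz.1)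
      by_cases h : z.2 ∈ Icc 0 l
      · have := hbd z.1 z.2 hz0 (hz2 h)
        rw [norm_mul, Real.norm_eq_abs, Real.norm_eq_abs, abs_of_nonneg (by linarith : 0 ≤ B - weightPot κ z.1 z.2)]
        exact mul_le_mul_of_nonneg_left (by linarith) (abs_nonneg _)
      · simp [hy.supp _ h]
  rw [setIntegral_congr_fun measurableSet_Ioo hD, integral_integral_swap hI]
  unfold wmom
  rw [← integral_const_mul]
  refine integral_congr_ae ?_
  filter_upwards [hpos] with s hs
  by_cases h : s ∈ Icc 0 l
  · have : ∀ c, rhoDeriv κ x c * (y s * (B - weightPot κ c s))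
        = y s * (rhoDeriv κ x c * (B - weightPot κ c s)) := fun c => by ring
    simp_rw [this]
    rw [integral_const_mul, hkernel s (hs h) h.2]
    ring
  · simp [hy.supp s h]

theorem rhoDeriv_sub_le {κ l x x' c : ℝ} (hκ : 0 < κ) (hκ1 : κ < 1 / 2) (hl : 0 < l)
    (hx : l / 2 ≤ x) (hxx : x ≤ x') (hc : x' < c) (hcl : c < l) :
    |rhoDeriv κ x c - rhoDeriv κ x' c| ≤ (l / 2) ^ (2 * κ - 1) * (x' - x) ^ (1 - κ)
      + l ^ (2 * κ) * ((1 - κ) * ((c - x') ^ (-κ) - (c - x) ^ (-κ))) := by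
  have h1 : (c - x) ^ (1 - κ) ≤ (c - x') ^ (1 - κ) + (x' - x) ^ (1 - κ) := by
    have := Real.rpow_add_le_add_rpow (a := c - x') (b := x' - x) (by linarith) (by linarith)
      (p := 1 - κ) (by linarith) (by linarith)
    rwa [sub_add_sub_cancel] at this
  have h1' : (c - x') ^ (1 - κ) ≤ (c - x) ^ (1 - κ) :=
    Real.rpow_le_rpow (by linarith) (by linarith) (by linarith)
  have h2 : (c - x) ^ (-κ) ≤ (c - x') ^ (-κ) :=
    Real.rpow_le_rpow_of_nonpos (by linarith) (by linarith) (by linarith)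
  have h3 : c ^ (2 * κ - 1) ≤ (l / 2) ^ (2 * κ - 1) :=
    Real.rpow_le_rpow_of_nonpos (by linarith) (by linarith) (by linarith)
  have h4 : c ^ (2 * κ) ≤ l ^ (2 * κ) := Real.rpow_le_rpow (by linarith) hcl.le (by linarith)
  have h5 : 0 ≤ c ^ (2 * κ - 1) := Real.rpow_nonneg (by linarith) _
  have h6 : 0 ≤ c ^ (2 * κ) := Real.rpow_nonneg (by linarith) _
  have h7 : 0 ≤ (x' - x) ^ (1 - κ) := Real.rpow_nonneg (by linarith) _
  have e : rhoDeriv κ x c - rhoDeriv κ x' c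
      = 2 * κ * (c ^ (2 * κ - 1) * ((c - x) ^ (1 - κ) - (c - x') ^ (1 - κ)))
        - c ^ (2 * κ) * ((1 - κ) * ((c - x') ^ (-κ) - (c - x) ^ (-κ))) := by
    unfold rhoDeriv; ring
  have b1 : 0 ≤ c ^ (2 * κ - 1) * ((c - x) ^ (1 - κ) - (c - x') ^ (1 - κ)) :=
    mul_nonneg h5 (by linarith)
  have b2 : c ^ (2 * κ - 1) * ((c - x) ^ (1 - κ) - (c - x') ^ (1 - κ))
      ≤ (l / 2) ^ (2 * κ - 1) * (x' - x) ^ (1 - κ) :=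
    mul_le_mul h3 (by linarith) (by linarith) (h5.trans h3)
  have b3 : 0 ≤ (1 - κ) * ((c - x') ^ (-κ) - (c - x) ^ (-κ)) :=
    mul_nonneg (by linarith) (by linarith)
  have b4 := mul_le_mul_of_nonneg_right h4 b3
  have b5 := mul_nonneg h6 b3
  have b6 : 2 * κ * (c ^ (2 * κ - 1) * ((c - x) ^ (1 - κ) - (c - x') ^ (1 - κ)))
      ≤ c ^ (2 * κ - 1) * ((c - x) ^ (1 - κ) - (c - x') ^ (1 - κ)) := by nlinarith
  have b7 : 0 ≤ 2 * κ * (c ^ (2 * κ - 1) * ((c - x) ^ (1 - κ) - (c - x') ^ (1 - κ))) := by positivity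
  rw [e, abs_le]
  constructor <;> linarith

end

section

variable {l : ℝ} {y : ℝ → ℝ}

theorem integral_sub_rpow {κ u p q : ℝ} (hκ1 : κ < 1 / 2) (hpq : p ≤ q) :
    IntegrableOn (fun c => (c - u) ^ (-κ)) (Ioo p q) ∧
      (1 - κ) * ∫ c in Ioo p q, (c - u) ^ (-κ) = (q - u) ^ (1 - κ) - (p - u) ^ (1 - κ) := by
  have h := (intervalIntegral.intervalIntegrable_rpow' (r := -κ) (by linarith)
      (a := p - u) (b := q - u)).comp_sub_right u
  simp only [sub_add_cancel] at h
  refine ⟨h.1.mono_set Ioo_subset_Ioc_self, ?_⟩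
  rw [← integral_Ioc_eq_integral_Ioo, ← intervalIntegral.integral_of_le hpq,
    intervalIntegral.integral_comp_sub_right (fun x => x ^ (-κ)) u,
    integral_rpow (Or.inl (by linarith))]
  have : 1 - κ ≠ 0 := by linarith
  rw [show -κ + 1 = 1 - κ by ring]
  field_simp

theorem wmom_holder {κ : ℝ} (hκ : 0 < κ) (hκ1 : κ < 1 / 2) (hl : 0 < l) :
    ∃ C : ℝ, 0 < C ∧ ∀ y, Adm 0 l y → ∀ Q, (∀ c ∈ Icc (l / 2) l, |weightMean κ y c| ≤ Q) →
      ∀ x x', l / 2 ≤ x → x ≤ x' → x' ≤ l →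
        |wmom κ y x - wmom κ y x'| ≤ C * Q * √(x' - x) := by
  obtain ⟨C0, hC0, hU⟩ := wmom_eq hκ hκ1
  set A1 := (l / 2) ^ (2 * κ - 1) with hA1
  set A2 := l ^ (2 * κ) with hA2
  have hA1p : 0 < A1 := by positivity
  have hA2p : 0 < A2 := by positivity
  refine ⟨C0⁻¹ * (2 * (A1 * l + 2 * A2) * l ^ (1 / 2 - κ)), by positivity, ?_⟩
  intro y hy Q hQ x x' hx hxx hxl
  have hx0 : 0 < x := by linarith
  have hx0' : 0 < x' := by linarith
  set D : ℝ → ℝ := fun c => weightMean κ y l - weightMean κ y c with hD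
  have hDm : Measurable D := measurable_const.sub (measurable_weightMean κ hy)
  have hDQ : ∀ c ∈ Icc (l / 2) l, |D c| ≤ 2 * Q := fun c hc => by
    have h1 := hQ c hc
    have h2 := hQ l ⟨by linarith, le_rfl⟩
    exact (abs_sub _ _).trans (by linarith)
  have hQ0 : 0 ≤ Q := (abs_nonneg _).trans (hQ l ⟨by linarith, le_rfl⟩)
  have hprod : ∀ {f : ℝ → ℝ} {p : ℝ}, l / 2 ≤ p → IntegrableOn f (Ioo p l) →
      IntegrableOn (fun c => f c * D c) (Ioo p l) := fun {f p} hp hf => by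
    refine Integrable.mono' (hf.abs.mul_const (2 * Q)) (hf.1.mul hDm.aestronglyMeasurable) ?_
    filter_upwards [ae_restrict_mem measurableSet_Ioo] with c hc
    rw [norm_mul, Real.norm_eq_abs, Real.norm_eq_abs]
    exact mul_le_mul_of_nonneg_left (hDQ c ⟨by linarith [hc.1], hc.2.le⟩) (abs_nonneg _)
  have i1 := (integral_rhoDeriv hκ hκ1 hx0 (hxx.trans hxl)).1.mono_set Ioo_subset_Ioc_self
  have i2 := (integral_rhoDeriv hκ hκ1 hx0' hxl).1.mono_set Ioo_subset_Ioc_self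
  have i1D := hprod hx i1
  have i2D := hprod (hx.trans hxx) i2
  have i1s : IntegrableOn (rhoDeriv κ x) (Ioo x' l) := i1.mono_set (Ioo_subset_Ioo_left hxx)
  have hU1 := hU l y hy x hx0 (hxx.trans hxl)
  have hU2 := hU l y hy x' hx0' hxl
  have hsplit : C0 * (wmom κ y x - wmom κ y x') = (∫ c in Ioc x x', rhoDeriv κ x c * D c)
      + ∫ c in Ioo x' l, (rhoDeriv κ x c - rhoDeriv κ x' c) * D c := by
    have e1 : ∫ c in Ioo x l, rhoDeriv κ x c * D c = (∫ c in Ioc x x', rhoDeriv κ x c * D c)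
        + ∫ c in Ioo x' l, rhoDeriv κ x c * D c := by
      have i := i1D
      rw [← integrableOn_Ioc_iff_integrableOn_Ioo] at i
      rw [← integral_Ioc_eq_integral_Ioo, ← integral_Ioc_eq_integral_Ioo,
        ← Ioc_union_Ioc_eq_Ioc hxx hxl, setIntegral_union (Ioc_disjoint_Ioc_of_le le_rfl)
        measurableSet_Ioc (i.mono_set (Ioc_subset_Ioc_right hxl))
        (i.mono_set (Ioc_subset_Ioc_left hxx))]
    have e2 : ∫ c in Ioo x' l, (rhoDeriv κ x c - rhoDeriv κ x' c) * D c
        = (∫ c in Ioo x' l, rhoDeriv κ x c * D c) - ∫ c in Ioo x' l, rhoDeriv κ x' c * D c := by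
      simp_rw [sub_mul]
      exact integral_sub (hprod (hx.trans hxx) i1s) i2D
    rw [mul_sub, ← hU1, ← hU2, e2]
    change (∫ c in Ioo x l, rhoDeriv κ x c * D c) - (∫ c in Ioo x' l, rhoDeriv κ x' c * D c) = _
    rw [e1]; ring
  set d := x' - x with hd
  have hd0 : 0 ≤ d := by linarith
  have b1 : |∫ c in Ioc x x', rhoDeriv κ x c * D c| ≤ A2 * d ^ (1 - κ) * (2 * Q) := by
    have h := integral_rhoDeriv hκ hκ1 hx0 hxx
    rw [← Real.norm_eq_abs]
    refine (norm_integral_le_of_norm_le (h.1.mul_const (2 * Q)) ?_).trans ?_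
    · filter_upwards [ae_restrict_mem measurableSet_Ioc] with c hc
      rw [norm_mul, Real.norm_eq_abs, Real.norm_eq_abs,
        abs_of_nonneg (rhoDeriv_nonneg hκ hκ1 hx0 hc.1)]
      exact mul_le_mul_of_nonneg_left (hDQ c ⟨by linarith [hc.1], hc.2.trans hxl⟩)
        (rhoDeriv_nonneg hκ hκ1 hx0 hc.1)
    · rw [integral_mul_const, h.2]
      have : x' ^ (2 * κ) ≤ A2 := Real.rpow_le_rpow hx0'.le hxl (by linarith)
      gcongr
  have b2 : |∫ c in Ioo x' l, (rhoDeriv κ x c - rhoDeriv κ x' c) * D c|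
      ≤ (A1 * d ^ (1 - κ) * l + A2 * d ^ (1 - κ)) * (2 * Q) := by
    have j1 := integral_sub_rpow (κ := κ) (u := x') (p := x') (q := l) hκ1 hxl
    have j2 := integral_sub_rpow (κ := κ) (u := x) (p := x') (q := l) hκ1 hxl
    rw [← hd] at j2
    have hgi : IntegrableOn (fun c => A1 * d ^ (1 - κ)
      + A2 * ((1 - κ) * ((c - x') ^ (-κ) - (c - x) ^ (-κ)))) (Ioo x' l) :=
      (integrableOn_const (by simp)).add (((j1.1.sub j2.1).const_mul (1 - κ)).const_mul A2)
    rw [← Real.norm_eq_abs]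
    refine (norm_integral_le_of_norm_le (hgi.mul_const (2 * Q)) ?_).trans ?_
    · filter_upwards [ae_restrict_mem measurableSet_Ioo] with c hc
      rw [norm_mul, Real.norm_eq_abs, Real.norm_eq_abs]
      have h1 := rhoDeriv_sub_le hκ hκ1 hl hx hxx hc.1 hc.2
      exact mul_le_mul h1 (hDQ c ⟨by linarith [hc.1], hc.2.le⟩) (abs_nonneg _)
        ((abs_nonneg _).trans h1)
    · rw [integral_mul_const]
      refine mul_le_mul_of_nonneg_right ?_ (by positivity)
      rw [integral_add (f := fun _ => A1 * d ^ (1 - κ))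
        (g := fun c => A2 * ((1 - κ) * ((c - x') ^ (-κ) - (c - x) ^ (-κ)))) (integrableOn_const (by simp))
        (((j1.1.sub j2.1).const_mul (1 - κ)).const_mul A2), setIntegral_const, integral_const_mul,
        integral_const_mul, integral_sub j1.1 j2.1, mul_sub (1 - κ), j1.2, j2.2, Measure.real,
        Real.volume_Ioo, ENNReal.toReal_ofReal (by linarith), smul_eq_mul, sub_self,
        Real.zero_rpow (by linarith), sub_zero]
      have h1 : (l - x') ^ (1 - κ) ≤ (l - x) ^ (1 - κ) :=
        Real.rpow_le_rpow (by linarith) (by linarith) (by linarith)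
      have h2 : 0 ≤ A1 * d ^ (1 - κ) := by positivity
      have h3 : (l - x') * (A1 * d ^ (1 - κ)) ≤ A1 * d ^ (1 - κ) * l := by nlinarith
      have h4 : A2 * ((l - x') ^ (1 - κ) - ((l - x) ^ (1 - κ) - d ^ (1 - κ)))
          ≤ A2 * d ^ (1 - κ) := mul_le_mul_of_nonneg_left (by linarith) hA2p.le
      linarith
  have hdp : d ^ (1 - κ) ≤ l ^ (1 / 2 - κ) * √d := by
    have : d ^ (1 - κ) = d ^ (1 / 2 - κ) * √d := by
      rw [Real.sqrt_eq_rpow, ← Real.rpow_add_of_nonneg hd0 (by linarith) (by norm_num)]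
      congr 1; ring
    rw [this]
    exact mul_le_mul_of_nonneg_right (Real.rpow_le_rpow hd0 (by linarith) (by linarith))
      (Real.sqrt_nonneg _)
  have hfin : C0 * |wmom κ y x - wmom κ y x'|
      ≤ 2 * (A1 * l + 2 * A2) * (l ^ (1 / 2 - κ) * √d) * Q := by
    have h1 : C0 * |wmom κ y x - wmom κ y x'| = |C0 * (wmom κ y x - wmom κ y x')| := by
      rw [abs_mul, abs_of_pos hC0]
    rw [h1, hsplit]
    refine (abs_add_le _ _).trans ((add_le_add b1 b2).trans ?_)
    have h2 : (A1 * l + 2 * A2) * d ^ (1 - κ) * Q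
        ≤ (A1 * l + 2 * A2) * (l ^ (1 / 2 - κ) * √d) * Q := by gcongr
    linarith
  have : |wmom κ y x - wmom κ y x'|
      ≤ C0⁻¹ * (2 * (A1 * l + 2 * A2) * (l ^ (1 / 2 - κ) * √d) * Q) := by
    rw [← div_eq_inv_mul, le_div_iff₀ hC0]
    linarith
  refine this.trans (le_of_eq ?_)
  ring

end

section

variable {l : ℝ} {y : ℝ → ℝ}

/-- Second antiderivative from the right. -/
def mom (y : ℝ → ℝ) (x : ℝ) : ℝ := ∫ s, y s * max (s - x) 0

/-- The kernel that converts `wmom` into `mom`. -/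
def momKer (κ x τ : ℝ) : ℝ :=
  2 * (-κ * τ ^ (-κ - 1)) + (τ - x) * (κ * (κ + 1) * τ ^ (-κ - 2))

theorem integral_momKer {κ x s : ℝ} (hx : 0 < x) (hs : x ≤ s) :
    ∫ τ in x..s, momKer κ x τ * (s - τ) = (s - x) * s ^ (-κ) - x ^ (-κ) * (s - x) := by
  have hpos : ∀ τ ∈ uIcc x s, τ ≠ 0 := fun τ hτ => by
    rw [uIcc_of_le hs] at hτ; linarith [hτ.1]
  have hder : ∀ τ ∈ uIcc x s, HasDerivAt
      (fun τ => (τ ^ (-κ) + (τ - x) * (-κ * τ ^ (-κ - 1))) * (s - τ) + (τ - x) * τ ^ (-κ))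
      (momKer κ x τ * (s - τ)) τ := fun τ hτ => by
    have h0 := Real.hasDerivAt_rpow_const (p := -κ) (Or.inl (hpos τ hτ))
    have h1 := (Real.hasDerivAt_rpow_const (p := -κ - 1) (Or.inl (hpos τ hτ))).const_mul (-κ)
    have h2 := (hasDerivAt_id' τ).sub_const x
    have h3 := (hasDerivAt_id' τ).const_sub s
    refine (((h0.add (h2.mul h1)).mul h3).add (h2.mul h0)).congr_deriv ?_
    unfold momKer
    rw [show -κ - 1 - 1 = -κ - 2 by ring]
    simp only [Pi.add_apply, Pi.mul_apply]
    ring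
  have hcont : ContinuousOn (fun τ => momKer κ x τ * (s - τ)) (uIcc x s) := by
    unfold momKer
    have h1 : ContinuousOn (fun τ : ℝ => τ ^ (-κ - 1)) (uIcc x s) := fun τ hτ =>
      (Real.continuousAt_rpow_const _ _ (Or.inl (hpos τ hτ))).continuousWithinAt
    have h2 : ContinuousOn (fun τ : ℝ => τ ^ (-κ - 2)) (uIcc x s) := fun τ hτ =>
      (Real.continuousAt_rpow_const _ _ (Or.inl (hpos τ hτ))).continuousWithinAt
    fun_prop
  rw [intervalIntegral.integral_eq_sub_of_hasDerivAt hder hcont.intervalIntegrable]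
  simp only [sub_self, mul_zero, zero_mul, add_zero, zero_add]

theorem abs_momKer_le {κ x τ : ℝ} (hκ : 0 < κ) (hκ1 : κ < 1 / 2) (hl : 0 < l) (hx : l / 2 ≤ x)
    (hτ : x ≤ τ) (hτl : τ ≤ l) :
    |momKer κ x τ| ≤ 2 * (l / 2) ^ (-κ - 1) + l * (l / 2) ^ (-κ - 2) := by
  have h1 : τ ^ (-κ - 1) ≤ (l / 2) ^ (-κ - 1) :=
    Real.rpow_le_rpow_of_nonpos (by linarith) (by linarith) (by linarith)
  have h2 : τ ^ (-κ - 2) ≤ (l / 2) ^ (-κ - 2) :=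
    Real.rpow_le_rpow_of_nonpos (by linarith) (by linarith) (by linarith)
  have p1 : 0 ≤ τ ^ (-κ - 1) := Real.rpow_nonneg (by linarith) _
  have p2 : 0 ≤ τ ^ (-κ - 2) := Real.rpow_nonneg (by linarith) _
  unfold momKer
  refine (abs_add_le _ _).trans (add_le_add ?_ ?_)
  · rw [abs_mul, abs_mul, abs_neg, abs_of_pos hκ, abs_of_nonneg p1, abs_of_pos two_pos]
    nlinarith
  · rw [abs_mul, abs_of_nonneg (by linarith : 0 ≤ τ - x), abs_of_nonneg (by positivity)]
    refine mul_le_mul (by linarith) ?_ (by positivity) hl.le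
    have : κ * (κ + 1) ≤ 1 := by nlinarith
    nlinarith

theorem measurable_wmom (κ : ℝ) (hy : Adm 0 l y) : Measurable (wmom κ y) := by
  have : StronglyMeasurable (Function.uncurry fun (x : ℝ) (s : ℝ) => y s * (s ^ κ * max (s - x) 0)) :=
    Measurable.stronglyMeasurable ((hy.meas.comp measurable_snd).mul (by fun_prop))
  exact (this.integral_prod_right (ν := volume)).measurable

theorem mom_eq {κ : ℝ} (hκ : 0 < κ) (hκ1 : κ < 1 / 2) (hl : 0 < l) (hy : Adm 0 l y)
    {x : ℝ} (hx : l / 2 ≤ x) (hxl : x ≤ l) :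
    mom y x = x ^ (-κ) * wmom κ y x + ∫ τ in Ioc x l, momKer κ x τ * wmom κ y τ := by
  obtain ⟨Y, hY0, hY⟩ := hy.exists_pos_bound
  have hx0 : 0 < x := by linarith
  set M := 2 * (l / 2) ^ (-κ - 1) + l * (l / 2) ^ (-κ - 2) with hM
  have hM0 : 0 ≤ M := by positivity
  have hkm : Measurable fun z : ℝ × ℝ => momKer κ x z.1 := by unfold momKer; fun_prop
  have hI : Integrable (Function.uncurry fun τ s => momKer κ x τ * (y s * (s ^ κ * max (s - τ) 0)))
      ((volume.restrict (Ioc x l)).prod volume) := by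
    have hc : Integrable (fun _ : ℝ => M) (volume.restrict (Ioc x l)) := integrableOn_const (by simp)
    refine Integrable.mono' (hc.mul_prod (hy.abs.integrable.mul_const (l ^ κ * l)))
      (Measurable.aestronglyMeasurable (hkm.mul ((hy.meas.comp measurable_snd).mul (by fun_prop)))) ?_
    have h1 : ∀ᵐ z : ℝ × ℝ ∂((volume.restrict (Ioc x l)).prod volume), z.1 ∈ Ioc x l :=
      Measure.quasiMeasurePreserving_fst.ae (ae_restrict_mem measurableSet_Ioc)
    filter_upwards [h1] with z hz
    simp only [Function.uncurry]
    rw [norm_mul, norm_mul, Real.norm_eq_abs, Real.norm_eq_abs]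
    refine mul_le_mul (abs_momKer_le hκ hκ1 hl hx hz.1.le hz.2) ?_ (by positivity) hM0
    by_cases h : z.2 ∈ Icc 0 l
    · refine mul_le_mul_of_nonneg_left ?_ (abs_nonneg _)
      rw [Real.norm_eq_abs, abs_of_nonneg (mul_nonneg (Real.rpow_nonneg h.1 _) (le_max_right _ _))]
      refine mul_le_mul (Real.rpow_le_rpow h.1 h.2 hκ.le) (max_le ?_ hl.le) (le_max_right _ _)
        (Real.rpow_nonneg hl.le _)
      linarith [h.2, hz.1]
    · simp [hy.supp _ h]
  have hswap : ∫ τ in Ioc x l, momKer κ x τ * wmom κ y τ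
      = ∫ s, ∫ τ in Ioc x l, momKer κ x τ * (y s * (s ^ κ * max (s - τ) 0)) := by
    unfold wmom
    simp_rw [← integral_const_mul]
    exact integral_integral_swap hI
  have hw : x ^ (-κ) * wmom κ y x = ∫ s, x ^ (-κ) * (y s * (s ^ κ * max (s - x) 0)) := by
    rw [integral_const_mul]; rfl
  have hwi : Integrable fun s => x ^ (-κ) * (y s * (s ^ κ * max (s - x) 0)) := by
    refine Integrable.const_mul ?_ _
    refine Integrable.mono' (hy.abs.integrable.mul_const (l ^ κ * l))
      (hy.meas.mul (by fun_prop)).aestronglyMeasurable (.of_forall fun s => ?_)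
    by_cases h : s ∈ Icc 0 l
    · rw [norm_mul, Real.norm_eq_abs, Real.norm_eq_abs,
        abs_of_nonneg (mul_nonneg (Real.rpow_nonneg h.1 _) (le_max_right _ _))]
      refine mul_le_mul_of_nonneg_left ?_ (abs_nonneg _)
      refine mul_le_mul (Real.rpow_le_rpow h.1 h.2 hκ.le) (max_le (by linarith [h.2]) hl.le)
        (le_max_right _ _) (Real.rpow_nonneg hl.le _)
    · simp [hy.supp _ h]
  have hswi : Integrable fun s => ∫ τ in Ioc x l, momKer κ x τ * (y s * (s ^ κ * max (s - τ) 0)) :=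
    hI.integral_prod_right
  rw [hw, hswap, ← integral_add hwi hswi]
  unfold mom
  refine integral_congr_ae (.of_forall fun s => ?_)
  simp only
  by_cases h : s ∈ Icc 0 l
  · rcases le_or_gt s x with hsx | hxs
    · rw [max_eq_right (by linarith), setIntegral_eq_zero_of_forall_eq_zero]
      · ring
      · intro τ hτ
        rw [max_eq_right (by linarith [hτ.1])]; ring
    · have e1 : ∫ τ in Ioc x l, momKer κ x τ * (y s * (s ^ κ * max (s - τ) 0))
          = y s * s ^ κ * ∫ τ in x..s, momKer κ x τ * (s - τ) := by
        rw [intervalIntegral.integral_of_le hxs.le, ← integral_const_mul]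
        rw [setIntegral_eq_of_subset_of_forall_sdiff_eq_zero measurableSet_Ioc
          (Ioc_subset_Ioc_right h.2)]
        · refine setIntegral_congr_fun measurableSet_Ioc fun τ hτ => ?_
          rw [max_eq_left (by linarith [hτ.2])]; ring
        · intro τ hτ
          have : s ≤ τ := by
            by_contra hh
            exact hτ.2 ⟨hτ.1.1, (not_le.1 hh).le⟩
          rw [max_eq_right (by linarith)]; ring
      rw [e1, integral_momKer hx0 hxs.le, max_eq_left (by linarith)]
      have : s ^ κ * s ^ (-κ) = 1 := by
        rw [← Real.rpow_add (hx0.trans hxs), add_neg_cancel, Real.rpow_zero]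
      linear_combination (-(y s * (s - x))) * this
  · simp [hy.supp _ h]

theorem mom_holder {κ : ℝ} (hκ : 0 < κ) (hκ1 : κ < 1 / 2) (hl : 0 < l) :
    ∃ C : ℝ, 0 < C ∧ ∀ y, Adm 0 l y → ∀ Q, (∀ c ∈ Icc (l / 2) l, |weightMean κ y c| ≤ Q) →
      ∀ x x', l / 2 ≤ x → x ≤ x' → x' ≤ l → |mom y x - mom y x'| ≤ C * Q * √(x' - x) := by
  obtain ⟨C, hC, hU⟩ := wmom_holder hκ hκ1 hl
  set W0 := (l / 2) ^ (-κ) with hW0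
  set W1 := (l / 2) ^ (-κ - 1) with hW1
  set W2 := (l / 2) ^ (-κ - 2) with hW2
  have hW0p : 0 < W0 := by positivity
  have hW1p : 0 < W1 := by positivity
  have hW2p : 0 < W2 := by positivity
  refine ⟨W0 * C + (W1 + (2 * W1 + l * W2) + l * W2) * (C * √l) * √l, by positivity, ?_⟩
  intro y hy Q hQ x x' hx hxx hxl
  have hQ0 : 0 ≤ Q := (abs_nonneg _).trans (hQ l ⟨by linarith, le_rfl⟩)
  have hU := hU y hy Q hQ
  have hUl : wmom κ y l = 0 := by
    unfold wmom
    refine integral_eq_zero_of_ae (.of_forall fun s => ?_)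
    by_cases h : s ∈ Icc 0 l
    · simp only [max_eq_right (sub_nonpos.2 h.2), mul_zero, Pi.zero_apply]
    · simp only [hy.supp s h, zero_mul, Pi.zero_apply]
  set M := C * Q * √l with hM
  have hM0 : 0 ≤ M := by positivity
  have hUM : ∀ τ, l / 2 ≤ τ → τ ≤ l → |wmom κ y τ| ≤ M := fun τ h1 h2 => by
    have := hU τ l h1 h2 le_rfl
    rw [hUl, sub_zero] at this
    exact this.trans (mul_le_mul_of_nonneg_left (Real.sqrt_le_sqrt (by linarith)) (by positivity))
  set K := 2 * W1 + l * W2 with hK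
  have hK0 : 0 < K := by positivity
  have hkm : ∀ x, Measurable (momKer κ x) := fun x => by unfold momKer; fun_prop
  have hint : ∀ x p, l / 2 ≤ x → x ≤ p → IntegrableOn (fun τ => momKer κ x τ * wmom κ y τ) (Ioc p l) :=
    fun x p hx hp => by
      refine Integrable.mono' (g := fun _ => K * M) (integrableOn_const (by simp))
        ((hkm x).mul (measurable_wmom κ hy)).aestronglyMeasurable ?_
      filter_upwards [ae_restrict_mem measurableSet_Ioc] with τ hτ
      rw [norm_mul, Real.norm_eq_abs, Real.norm_eq_abs]
      exact mul_le_mul (abs_momKer_le hκ hκ1 hl hx (by linarith [hτ.1]) hτ.2)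
        (hUM τ (by linarith [hτ.1]) hτ.2) (abs_nonneg _) hK0.le
  set d := x' - x with hd
  have hd0 : 0 ≤ d := by linarith
  have hx0 : 0 < x := by linarith
  have e1 : ∫ τ in Ioc x l, momKer κ x τ * wmom κ y τ = (∫ τ in Ioc x x', momKer κ x τ * wmom κ y τ)
      + ∫ τ in Ioc x' l, momKer κ x τ * wmom κ y τ := by
    rw [← Ioc_union_Ioc_eq_Ioc hxx hxl, setIntegral_union (Ioc_disjoint_Ioc_of_le le_rfl)
      measurableSet_Ioc ((hint x x hx le_rfl).mono_set (Ioc_subset_Ioc_right hxl))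
      (hint x x' hx hxx)]
  have e2 : (∫ τ in Ioc x' l, momKer κ x τ * wmom κ y τ)
      - (∫ τ in Ioc x' l, momKer κ x' τ * wmom κ y τ)
      = ∫ τ in Ioc x' l, d * (κ * (κ + 1) * τ ^ (-κ - 2)) * wmom κ y τ := by
    rw [← integral_sub (hint x x' hx hxx) (hint x' x' (hx.trans hxx) le_rfl)]
    refine integral_congr_ae (.of_forall fun τ => ?_)
    simp only [momKer, hd]; ring
  have b1 : |x ^ (-κ) * (wmom κ y x - wmom κ y x')| ≤ W0 * (C * Q * √d) := by
    rw [abs_mul, abs_of_nonneg (Real.rpow_nonneg hx0.le _)]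
    exact mul_le_mul (Real.rpow_le_rpow_of_nonpos (by linarith) hx (by linarith))
      (hU x x' hx hxx hxl) (abs_nonneg _) hW0p.le
  have b2 : |(x ^ (-κ) - x' ^ (-κ)) * wmom κ y x'| ≤ W1 * d * M := by
    rw [abs_mul]
    refine mul_le_mul ?_ (hUM x' (by linarith) hxl) (abs_nonneg _) (by positivity)
    have := norm_image_sub_le_of_norm_deriv_le_segment' (f := fun τ : ℝ => τ ^ (-κ))
      (f' := fun τ => -κ * τ ^ (-κ - 1)) (a := x) (b := x') (C := W1)
      (fun τ hτ => (Real.hasDerivAt_rpow_const (Or.inl (by linarith [hτ.1]))).hasDerivWithinAt)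
      (fun τ hτ => by
        have p1 : 0 ≤ τ ^ (-κ - 1) := Real.rpow_nonneg (by linarith [hτ.1]) _
        have p2 : τ ^ (-κ - 1) ≤ W1 :=
          Real.rpow_le_rpow_of_nonpos (by linarith) (by linarith [hτ.1]) (by linarith)
        rw [Real.norm_eq_abs, abs_mul, abs_neg, abs_of_pos hκ, abs_of_nonneg p1]
        nlinarith) x' ⟨hxx, le_rfl⟩
    rwa [Real.norm_eq_abs, abs_sub_comm] at this
  have b3 : |∫ τ in Ioc x x', momKer κ x τ * wmom κ y τ| ≤ K * M * d := by
    rw [← Real.norm_eq_abs]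
    refine (norm_setIntegral_le_of_norm_le_const (C := K * M) (by simp) fun τ hτ => ?_).trans ?_
    · rw [norm_mul, Real.norm_eq_abs, Real.norm_eq_abs]
      exact mul_le_mul (abs_momKer_le hκ hκ1 hl hx hτ.1.le (by linarith [hτ.2]))
        (hUM τ (by linarith [hτ.1]) (by linarith [hτ.2])) (abs_nonneg _) hK0.le
    · rw [Measure.real, Real.volume_Ioc, ENNReal.toReal_ofReal hd0]
  have b4 : |∫ τ in Ioc x' l, d * (κ * (κ + 1) * τ ^ (-κ - 2)) * wmom κ y τ|
      ≤ d * W2 * M * l := by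
    rw [← Real.norm_eq_abs]
    refine (norm_setIntegral_le_of_norm_le_const (C := d * W2 * M) (by simp) fun τ hτ => ?_).trans ?_
    · have p1 : 0 ≤ τ ^ (-κ - 2) := Real.rpow_nonneg (by linarith [hτ.1]) _
      have p2 : τ ^ (-κ - 2) ≤ W2 :=
        Real.rpow_le_rpow_of_nonpos (by linarith) (by linarith [hτ.1]) (by linarith)
      have p3 : κ * (κ + 1) ≤ 1 := by nlinarith
      rw [norm_mul, Real.norm_eq_abs, Real.norm_eq_abs, abs_of_nonneg (by positivity)]
      refine mul_le_mul (mul_le_mul_of_nonneg_left (by nlinarith) hd0)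
        (hUM τ (by linarith [hτ.1]) hτ.2) (abs_nonneg _) (by positivity)
    · rw [Measure.real, Real.volume_Ioc, ENNReal.toReal_ofReal (by linarith)]
      exact mul_le_mul_of_nonneg_left (by linarith) (by positivity)
  have hsd : d ≤ √l * √d := by
    nth_rewrite 1 [← Real.mul_self_sqrt hd0]
    exact mul_le_mul_of_nonneg_right (Real.sqrt_le_sqrt (by linarith)) (Real.sqrt_nonneg _)
  have htot : mom y x - mom y x' = x ^ (-κ) * (wmom κ y x - wmom κ y x')
      + (x ^ (-κ) - x' ^ (-κ)) * wmom κ y x' + (∫ τ in Ioc x x', momKer κ x τ * wmom κ y τ)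
      + ∫ τ in Ioc x' l, d * (κ * (κ + 1) * τ ^ (-κ - 2)) * wmom κ y τ := by
    rw [mom_eq hκ hκ1 hl hy hx (hxx.trans hxl), mom_eq hκ hκ1 hl hy (hx.trans hxx) hxl, e1, ← e2]
    ring
  rw [htot]
  refine (abs_add_le _ _).trans ((add_le_add ((abs_add_le _ _).trans (add_le_add
    ((abs_add_le _ _).trans (add_le_add b1 b2)) b3)) b4).trans ?_)
  have h5 : (W1 + K + l * W2) * M * d ≤ (W1 + K + l * W2) * M * (√l * √d) :=
    mul_le_mul_of_nonneg_left hsd (by positivity)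
  calc W0 * (C * Q * √d) + W1 * d * M + K * M * d + d * W2 * M * l
      = W0 * (C * Q * √d) + (W1 + K + l * W2) * M * d := by ring
    _ ≤ W0 * (C * Q * √d) + (W1 + K + l * W2) * M * (√l * √d) := by
        linarith
    _ = _ := by rw [hM]; ring

end

section

/-- The solution of `Y'' = y` on `(a, b)` with `Y(a) = 0` and `Y'(b) = 0`. -/
def secondAnti (a : ℝ) (y : ℝ → ℝ) (x : ℝ) : ℝ := -∫ s, y s * min (s - a) (x - a)

section Origin

variable {l : ℝ} {y : ℝ → ℝ}

theorem Adm.comp_reflect (hy : Adm 0 l y) : Adm 0 l fun s => y (l - s) := by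
  obtain ⟨M, hM⟩ := hy.bdd
  refine ⟨hy.meas.comp (by fun_prop), ⟨M, fun x => hM _⟩, fun x hx => hy.supp _ fun h => hx ?_⟩
  exact ⟨by linarith [h.2], by linarith [h.1]⟩

theorem pot_reflect (μ : ℝ) (y : ℝ → ℝ) (x : ℝ) :
    pot μ (fun s => y (l - s)) x = pot μ y (l - x) := by
  unfold pot
  rw [← integral_sub_left_eq_self (fun s => ker μ (l - x - s) * y s) volume l]
  congr 1; ext s
  rw [← ker_neg]
  congr 2; ring

theorem integral_pot_reflect (μ : ℝ) (y : ℝ → ℝ) :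
    ∫ x in Ioo 0 l, pot μ (fun s => y (l - s)) x ^ 2 = ∫ x in Ioo 0 l, pot μ y x ^ 2 := by
  rw [← integral_indicator measurableSet_Ioo, ← integral_indicator measurableSet_Ioo,
    ← integral_sub_left_eq_self _ volume l]
  congr 1; ext x
  simp only [indicator, mem_Ioo, pot_reflect, sub_sub_cancel]
  congr 1
  simp only [sub_pos, sub_lt_self_iff, eq_iff_iff]
  exact and_comm

theorem weightMean_full {κ : ℝ} (hκ : 0 < κ) (hκ1 : κ < 1 / 2) :
    ∃ B : ℝ, 0 < B ∧ ∀ l y, 0 < l → Adm 0 l y → weightMean κ y l = B * ∫ s, y s := by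
  obtain ⟨C, B, hC, hB, -, -, heq, -⟩ := weightPot_properties hκ hκ1
  refine ⟨B, hB, fun l y hl hy => ?_⟩
  rw [weightMean_eq hκ hκ1 hy hl, ← integral_const_mul]
  have : ∀ᵐ s : ℝ, s ≠ 0 := by simp [ae_iff, measure_singleton]
  refine integral_congr_ae ?_
  filter_upwards [this] with s hs
  by_cases h : s ∈ Icc 0 l
  · simp only [heq l s (lt_of_le_of_ne h.1 (Ne.symm hs)) h.2, mul_comm]
  · simp only [hy.supp s h, zero_mul, mul_zero]

theorem integrable_mul_of_bound (hy : Adm 0 l y) {g : ℝ → ℝ} (hg : Measurable g) {M : ℝ}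
    (hM : ∀ s ∈ Icc 0 l, |g s| ≤ M) : Integrable fun s => y s * g s := by
  refine Integrable.mono' (hy.abs.integrable.mul_const M) (hy.meas.mul hg).aestronglyMeasurable
    (.of_forall fun s => ?_)
  by_cases h : s ∈ Icc 0 l
  · rw [norm_mul, Real.norm_eq_abs, Real.norm_eq_abs]
    exact mul_le_mul_of_nonneg_left (hM s h) (abs_nonneg _)
  · simp [hy.supp s h]

theorem secondAnti_eq_mom (hy : Adm 0 l y) {x : ℝ} (hx : x ∈ Icc 0 l) :
    secondAnti 0 y x = mom y x - ∫ s, y s * s := by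
  have h1 : Integrable fun s => y s * s := integrable_mul_of_bound hy measurable_id (M := l)
    fun s hs => (abs_of_nonneg hs.1).le.trans hs.2
  have h2 : Integrable fun s => y s * max (s - x) 0 := integrable_mul_of_bound hy (by fun_prop) (M := l)
    fun s hs => by
      rw [abs_of_nonneg (le_max_right _ _)]
      exact max_le (by linarith [hs.2, hx.1]) (by linarith [hx.1, hx.2])
  unfold secondAnti mom
  rw [← integral_neg, ← integral_sub h2 h1]
  congr 1; ext s
  rcases le_total s x with h | h
  · rw [min_eq_left (by linarith), max_eq_right (by linarith)]; ring
  · rw [min_eq_right (by linarith), max_eq_left (by linarith)]; ring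

theorem secondAnti_eq_mom_reflect (hy : Adm 0 l y) {x : ℝ} (hx : x ∈ Icc 0 l) :
    secondAnti 0 y x = mom (fun s => y (l - s)) (l - x) - x * ∫ s, y s := by
  have e : mom (fun s => y (l - s)) (l - x) = ∫ s, y s * max (x - s) 0 := by
    unfold mom
    rw [← integral_sub_left_eq_self (fun s => y s * max (x - s) 0) volume l]
    congr 1; ext s
    congr 2; ring
  have h2 : Integrable fun s => y s * max (x - s) 0 := integrable_mul_of_bound hy (by fun_prop) (M := l)
    fun s hs => by
      rw [abs_of_nonneg (le_max_right _ _)]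
      exact max_le (by linarith [hs.1, hx.2]) (by linarith [hx.1, hx.2])
  rw [e, ← integral_const_mul, ← integral_sub h2 (hy.integrable.const_mul x)]
  unfold secondAnti
  rw [← integral_neg]
  congr 1; ext s
  rcases le_total s x with h | h
  · rw [min_eq_left (by linarith), max_eq_left (by linarith)]; ring
  · rw [min_eq_right (by linarith), max_eq_right (by linarith)]; ring

theorem secondAnti_holder_origin {μ : ℝ} (hμ : 0 < μ) (hμ1 : μ < 1) (hl : 0 < l) :
    ∃ C : ℝ, 0 < C ∧ ∀ y, Adm 0 l y → ∀ F, 0 ≤ F → ∫ x in Ioo 0 l, pot μ y x ^ 2 ≤ F ^ 2 →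
      ∀ x x', 0 ≤ x → x ≤ x' → x' ≤ l →
        |secondAnti 0 y x - secondAnti 0 y x'| ≤ C * F * √(x' - x) := by
  obtain ⟨κ, rfl⟩ : ∃ κ, μ = 2 * κ := ⟨μ / 2, by ring⟩
  have hκ : 0 < κ := by linarith
  have hκ1 : κ < 1 / 2 := by linarith
  obtain ⟨C1, hC1, h1⟩ := weightMean_sq_le hκ hκ1 hl
  obtain ⟨C2, hC2, h2⟩ := mom_holder hκ hκ1 hl
  obtain ⟨B, hB, h3⟩ := weightMean_full hκ hκ1
  set S := √C1 with hS
  have hS0 : 0 < S := Real.sqrt_pos.2 hC1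
  refine ⟨2 * (C2 * S + √l * (S / B)), by positivity, fun y hy F hF hyF x x' hx hxx hxl => ?_⟩
  have hQ : ∀ y, Adm 0 l y → ∫ x in Ioo 0 l, pot (2 * κ) y x ^ 2 ≤ F ^ 2 →
      ∀ c ∈ Icc (l / 2) l, |weightMean κ y c| ≤ S * F := fun y hy hyF c hc => by
    refine abs_le_of_sq_le_sq ?_ (by positivity)
    rw [mul_pow, hS, Real.sq_sqrt hC1.le]
    exact (h1 y hy c hc).trans (mul_le_mul_of_nonneg_left hyF hC1.le)
  have hyr : ∫ x in Ioo 0 l, pot (2 * κ) (fun s => y (l - s)) x ^ 2 ≤ F ^ 2 := by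
    rwa [integral_pot_reflect]
  have hQ1 := hQ y hy hyF
  have hQ2 := hQ _ hy.comp_reflect hyr
  have hI : |∫ s, y s| ≤ S / B * F := by
    have := hQ1 l ⟨by linarith, le_rfl⟩
    rw [h3 l y hl hy, abs_mul, abs_of_pos hB] at this
    rw [div_mul_eq_mul_div, le_div_iff₀ hB]
    linarith
  have hright : ∀ x x', l / 2 ≤ x → x ≤ x' → x' ≤ l →
      |secondAnti 0 y x - secondAnti 0 y x'|
        ≤ (C2 * S + √l * (S / B)) * F * √(x' - x) := by
    intro x x' hx hxx hxl
    rw [secondAnti_eq_mom hy ⟨by linarith, by linarith⟩,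
      secondAnti_eq_mom hy ⟨by linarith, by linarith⟩, sub_sub_sub_cancel_right]
    refine (h2 y hy _ hQ1 x x' hx hxx hxl).trans ?_
    have : 0 ≤ √l * (S / B) * F * √(x' - x) := by positivity
    linarith
  have hleft : ∀ x x', 0 ≤ x → x ≤ x' → x' ≤ l / 2 →
      |secondAnti 0 y x - secondAnti 0 y x'|
        ≤ (C2 * S + √l * (S / B)) * F * √(x' - x) := by
    intro x x' hx hxx hxl
    rw [secondAnti_eq_mom_reflect hy ⟨by linarith, by linarith⟩,
      secondAnti_eq_mom_reflect hy ⟨by linarith, by linarith⟩]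
    have b1 := h2 _ hy.comp_reflect _ hQ2 (l - x') (l - x) (by linarith) (by linarith) (by linarith)
    rw [sub_sub_sub_cancel_left] at b1
    have b2 : |(x' - x) * ∫ s, y s| ≤ √l * √(x' - x) * (S / B * F) := by
      rw [abs_mul, abs_of_nonneg (by linarith : 0 ≤ x' - x)]
      refine mul_le_mul ?_ hI (abs_nonneg _) (by positivity)
      nth_rewrite 1 [← Real.mul_self_sqrt (by linarith : 0 ≤ x' - x)]
      exact mul_le_mul_of_nonneg_right (Real.sqrt_le_sqrt (by linarith)) (Real.sqrt_nonneg _)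
    have e : mom (fun s => y (l - s)) (l - x) - (x * ∫ s, y s)
        - (mom (fun s => y (l - s)) (l - x') - (x' * ∫ s, y s))
        = -(mom (fun s => y (l - s)) (l - x') - mom (fun s => y (l - s)) (l - x))
          + (x' - x) * ∫ s, y s := by ring
    rw [e]
    refine (abs_add_le _ _).trans ?_
    rw [abs_neg]
    linarith
  have hK : 0 ≤ (C2 * S + √l * (S / B)) * F := by positivity
  have hsq := Real.sqrt_nonneg (x' - x)
  rcases le_total (l / 2) x with h | h
  · have := hright x x' h hxx hxl
    have := mul_nonneg hK hsq
    linarith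
  rcases le_total x' (l / 2) with h' | h'
  · have := hleft x x' hx hxx h'
    have := mul_nonneg hK hsq
    linarith
  · have b1 := hleft x (l / 2) hx h le_rfl
    have b2 := hright (l / 2) x' le_rfl h' hxl
    have b3 := mul_le_mul_of_nonneg_left (Real.sqrt_le_sqrt (by linarith : l / 2 - x ≤ x' - x)) hK
    have b4 := mul_le_mul_of_nonneg_left (Real.sqrt_le_sqrt (by linarith : x' - l / 2 ≤ x' - x)) hK
    have := abs_sub_le (secondAnti 0 y x) (secondAnti 0 y (l / 2)) (secondAnti 0 y x')
    linarith

end Origin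

variable {a b : ℝ} {y : ℝ → ℝ}

/-- The second antiderivative of a function is Hölder continuous of order one half, with a constant
controlled by the `L²` norm of its Riesz potential on `(a, b)`. -/
theorem secondAnti_bound {μ : ℝ} (hμ : 0 < μ) (hμ1 : μ < 1) (hab : a < b) :
    ∃ C : ℝ, 0 < C ∧ ∀ y, Adm a b y → ∀ F, 0 ≤ F → ∫ x in Ioo a b, pot μ y x ^ 2 ≤ F ^ 2 →
      (∀ x ∈ Icc a b, |secondAnti a y x| ≤ C * F) ∧
      ∀ x ∈ Icc a b, ∀ x' ∈ Icc a b,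
        (secondAnti a y x - secondAnti a y x') ^ 2 ≤ (C * F) ^ 2 * |x - x'| := by
  have hl : 0 < b - a := by linarith
  obtain ⟨C, hC, h⟩ := secondAnti_holder_origin hμ hμ1 hl
  refine ⟨C * (√(b - a) + 1), by positivity, fun y hy F hF hyF => ?_⟩
  set z : ℝ → ℝ := fun s => y (s + a) with hz
  have hza : Adm 0 (b - a) z := by
    obtain ⟨M, hM⟩ := hy.bdd
    refine ⟨hy.meas.comp (by fun_prop), ⟨M, fun x => hM _⟩, fun x hx => hy.supp _ fun h => hx ?_⟩
    exact ⟨by linarith [h.1], by linarith [h.2]⟩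
  have hpot : ∀ x, pot μ z x = pot μ y (x + a) := fun x => by
    unfold pot
    rw [← integral_add_right_eq_self (fun s => ker μ (x + a - s) * y s) a]
    congr 1; ext s
    congr 2; ring
  have hzF : ∫ x in Ioo 0 (b - a), pot μ z x ^ 2 ≤ F ^ 2 := by
    refine le_trans (le_of_eq ?_) hyF
    rw [← integral_indicator measurableSet_Ioo, ← integral_indicator measurableSet_Ioo,
      ← integral_add_right_eq_self ((Ioo a b).indicator fun x => pot μ y x ^ 2) a]
    congr 1; ext x
    have : x + a ∈ Ioo a b ↔ x ∈ Ioo 0 (b - a) := by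
      constructor <;> intro h <;> constructor <;> linarith [h.1, h.2]
    simp only [indicator, this, hpot]
  have hsa : ∀ x, secondAnti a y x = secondAnti 0 z (x - a) := fun x => by
    unfold secondAnti
    rw [← integral_add_right_eq_self (fun s => y s * min (s - a) (x - a)) a]
    simp only [add_sub_cancel_right, sub_zero, hz]
  have h0 : secondAnti a y a = 0 := by
    unfold secondAnti
    rw [neg_eq_zero]
    refine integral_eq_zero_of_ae (.of_forall fun s => ?_)
    by_cases hs : s ∈ Icc a b
    · simp only [sub_self, min_eq_right (sub_nonneg.2 hs.1), mul_zero, Pi.zero_apply]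
    · simp only [hy.supp s hs, zero_mul, Pi.zero_apply]
  have hH : ∀ x ∈ Icc a b, ∀ x' ∈ Icc a b, x ≤ x' →
      |secondAnti a y x - secondAnti a y x'| ≤ C * F * √(x' - x) := by
    intro x hx x' hx' hxx
    have := h z hza F hF hzF (x - a) (x' - a) (by linarith [hx.1]) (by linarith) (by linarith [hx'.2])
    rwa [← hsa, ← hsa, sub_sub_sub_cancel_right] at this
  have hs1 := Real.sqrt_nonneg (b - a)
  refine ⟨fun x hx => ?_, ?_⟩
  · have := hH a ⟨le_rfl, hab.le⟩ x hx hx.1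
    rw [h0, zero_sub, abs_neg] at this
    refine this.trans ?_
    have h2 : √(x - a) ≤ √(b - a) := Real.sqrt_le_sqrt (by linarith [hx.2])
    have h3 := mul_le_mul_of_nonneg_left (h2.trans (le_add_of_nonneg_right zero_le_one))
      (mul_nonneg hC.le hF)
    linarith
  · have key : ∀ x ∈ Icc a b, ∀ x' ∈ Icc a b, x ≤ x' →
        (secondAnti a y x - secondAnti a y x') ^ 2
          ≤ (C * (√(b - a) + 1) * F) ^ 2 * |x - x'| := by
      intro x hx x' hx' hxx
      have h1 := hH x hx x' hx' hxx
      rw [abs_sub_comm x x', abs_of_nonneg (sub_nonneg.2 hxx), ← sq_abs]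
      calc |secondAnti a y x - secondAnti a y x'| ^ 2 ≤ (C * F * √(x' - x)) ^ 2 := by gcongr
        _ = (C * F) ^ 2 * (x' - x) := by rw [mul_pow, Real.sq_sqrt (by linarith)]
        _ ≤ (C * (√(b - a) + 1) * F) ^ 2 * (x' - x) := by
            refine mul_le_mul_of_nonneg_right ?_ (by linarith)
            refine pow_le_pow_left₀ (by positivity) ?_ 2
            have : 0 ≤ C * F * √(b - a) := by positivity
            linarith
    intro x hx x' hx'
    rcases le_total x x' with hxx | hxx
    · exact key x hx x' hx' hxx
    · have := key x' hx' x hx hxx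
      rwa [abs_sub_comm x' x, ← neg_sub, neg_sq] at this

end

section

open Polynomial in
/-- The polynomial with given coefficients. -/
def refPoly (N : ℕ) : (Fin (N + 1) → ℝ) →ₗ[ℝ] Polynomial ℝ where
  toFun c := ∑ i, C (c i) * X ^ (i : ℕ)
  map_add' c d := by simp [add_mul, Finset.sum_add_distrib]
  map_smul' r c := by
    simp only [Pi.smul_apply, smul_eq_mul, C_mul, RingHom.id_apply, Finset.smul_sum,
      Polynomial.smul_eq_C_mul, mul_assoc]

variable {N : ℕ}

theorem refPoly_coeff (c : Fin (N + 1) → ℝ) (i : Fin (N + 1)) : (refPoly N c).coeff i = c i := by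
  simp only [refPoly, LinearMap.coe_mk, AddHom.coe_mk, Polynomial.finsetSum_coeff,
    Polynomial.coeff_C_mul_X_pow]
  rw [Finset.sum_eq_single i] <;> simp +contextual [Fin.ext_iff, eq_comm]

theorem refPoly_natDegree_le (c : Fin (N + 1) → ℝ) : (refPoly N c).natDegree ≤ N := by
  simp only [refPoly, LinearMap.coe_mk, AddHom.coe_mk]
  refine Polynomial.natDegree_sum_le_of_forall_le _ _ fun i _ => ?_
  exact (Polynomial.natDegree_C_mul_X_pow_le _ _).trans (Nat.lt_succ_iff.1 i.2)

theorem refPoly_coeffs {p : Polynomial ℝ} (hp : p.natDegree ≤ N) :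
    refPoly N (fun i => p.coeff i) = p := by
  ext n
  by_cases h : n < N + 1
  · exact refPoly_coeff (fun i : Fin (N + 1) => p.coeff i) ⟨n, h⟩
  · rw [Polynomial.coeff_eq_zero_of_natDegree_lt, Polynomial.coeff_eq_zero_of_natDegree_lt] <;>
    have := refPoly_natDegree_le (N := N) (fun i => p.coeff i) <;> omega

theorem refPoly_injective : Function.Injective (refPoly N) := fun c d h => by
  ext i
  rw [← refPoly_coeff c i, ← refPoly_coeff d i, h]

theorem refPoly_eval (c : Fin (N + 1) → ℝ) (x : ℝ) :
    (refPoly N c).eval x = ∑ i, c i * x ^ (i : ℕ) := by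
  simp [refPoly, Polynomial.eval_finsetSum]

theorem abs_refPoly_eval_le (c : Fin (N + 1) → ℝ) {x : ℝ} (hx : x ∈ Icc (0:ℝ) 1) :
    |(refPoly N c).eval x| ≤ (N + 1) * ‖c‖ := by
  rw [refPoly_eval]
  refine (Finset.abs_sum_le_sum_abs _ _).trans ?_
  refine (Finset.sum_le_card_nsmul _ _ ‖c‖ fun i _ => ?_).trans (by simp)
  rw [abs_mul, abs_of_nonneg (pow_nonneg hx.1 _)]
  exact (mul_le_of_le_one_right (abs_nonneg _) (pow_le_one₀ hx.1 hx.2)).trans (norm_le_pi_norm c i)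

theorem abs_refPoly_derivative_eval_le (c : Fin (N + 1) → ℝ) {x : ℝ} (hx : x ∈ Icc (0:ℝ) 1) :
    |(refPoly N c).derivative.eval x| ≤ (N + 1) * (N * ‖c‖) := by
  have e : (refPoly N c).derivative.eval x = ∑ i, c i * (i * x ^ ((i : ℕ) - 1)) := by
    simp [refPoly, Polynomial.eval_finsetSum, Polynomial.derivative_X_pow]
  rw [e]
  refine (Finset.abs_sum_le_sum_abs _ _).trans ?_
  refine (Finset.sum_le_card_nsmul _ _ (N * ‖c‖) fun i _ => ?_).trans (by simp)
  rw [abs_mul, abs_mul, abs_of_nonneg (pow_nonneg hx.1 _), Nat.abs_cast]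
  have h1 : ((i : ℕ) : ℝ) ≤ N := by exact_mod_cast Nat.lt_succ_iff.1 i.2
  have h2 : x ^ ((i : ℕ) - 1) ≤ 1 := pow_le_one₀ hx.1 hx.2
  have h3 : (i : ℝ) * x ^ ((i : ℕ) - 1) ≤ N * 1 :=
    mul_le_mul h1 h2 (pow_nonneg hx.1 _) (Nat.cast_nonneg _)
  rw [mul_one] at h3
  rw [mul_comm]
  exact mul_le_mul h3 (norm_le_pi_norm c i) (abs_nonneg _) (Nat.cast_nonneg _)

theorem refPoly_lipschitz (c : Fin (N + 1) → ℝ) {x y : ℝ} (hx : x ∈ Icc (0:ℝ) 1)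
    (hy : y ∈ Icc (0:ℝ) 1) :
    |(refPoly N c).eval x - (refPoly N c).eval y| ≤ (N + 1) * (N * ‖c‖) * |x - y| := by
  have := (convex_Icc (0:ℝ) 1).norm_image_sub_le_of_norm_hasDerivWithin_le
    (f := fun x => (refPoly N c).eval x) (f' := fun x => (refPoly N c).derivative.eval x)
    (C := (N + 1) * (N * ‖c‖))
    (fun x _ => ((refPoly N c).hasDerivAt x).hasDerivWithinAt)
    (fun x hx => abs_refPoly_derivative_eval_le c hx) hy hx
  simpa only [Real.norm_eq_abs] using this

/-- The defining data of a projection on the reference element: moments, the last of which may be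
replaced by the value at one end point. -/
def refData (N : ℕ) (e : Option Bool) (f : ℝ → ℝ) (j : Fin (N + 1)) : ℝ :=
  if j = Fin.last N then
    e.elim (∫ σ in (0:ℝ)..1, f σ * σ ^ (j : ℕ)) (fun i => f (cond i 1 0))
  else ∫ σ in (0:ℝ)..1, f σ * σ ^ (j : ℕ)

theorem intervalIntegrable_mul_pow {f : ℝ → ℝ} (hf : ContinuousOn f (Icc 0 1)) (j : ℕ) :
    IntervalIntegrable (fun σ => f σ * σ ^ j) volume 0 1 := by
  refine ContinuousOn.intervalIntegrable ?_
  rw [uIcc_of_le zero_le_one]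
  fun_prop

theorem refData_add (e : Option Bool) {f g : ℝ → ℝ} (hf : ContinuousOn f (Icc 0 1))
    (hg : ContinuousOn g (Icc 0 1)) :
    refData N e (fun x => f x + g x) = refData N e f + refData N e g := by
  have hI : ∀ j : ℕ, ∫ σ in (0:ℝ)..1, (f σ + g σ) * σ ^ j
      = (∫ σ in (0:ℝ)..1, f σ * σ ^ j) + ∫ σ in (0:ℝ)..1, g σ * σ ^ j := fun j => by
    rw [← intervalIntegral.integral_add (intervalIntegrable_mul_pow hf j)
      (intervalIntegrable_mul_pow hg j)]
    simp_rw [add_mul]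
  ext j
  simp only [refData, Pi.add_apply]
  split_ifs
  · cases e <;> simp [hI]
  · exact hI _

theorem refData_smul (e : Option Bool) (r : ℝ) (f : ℝ → ℝ) :
    refData N e (fun x => r * f x) = r • refData N e f := by
  have hI : ∀ j : ℕ, ∫ σ in (0:ℝ)..1, (r * f σ) * σ ^ j = r * ∫ σ in (0:ℝ)..1, f σ * σ ^ j :=
    fun j => by
    rw [← intervalIntegral.integral_const_mul]
    simp_rw [mul_assoc]
  ext j
  simp only [refData, Pi.smul_apply, smul_eq_mul]
  split_ifs
  · cases e <;> simp [hI]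
  · exact hI _

theorem abs_refData_le (e : Option Bool) {f : ℝ → ℝ} {M : ℝ} (hM : ∀ x ∈ Icc (0:ℝ) 1, |f x| ≤ M) :
    ‖refData N e f‖ ≤ M := by
  have hM0 : 0 ≤ M := (abs_nonneg _).trans (hM 0 ⟨le_rfl, zero_le_one⟩)
  have hI : ∀ j : ℕ, ‖∫ σ in (0:ℝ)..1, f σ * σ ^ j‖ ≤ M := fun j => by
    have := intervalIntegral.norm_integral_le_of_norm_le_const (a := (0:ℝ)) (b := 1)
      (f := fun σ => f σ * σ ^ j) (C := M) fun σ hσ => by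
        rw [uIoc_of_le zero_le_one] at hσ
        rw [norm_mul, Real.norm_eq_abs, Real.norm_eq_abs, abs_of_nonneg (pow_nonneg hσ.1.le _)]
        exact (mul_le_of_le_one_right (abs_nonneg _) (pow_le_one₀ hσ.1.le hσ.2)).trans
          (hM σ ⟨hσ.1.le, hσ.2⟩)
    simpa using this
  refine (pi_norm_le_iff_of_nonneg hM0).2 fun j => ?_
  simp only [refData]
  split_ifs
  · cases e with
    | none => exact hI _
    | some i => cases i
                · exact hM 0 ⟨le_rfl, zero_le_one⟩
                · exact hM 1 ⟨zero_le_one, le_rfl⟩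
  · exact hI _

/-- The data map on polynomials. -/
def refDataL (N : ℕ) (e : Option Bool) : (Fin (N + 1) → ℝ) →ₗ[ℝ] (Fin (N + 1) → ℝ) where
  toFun c := refData N e fun x => (refPoly N c).eval x
  map_add' c d := by
    rw [← refData_add e (refPoly N c).continuous.continuousOn (refPoly N d).continuous.continuousOn]
    simp
  map_smul' r c := by
    rw [RingHom.id_apply, ← refData_smul]
    simp

theorem integral_mul_refPoly_eq_zero {f : ℝ → ℝ} (hf : ContinuousOn f (Icc 0 1)) {d : ℕ}
    (h : ∀ j < d, ∫ σ in (0:ℝ)..1, f σ * σ ^ j = 0) {p : Polynomial ℝ} (hp : p.degree < d) :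
    ∫ σ in (0:ℝ)..1, f σ * p.eval σ = 0 := by
  have e : ∀ σ, f σ * p.eval σ = ∑ i ∈ Finset.range d, p.coeff i * (f σ * σ ^ i) := by
    intro σ
    rcases eq_or_ne p 0 with rfl | h0
    · simp
    · rw [Polynomial.eval_eq_sum_range' ((Polynomial.natDegree_lt_iff_degree_lt h0).2 hp),
        Finset.mul_sum]
      exact Finset.sum_congr rfl fun i _ => by ring
  simp_rw [e]
  rw [intervalIntegral.integral_finsetSum fun i _ => (intervalIntegrable_mul_pow hf i).const_mul _]
  refine Finset.sum_eq_zero fun i hi => ?_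
  rw [intervalIntegral.integral_const_mul, h i (Finset.mem_range.1 hi), mul_zero]

theorem eq_zero_of_integral_weight {p : Polynomial ℝ} {w : ℝ → ℝ} (hw : Continuous w)
    (hpos : ∀ x ∈ Ioo (0:ℝ) 1, 0 < w x) (h : ∫ σ in (0:ℝ)..1, w σ * p.eval σ ^ 2 = 0) : p = 0 := by
  have hp := p.continuous
  have hnn : ∀ x ∈ Ioc (0:ℝ) 1, 0 ≤ w x := fun x hx => by
    have h1 : (1:ℝ) ∈ closure (Ioo (0:ℝ) 1) := by
      rw [closure_Ioo (by norm_num)]; exact ⟨zero_le_one, le_rfl⟩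
    rcases eq_or_lt_of_le hx.2 with h2 | h2
    · rw [h2]
      exact (isClosed_Ici.preimage hw).closure_subset_iff.2 (fun x hx => (hpos x hx).le) h1
    · exact (hpos x ⟨hx.1, h2⟩).le
  have hzero : ∀ x ∈ Ioo (0:ℝ) 1, p.eval x = 0 := by
    by_contra hne
    push Not at hne
    obtain ⟨x, hx, hpx⟩ := hne
    have := intervalIntegral.integral_pos (a := (0:ℝ)) (b := 1) (f := fun σ => w σ * p.eval σ ^ 2)
      one_pos (by fun_prop) (fun x hx => mul_nonneg (hnn x hx) (sq_nonneg _))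
      ⟨x, Ioo_subset_Icc_self hx, mul_pos (hpos x hx) (by positivity)⟩
    linarith
  refine Polynomial.eq_zero_of_infinite_isRoot p ?_
  exact (Ioo_infinite (zero_lt_one' ℝ)).mono hzero

theorem refDataL_injective (e : Option Bool) : Function.Injective (refDataL N e) := by
  rw [← LinearMap.ker_eq_bot, LinearMap.ker_eq_bot']
  intro c hc
  set p := refPoly N c with hp
  have hdeg : p.degree < (N + 1 : ℕ) :=
    (Polynomial.degree_le_of_natDegree_le (refPoly_natDegree_le c)).trans_lt
      (by exact_mod_cast Nat.lt_succ_self N)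
  have hcont : ContinuousOn (fun x => p.eval x) (Icc 0 1) := p.continuous.continuousOn
  have hlow : ∀ j < N, ∫ σ in (0:ℝ)..1, p.eval σ * σ ^ j = 0 := fun j hj => by
    have := congrFun hc ⟨j, hj.trans (Nat.lt_succ_self N)⟩
    simpa only [refDataL, LinearMap.coe_mk, AddHom.coe_mk, refData, Fin.ext_iff, Fin.val_last,
      hj.ne, if_false, Pi.zero_apply] using this
  have hlast := congrFun hc (Fin.last N)
  simp only [refDataL, LinearMap.coe_mk, AddHom.coe_mk, refData, if_true, Pi.zero_apply] at hlast
  suffices p = 0 by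
    apply refPoly_injective
    rw [map_zero]; exact this
  cases e with
  | none =>
    have hall : ∀ j < N + 1, ∫ σ in (0:ℝ)..1, p.eval σ * σ ^ j = 0 := fun j hj => by
      rcases Nat.lt_succ_iff_lt_or_eq.1 hj with h | rfl
      · exact hlow j h
      · exact hlast
    have := integral_mul_refPoly_eq_zero hcont hall hdeg
    refine eq_zero_of_integral_weight (w := fun _ => 1) continuous_const (fun _ _ => one_pos) ?_
    simpa only [one_mul, sq] using this
  | some i =>
    obtain ⟨r, hr⟩ := Polynomial.dvd_iff_isRoot.2 (show p.IsRoot (cond i 1 0) from hlast)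
    have hrdeg : r.degree < (N : ℕ) := by
      rcases eq_or_ne r 0 with h0 | h0
      · rw [h0, Polynomial.degree_zero]; exact WithBot.bot_lt_coe _
      · have h1 : p.natDegree = 1 + r.natDegree := by
          rw [hr, Polynomial.natDegree_mul (Polynomial.X_sub_C_ne_zero _) h0,
            Polynomial.natDegree_X_sub_C]
        have h2 : p.natDegree ≤ N := refPoly_natDegree_le c
        rw [← Polynomial.natDegree_lt_iff_degree_lt h0]
        omega
    have h0 := integral_mul_refPoly_eq_zero hcont hlow hrdeg
    have hr0 : r = 0 := by
      cases i with
      | false =>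
        refine eq_zero_of_integral_weight (w := fun x => x) continuous_id (fun x hx => hx.1) ?_
        refine Eq.trans ?_ h0
        refine intervalIntegral.integral_congr fun x _ => ?_
        simp only [hr, Polynomial.eval_mul, Polynomial.eval_sub, Polynomial.eval_X,
          Polynomial.eval_C, cond_false]
        ring
      | true =>
        refine eq_zero_of_integral_weight (w := fun x => 1 - x) (by fun_prop)
          (fun x hx => by linarith [hx.2]) ?_
        rw [← neg_eq_zero, ← intervalIntegral.integral_neg]
        refine Eq.trans ?_ h0
        refine intervalIntegral.integral_congr fun x _ => ?_
        simp only [hr, Polynomial.eval_mul, Polynomial.eval_sub, Polynomial.eval_X,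
          Polynomial.eval_C, cond_true]
        ring
    rw [hr, hr0, mul_zero]

/-- The data map as a linear equivalence. -/
def refDataEquiv (N : ℕ) (e : Option Bool) : (Fin (N + 1) → ℝ) ≃ₗ[ℝ] (Fin (N + 1) → ℝ) :=
  LinearEquiv.ofInjectiveEndo _ (refDataL_injective e)

/-- The projection on the reference element. -/
def refProj (N : ℕ) (e : Option Bool) (f : ℝ → ℝ) : Fin (N + 1) → ℝ :=
  (refDataEquiv N e).symm (refData N e f)

theorem refData_refProj (e : Option Bool) (f : ℝ → ℝ) :
    refData N e (fun x => (refPoly N (refProj N e f)).eval x) = refData N e f :=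
  (refDataEquiv N e).apply_symm_apply (refData N e f)

theorem refProj_refPoly (e : Option Bool) (c : Fin (N + 1) → ℝ) :
    refProj N e (fun x => (refPoly N c).eval x) = c :=
  (refDataEquiv N e).symm_apply_apply c

theorem refProj_add (e : Option Bool) {f g : ℝ → ℝ} (hf : ContinuousOn f (Icc 0 1))
    (hg : ContinuousOn g (Icc 0 1)) :
    refProj N e (fun x => f x + g x) = refProj N e f + refProj N e g := by
  simp only [refProj, refData_add e hf hg, map_add]

theorem refProj_smul (e : Option Bool) (r : ℝ) (f : ℝ → ℝ) :
    refProj N e (fun x => r * f x) = r • refProj N e f := by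
  simp only [refProj, refData_smul, map_smul]

theorem refProj_stable (N : ℕ) : ∃ C : ℝ, 0 < C ∧ ∀ (e : Option Bool) (f : ℝ → ℝ) (M : ℝ),
    (∀ x ∈ Icc (0:ℝ) 1, |f x| ≤ M) → ‖refProj N e f‖ ≤ C * M := by
  have h : ∀ e : Option Bool, ∃ C : ℝ, 0 < C ∧ ∀ d, ‖(refDataEquiv N e).symm d‖ ≤ C * ‖d‖ := fun e => by
    obtain ⟨C, hC, h⟩ := ((refDataEquiv N e).symm.toLinearMap.toContinuousLinearMap).isBoundedLinearMap.bound
    exact ⟨C, hC, h⟩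
  choose C hC h using h
  refine ⟨∑ e, C e, Finset.sum_pos (fun e _ => hC e) Finset.univ_nonempty, fun e f M hM => ?_⟩
  have hM0 : 0 ≤ M := (abs_nonneg _).trans (hM 0 ⟨le_rfl, zero_le_one⟩)
  refine (h e _).trans (mul_le_mul ?_ (abs_refData_le e hM) (norm_nonneg _)
    (Finset.sum_nonneg fun e _ => (hC e).le))
  exact Finset.single_le_sum (f := C) (fun e _ => (hC e).le) (Finset.mem_univ e)

theorem refProj_orthogonal (e : Option Bool) {f : ℝ → ℝ} (hf : ContinuousOn f (Icc 0 1))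
    {p : Polynomial ℝ} (hp : p.degree < N ∨ e = none ∧ p.degree < (N + 1 : ℕ)) :
    ∫ σ in (0:ℝ)..1, ((refPoly N (refProj N e f)).eval σ - f σ) * p.eval σ = 0 := by
  set q := refPoly N (refProj N e f) with hq
  have h := refData_refProj (N := N) e f
  have hc : ContinuousOn (fun σ => q.eval σ - f σ) (Icc 0 1) := q.continuous.continuousOn.sub hf
  have hmom : ∀ j : Fin (N + 1), (j ≠ Fin.last N ∨ e = none) →
      ∫ σ in (0:ℝ)..1, (q.eval σ - f σ) * σ ^ (j : ℕ) = 0 := by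
    intro j hj
    simp_rw [sub_mul]
    rw [intervalIntegral.integral_sub (intervalIntegrable_mul_pow q.continuous.continuousOn _)
      (intervalIntegrable_mul_pow hf _), sub_eq_zero]
    have := congrFun h j
    simp only [refData] at this
    rcases eq_or_ne j (Fin.last N) with hl | hl
    · have he : e = none := by
        rcases hj with hj | hj
        · exact absurd hl hj
        · exact hj
      subst he
      simpa only [ite_self, Option.elim_none] using this
    · rwa [if_neg hl, if_neg hl] at this
  rcases hp with hp | ⟨he, hp⟩
  · refine integral_mul_refPoly_eq_zero hc (fun j hj => ?_) hp
    refine hmom ⟨j, hj.trans (Nat.lt_succ_self N)⟩ (Or.inl ?_)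
    simp only [ne_eq, Fin.ext_iff, Fin.val_last]; omega
  · refine integral_mul_refPoly_eq_zero hc (fun j hj => ?_) hp
    exact hmom ⟨j, hj⟩ (Or.inr he)

theorem refProj_endpoint (i : Bool) (f : ℝ → ℝ) :
    (refPoly N (refProj N (some i) f)).eval (cond i 1 0) = f (cond i 1 0) := by
  have := congrFun (refData_refProj (N := N) (some i) f) (Fin.last N)
  simpa only [refData, if_true, Option.elim_some] using this

theorem norm_sq_le_integral_refPoly (N : ℕ) : ∃ C : ℝ, 0 < C ∧ ∀ c : Fin (N + 1) → ℝ,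
    ‖c‖ ^ 2 ≤ C * ∫ σ in (0:ℝ)..1, (refPoly N c).eval σ ^ 2 := by
  obtain ⟨C, hC, h⟩ :=
    ((refDataEquiv N none).symm.toLinearMap.toContinuousLinearMap).isBoundedLinearMap.bound
  refine ⟨C ^ 2, by positivity, fun c => ?_⟩
  set I := ∫ σ in (0:ℝ)..1, (refPoly N c).eval σ ^ 2 with hI
  have hI0 : 0 ≤ I := intervalIntegral.integral_nonneg zero_le_one fun x _ => sq_nonneg _
  have hd : ‖refDataL N none c‖ ≤ √I := by
    refine (pi_norm_le_iff_of_nonneg (Real.sqrt_nonneg _)).2 fun j => ?_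
    have e : refDataL N none c j = ∫ σ in (0:ℝ)..1, (refPoly N c).eval σ * σ ^ (j : ℕ) := by
      simp [refDataL, refData]
    rw [e]
    refine Real.abs_le_sqrt ?_
    have hp := (refPoly N c).continuous
    have key := sq_integral_mul_le (ν := volume.restrict (Ioc (0:ℝ) 1))
      (f := fun σ => (refPoly N c).eval σ) (g := fun σ => σ ^ (j : ℕ))
      ((hp.pow 2).integrableOn_Ioc) ((continuous_pow _ |>.pow 2).integrableOn_Ioc)
      ((hp.mul (continuous_pow _)).integrableOn_Ioc)
    rw [intervalIntegral.integral_of_le zero_le_one]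
    refine key.trans ?_
    rw [hI, intervalIntegral.integral_of_le zero_le_one]
    refine mul_le_of_le_one_right (integral_nonneg fun x => sq_nonneg _) ?_
    rw [← intervalIntegral.integral_of_le zero_le_one]
    have : ∫ σ in (0:ℝ)..1, (σ ^ (j : ℕ)) ^ 2 = ∫ σ in (0:ℝ)..1, σ ^ ((j : ℕ) * 2) := by
      simp_rw [← pow_mul]
    rw [this, integral_pow]
    simp only [one_pow]
    rw [zero_pow (by omega), sub_zero]
    exact div_le_one_of_le₀ (by
      have : (0:ℝ) ≤ (((j : ℕ) * 2 : ℕ) : ℝ) := Nat.cast_nonneg _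
      linarith) (by positivity)
  have h2 := h (refDataL N none c)
  have e2 : ((refDataEquiv N none).symm.toLinearMap.toContinuousLinearMap) (refDataL N none c) = c :=
    (refDataEquiv N none).symm_apply_apply c
  rw [e2] at h2
  calc ‖c‖ ^ 2 ≤ (C * √I) ^ 2 :=
        pow_le_pow_left₀ (norm_nonneg _) (h2.trans (mul_le_mul_of_nonneg_left hd hC.le)) 2
    _ = C ^ 2 * I := by rw [mul_pow, Real.sq_sqrt hI0]

end

section

/-- Local coefficients of the piecewise polynomials of degree at most `N` on `K` elements. -/
abbrev Coeff (K N : ℕ) : Type := Fin K → Fin (N + 1) → ℝ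

open Polynomial in
theorem exists_antiderivative (q : Polynomial ℝ) :
    ∃ p : Polynomial ℝ, p.derivative = q ∧ p.natDegree ≤ q.natDegree + 1 := by
  refine ⟨∑ i ∈ Finset.range (q.natDegree + 1), C (q.coeff i / (i + 1)) * X ^ (i + 1), ?_, ?_⟩
  · conv_rhs => rw [q.as_sum_range_C_mul_X_pow]
    rw [derivative_sum]
    refine Finset.sum_congr rfl fun i _ => ?_
    rw [derivative_C_mul_X_pow]
    simp only [Nat.cast_add, Nat.cast_one, Nat.add_sub_cancel]
    have : (i : ℝ) + 1 ≠ 0 := by positivity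
    rw [div_mul_cancel₀ _ this]
  · refine natDegree_sum_le_of_forall_le _ _ fun i hi => ?_
    exact (natDegree_C_mul_X_pow_le _ _).trans (by have := Finset.mem_range.1 hi; omega)

/-- `f` is a chain of `n` successive derivatives on `[l, r]`. -/
def DerivChain (n : ℕ) (l r : ℝ) (f : ℕ → ℝ → ℝ) : Prop :=
  ∀ j < n, ∀ x ∈ Icc l r, HasDerivWithinAt (f j) (f (j + 1) x) (Icc l r) x

theorem DerivChain.mono {n n' : ℕ} {l r l' r' : ℝ} {f : ℕ → ℝ → ℝ} (h : DerivChain n l r f)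
    (hn : n' ≤ n) (hs : Icc l' r' ⊆ Icc l r) : DerivChain n' l' r' f :=
  fun j hj x hx => (h j (hj.trans_le hn) x (hs hx)).mono hs

theorem DerivChain.shift {n : ℕ} {l r : ℝ} {f : ℕ → ℝ → ℝ} (h : DerivChain (n + 1) l r f) :
    DerivChain n l r fun j => f (j + 1) :=
  fun j hj x hx => h (j + 1) (Nat.succ_lt_succ hj) x hx

theorem DerivChain.continuousOn {n : ℕ} {l r : ℝ} {f : ℕ → ℝ → ℝ} (h : DerivChain n l r f) {j : ℕ}
    (hj : j < n) : ContinuousOn (f j) (Icc l r) :=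
  fun x hx => (h j hj x hx).continuousWithinAt

theorem exists_taylor_step {l r R : ℝ} (hlr : l ≤ r) {f f' : ℝ → ℝ}
    (hf : ∀ x ∈ Icc l r, HasDerivWithinAt f (f' x) (Icc l r) x) (T' : Polynomial ℝ)
    (hT' : ∀ x ∈ Icc l r, |f' x - T'.eval x| ≤ R) :
    ∃ T : Polynomial ℝ, T.natDegree ≤ T'.natDegree + 1 ∧
      (∀ x ∈ Icc l r, ∀ y ∈ Icc l r, |(f x - T.eval x) - (f y - T.eval y)| ≤ R * |x - y|) ∧
      ∀ x ∈ Icc l r, |f x - T.eval x| ≤ R * (r - l) := by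
  obtain ⟨p, hp, hpd⟩ := exists_antiderivative T'
  set T := p + Polynomial.C (f l - p.eval l) with hT
  have hlip : ∀ x ∈ Icc l r, ∀ y ∈ Icc l r,
      |(f x - T.eval x) - (f y - T.eval y)| ≤ R * |x - y| := by
    intro x hx y hy
    have := (convex_Icc l r).norm_image_sub_le_of_norm_hasDerivWithin_le
      (f := fun x => f x - T.eval x) (f' := fun x => f' x - T'.eval x) (C := R)
      (fun x hx => (hf x hx).sub (by
        have h1 := (T.hasDerivAt x).hasDerivWithinAt (s := Icc l r)
        rwa [hT, Polynomial.derivative_add, Polynomial.derivative_C, add_zero, hp, ← hT] at h1))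
      (fun x hx => hT' x hx) hy hx
    simpa only [Real.norm_eq_abs] using this
  refine ⟨T, ?_, hlip, fun x hx => ?_⟩
  · rw [hT]
    refine (Polynomial.natDegree_add_le _ _).trans (max_le hpd ?_)
    rw [Polynomial.natDegree_C]; omega
  · have h1 := hlip x hx l ⟨le_rfl, hlr⟩
    have h2 : f l - T.eval l = 0 := by
      rw [hT, Polynomial.eval_add, Polynomial.eval_C]; ring
    rw [h2, sub_zero, abs_of_nonneg (sub_nonneg.2 hx.1)] at h1
    have hR : 0 ≤ R := (abs_nonneg _).trans (hT' x hx)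
    exact h1.trans (mul_le_mul_of_nonneg_left (by linarith [hx.2]) hR)

theorem exists_taylor (n : ℕ) {l r R : ℝ} (hlr : l ≤ r) {f : ℕ → ℝ → ℝ}
    (hf : DerivChain (n + 1) l r f) (hR : ∀ x ∈ Icc l r, |f (n + 1) x| ≤ R) :
    ∃ T : Polynomial ℝ, T.natDegree ≤ n ∧
      (∀ x ∈ Icc l r, ∀ y ∈ Icc l r,
        |(f 0 x - T.eval x) - (f 0 y - T.eval y)| ≤ R * (r - l) ^ n * |x - y|) ∧
      ∀ x ∈ Icc l r, |f 0 x - T.eval x| ≤ R * (r - l) ^ (n + 1) := by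
  induction n generalizing f with
  | zero =>
    have h0 : ∀ x ∈ Icc l r, |f 1 x - (0 : Polynomial ℝ).eval x| ≤ R := fun x hx => by
      simpa using hR x hx
    obtain ⟨p, hp⟩ : ∃ p : Polynomial ℝ, p = Polynomial.C (f 0 l) := ⟨_, rfl⟩
    have hlip : ∀ x ∈ Icc l r, ∀ y ∈ Icc l r, |f 0 x - f 0 y| ≤ R * |x - y| := fun x hx y hy => by
      have := (convex_Icc l r).norm_image_sub_le_of_norm_hasDerivWithin_le
        (fun x hx => hf 0 one_pos x hx) (fun x hx => hR x hx) hy hx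
      simpa only [Real.norm_eq_abs] using this
    refine ⟨p, by rw [hp, Polynomial.natDegree_C], fun x hx y hy => ?_, fun x hx => ?_⟩
    · rw [hp, Polynomial.eval_C, Polynomial.eval_C, sub_sub_sub_cancel_right, pow_zero, mul_one]
      exact hlip x hx y hy
    · rw [hp, Polynomial.eval_C, zero_add, pow_one]
      have hR0 : 0 ≤ R := (abs_nonneg _).trans (hR x hx)
      refine (hlip x hx l ⟨le_rfl, hlr⟩).trans ?_
      rw [abs_of_nonneg (sub_nonneg.2 hx.1)]
      exact mul_le_mul_of_nonneg_left (by linarith [hx.2]) hR0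
  | succ n ih =>
    obtain ⟨T', hd, -, hT'⟩ := ih hf.shift hR
    obtain ⟨T, hTd, h1, h2⟩ := exists_taylor_step hlr (fun x hx => hf 0 (Nat.succ_pos _) x hx) T' hT'
    refine ⟨T, hTd.trans (by omega), h1, fun x hx => (h2 x hx).trans (le_of_eq ?_)⟩
    rw [pow_succ _ (n + 1)]; ring

variable {a b : ℝ} {K N : ℕ} (m : Mesh a b K)

open Polynomial in
/-- The piecewise polynomial with given coefficients with respect to the local coordinates. -/
def pw : Coeff K N →ₗ[ℝ] PWPoly K where
  toFun c k := (refPoly N (c k)).comp (C (m.hi k - m.lo k)⁻¹ * (X - C (m.lo k)))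
  map_add' c d := by
    funext k
    simp only [Pi.add_apply, map_add, add_comp]
  map_smul' r c := by
    funext k
    simp only [Pi.smul_apply, map_smul, smul_comp, RingHom.id_apply]

theorem pw_eval (c : Coeff K N) (k : Fin K) (x : ℝ) :
    (pw m c k).eval x = (refPoly N (c k)).eval ((x - m.lo k) / (m.hi k - m.lo k)) := by
  simp only [pw, LinearMap.coe_mk, AddHom.coe_mk, Polynomial.eval_comp, Polynomial.eval_mul,
    Polynomial.eval_C, Polynomial.eval_sub, Polynomial.eval_X]
  rw [inv_mul_eq_div]

theorem pw_natDegree_le (c : Coeff K N) : (pw m c).DegLE N := fun k => by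
  refine (Polynomial.natDegree_comp_le).trans ?_
  have h1 : (Polynomial.C (m.hi k - m.lo k)⁻¹ * (Polynomial.X - Polynomial.C (m.lo k))).natDegree ≤ 1 := by
    refine (Polynomial.natDegree_C_mul_le _ _).trans (Polynomial.natDegree_X_sub_C_le _)
  exact (Nat.mul_le_mul (refPoly_natDegree_le (c k)) h1).trans (by omega)

theorem exists_pw_cell {p : Polynomial ℝ} (hp : p.natDegree ≤ N) (k : Fin K) :
    ∃ c : Fin (N + 1) → ℝ, (∀ σ, (refPoly N c).eval σ
      = p.eval (m.lo k + (m.hi k - m.lo k) * σ)) ∧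
      (refPoly N c).comp (Polynomial.C (m.hi k - m.lo k)⁻¹ *
        (Polynomial.X - Polynomial.C (m.lo k))) = p := by
  set q := p.comp (Polynomial.C (m.lo k) + Polynomial.C (m.hi k - m.lo k) * Polynomial.X) with hq
  have hqd : q.natDegree ≤ N := by
    refine (Polynomial.natDegree_comp_le).trans ?_
    have h1 : (Polynomial.C (m.lo k) + Polynomial.C (m.hi k - m.lo k) * Polynomial.X).natDegree ≤ 1 :=
      (Polynomial.natDegree_add_le _ _).trans (max_le (by simp)
        ((Polynomial.natDegree_C_mul_le _ _).trans Polynomial.natDegree_X_le))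
    exact (Nat.mul_le_mul hp h1).trans (by omega)
  refine ⟨fun i => q.coeff i, fun σ => ?_, ?_⟩
  · rw [refPoly_coeffs hqd, hq]; simp
  · rw [refPoly_coeffs hqd, hq]
    have hh : m.hi k - m.lo k ≠ 0 := (m.len_pos k).ne'
    refine Polynomial.funext fun x => ?_
    simp only [Polynomial.eval_comp, Polynomial.eval_add, Polynomial.eval_C, Polynomial.eval_mul,
      Polynomial.eval_X, Polynomial.eval_sub]
    congr 1; field_simp; ring

theorem exists_pw {v : PWPoly K} (hv : v.DegLE N) : ∃ c : Coeff K N, pw m c = v := by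
  choose c hc using fun k => (exists_pw_cell m (hv k) k)
  exact ⟨c, funext fun k => (hc k).2⟩

theorem local_coord_mem {k : Fin K} {x : ℝ} (hx : x ∈ Icc (m.lo k) (m.hi k)) :
    (x - m.lo k) / (m.hi k - m.lo k) ∈ Icc (0:ℝ) 1 := by
  have hh := m.len_pos k
  exact ⟨div_nonneg (by linarith [hx.1]) hh.le, (div_le_one hh).2 (by linarith [hx.2])⟩

theorem local_point_mem {k : Fin K} {σ : ℝ} (hσ : σ ∈ Icc (0:ℝ) 1) :
    m.lo k + (m.hi k - m.lo k) * σ ∈ Icc (m.lo k) (m.hi k) := by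
  have hh := m.len_pos k
  exact ⟨by nlinarith [hσ.1], by nlinarith [hσ.2]⟩

theorem abs_pw_eval_le (c : Coeff K N) {k : Fin K} {x : ℝ}
    (hx : x ∈ Icc (m.lo k) (m.hi k)) : |(pw m c k).eval x| ≤ (N + 1) * ‖c k‖ := by
  rw [pw_eval]
  exact abs_refPoly_eval_le _ (local_coord_mem m hx)

theorem pw_lipschitz (c : Coeff K N) {k : Fin K} {x y : ℝ}
    (hx : x ∈ Icc (m.lo k) (m.hi k)) (hy : y ∈ Icc (m.lo k) (m.hi k)) :
    |(pw m c k).eval x - (pw m c k).eval y|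
      ≤ (N + 1) * (N * ‖c k‖) / (m.hi k - m.lo k) * |x - y| := by
  have hh := m.len_pos k
  rw [pw_eval, pw_eval]
  refine (refPoly_lipschitz _ (local_coord_mem m hx) (local_coord_mem m hy)).trans (le_of_eq ?_)
  rw [← sub_div, sub_sub_sub_cancel_right, abs_div, abs_of_pos hh]
  ring

theorem abs_sub_le_sqrt_mul {l r x y : ℝ} (hx : x ∈ Icc l r) (hy : y ∈ Icc l r) :
    |x - y| ≤ √(r - l) * √|x - y| := by
  nth_rewrite 1 [← Real.mul_self_sqrt (abs_nonneg (x - y))]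
  refine mul_le_mul_of_nonneg_right (Real.sqrt_le_sqrt ?_) (Real.sqrt_nonneg _)
  rw [abs_le]
  constructor <;> linarith [hx.1, hx.2, hy.1, hy.2]

theorem pw_holder (c : Coeff K N) {k : Fin K} {x y : ℝ}
    (hx : x ∈ Icc (m.lo k) (m.hi k)) (hy : y ∈ Icc (m.lo k) (m.hi k)) :
    |(pw m c k).eval x - (pw m c k).eval y|
      ≤ (N + 1) * (N * ‖c k‖) / √(m.hi k - m.lo k) * √|x - y| := by
  have hh := m.len_pos k
  refine (pw_lipschitz m c hx hy).trans ?_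
  refine (mul_le_mul_of_nonneg_left (abs_sub_le_sqrt_mul hx hy) (by positivity)).trans (le_of_eq ?_)
  have hs := Real.sqrt_pos.2 hh
  nth_rewrite 1 [← Real.mul_self_sqrt hh.le]
  field_simp

theorem integral_cell (f : ℝ → ℝ) (k : Fin K) :
    ∫ x in (m.lo k)..(m.hi k), f x
      = (m.hi k - m.lo k) * ∫ σ in (0:ℝ)..1, f (m.lo k + (m.hi k - m.lo k) * σ) := by
  have hh : m.hi k - m.lo k ≠ 0 := (m.len_pos k).ne'
  rw [intervalIntegral.mul_integral_comp_add_mul]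
  simp

theorem pw_eval_local (c : Coeff K N) (k : Fin K) (σ : ℝ) :
    (pw m c k).eval (m.lo k + (m.hi k - m.lo k) * σ) = (refPoly N (c k)).eval σ := by
  have hh : m.hi k - m.lo k ≠ 0 := (m.len_pos k).ne'
  rw [pw_eval]
  congr 1; field_simp; ring

theorem norm_sq_le_integral_pw (N : ℕ) : ∃ C : ℝ, 0 < C ∧ ∀ {a b : ℝ} {K : ℕ} (m : Mesh a b K)
    (c : Coeff K N) (k : Fin K),
    (m.hi k - m.lo k) * ‖c k‖ ^ 2 ≤ C * ∫ x in (m.lo k)..(m.hi k), (pw m c k).eval x ^ 2 := by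
  obtain ⟨C, hC, h⟩ := norm_sq_le_integral_refPoly N
  refine ⟨C, hC, fun m c k => ?_⟩
  have hh := m.len_pos k
  rw [integral_cell]
  simp_rw [pw_eval_local]
  have := mul_le_mul_of_nonneg_left (h (c k)) hh.le
  linarith

/-- The projections onto piecewise polynomials. -/
def proj (N : ℕ) (e : Option Bool) (f : ℝ → ℝ) : Coeff K N :=
  fun k => refProj N e fun σ => f (m.lo k + (m.hi k - m.lo k) * σ)

variable {m}

theorem continuousOn_local {f : ℝ → ℝ} {k : Fin K} (hf : ContinuousOn f (Icc (m.lo k) (m.hi k))) :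
    ContinuousOn (fun σ => f (m.lo k + (m.hi k - m.lo k) * σ)) (Icc 0 1) :=
  hf.comp (by fun_prop) fun _ hσ => local_point_mem m hσ

theorem cell_subset (k : Fin K) : Icc (m.lo k) (m.hi k) ⊆ Icc a b :=
  Icc_subset_Icc (m.le_lo k) (m.hi_le k)

theorem proj_add (e : Option Bool) {f g : ℝ → ℝ} (hf : ContinuousOn f (Icc a b))
    (hg : ContinuousOn g (Icc a b)) :
    proj m N e (fun x => f x + g x) = proj m N e f + proj m N e g := by
  funext k
  exact refProj_add e (continuousOn_local (hf.mono (cell_subset k)))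
    (continuousOn_local (hg.mono (cell_subset k)))

theorem proj_smul (e : Option Bool) (r : ℝ) (f : ℝ → ℝ) :
    proj m N e (fun x => r * f x) = r • proj m N e f := by
  funext k
  exact refProj_smul e r _

theorem proj_orthogonal (e : Option Bool) {f : ℝ → ℝ} {k : Fin K}
    (hf : ContinuousOn f (Icc (m.lo k) (m.hi k)))
    {p : Polynomial ℝ} (hp : p.degree < N ∨ e = none ∧ p.natDegree ≤ N) :
    ∫ x in (m.lo k)..(m.hi k), ((pw m (proj m N e f) k).eval x - f x) * p.eval x = 0 := by
  rw [integral_cell]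
  have hh : m.hi k - m.lo k ≠ 0 := (m.len_pos k).ne'
  set L := Polynomial.C (m.lo k) + Polynomial.C (m.hi k - m.lo k) * Polynomial.X with hL
  have hLd : L.natDegree = 1 := by
    rw [hL, add_comm]
    exact Polynomial.natDegree_linear hh
  have hpd : (p.comp L).natDegree = p.natDegree := by
    rw [Polynomial.natDegree_comp, hLd, mul_one]
  have hq : (p.comp L).degree < N ∨ e = none ∧ (p.comp L).degree < (N + 1 : ℕ) := by
    rcases hp with hp | ⟨he, hp⟩
    · left
      rcases eq_or_ne p 0 with h0 | h0
      · rw [h0, Polynomial.zero_comp, Polynomial.degree_zero]; exact WithBot.bot_lt_coe _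
      · have := (Polynomial.natDegree_lt_iff_degree_lt h0).2 hp
        refine (Polynomial.degree_le_natDegree).trans_lt ?_
        rw [hpd]; exact_mod_cast this
    · right
      refine ⟨he, (Polynomial.degree_le_natDegree).trans_lt ?_⟩
      rw [hpd]; exact_mod_cast Nat.lt_succ_of_le hp
  have := refProj_orthogonal (N := N) e (continuousOn_local hf) hq
  simp_rw [pw_eval_local]
  have e2 : ∀ σ, (p.comp L).eval σ = p.eval (m.lo k + (m.hi k - m.lo k) * σ) := fun σ => by
    rw [hL]; simp
  simp_rw [e2] at this
  unfold proj
  rw [this, mul_zero]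

theorem proj_hi (f : ℝ → ℝ) (k : Fin K) :
    (pw m (proj m N (some true) f) k).eval (m.hi k) = f (m.hi k) := by
  have h := refProj_endpoint (N := N) true fun σ => f (m.lo k + (m.hi k - m.lo k) * σ)
  simp only [cond_true, mul_one, add_sub_cancel] at h
  have h2 := pw_eval_local m (proj m N (some true) f) k 1
  rw [mul_one, add_sub_cancel] at h2
  rw [h2]
  exact h

theorem proj_lo (f : ℝ → ℝ) (k : Fin K) :
    (pw m (proj m N (some false) f) k).eval (m.lo k) = f (m.lo k) := by
  have h := refProj_endpoint (N := N) false fun σ => f (m.lo k + (m.hi k - m.lo k) * σ)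
  simp only [cond_false, mul_zero, add_zero] at h
  have h2 := pw_eval_local m (proj m N (some false) f) k 0
  rw [mul_zero, add_zero] at h2
  rw [h2]
  exact h

theorem proj_stable (N : ℕ) : ∃ C : ℝ, 0 < C ∧ ∀ {a b : ℝ} {K : ℕ} (m : Mesh a b K) (e : Option Bool)
    (f : ℝ → ℝ) (k : Fin K) (M : ℝ), (∀ x ∈ Icc (m.lo k) (m.hi k), |f x| ≤ M) →
    ‖proj m N e f k‖ ≤ C * M := by
  obtain ⟨C, hC, h⟩ := refProj_stable N
  exact ⟨C, hC, fun m e f k M hM => h e _ M fun σ hσ => hM _ (local_point_mem m hσ)⟩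

theorem proj_error (N : ℕ) : ∃ C : ℝ, 0 < C ∧ ∀ {a b : ℝ} {K : ℕ} (m : Mesh a b K) (e : Option Bool)
    (f : ℝ → ℝ) (k : Fin K) (T : Polynomial ℝ) (δ H : ℝ), T.natDegree ≤ N →
    ContinuousOn f (Icc (m.lo k) (m.hi k)) →
    (∀ x ∈ Icc (m.lo k) (m.hi k), |f x - T.eval x| ≤ δ) →
    (∀ x ∈ Icc (m.lo k) (m.hi k), ∀ y ∈ Icc (m.lo k) (m.hi k),
      |(f x - T.eval x) - (f y - T.eval y)| ≤ H * √|x - y|) →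
    (∀ x ∈ Icc (m.lo k) (m.hi k), |(pw m (proj m N e f) k).eval x - f x| ≤ C * δ) ∧
    ∀ x ∈ Icc (m.lo k) (m.hi k), ∀ y ∈ Icc (m.lo k) (m.hi k),
      |((pw m (proj m N e f) k).eval x - f x) - ((pw m (proj m N e f) k).eval y - f y)|
        ≤ (C * (δ / √(m.hi k - m.lo k)) + H) * √|x - y| := by
  obtain ⟨C, hC, hst⟩ := proj_stable N
  refine ⟨(N + 1) * C + (N + 1) * (N * C) + 1, by positivity, ?_⟩
  intro a b K m e f k T δ H hT hf h1 h2
  have hδ : 0 ≤ δ := (abs_nonneg _).trans (h1 _ ⟨le_rfl, (m.lo_lt_hi k).le⟩)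
  have hh := m.len_pos k
  obtain ⟨cT, hcT, hcT2⟩ := exists_pw_cell m hT k
  set g : ℝ → ℝ := fun x => f x - T.eval x with hg
  have hgc : ContinuousOn g (Icc (m.lo k) (m.hi k)) := hf.sub T.continuous.continuousOn
  have hpf : proj m N e f k = proj m N e g k + cT := by
    have e1 : proj m N e f k = refProj N e fun σ => g (m.lo k + (m.hi k - m.lo k) * σ)
        + (refPoly N cT).eval σ := by
      unfold proj
      congr 1; ext σ
      simp only [hg, hcT]; ring
    rw [e1, refProj_add e (continuousOn_local hgc) (refPoly N cT).continuous.continuousOn,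
      refProj_refPoly]
    rfl
  have hev : ∀ x, (pw m (proj m N e f) k).eval x = (pw m (proj m N e g) k).eval x + T.eval x := by
    intro x
    have : pw m (proj m N e f) k = pw m (proj m N e g) k + T := by
      simp only [pw, LinearMap.coe_mk, AddHom.coe_mk, hpf, map_add, Polynomial.add_comp, hcT2]
    rw [this, Polynomial.eval_add]
  have hE : ∀ x, (pw m (proj m N e f) k).eval x - f x = (pw m (proj m N e g) k).eval x - g x := by
    intro x
    rw [hev, hg]; ring
  have hn := hst m e g k δ h1
  refine ⟨fun x hx => ?_, fun x hx y hy => ?_⟩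
  · rw [hE]
    refine (abs_sub _ _).trans ?_
    have h3 := (abs_pw_eval_le m (proj m N e g) hx).trans
      (mul_le_mul_of_nonneg_left hn (by positivity))
    have h4 : 0 ≤ (N + 1) * (N * C) * δ := by positivity
    have := h1 x hx
    nlinarith
  · rw [hE, hE]
    have h3 := pw_holder m (proj m N e g) hx hy
    have h4 := h2 x hx y hy
    have e2 : (pw m (proj m N e g) k).eval x - g x - ((pw m (proj m N e g) k).eval y - g y)
        = ((pw m (proj m N e g) k).eval x - (pw m (proj m N e g) k).eval y) - (g x - g y) := by ring
    rw [e2]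
    refine (abs_sub _ _).trans ((add_le_add h3 h4).trans ?_)
    rw [← add_mul]
    refine mul_le_mul_of_nonneg_right (add_le_add ?_ le_rfl) (Real.sqrt_nonneg _)
    rw [← mul_div_assoc]
    refine div_le_div_of_nonneg_right ?_ (Real.sqrt_nonneg _)
    have h5 : (N + 1) * (N * ‖proj m N e g k‖) ≤ ((N:ℝ) + 1) * (N * (C * δ)) := by gcongr
    have h6 : 0 ≤ ((N:ℝ) + 1) * C * δ := by positivity
    nlinarith

theorem proj_error_smooth (N : ℕ) : ∃ C : ℝ, 0 < C ∧ ∀ {a b : ℝ} {K : ℕ} (m : Mesh a b K)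
    (e : Option Bool) (f : ℕ → ℝ → ℝ) (R : ℝ), DerivChain (N + 1) a b f →
    (∀ x ∈ Icc a b, |f (N + 1) x| ≤ R) → ∀ k,
    (∀ x ∈ Icc (m.lo k) (m.hi k), |(pw m (proj m N e (f 0)) k).eval x - f 0 x|
      ≤ C * R * (m.hi k - m.lo k) ^ (N + 1)) ∧
    ∀ x ∈ Icc (m.lo k) (m.hi k), ∀ y ∈ Icc (m.lo k) (m.hi k),
      |((pw m (proj m N e (f 0)) k).eval x - f 0 x) - ((pw m (proj m N e (f 0)) k).eval y - f 0 y)|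
        ≤ C * R * ((m.hi k - m.lo k) ^ N * √(m.hi k - m.lo k)) * √|x - y| := by
  obtain ⟨C, hC, h⟩ := proj_error N
  refine ⟨C + 1, by positivity, fun m e f R hf hR k => ?_⟩
  have hh := m.len_pos k
  have hsub := cell_subset (m := m) k
  obtain ⟨T, hTd, hT1, hT2⟩ := exists_taylor N (m.lo_lt_hi k).le (hf.mono le_rfl hsub)
    fun x hx => hR x (hsub hx)
  have hR0 : 0 ≤ R := (abs_nonneg _).trans (hR _ (hsub ⟨le_rfl, (m.lo_lt_hi k).le⟩))
  set d := m.hi k - m.lo k with hd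
  have hs := Real.sqrt_pos.2 hh
  have hss := Real.mul_self_sqrt hh.le
  obtain ⟨h1, h2⟩ := h m e (f 0) k T (R * d ^ (N + 1)) (R * d ^ N * √d) hTd
    ((hf.continuousOn (Nat.succ_pos N)).mono hsub) hT2 (fun x hx y hy => by
      refine (hT1 x hx y hy).trans ?_
      refine (mul_le_mul_of_nonneg_left (abs_sub_le_sqrt_mul hx hy) (by positivity)).trans (le_of_eq ?_)
      ring)
  refine ⟨fun x hx => (h1 x hx).trans ?_, fun x hx y hy => (h2 x hx y hy).trans (le_of_eq ?_)⟩
  · have : 0 ≤ R * d ^ (N + 1) := by positivity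
    nlinarith
  · congr 1
    have : R * d ^ (N + 1) / √d = R * (d ^ N * √d) := by
      rw [div_eq_iff hs.ne', pow_succ]
      linear_combination (-(R * d ^ N)) * hss
    rw [this]; ring

theorem abs_proj_sub_le (N : ℕ) : ∃ C : ℝ, 0 < C ∧ ∀ {a b : ℝ} {K : ℕ} (m : Mesh a b K)
    (e : Option Bool) (f : ℕ → ℝ → ℝ) (R : ℝ), DerivChain (N + 1) a b f →
    (∀ x ∈ Icc a b, |f (N + 1) x| ≤ R) → ∀ k, ∀ x ∈ Icc (m.lo k) (m.hi k),
      |(pw m (proj m N e (f 0)) k).eval x - f 0 x| ≤ C * (R * m.size ^ (N + 1)) := by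
  obtain ⟨C, hC, h⟩ := proj_error_smooth N
  refine ⟨C, hC, fun m e f R hf hR k x hx => ((h m e f R hf hR k).1 x hx).trans ?_⟩
  have hR0 : 0 ≤ R := (abs_nonneg _).trans (hR x (cell_subset k hx))
  rw [mul_assoc]
  gcongr
  exacts [(m.len_pos k).le, m.len_le_size k]

end

section

variable {a b : ℝ} {K : ℕ}

/-- `s` is the discrete derivative of `q` with the numerical traces `q⁻`. -/
def IsDerivMinus (m : Mesh a b K) (N : ℕ) (q s : PWPoly K) : Prop :=
  ∀ k, ∀ φ : Polynomial ℝ, φ.natDegree ≤ N →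
    m.inner k (fun x => (s k).eval x) (fun x => φ.eval x)
      = - m.inner k (fun x => (q k).eval x) (fun x => φ.derivative.eval x)
        + m.bdry k (m.traceMinus q) φ

/-- `r` is the discrete derivative of `s` with the numerical traces `s⁺`. -/
def IsDerivPlus (m : Mesh a b K) (N : ℕ) (s r : PWPoly K) : Prop :=
  ∀ k, ∀ φ : Polynomial ℝ, φ.natDegree ≤ N →
    m.inner k (fun x => (r k).eval x) (fun x => φ.eval x)
      = - m.inner k (fun x => (s k).eval x) (fun x => φ.derivative.eval x)
        + m.bdry k (m.tracePlus s) φ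

variable {m : Mesh a b K} {N : ℕ}

theorem traceMinus_sub (u v : PWPoly K) (j : Fin (K + 1)) :
    m.traceMinus (u - v) j = m.traceMinus u j - m.traceMinus v j := by
  refine Fin.cases ?_ (fun k => ?_) j
  · simp [Mesh.traceMinus]
  · simp [Mesh.traceMinus]

theorem tracePlus_sub (u v : PWPoly K) (j : Fin (K + 1)) :
    m.tracePlus (u - v) j = m.tracePlus u j - m.tracePlus v j := by
  refine Fin.lastCases ?_ (fun k => ?_) j
  · simp [Mesh.tracePlus]
  · simp [Mesh.tracePlus]

theorem inner_poly_sub (k : Fin K) (p q φ : Polynomial ℝ) :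
    m.inner k (fun x => (p - q).eval x) (fun x => φ.eval x)
      = m.inner k (fun x => p.eval x) (fun x => φ.eval x)
        - m.inner k (fun x => q.eval x) (fun x => φ.eval x) := by
  unfold Mesh.inner
  rw [← intervalIntegral.integral_sub (f := fun x => p.eval x * φ.eval x)
    (g := fun x => q.eval x * φ.eval x) ((p.continuous.mul φ.continuous).intervalIntegrable _ _)
    ((q.continuous.mul φ.continuous).intervalIntegrable _ _)]
  simp [sub_mul]

theorem IsDerivMinus.sub {q s q' s' : PWPoly K} (h : IsDerivMinus m N q s)
    (h' : IsDerivMinus m N q' s') : IsDerivMinus m N (q - q') (s - s') := fun k φ hφ => by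
  have h1 := h k φ hφ
  have h2 := h' k φ hφ
  simp only [Pi.sub_apply, inner_poly_sub, Mesh.bdry, traceMinus_sub] at *
  linarith

theorem IsDerivPlus.sub {q s q' s' : PWPoly K} (h : IsDerivPlus m N q s)
    (h' : IsDerivPlus m N q' s') : IsDerivPlus m N (q - q') (s - s') := fun k φ hφ => by
  have h1 := h k φ hφ
  have h2 := h' k φ hφ
  simp only [Pi.sub_apply, inner_poly_sub, Mesh.bdry, tracePlus_sub] at *
  linarith

theorem derivative_degree_lt {φ : Polynomial ℝ} (h : φ.natDegree ≤ N) :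
    φ.derivative.degree < N := by
  rcases Nat.eq_zero_or_pos φ.natDegree with h0 | h0
  · rw [Polynomial.derivative_of_natDegree_zero h0, Polynomial.degree_zero]
    exact WithBot.bot_lt_coe _
  · refine (Polynomial.degree_lt_degree ?_).trans_le
      ((Polynomial.degree_le_natDegree).trans (by exact_mod_cast h))
    exact Polynomial.natDegree_derivative_lt h0.ne'

theorem integral_by_parts_cell {Ψ ψ : ℝ → ℝ} {k : Fin K}
    (hΨ : ContinuousOn Ψ (Icc (m.lo k) (m.hi k))) (hψ : ContinuousOn ψ (Icc (m.lo k) (m.hi k)))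
    (hd : ∀ x ∈ Ioo (m.lo k) (m.hi k), HasDerivAt Ψ (ψ x) x) (φ : Polynomial ℝ) :
    m.inner k ψ (fun x => φ.eval x) = -m.inner k Ψ (fun x => φ.derivative.eval x)
      + (Ψ (m.hi k) * φ.eval (m.hi k) - Ψ (m.lo k) * φ.eval (m.lo k)) := by
  have hle := (m.lo_lt_hi k).le
  have hφ := φ.continuous
  have hφ' := φ.derivative.continuous
  have i1 : IntervalIntegrable (fun x => ψ x * φ.eval x) volume (m.lo k) (m.hi k) := by
    refine ContinuousOn.intervalIntegrable ?_
    rw [uIcc_of_le hle]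
    exact hψ.mul hφ.continuousOn
  have i2 : IntervalIntegrable (fun x => Ψ x * φ.derivative.eval x) volume (m.lo k) (m.hi k) := by
    refine ContinuousOn.intervalIntegrable ?_
    rw [uIcc_of_le hle]
    exact hΨ.mul hφ'.continuousOn
  have := intervalIntegral.integral_eq_sub_of_hasDerivAt_of_le hle
    (f := fun x => Ψ x * φ.eval x) (f' := fun x => ψ x * φ.eval x + Ψ x * φ.derivative.eval x)
    (hΨ.mul hφ.continuousOn) (fun x hx => (hd x hx).mul (φ.hasDerivAt x)) (i1.add i2)
  rw [intervalIntegral.integral_add i1 i2] at this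
  unfold Mesh.inner
  linarith

theorem inner_proj_eq (e : Option Bool) {f : ℝ → ℝ} {k : Fin K}
    (hf : ContinuousOn f (Icc (m.lo k) (m.hi k)))
    {p : Polynomial ℝ} (hp : p.degree < N ∨ e = none ∧ p.natDegree ≤ N) :
    m.inner k (fun x => (pw m (proj m N e f) k).eval x) (fun x => p.eval x)
      = m.inner k f (fun x => p.eval x) := by
  have h := proj_orthogonal (N := N) e hf hp
  have hle := (m.lo_lt_hi k).le
  simp_rw [sub_mul] at h
  rw [intervalIntegral.integral_sub
    (f := fun x => (pw m (proj m N e f) k).eval x * p.eval x) (g := fun x => f x * p.eval x)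
    (((pw m (proj m N e f) k).continuous.mul p.continuous).intervalIntegrable _ _), sub_eq_zero] at h
  · exact h
  · refine ContinuousOn.intervalIntegrable ?_
    rw [uIcc_of_le hle]
    exact hf.mul p.continuous.continuousOn

theorem isDerivMinus_proj {Ψ : ℝ → ℝ} {ψ : Fin K → ℝ → ℝ} {s : PWPoly K}
    (hΨ : ContinuousOn Ψ (Icc a b)) (hψ : ∀ k, ContinuousOn (ψ k) (Icc (m.lo k) (m.hi k)))
    (hd : ∀ k, ∀ x ∈ Ioo (m.lo k) (m.hi k), HasDerivAt Ψ (ψ k x) x) (h0 : Ψ a = 0)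
    (hs : ∀ k, ∀ φ : Polynomial ℝ, φ.natDegree ≤ N →
      m.inner k (fun x => (s k).eval x) (fun x => φ.eval x) = m.inner k (ψ k) fun x => φ.eval x) :
    IsDerivMinus m N (pw m (proj m N (some true) Ψ)) s := fun k φ hφ => by
  have hc := hΨ.mono (cell_subset (m := m) k)
  have htr : ∀ j, m.traceMinus (pw m (proj m N (some true) Ψ)) j = Ψ (m.node j) := fun j => by
    refine Fin.cases ?_ (fun i => ?_) j
    · rw [m.node_zero, h0]; rfl
    · exact proj_hi Ψ i
  rw [hs k φ hφ, integral_by_parts_cell hc (hψ k) (hd k),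
    inner_proj_eq _ hc (Or.inl (derivative_degree_lt hφ))]
  simp only [Mesh.bdry, htr]
  rfl

theorem isDerivPlus_proj {Ψ : ℝ → ℝ} {ψ : Fin K → ℝ → ℝ} {s : PWPoly K}
    (hΨ : ContinuousOn Ψ (Icc a b)) (hψ : ∀ k, ContinuousOn (ψ k) (Icc (m.lo k) (m.hi k)))
    (hd : ∀ k, ∀ x ∈ Ioo (m.lo k) (m.hi k), HasDerivAt Ψ (ψ k x) x) (h0 : Ψ b = 0)
    (hs : ∀ k, ∀ φ : Polynomial ℝ, φ.natDegree ≤ N →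
      m.inner k (fun x => (s k).eval x) (fun x => φ.eval x) = m.inner k (ψ k) fun x => φ.eval x) :
    IsDerivPlus m N (pw m (proj m N (some false) Ψ)) s := fun k φ hφ => by
  have hc := hΨ.mono (cell_subset (m := m) k)
  have htr : ∀ j, m.tracePlus (pw m (proj m N (some false) Ψ)) j = Ψ (m.node j) := fun j => by
    refine Fin.lastCases ?_ (fun i => ?_) j
    · rw [m.node_last, h0]
      simp [Mesh.tracePlus]
    · have : m.tracePlus (pw m (proj m N (some false) Ψ)) i.castSucc
          = (pw m (proj m N (some false) Ψ) i).eval (m.lo i) := by simp [Mesh.tracePlus]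
      rw [this]
      exact proj_lo Ψ i
  rw [hs k φ hφ, integral_by_parts_cell hc (hψ k) (hd k),
    inner_proj_eq _ hc (Or.inl (derivative_degree_lt hφ))]
  simp only [Mesh.bdry, htr]
  rfl

/-- The two discrete derivatives are negative adjoints of each other. -/
theorem sum_inner_adjoint {s r θ ζ : PWPoly K} (hs : s.DegLE N) (hθ : θ.DegLE N)
    (h1 : IsDerivPlus m N s r) (h2 : IsDerivMinus m N θ ζ) :
    ∑ k, m.inner k (fun x => (r k).eval x) (fun x => (θ k).eval x)
      = -∑ k, m.inner k (fun x => (ζ k).eval x) (fun x => (s k).eval x) := by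
  have hcell : ∀ k, m.inner k (fun x => (r k).eval x) (fun x => (θ k).eval x)
      + m.inner k (fun x => (ζ k).eval x) (fun x => (s k).eval x)
      = m.tracePlus s k.succ * m.traceMinus θ k.succ
        - m.tracePlus s k.castSucc * m.traceMinus θ k.castSucc := fun k => by
    have e1 := h1 k (θ k) (hθ k)
    have e2 := h2 k (s k) (hs k)
    have e3 := integral_by_parts_cell (m := m) (k := k) (s k).continuous.continuousOn
      (s k).derivative.continuous.continuousOn (fun x _ => (s k).hasDerivAt x) (θ k)
    have e4 : m.inner k (fun x => (s k).derivative.eval x) (fun x => (θ k).eval x)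
        = m.inner k (fun x => (θ k).eval x) (fun x => (s k).derivative.eval x) := by
      unfold Mesh.inner
      simp_rw [mul_comm]
    have t1 : m.traceMinus θ k.succ = (θ k).eval (m.hi k) := by simp [Mesh.traceMinus]
    have t2 : m.tracePlus s k.castSucc = (s k).eval (m.lo k) := by simp [Mesh.tracePlus]
    simp only [Mesh.bdry] at e1 e2
    rw [t2] at e1 ⊢
    rw [t1] at e2 ⊢
    linarith
  have hsum := Finset.sum_congr rfl fun k (_ : k ∈ Finset.univ) => hcell k
  rw [Finset.sum_add_distrib, Finset.sum_sub_distrib] at hsum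
  have f1 := Fin.sum_univ_succ fun j => m.tracePlus s j * m.traceMinus θ j
  have f2 := Fin.sum_univ_castSucc fun j => m.tracePlus s j * m.traceMinus θ j
  have z1 : m.traceMinus θ 0 = 0 := rfl
  have z2 : m.tracePlus s (Fin.last K) = 0 := by simp [Mesh.tracePlus]
  rw [z1, mul_zero, zero_add] at f1
  rw [z2, zero_mul, add_zero] at f2
  linarith

variable (m)

/-- The function on the line with given local coefficients. -/
def fn (c : Coeff K N) : ℝ → ℝ := m.toFun (pw m c)

theorem fn_add (c d : Coeff K N) : fn m (c + d) = fn m c + fn m d := by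
  ext x
  simp only [fn, Mesh.toFun, map_add, Pi.add_apply, ← Finset.sum_add_distrib]
  refine Finset.sum_congr rfl fun k _ => ?_
  by_cases h : x ∈ Ioo (m.lo k) (m.hi k) <;> simp [h]

theorem fn_smul (r : ℝ) (c : Coeff K N) : fn m (r • c) = r • fn m c := by
  ext x
  simp only [fn, Mesh.toFun, map_smul, Pi.smul_apply, smul_eq_mul, Finset.mul_sum]
  refine Finset.sum_congr rfl fun k _ => ?_
  by_cases h : x ∈ Ioo (m.lo k) (m.hi k) <;> simp [h]

theorem fn_of_mem (c : Coeff K N) {k : Fin K} {x : ℝ}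
    (hx : x ∈ Ioo (m.lo k) (m.hi k)) : fn m c x = (pw m c k).eval x :=
  glue_of_mem (F := fun k x => (pw m c k).eval x) hx

theorem adm_fn (c : Coeff K N) : Adm a b (fn m c) :=
  adm_glue fun k => (pw m c k).continuous.continuousOn

theorem integral_fn_mul (hab : a < b) (c : Coeff K N) {w : ℝ → ℝ} (hw : Adm a b w) :
    ∫ x, fn m c x * w x = ∑ k, ∫ x in (m.lo k)..(m.hi k), (pw m c k).eval x * w x :=
  integral_glue_mul hab (fun k => (pw m c k).continuous.continuousOn) hw

theorem integral_fn_mul_fn (hab : a < b) (c d : Coeff K N) :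
    ∫ x, fn m c x * fn m d x
      = ∑ k, m.inner k (fun x => (pw m c k).eval x) (fun x => (pw m d k).eval x) := by
  rw [integral_fn_mul m hab c (adm_fn m d)]
  refine Finset.sum_congr rfl fun k _ => ?_
  unfold Mesh.inner
  rw [intervalIntegral.integral_of_le (m.lo_lt_hi k).le, intervalIntegral.integral_of_le
    (m.lo_lt_hi k).le, integral_Ioc_eq_integral_Ioo, integral_Ioc_eq_integral_Ioo]
  exact setIntegral_congr_fun measurableSet_Ioo fun x hx => by simp only [fn_of_mem m d hx]

variable {m}

theorem Adm.continuous_primitive {v : ℝ → ℝ} (hv : Adm a b v) (c : ℝ) :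
    Continuous fun x => ∫ s in c..x, v s :=
  intervalIntegral.continuous_primitive (fun _ _ => hv.integrable.intervalIntegrable) c

theorem hasDerivAt_primitive_fn (c : Coeff K N) (y : ℝ) {k : Fin K} {x : ℝ}
    (hx : x ∈ Ioo (m.lo k) (m.hi k)) :
    HasDerivAt (fun x => ∫ s in y..x, fn m c s) ((pw m c k).eval x) x := by
  have hev : fn m c =ᶠ[𝓝 x] fun x => (pw m c k).eval x := by
    filter_upwards [isOpen_Ioo.mem_nhds hx] with z hz using fn_of_mem m c hz
  have hc : ContinuousAt (fn m c) x := (pw m c k).continuous.continuousAt.congr hev.symm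
  have := intervalIntegral.integral_hasDerivAt_right
    ((adm_fn m c).integrable.intervalIntegrable (a := y) (b := x))
    ((adm_fn m c).meas.stronglyMeasurable.stronglyMeasurableAtFilter) hc
  rwa [fn_of_mem m c hx] at this

variable (m)

/-- The inverse of the discrete derivative with traces from the left. -/
def invMinus : Coeff K N →ₗ[ℝ] Coeff K N where
  toFun c := proj m N (some true) fun x => ∫ s in a..x, fn m c s
  map_add' c d := by
    rw [← proj_add _ ((adm_fn m c).continuous_primitive a).continuousOn
      ((adm_fn m d).continuous_primitive a).continuousOn]
    congr 1; ext x
    rw [← intervalIntegral.integral_add (adm_fn m c).integrable.intervalIntegrable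
      (adm_fn m d).integrable.intervalIntegrable, fn_add]
    rfl
  map_smul' r c := by
    rw [RingHom.id_apply, ← proj_smul]
    congr 1; ext x
    rw [← intervalIntegral.integral_const_mul, fn_smul]
    rfl

/-- The inverse of the discrete derivative with traces from the right. -/
def invPlus : Coeff K N →ₗ[ℝ] Coeff K N where
  toFun c := proj m N (some false) fun x => ∫ s in b..x, fn m c s
  map_add' c d := by
    rw [← proj_add _ ((adm_fn m c).continuous_primitive b).continuousOn
      ((adm_fn m d).continuous_primitive b).continuousOn]
    congr 1; ext x
    rw [← intervalIntegral.integral_add (adm_fn m c).integrable.intervalIntegrable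
      (adm_fn m d).integrable.intervalIntegrable, fn_add]
    rfl
  map_smul' r c := by
    rw [RingHom.id_apply, ← proj_smul]
    congr 1; ext x
    rw [← intervalIntegral.integral_const_mul, fn_smul]
    rfl

theorem invMinus_apply (c : Coeff K N) :
    invMinus m c = proj m N (some true) fun x => ∫ s in a..x, fn m c s := rfl

theorem invPlus_apply (c : Coeff K N) :
    invPlus m c = proj m N (some false) fun x => ∫ s in b..x, fn m c s := rfl

theorem isDerivMinus_invMinus (c : Coeff K N) :
    IsDerivMinus m N (pw m (invMinus m c)) (pw m c) := by
  rw [invMinus_apply]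
  exact isDerivMinus_proj (Ψ := fun x => ∫ s in a..x, fn m c s)
    (ψ := fun k x => (pw m c k).eval x) ((adm_fn m c).continuous_primitive a).continuousOn
    (fun k => (pw m c k).continuous.continuousOn) (fun k x hx => hasDerivAt_primitive_fn c a hx)
    intervalIntegral.integral_same fun _ _ _ => rfl

theorem isDerivPlus_invPlus (c : Coeff K N) :
    IsDerivPlus m N (pw m (invPlus m c)) (pw m c) := by
  rw [invPlus_apply]
  exact isDerivPlus_proj (Ψ := fun x => ∫ s in b..x, fn m c s)
    (ψ := fun k x => (pw m c k).eval x) ((adm_fn m c).continuous_primitive b).continuousOn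
    (fun k => (pw m c k).continuous.continuousOn) (fun k x hx => hasDerivAt_primitive_fn c b hx)
    intervalIntegral.integral_same fun _ _ _ => rfl

end

section

variable {a b : ℝ} {K N : ℕ}

/-- The `L²` inner product of the functions with given local coefficients. -/
def ip (m : Mesh a b K) :
    Coeff K N →ₗ[ℝ] Coeff K N →ₗ[ℝ] ℝ :=
  LinearMap.mk₂ ℝ (fun c d => ∫ x, fn m c x * fn m d x)
    (fun c c' d => by
      rw [fn_add, ← integral_add (f := fun x => fn m c x * fn m d x)
        (g := fun x => fn m c' x * fn m d x) ((adm_fn m c).mul (adm_fn m d)).integrable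
        ((adm_fn m c').mul (adm_fn m d)).integrable]
      simp only [Pi.add_apply, add_mul])
    (fun r c d => by
      rw [fn_smul, smul_eq_mul, ← integral_const_mul]
      simp only [Pi.smul_apply, smul_eq_mul, mul_assoc])
    (fun c d d' => by
      rw [fn_add, ← integral_add (f := fun x => fn m c x * fn m d x)
        (g := fun x => fn m c x * fn m d' x) ((adm_fn m c).mul (adm_fn m d)).integrable
        ((adm_fn m c).mul (adm_fn m d')).integrable]
      simp only [Pi.add_apply, mul_add])
    (fun r c d => by
      rw [fn_smul, smul_eq_mul, ← integral_const_mul]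
      simp only [Pi.smul_apply, smul_eq_mul, mul_left_comm])

theorem ip_apply (m : Mesh a b K) (c d : Coeff K N) :
    ip m c d = ∫ x, fn m c x * fn m d x := rfl

theorem ip_comm (m : Mesh a b K) (c d : Coeff K N) : ip m c d = ip m d c := by
  simp only [ip_apply, mul_comm]

theorem ip_self_nonneg (m : Mesh a b K) (c : Coeff K N) : 0 ≤ ip m c c :=
  integral_nonneg fun _ => mul_self_nonneg _

variable {μ : ℝ}

/-- The energy form on the functions with given local coefficients. -/
def af (hμ : 0 < μ) (m : Mesh a b K) :
    Coeff K N →ₗ[ℝ] Coeff K N →ₗ[ℝ] ℝ :=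
  LinearMap.mk₂ ℝ (fun c d => en μ (fn m c) (fn m d))
    (fun c c' d => by
      rw [fn_add]; exact en_add_left hμ (adm_fn m c) (adm_fn m c') (adm_fn m d))
    (fun r c d => by rw [fn_smul]; exact en_const_mul_left r)
    (fun c d d' => by
      rw [fn_add, en_symm, en_symm μ (v := fn m c), en_symm μ (v := fn m c) (w := fn m d')]
      exact en_add_left hμ (adm_fn m d) (adm_fn m d') (adm_fn m c))
    (fun r c d => by
      rw [fn_smul, en_symm, en_symm μ (v := fn m c)]; exact en_const_mul_left r)

theorem af_apply (hμ : 0 < μ) (m : Mesh a b K) (c d : Coeff K N) :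
    af hμ m c d = en μ (fn m c) (fn m d) := rfl

theorem af_comm (hμ : 0 < μ) (m : Mesh a b K) (c d : Coeff K N) :
    af hμ m c d = af hμ m d c := en_symm μ

theorem inverse_estimate (N : ℕ) (hμ : 0 < μ) (hμ1 : μ < 1) (hab : a < b) :
    ∃ C : ℝ, 0 < C ∧ ∀ (K : ℕ) (m : Mesh a b K) (c : Coeff K N),
      ∑ k, (m.hi k - m.lo k) ^ (μ + 1) * ‖c k‖ ^ 2 ≤ C * af hμ m c c := by
  obtain ⟨C1, hC1, h1⟩ := pairing_glue_sq_le hμ hμ1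
  obtain ⟨C2, hC2, h2⟩ := norm_sq_le_integral_pw N
  set D : ℝ := ((N + 1) * N) ^ 2 + (N + 1) ^ 2 with hD
  refine ⟨C2 ^ 2 * (C1 * D), by positivity, fun K m c => ?_⟩
  set X := ∑ k, (m.hi k - m.lo k) ^ (μ + 1) * ‖c k‖ ^ 2 with hX
  have hlen := m.len_pos
  have hX0 : 0 ≤ X := Finset.sum_nonneg fun k _ =>
    mul_nonneg (Real.rpow_nonneg (hlen k).le _) (sq_nonneg _)
  have hen : 0 ≤ af hμ m c c := en_nonneg hμ hμ1 (adm_fn m c)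
  have hp := h1 m hab (fun k x => (m.hi k - m.lo k) ^ μ * (pw m c k).eval x)
    (fun k => (m.hi k - m.lo k) ^ μ * ((N + 1) * ‖c k‖))
    (fun k => (m.hi k - m.lo k) ^ μ * ((N + 1) * (N * ‖c k‖) / √(m.hi k - m.lo k)))
    (fun k => (continuous_const.mul (pw m c k).continuous).continuousOn)
    (fun k x hx => by
      rw [abs_mul, abs_of_nonneg (Real.rpow_nonneg (hlen k).le _)]
      exact mul_le_mul_of_nonneg_left (abs_pw_eval_le m c hx) (Real.rpow_nonneg (hlen k).le _))
    (fun k x hx y hy => by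
      rw [← mul_sub, mul_pow, mul_pow, mul_assoc]
      refine mul_le_mul_of_nonneg_left ?_ (sq_nonneg _)
      have := pow_le_pow_left₀ (abs_nonneg _) (pw_holder m c hx hy) 2
      rwa [sq_abs, mul_pow, Real.sq_sqrt (abs_nonneg _)] at this)
    (fn m c) (adm_fn m c)
  have hL : X ≤ C2 * ∑ k, ∫ x in (m.lo k)..(m.hi k),
      (m.hi k - m.lo k) ^ μ * (pw m c k).eval x * fn m c x := by
    rw [Finset.mul_sum]
    refine Finset.sum_le_sum fun k _ => ?_
    have e : ∫ x in (m.lo k)..(m.hi k), (m.hi k - m.lo k) ^ μ * (pw m c k).eval x * fn m c x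
        = (m.hi k - m.lo k) ^ μ * ∫ x in (m.lo k)..(m.hi k), (pw m c k).eval x ^ 2 := by
      rw [← intervalIntegral.integral_const_mul, intervalIntegral.integral_of_le (m.lo_lt_hi k).le,
        intervalIntegral.integral_of_le (m.lo_lt_hi k).le, integral_Ioc_eq_integral_Ioo,
        integral_Ioc_eq_integral_Ioo]
      exact setIntegral_congr_fun measurableSet_Ioo fun x hx => by
        simp only [fn_of_mem m c hx]; ring
    rw [e, Real.rpow_add (hlen k), Real.rpow_one]
    calc _ = (m.hi k - m.lo k) ^ μ * ((m.hi k - m.lo k) * ‖c k‖ ^ 2) := by ring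
      _ ≤ (m.hi k - m.lo k) ^ μ * (C2 * ∫ x in (m.lo k)..(m.hi k), (pw m c k).eval x ^ 2) :=
        mul_le_mul_of_nonneg_left (h2 m c k) (Real.rpow_nonneg (hlen k).le _)
      _ = _ := by ring
  have hR : ∑ k, (((m.hi k - m.lo k) ^ μ *
        ((N + 1) * (N * ‖c k‖) / √(m.hi k - m.lo k))) ^ 2 * (m.hi k - m.lo k) ^ (2 - μ)
      + ((m.hi k - m.lo k) ^ μ * ((N + 1) * ‖c k‖)) ^ 2 * (m.hi k - m.lo k) ^ (1 - μ)) = D * X := by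
    rw [hX, Finset.mul_sum]
    refine Finset.sum_congr rfl fun k _ => ?_
    have hl := hlen k
    have e1 : (m.hi k - m.lo k) ^ (2 - μ) = (m.hi k - m.lo k) * (m.hi k - m.lo k) ^ (1 - μ) := by
      rw [show (2 - μ : ℝ) = 1 + (1 - μ) by ring, Real.rpow_add hl, Real.rpow_one]
    have e2 : (m.hi k - m.lo k) ^ (μ + 1) = ((m.hi k - m.lo k) ^ μ) ^ 2
        * (m.hi k - m.lo k) ^ (1 - μ) := by
      rw [← Real.rpow_natCast, ← Real.rpow_mul hl.le, ← Real.rpow_add hl]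
      congr 1; push_cast; ring
    rw [e1, e2, mul_pow _ (_ / _), div_pow, Real.sq_sqrt hl.le, hD]
    field_simp
  rw [hR] at hp
  have hsq := pow_le_pow_left₀ hX0 hL 2
  rw [mul_pow] at hsq
  have hfin : X * X ≤ (C2 ^ 2 * (C1 * D) * af hμ m c c) * X := by
    have := mul_le_mul_of_nonneg_left hp (sq_nonneg C2)
    rw [af_apply]
    nlinarith
  rcases hX0.eq_or_lt with h0 | h0
  · rw [← h0]; positivity
  · exact le_of_mul_le_mul_right hfin h0

theorem eq_zero_of_af_self {hμ : 0 < μ} (hμ1 : μ < 1) (hab : a < b) {m : Mesh a b K}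
    {c : Coeff K N} (h : af hμ m c c = 0) : c = 0 := by
  obtain ⟨C, -, hC⟩ := inverse_estimate N hμ hμ1 hab
  have h1 := hC K m c
  rw [h, mul_zero] at h1
  have h0 : ∀ k ∈ Finset.univ, 0 ≤ (m.hi k - m.lo k) ^ (μ + 1) * ‖c k‖ ^ 2 := fun k _ =>
    mul_nonneg (Real.rpow_nonneg (m.len_pos k).le _) (sq_nonneg _)
  have h2 := (Finset.sum_eq_zero_iff_of_nonneg h0).1 (le_antisymm h1 (Finset.sum_nonneg h0))
  ext1 k
  have := h2 k (Finset.mem_univ k)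
  have hl := Real.rpow_pos_of_pos (m.len_pos k) (μ + 1)
  simpa [hl.ne'] using this

/-- The energy form is invertible on the piecewise polynomials. -/
theorem exists_energy_inverse (N : ℕ) (hμ : 0 < μ) (hμ1 : μ < 1) (hab : a < b) (m : Mesh a b K) :
    ∃ S : Coeff K N →ₗ[ℝ] Coeff K N,
      ∀ z w, af hμ m (S z) w = ip m z w := by
  have hinj : Function.Injective (af (N := N) hμ m) := by
    rw [injective_iff_map_eq_zero]
    intro c hc
    exact eq_zero_of_af_self hμ1 hab (hμ := hμ) (m := m) (by rw [hc]; rfl)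
  let A := LinearMap.linearEquivOfInjective (af (N := N) hμ m) hinj
    (Subspace.dual_finrank_eq (K := ℝ) (V := Coeff K N)).symm
  refine ⟨A.symm.toLinearMap ∘ₗ ip m, fun z w => ?_⟩
  have : A (A.symm (ip m z)) = ip m z := A.apply_symm_apply _
  exact LinearMap.congr_fun this w

/-- `Ψ` is bounded by `L` on `[a, b]` and Hölder continuous there, of exponent one half. -/
structure HolderHalf (a b L : ℝ) (Ψ : ℝ → ℝ) : Prop where
  cont : ContinuousOn Ψ (Icc a b)
  bound : ∀ x ∈ Icc a b, |Ψ x| ≤ L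
  holder : ∀ x ∈ Icc a b, ∀ y ∈ Icc a b, (Ψ x - Ψ y) ^ 2 ≤ L ^ 2 * |x - y|

theorem HolderHalf.abs_sub_le {L : ℝ} {Ψ : ℝ → ℝ} (h : HolderHalf a b L Ψ) (hL : 0 ≤ L) {x y : ℝ}
    (hx : x ∈ Icc a b) (hy : y ∈ Icc a b) : |Ψ x - Ψ y| ≤ L * √|x - y| := by
  refine abs_le_of_sq_le_sq ?_ (by positivity)
  rw [mul_pow, Real.sq_sqrt (abs_nonneg _)]
  exact h.holder x hx y hy

theorem HolderHalf.add {L L' : ℝ} {Ψ Ψ' : ℝ → ℝ} (h : HolderHalf a b L Ψ) (hL : 0 ≤ L)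
    (h' : HolderHalf a b L' Ψ') (hL' : 0 ≤ L') :
    HolderHalf a b (L + L') fun x => Ψ x + Ψ' x where
  cont := h.cont.add h'.cont
  bound x hx := (abs_add_le _ _).trans (add_le_add (h.bound x hx) (h'.bound x hx))
  holder x hx y hy := by
    have h3 : |Ψ x + Ψ' x - (Ψ y + Ψ' y)| ≤ (L + L') * √|x - y| := by
      calc _ = |(Ψ x - Ψ y) + (Ψ' x - Ψ' y)| := by congr 1; ring
        _ ≤ _ := abs_add_le _ _
        _ ≤ _ := add_le_add (h.abs_sub_le hL hx hy) (h'.abs_sub_le hL' hx hy)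
        _ = _ := by ring
    have := pow_le_pow_left₀ (abs_nonneg _) h3 2
    rwa [sq_abs, mul_pow, Real.sq_sqrt (abs_nonneg _)] at this

theorem Adm.continuousOn_mul {F w : ℝ → ℝ} (hw : Adm a b w) {l r : ℝ} (hlr : l ≤ r)
    (hF : ContinuousOn F (Icc l r)) : IntervalIntegrable (fun x => F x * w x) volume l r := by
  rw [← uIcc_of_le hlr] at hF
  exact (hw.intervalIntegrable l r).continuousOn_mul hF

theorem integral_fn_mul_eq_add (m : Mesh a b K) (hab : a < b) (c : Coeff K N)
    {F w : ℝ → ℝ} (hF : ContinuousOn F (Icc a b)) (hw : Adm a b w) :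
    ∫ x, fn m c x * w x = (∑ k, ∫ x in (m.lo k)..(m.hi k), ((pw m c k).eval x - F x) * w x)
      + ∫ x in a..b, F x * w x := by
  have h : ∀ k, IntervalIntegrable (fun x => F x * w x) volume (m.lo k) (m.hi k) := fun k =>
    hw.continuousOn_mul (m.lo_lt_hi k).le (hF.mono (cell_subset k))
  rw [integral_fn_mul m hab c hw, ← m.sum_integral (fun x => F x * w x) h,
    ← Finset.sum_add_distrib]
  refine Finset.sum_congr rfl fun k _ => ?_
  rw [← intervalIntegral.integral_add (f := fun x => ((pw m c k).eval x - F x) * w x)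
    (g := fun x => F x * w x) (hw.continuousOn_mul (m.lo_lt_hi k).le
      ((pw m c k).continuous.continuousOn.sub (hF.mono (cell_subset k)))) (h k)]
  simp only [sub_mul, sub_add_cancel]

theorem proj_holderHalf (N : ℕ) (hμ : 0 < μ) (hμ1 : μ < 1) (hab : a < b) :
    ∃ C : ℝ, 0 < C ∧ ∀ (K : ℕ) (m : Mesh a b K) (e : Option Bool) (Ψ : ℝ → ℝ) (L : ℝ), 0 ≤ L →
      HolderHalf a b L Ψ →
      (∀ w, Adm a b w → (∫ x, fn m (proj m N e Ψ) x * w x) ^ 2 ≤ C * L ^ 2 * en μ w w) ∧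
      ∀ k, ‖proj m N e Ψ k‖ ≤ C * L := by
  obtain ⟨C1, hC1, h1⟩ := proj_stable N
  obtain ⟨C2, hC2, h2⟩ := proj_error N
  obtain ⟨C3, hC3, h3⟩ := pairing_glue_le hμ hμ1
  obtain ⟨C4, hC4, h4⟩ := pairing_holder_le hμ hμ1 hab
  have hba : 0 < b - a := sub_pos.2 hab
  have hB := Real.rpow_pos_of_pos hba (1 - μ)
  set D := 2 * (C3 * (b - a) * (C2 + 1) ^ 2 * (b - a) ^ (1 - μ)) + 2 * C4 with hD
  refine ⟨C1 + D, by positivity, fun K m e Ψ L hL hΨ => ⟨fun w hw => ?_, fun k => ?_⟩⟩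
  · have hlen := m.len_pos
    have hen := en_nonneg hμ hμ1 hw
    have herr := fun k => h2 m e Ψ k (Polynomial.C (Ψ (m.lo k)))
      (L * √(m.hi k - m.lo k)) L (by simp) (hΨ.cont.mono (cell_subset k))
      (fun x hx => by
        rw [Polynomial.eval_C]
        refine (hΨ.abs_sub_le hL (cell_subset k hx)
          (cell_subset k (left_mem_Icc.2 (m.lo_lt_hi k).le))).trans ?_
        refine mul_le_mul_of_nonneg_left (Real.sqrt_le_sqrt ?_) hL
        rw [abs_of_nonneg (by linarith [hx.1])]
        linarith [hx.2])
      (fun x hx y hy => by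
        simp only [Polynomial.eval_C, sub_sub_sub_cancel_right]
        exact hΨ.abs_sub_le hL (cell_subset k hx) (cell_subset k hy))
    have e1 := h3 m hab (fun k x => (pw m (proj m N e Ψ) k).eval x - Ψ x) ((C2 + 1) * L) (1 / 2)
      (by positivity) le_rfl
      (fun k => (pw m _ k).continuous.continuousOn.sub (hΨ.cont.mono (cell_subset k)))
      (fun k x hx => by
        refine ((herr k).1 x hx).trans ?_
        rw [← Real.sqrt_eq_rpow]
        nlinarith [mul_nonneg hL (Real.sqrt_nonneg (m.hi k - m.lo k))])
      (fun k x hx y hy => by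
        have := pow_le_pow_left₀ (abs_nonneg _) ((herr k).2 x hx y hy) 2
        rw [sq_abs, mul_pow, Real.sq_sqrt (abs_nonneg _), mul_div_cancel_right₀ _
          (Real.sqrt_pos.2 (hlen k)).ne'] at this
        rw [sub_self, Real.rpow_zero, mul_one, add_mul, one_mul]
        exact this)
      w hw
    have e2 := h4 Ψ L hL hΨ.cont hΨ.bound hΨ.holder w hw
    rw [integral_fn_mul_eq_add m hab _ hΨ.cont hw]
    have e3 : m.size ^ (2 * (1 / 2) - μ) ≤ (b - a) ^ (1 - μ) := by
      rw [show (2 * (1 / 2) - μ : ℝ) = 1 - μ by ring]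
      exact Real.rpow_le_rpow (m.size_pos hab).le (m.size_le hab) (by linarith)
    have e4 : C3 * (b - a) * ((C2 + 1) * L) ^ 2 * m.size ^ (2 * (1 / 2) - μ) * en μ w w
        ≤ C3 * (b - a) * ((C2 + 1) * L) ^ 2 * (b - a) ^ (1 - μ) * en μ w w := by gcongr
    have e5 : 0 ≤ C1 * L ^ 2 * en μ w w := by positivity
    refine (add_sq_le).trans ?_
    rw [hD]
    nlinarith
  · refine (h1 m e Ψ k L fun x hx => hΨ.bound x (cell_subset k hx)).trans ?_
    have : 0 ≤ D := by positivity
    nlinarith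

theorem proj_error_pairing (N : ℕ) (hμ : 0 < μ) (hμ1 : μ < 1) (hab : a < b) :
    ∃ C : ℝ, 0 < C ∧ ∀ (K : ℕ) (m : Mesh a b K) (e : Option Bool) (f : ℕ → ℝ → ℝ) (R : ℝ),
      0 ≤ R → DerivChain (N + 1) a b f → (∀ x ∈ Icc a b, |f (N + 1) x| ≤ R) →
      ∀ w, Adm a b w →
        (∑ k, ∫ x in (m.lo k)..(m.hi k), ((pw m (proj m N e (f 0)) k).eval x - f 0 x) * w x) ^ 2
          ≤ C * (R * m.size ^ (N + 1)) ^ 2 * m.size ^ (-μ) * en μ w w := by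
  obtain ⟨C1, hC1, h1⟩ := proj_error_smooth N
  obtain ⟨C3, hC3, h3⟩ := pairing_glue_le hμ hμ1
  have hba : 0 < b - a := sub_pos.2 hab
  refine ⟨C3 * (b - a) * C1 ^ 2, by positivity, fun K m e f R hR hf hfR w hw => ?_⟩
  have hlen := m.len_pos
  have herr := h1 m e f R hf hfR
  have e1 := h3 m hab (fun k x => (pw m (proj m N e (f 0)) k).eval x - f 0 x) (C1 * R) (N + 1 : ℕ)
      (by positivity) (by push_cast; linarith [(Nat.cast_nonneg N : (0:ℝ) ≤ N)])
      (fun k => (pw m _ k).continuous.continuousOn.sub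
        ((hf.continuousOn (Nat.succ_pos N)).mono (cell_subset k)))
      (fun k x hx => by rw [Real.rpow_natCast]; exact (herr k).1 x hx)
      (fun k x hx y hy => by
        have := pow_le_pow_left₀ (abs_nonneg _) ((herr k).2 x hx y hy) 2
        rw [sq_abs, mul_pow, Real.sq_sqrt (abs_nonneg _)] at this
        rwa [show (((N + 1 : ℕ) : ℝ) - 1 / 2) = N + 1 / 2 by push_cast; ring,
          Real.rpow_add (hlen k), Real.rpow_natCast, ← Real.sqrt_eq_rpow])
      w hw
  refine e1.trans (le_of_eq ?_)
  have hs := m.size_pos hab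
  rw [show 2 * ((N + 1 : ℕ) : ℝ) - μ = (((N + 1) * 2 : ℕ) : ℝ) + -μ by push_cast; ring,
    Real.rpow_add hs, Real.rpow_natCast, pow_mul]
  ring

end

section

variable {a b : ℝ} {K N : ℕ} {μ : ℝ} {m : Mesh a b K}

theorem adm_indicator_of_bound {f : ℝ → ℝ} (hf : Measurable ((Ioo a b).indicator f)) {M : ℝ}
    (hM : ∀ x ∈ Ioo a b, |f x| ≤ M) : Adm a b ((Ioo a b).indicator f) := by
  refine ⟨hf, ⟨|M|, fun x => ?_⟩, fun x hx => indicator_of_notMem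
    (fun h => hx (Ioo_subset_Icc_self h)) _⟩
  by_cases h : x ∈ Ioo a b
  · rw [indicator_of_mem h]; exact (hM x h).trans (le_abs_self M)
  · rw [indicator_of_notMem h, abs_zero]; exact abs_nonneg M

theorem adm_indicator {f : ℝ → ℝ} (hf : ContinuousOn f (Icc a b)) :
    Adm a b ((Ioo a b).indicator f) := by
  obtain ⟨C, hC⟩ := isCompact_Icc.exists_bound_of_continuousOn hf
  refine adm_indicator_of_bound ?_ fun x hx => hC x (Ioo_subset_Icc_self hx)
  rw [← Set.piecewise_eq_indicator]
  exact (hf.mono Ioo_subset_Icc_self).measurable_piecewise continuousOn_const measurableSet_Ioo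

theorem integral_indicator_of_le {f : ℝ → ℝ} {x y : ℝ} (hx : x ∈ Icc a b) (hy : y ∈ Icc a b) :
    ∫ t in x..y, (Ioo a b).indicator f t = ∫ t in x..y, f t := by
  wlog h : x ≤ y generalizing x y
  · rw [intervalIntegral.integral_symm, this hy hx (le_of_not_ge h),
      ← intervalIntegral.integral_symm]
  rw [intervalIntegral.integral_of_le h, intervalIntegral.integral_of_le h,
    integral_Ioc_eq_integral_Ioo, integral_Ioc_eq_integral_Ioo]
  refine setIntegral_congr_fun measurableSet_Ioo fun t ht => ?_
  exact indicator_of_mem (show t ∈ Ioo a b from ⟨hx.1.trans_lt ht.1, ht.2.trans_le hy.2⟩) _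

theorem integral_sq_le_of_cells (hab : a < b) {v : ℝ → ℝ} (hv : Adm a b v) {M : Fin K → ℝ}
    (hM : ∀ k, ∀ x ∈ Ioo (m.lo k) (m.hi k), |v x| ≤ M k) :
    ∫ x, v x ^ 2 ≤ ∑ k, (m.hi k - m.lo k) * M k ^ 2 := by
  rw [hv.sq.integral_eq_sum m hab]
  refine Finset.sum_le_sum fun k _ => ?_
  rw [intervalIntegral.integral_of_le (m.lo_lt_hi k).le, integral_Ioc_eq_integral_Ioo]
  calc _ ≤ ∫ x in Ioo (m.lo k) (m.hi k), M k ^ 2 := by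
        refine setIntegral_mono_on hv.sq.integrable.integrableOn
          (integrableOn_const (by simp)) measurableSet_Ioo fun x hx => ?_
        exact sq_le_sq.2 ((hM k x hx).trans (le_abs_self _))
    _ = _ := by simp [max_eq_left (m.len_pos k).le]

theorem integral_sq_le_of_bound (hab : a < b) {v : ℝ → ℝ} (hv : Adm a b v) {M : ℝ}
    (hM : ∀ k, ∀ x ∈ Ioo (m.lo k) (m.hi k), |v x| ≤ M) : ∫ x, v x ^ 2 ≤ (b - a) * M ^ 2 := by
  refine (integral_sq_le_of_cells hab hv hM).trans (le_of_eq ?_)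
  rw [← Finset.sum_mul, m.sum_len]

theorem HolderHalf.of_bounds {L : ℝ} {Ψ : ℝ → ℝ} (hL : 0 ≤ L) (h1 : ∀ x ∈ Icc a b, |Ψ x| ≤ L)
    (h2 : ∀ x ∈ Icc a b, ∀ y ∈ Icc a b, (Ψ x - Ψ y) ^ 2 ≤ L ^ 2 * |x - y|) :
    HolderHalf a b L Ψ := by
  refine ⟨fun x hx => ?_, h1, h2⟩
  have hlim : Tendsto (fun y => L * √|y - x|) (𝓝[Icc a b] x) (𝓝 0) := by
    have hc : Continuous fun y => L * √|y - x| := by fun_prop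
    have := (hc.tendsto x).mono_left (nhdsWithin_le_nhds (s := Icc a b))
    simpa using this
  rw [ContinuousWithinAt, tendsto_iff_norm_sub_tendsto_zero]
  refine squeeze_zero' (.of_forall fun y => norm_nonneg _) ?_ hlim
  filter_upwards [self_mem_nhdsWithin] with y hy
  refine abs_le_of_sq_le_sq ?_ (by positivity)
  rw [mul_pow, Real.sq_sqrt (abs_nonneg _)]
  exact h2 y hy x hx

theorem HolderHalf.primitive {v : ℝ → ℝ} (hab : a < b) (hv : Adm a b v) {δ : ℝ} (hδ : 0 ≤ δ)
    (h : ∫ x, v x ^ 2 ≤ δ ^ 2) :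
    HolderHalf a b ((1 + (b - a)) * δ) fun x => ∫ s in a..x, v s := by
  have hba : 0 < b - a := sub_pos.2 hab
  have key : ∀ x ∈ Icc a b, ∀ y ∈ Icc a b,
      ((∫ s in a..x, v s) - ∫ s in a..y, v s) ^ 2 ≤ |x - y| * δ ^ 2 := fun x hx y hy => by
    rw [intervalIntegral.integral_interval_sub_left (hv.intervalIntegrable _ _)
      (hv.intervalIntegrable _ _)]
    wlog hyx : y ≤ x generalizing x y
    · have := this y hy x hx (le_of_not_ge hyx)
      rwa [intervalIntegral.integral_symm, neg_sq, abs_sub_comm] at this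
    refine (sq_integral_interval_le hv hyx).trans ?_
    rw [abs_of_nonneg (sub_nonneg.2 hyx)]
    refine mul_le_mul_of_nonneg_left (le_trans ?_ h) (sub_nonneg.2 hyx)
    rw [intervalIntegral.integral_of_le hyx]
    exact setIntegral_le_integral hv.sq.integrable (.of_forall fun x => sq_nonneg _)
  refine HolderHalf.of_bounds (by positivity) (fun x hx => ?_) fun x hx y hy => ?_
  · refine abs_le_of_sq_le_sq ?_ (by positivity)
    have := key x hx a (left_mem_Icc.2 hab.le)
    rw [intervalIntegral.integral_same, sub_zero, abs_of_nonneg (sub_nonneg.2 hx.1)] at this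
    refine this.trans ?_
    rw [mul_pow]
    exact mul_le_mul_of_nonneg_right (by nlinarith [hx.2]) (sq_nonneg _)
  · refine (key x hx y hy).trans ?_
    rw [mul_comm, mul_pow]
    refine mul_le_mul_of_nonneg_right ?_ (abs_nonneg _)
    have : (1:ℝ) ≤ (1 + (b - a)) ^ 2 := by nlinarith
    nlinarith [sq_nonneg δ]

theorem secondAnti_eq_integral {y : ℝ → ℝ} (hy : Adm a b y) {x : ℝ} (hx : x ∈ Icc a b) :
    secondAnti a y x = ∫ t in a..x, ∫ s in b..t, y s := by
  have hint : Integrable (fun z : ℝ × ℝ => (Ioi z.1).indicator y z.2)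
      ((volume.restrict (Ioc a x)).prod volume) := by
    have h1 : Integrable (fun z : ℝ × ℝ => (1:ℝ) * y z.2)
        ((volume.restrict (Ioc a x)).prod volume) :=
      Integrable.mul_prod (f := fun _ : ℝ => (1:ℝ)) (integrable_const _) hy.integrable
    have h2 : MeasurableSet {z : ℝ × ℝ | z.1 < z.2} :=
      measurableSet_lt measurable_fst measurable_snd
    refine (h1.indicator h2).congr (.of_forall fun z => ?_)
    simp [indicator]
  have hsw := integral_integral_swap (f := fun t s => (Ioi t).indicator y s) hint
  have e1 : ∀ t ∈ Ioc a x, ∫ s, (Ioi t).indicator y s = -∫ s in b..t, y s := fun t ht => by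
    rw [intervalIntegral.integral_symm, neg_neg, integral_indicator measurableSet_Ioi,
      intervalIntegral.integral_of_le (ht.2.trans hx.2)]
    refine setIntegral_eq_of_subset_of_forall_sdiff_eq_zero measurableSet_Ioi
      (fun s hs => hs.1) fun s hs => hy.supp s fun h => hs.2 ⟨hs.1, h.2⟩
  have e2 : ∀ s, ∫ t in Ioc a x, (Ioi t).indicator y s = y s * min (s - a) (x - a) := fun s => by
    by_cases hs : s ∈ Icc a b
    · have : ∫ t in Ioc a x, (Ioi t).indicator y s = ∫ t in Ioo a (min s x), y s := by
        have e3 : ∀ t, (Ioi t).indicator y s = (Iio s).indicator (fun _ => y s) t := fun t => by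
          simp [indicator]
        simp_rw [e3]
        rw [integral_Ioc_eq_integral_Ioo, setIntegral_indicator measurableSet_Iio]
        congr 2
        ext t
        simp only [mem_inter_iff, mem_Ioo, mem_Iio, lt_min_iff]
        tauto
      rw [this, min_sub_sub_right]
      have : 0 ≤ min s x - a := sub_nonneg.2 (le_min hs.1 hx.1)
      simp [max_eq_left this, mul_comm]
    · simp [indicator, hy.supp s hs]
  simp_rw [e2] at hsw
  rw [secondAnti, ← hsw, intervalIntegral.integral_of_le hx.1, ← integral_neg]
  exact setIntegral_congr_fun measurableSet_Ioc fun t ht => by simp only [e1 t ht, neg_neg]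

theorem en_eq_integral_pot (hμ : 0 < μ) {v w : ℝ → ℝ} (hv : Adm a b v) (hw : Adm a b w) :
    en μ v w = ∫ x, v x * pot μ w x :=
  bil_eq_iterated hv hw (integrableOn_ker hμ _)

theorem adm_indicator_pot (hμ : 0 < μ) (hab : a < b) {y : ℝ → ℝ} (hy : Adm a b y) :
    Adm a b ((Ioo a b).indicator (pot μ y)) := by
  obtain ⟨M, -, hM⟩ := pot_bounded hμ hab.le hy
  exact adm_indicator_of_bound ((measurable_pot hy).indicator measurableSet_Ioo)
    fun x hx => hM x (Ioo_subset_Icc_self hx)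

theorem integral_mul_indicator_Ioo {v f : ℝ → ℝ} (hv : Adm a b v) :
    ∫ x, v x * (Ioo a b).indicator f x = ∫ x, v x * f x := by
  have h : ∀ᵐ x : ℝ, x ∉ ({a, b} : Set ℝ) :=
    compl_mem_ae_iff.2 ((Set.toFinite {a, b}).measure_zero _)
  refine integral_congr_ae ?_
  filter_upwards [h] with x hx
  by_cases hx' : x ∈ Ioo a b
  · rw [indicator_of_mem hx']
  · have : x ∉ Icc a b := fun h => by
      simp only [mem_insert_iff, mem_singleton_iff, not_or] at hx
      exact hx' ⟨lt_of_le_of_ne h.1 (Ne.symm hx.1), lt_of_le_of_ne h.2 hx.2⟩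
    rw [hv.supp x this]; simp

/-- The characteristic function of an element is a piecewise polynomial. -/
theorem exists_pw_cell_indicator (N : ℕ) (m : Mesh a b K) (k : Fin K) :
    ∃ c : Coeff K N, pw m c = Pi.single k 1 :=
  exists_pw m (v := Pi.single k 1) fun j => by
    by_cases h : j = k
    · subst h; simp
    · simp [h]

theorem integral_cell_eq_zero_of_orthogonal (hab : a < b) {γ : ℝ → ℝ} (hγ : Adm a b γ)
    (h : ∀ w : Coeff K N, ∫ x, fn m w x * γ x = 0) (k : Fin K) :
    ∫ x in (m.lo k)..(m.hi k), γ x = 0 := by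
  obtain ⟨c, hc⟩ := exists_pw_cell_indicator N m k
  have := h c
  rw [integral_fn_mul m hab c hγ, hc, Finset.sum_eq_single k] at this
  · simpa using this
  · intro j _ hj
    simp [hj]
  · simp

end

section

variable {a b : ℝ} {K N : ℕ} {μ : ℝ} {m : Mesh a b K}

theorem HolderHalf.congr {L : ℝ} {Ψ Φ : ℝ → ℝ} (h : HolderHalf a b L Ψ)
    (he : ∀ x ∈ Icc a b, Φ x = Ψ x) : HolderHalf a b L Φ where
  cont := h.cont.congr he
  bound x hx := by rw [he x hx]; exact h.bound x hx
  holder x hx y hy := by rw [he x hx, he y hy]; exact h.holder x hx y hy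

/-- The coefficients `d` define a function of size `δ` in the maximum norm and in the dual of the
energy norm. -/
structure SmallDual (μ δ : ℝ) (m : Mesh a b K) (d : Coeff K N) : Prop where
  dual : ∀ w, Adm a b w → (∫ x, fn m d x * w x) ^ 2 ≤ δ ^ 2 * en μ w w
  sup : ∀ k, ‖d k‖ ≤ δ

theorem SmallDual.mono {δ δ' : ℝ} {d : Coeff K N} (h : SmallDual μ δ m d) (h0 : 0 ≤ δ)
    (hδ : δ ≤ δ') (hμ : 0 < μ) (hμ1 : μ < 1) : SmallDual μ δ' m d where
  dual w hw := (h.dual w hw).trans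
    (mul_le_mul_of_nonneg_right (pow_le_pow_left₀ h0 hδ 2) (en_nonneg hμ hμ1 hw))
  sup k := (h.sup k).trans hδ

theorem proj_smallDual (N : ℕ) (hμ : 0 < μ) (hμ1 : μ < 1) (hab : a < b) :
    ∃ C : ℝ, 0 < C ∧ ∀ (K : ℕ) (m : Mesh a b K) (e : Option Bool) (Ψ : ℝ → ℝ) (L : ℝ), 0 ≤ L →
      HolderHalf a b L Ψ → SmallDual μ (C * L) m (proj m N e Ψ) := by
  obtain ⟨C, hC, h⟩ := proj_holderHalf N hμ hμ1 hab
  refine ⟨1 + C, by positivity, fun K m e Ψ L hL hΨ => ⟨fun w hw => ?_, fun k => ?_⟩⟩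
  · refine ((h K m e Ψ L hL hΨ).1 w hw).trans
      (mul_le_mul_of_nonneg_right ?_ (en_nonneg hμ hμ1 hw))
    rw [mul_pow]
    exact mul_le_mul_of_nonneg_right (by nlinarith) (sq_nonneg L)
  · refine ((h K m e Ψ L hL hΨ).2 k).trans (mul_le_mul_of_nonneg_right (by linarith) hL)

/-- The projection for which the discrete derivative is the Gauss-Radau projection of `f'`. -/
def ritz (m : Mesh a b K) (N : ℕ) (f' : ℝ → ℝ) : Coeff K N :=
  invMinus m (proj m N (some false) f')

theorem ritz_defect (N : ℕ) (hμ : 0 < μ) (hμ1 : μ < 1) (hab : a < b) :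
    ∃ C : ℝ, 0 < C ∧ ∀ (K : ℕ) (m : Mesh a b K) (f : ℕ → ℝ → ℝ) (R : ℝ), 0 ≤ R →
      DerivChain (N + 2) a b f → (∀ x ∈ Icc a b, |f (N + 2) x| ≤ R) → f 0 a = 0 →
      SmallDual μ (C * (R * m.size ^ (N + 1))) m
        (ritz m N (f 1) - proj m N (some true) (f 0)) := by
  obtain ⟨C1, hC1, h1⟩ := abs_proj_sub_le N
  obtain ⟨C2, hC2, h2⟩ := proj_smallDual N hμ hμ1 hab
  have hba : 0 < b - a := sub_pos.2 hab
  refine ⟨C2 * ((1 + (b - a)) * ((1 + (b - a)) * C1)), by positivity,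
    fun K m f R hR hf hfR h0 => ?_⟩
  set p := proj m N (some false) (f 1) with hp
  set δ := R * m.size ^ (N + 1) with hδ
  have hδ0 : 0 ≤ δ := mul_nonneg hR (pow_nonneg (m.size_pos hab).le _)
  have hf1 := hf.continuousOn (j := 1) (by omega)
  have hf0 := hf.continuousOn (j := 0) (by omega)
  have hv := (adm_fn m p).sub (adm_indicator hf1)
  have hbd : ∀ k, ∀ x ∈ Ioo (m.lo k) (m.hi k),
      |fn m p x - (Ioo a b).indicator (f 1) x| ≤ C1 * δ := fun k x hx => by
    rw [fn_of_mem m p hx, indicator_of_mem (m.Ioo_subset k hx)]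
    exact h1 m (some false) (fun j => f (j + 1)) R hf.shift hfR k x (Ioo_subset_Icc_self hx)
  have hG := HolderHalf.primitive hab hv (δ := (1 + (b - a)) * (C1 * δ)) (by positivity) (by
    refine (integral_sq_le_of_bound hab hv hbd).trans ?_
    rw [mul_pow (1 + (b - a))]
    exact mul_le_mul_of_nonneg_right (by nlinarith) (sq_nonneg _))
  have hFl : HolderHalf a b ((1 + (b - a)) * ((1 + (b - a)) * (C1 * δ)))
      fun x => (∫ s in a..x, fn m p s) + (-1) * f 0 x := by
    refine hG.congr fun x hx => ?_
    have hftc : ∫ t in a..x, f 1 t = f 0 x - f 0 a := by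
      refine intervalIntegral.integral_eq_sub_of_hasDerivAt_of_le hx.1
        (hf0.mono (Icc_subset_Icc_right hx.2)) (fun t ht => ?_) ?_
      · have hd := hf 0 (by omega) t ⟨ht.1.le, ht.2.le.trans hx.2⟩
        exact hd.hasDerivAt (Icc_mem_nhds ht.1 (ht.2.trans_le hx.2))
      · refine ContinuousOn.intervalIntegrable ?_
        rw [uIcc_of_le hx.1]
        exact hf1.mono (Icc_subset_Icc_right hx.2)
    rw [intervalIntegral.integral_sub ((adm_fn m p).intervalIntegrable _ _)
      ((adm_indicator hf1).intervalIntegrable _ _),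
      integral_indicator_of_le (left_mem_Icc.2 hab.le) hx, hftc, h0]
    ring
  have e : ritz m N (f 1) - proj m N (some true) (f 0)
      = proj m N (some true) fun x => (∫ s in a..x, fn m p s) + (-1) * f 0 x := by
    rw [proj_add (g := fun x => -1 * f 0 x) _ ((adm_fn m p).continuous_primitive a).continuousOn
      (continuousOn_const.mul hf0), proj_smul, neg_one_smul, ← sub_eq_add_neg]
    rfl
  rw [e]
  convert h2 K m (some true) _ _ (by positivity) hFl using 1
  ring

theorem one_le_size_rpow (hμ : 0 < μ) (hab : a < b) (m : Mesh a b K) :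
    1 ≤ (b - a) ^ μ * m.size ^ (-μ) := by
  have hs := m.size_pos hab
  rw [Real.rpow_neg hs.le, ← div_eq_mul_inv, one_le_div (Real.rpow_pos_of_pos hs _)]
  exact Real.rpow_le_rpow hs.le (m.size_le hab) hμ.le

theorem defect_pairing (N : ℕ) (hμ : 0 < μ) (hμ1 : μ < 1) (hab : a < b) :
    ∃ C : ℝ, 0 < C ∧ ∀ (K : ℕ) (m : Mesh a b K) (f : ℕ → ℝ → ℝ) (R : ℝ), 0 ≤ R →
      DerivChain (N + 2) a b f → (∀ x ∈ Icc a b, |f (N + 1) x| ≤ R) →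
      (∀ x ∈ Icc a b, |f (N + 2) x| ≤ R) → f 0 a = 0 → ∀ w, Adm a b w →
      (∫ x, fn m (ritz m N (f 1) - proj m N none (f 0)) x * w x) ^ 2
        ≤ C * (R * m.size ^ (N + 1)) ^ 2 * m.size ^ (-μ) * en μ w w := by
  obtain ⟨C1, hC1, h1⟩ := ritz_defect N hμ hμ1 hab
  obtain ⟨C2, hC2, h2⟩ := proj_error_pairing N hμ hμ1 hab
  have hba : 0 < b - a := sub_pos.2 hab
  have hB := Real.rpow_pos_of_pos hba μ
  refine ⟨3 * (C1 ^ 2 * (b - a) ^ μ) + 6 * C2, by positivity, fun K m f R hR hf hR1 hR2 h0 w hw => ?_⟩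
  set δ := R * m.size ^ (N + 1) with hδ
  have hen := en_nonneg hμ hμ1 hw
  have hs := Real.rpow_pos_of_pos (m.size_pos hab) (-μ)
  set d := ritz m N (f 1) - proj m N (some true) (f 0) with hd
  have e1 := (h1 K m f R hR hf hR2 h0).dual w hw
  have e2 := fun e => h2 K m e f R hR (hf.mono (by omega) Subset.rfl) hR1 w hw
  have hf0 := hf.continuousOn (j := 0) (by omega)
  have e3 : ∫ x, fn m (ritz m N (f 1) - proj m N none (f 0)) x * w x
      = (∫ x, fn m d x * w x) + (∫ x, fn m (proj m N (some true) (f 0)) x * w x)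
        - ∫ x, fn m (proj m N none (f 0)) x * w x := by
    have : ritz m N (f 1) - proj m N none (f 0)
        = d + (proj m N (some true) (f 0) + (-1 : ℝ) • proj m N none (f 0)) := by
      rw [hd, neg_one_smul]; abel
    rw [this, fn_add, fn_add, fn_smul]
    have i1 := ((adm_fn m d).mul hw).integrable
    have i2 := ((adm_fn m (proj m N (some true) (f 0))).mul hw).integrable
    have i3 := ((adm_fn m (proj m N none (f 0))).mul hw).integrable
    rw [← integral_add i1 i2, ← integral_sub (f := fun x => fn m d x * w x
      + fn m (proj m N (some true) (f 0)) x * w x) (i1.add i2) i3]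
    congr 1; ext x
    simp only [Pi.add_apply, Pi.smul_apply, smul_eq_mul]; ring
  rw [e3, integral_fn_mul_eq_add m hab (proj m N (some true) (f 0)) hf0 hw,
    integral_fn_mul_eq_add m hab (proj m N none (f 0)) hf0 hw]
  rw [← hd, ← hδ] at e1
  simp only [← hδ] at e2
  have e4 := e2 none
  have e5 := e2 (some true)
  generalize (∑ k, ∫ x in (m.lo k)..(m.hi k),
    ((pw m (proj m N none (f 0)) k).eval x - f 0 x) * w x) = X at e4 ⊢
  generalize (∑ k, ∫ x in (m.lo k)..(m.hi k),
    ((pw m (proj m N (some true) (f 0)) k).eval x - f 0 x) * w x) = Y at e5 ⊢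
  generalize (∫ x, fn m d x * w x) = Z at e1 ⊢
  have e6 : (C1 * δ) ^ 2 * en μ w w
      ≤ C1 ^ 2 * (b - a) ^ μ * δ ^ 2 * m.size ^ (-μ) * en μ w w := by
    have := mul_le_mul_of_nonneg_left (one_le_size_rpow hμ hab m)
      (show 0 ≤ C1 ^ 2 * δ ^ 2 * en μ w w by positivity)
    linarith
  calc (Z + (Y + ∫ x in a..b, f 0 x * w x) - (X + ∫ x in a..b, f 0 x * w x)) ^ 2
      = (Z + Y - X) ^ 2 := by ring
    _ ≤ 3 * (Z ^ 2 + Y ^ 2 + X ^ 2) := by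
      nlinarith [sq_nonneg (Z - Y), sq_nonneg (Z + X), sq_nonneg (Y + X)]
    _ ≤ _ := by linarith

theorem defect_sup (N : ℕ) (hμ : 0 < μ) (hμ1 : μ < 1) (hab : a < b) :
    ∃ C : ℝ, 0 < C ∧ ∀ (K : ℕ) (m : Mesh a b K) (f : ℕ → ℝ → ℝ) (R : ℝ), 0 ≤ R →
      DerivChain (N + 2) a b f → (∀ x ∈ Icc a b, |f (N + 1) x| ≤ R) →
      (∀ x ∈ Icc a b, |f (N + 2) x| ≤ R) → f 0 a = 0 → ∀ k, ∀ x ∈ Icc (m.lo k) (m.hi k),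
      |(pw m (ritz m N (f 1)) k).eval x - f 0 x| ≤ C * (R * m.size ^ (N + 1)) ∧
      |(pw m (ritz m N (f 1) - proj m N none (f 0)) k).eval x| ≤ C * (R * m.size ^ (N + 1)) := by
  obtain ⟨C1, hC1, h1⟩ := ritz_defect N hμ hμ1 hab
  obtain ⟨C2, hC2, h2⟩ := abs_proj_sub_le N
  refine ⟨(N + 1) * C1 + 2 * C2, by positivity, fun K m f R hR hf hR1 hR2 h0 k x hx => ?_⟩
  set δ := R * m.size ^ (N + 1) with hδ
  have hδ0 : 0 ≤ δ := mul_nonneg hR (pow_nonneg (m.size_pos hab).le _)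
  have e1 := (abs_pw_eval_le m _ hx).trans
    (mul_le_mul_of_nonneg_left ((h1 K m f R hR hf hR2 h0).sup k) (by positivity : (0:ℝ) ≤ N + 1))
  rw [← hδ] at e1
  have e2 : ∀ e, |(pw m (proj m N e (f 0)) k).eval x - f 0 x| ≤ C2 * δ := fun e =>
    h2 m e f R (hf.mono (by omega) Subset.rfl) hR1 k x hx
  have e3 := e2 none
  have e4 := e2 (some true)
  have hC1δ : 0 ≤ C2 * δ := by positivity
  simp only [map_sub, Pi.sub_apply, Polynomial.eval_sub] at e1 ⊢
  rw [abs_le] at e1 e3 e4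
  constructor <;> rw [abs_le] <;> constructor <;> linarith

theorem static_energy (N : ℕ) (hμ : 0 < μ) (hμ1 : μ < 1) (hab : a < b) :
    ∃ C : ℝ, 0 < C ∧ ∀ (K : ℕ) (m : Mesh a b K) (z y : Coeff K N) (δ : ℝ), 0 ≤ δ →
      (∀ w, af hμ m y w = ip m z w) →
      (∀ w, Adm a b w → (∫ x, fn m z x * w x) ^ 2 ≤ δ ^ 2 * m.size ^ (-μ) * en μ w w) →
      (∀ k, ∀ x ∈ Icc (m.lo k) (m.hi k), |(pw m z k).eval x| ≤ δ) →
      af hμ m y y ≤ δ ^ 2 * m.size ^ (-μ) ∧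
      ∫ x in Ioo a b, pot μ (fn m y) x ^ 2 ≤ (C * δ) ^ 2 := by
  have hba : 0 < b - a := sub_pos.2 hab
  set A := ((1 - μ) * (2 - μ)) * (1 / μ + 4 / (2 - μ)) with hA
  have hA0 : 0 < A := by
    have : 0 < 1 - μ := by linarith
    have : 0 < 2 - μ := by linarith
    positivity
  refine ⟨1 + 2 * (A + (b - a)), by positivity, fun K m z y δ hδ hy hz hsup => ?_⟩
  have hs := Real.rpow_pos_of_pos (m.size_pos hab) (-μ)
  have hyA := adm_fn m y
  have hen : 0 ≤ af hμ m y y := en_nonneg hμ hμ1 hyA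
  have h1 : af hμ m y y ≤ δ ^ 2 * m.size ^ (-μ) := by
    have := hz _ hyA
    rw [← ip_apply, ← hy, ← af_apply hμ] at this
    rcases hen.eq_or_lt with h0 | h0
    · rw [← h0]; positivity
    · rw [sq] at this; exact le_of_mul_le_mul_right this h0
  refine ⟨h1, ?_⟩
  have hpA := adm_indicator_pot hμ hab hyA
  set P := (Ioo a b).indicator (pot μ (fn m y)) with hP
  have hzA := adm_fn m z
  have hγ := hpA.sub hzA
  set γ : ℝ → ℝ := fun x => P x - fn m z x with hγd
  have horth : ∀ w : Coeff K N, ∫ x, fn m w x * γ x = 0 := fun w => by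
    have e : ∫ x, fn m w x * γ x = (∫ x, fn m w x * P x) - ∫ x, fn m w x * fn m z x := by
      rw [← integral_sub ((adm_fn m w).mul hpA).integrable ((adm_fn m w).mul hzA).integrable]
      simp only [hγd, mul_sub]
    rw [e, hP, integral_mul_indicator_Ioo (adm_fn m w), ← en_eq_integral_pot hμ (adm_fn m w) hyA,
      ← af_apply hμ, ← ip_apply, af_comm, hy, ip_comm, sub_self]
  have hmean := integral_cell_eq_zero_of_orthogonal hab hγ horth
  have hγen := en_le_of_mean_zero hμ hμ1 hab m hγ hmean
  have hγsq : ∫ x, γ x ^ 2 = en μ γ (fn m y) := by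
    have e : ∫ x, γ x ^ 2 = (∫ x, γ x * P x) - ∫ x, fn m z x * γ x := by
      rw [← integral_sub (hγ.mul hpA).integrable (hzA.mul hγ).integrable]
      congr 1; ext x; simp only [hγd]; ring
    rw [e, horth, sub_zero, hP, integral_mul_indicator_Ioo hγ, en_eq_integral_pot hμ hγ hyA]
  have hγ0 : 0 ≤ ∫ x, γ x ^ 2 := integral_nonneg fun _ => sq_nonneg _
  have hγle : ∫ x, γ x ^ 2 ≤ A * δ ^ 2 := by
    have hcs := en_sq_le hμ hμ1 hγ hyA
    rw [← hγsq] at hcs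
    have e1 : en μ γ γ * en μ (fn m y) (fn m y)
        ≤ (A * m.size ^ μ * ∫ x, γ x ^ 2) * (δ ^ 2 * m.size ^ (-μ)) :=
      mul_le_mul hγen h1 hen ((en_nonneg hμ hμ1 hγ).trans hγen)
    have e2 : (A * m.size ^ μ * ∫ x, γ x ^ 2) * (δ ^ 2 * m.size ^ (-μ))
        = A * δ ^ 2 * ∫ x, γ x ^ 2 := by
      have : m.size ^ μ * m.size ^ (-μ) = 1 := by
        rw [← Real.rpow_add (m.size_pos hab), add_neg_cancel, Real.rpow_zero]
      linear_combination (A * δ ^ 2 * ∫ x, γ x ^ 2) * this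
    rcases hγ0.eq_or_lt with h0 | h0
    · rw [← h0]; positivity
    · exact le_of_mul_le_mul_right (by nlinarith) h0
  have hz2 := integral_sq_le_of_bound hab hzA (M := δ) (m := m) fun k x hx => by
    rw [fn_of_mem m z hx]; exact hsup k x (Ioo_subset_Icc_self hx)
  have e3 : ∫ x in Ioo a b, pot μ (fn m y) x ^ 2 = ∫ x, P x ^ 2 := by
    rw [← integral_indicator measurableSet_Ioo]
    congr 1; ext x
    by_cases h : x ∈ Ioo a b <;> simp [hP, h]
  rw [e3]
  calc ∫ x, P x ^ 2 ≤ ∫ x, (2 * γ x ^ 2 + 2 * fn m z x ^ 2) := by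
        refine integral_mono hpA.sq.integrable
          ((hγ.sq.integrable.const_mul 2).add (hzA.sq.integrable.const_mul 2)) fun x => ?_
        have : P x = γ x + fn m z x := by simp [hγd]
        simp only [this]
        nlinarith [sq_nonneg (γ x - fn m z x)]
    _ = 2 * (∫ x, γ x ^ 2) + 2 * ∫ x, fn m z x ^ 2 := by
        rw [integral_add (hγ.sq.integrable.const_mul 2) (hzA.sq.integrable.const_mul 2),
          integral_const_mul, integral_const_mul]
    _ ≤ 2 * (A * δ ^ 2) + 2 * ((b - a) * δ ^ 2) := by gcongr
    _ ≤ _ := by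
        rw [mul_pow]
        have : 0 ≤ δ ^ 2 := sq_nonneg _
        have h3 : 2 * (A + (b - a)) ≤ (1 + 2 * (A + (b - a))) ^ 2 := by
          have : 0 < A + (b - a) := by positivity
          nlinarith
        nlinarith

theorem double_primitive_smallDual (N : ℕ) (hμ : 0 < μ) (hμ1 : μ < 1) (hab : a < b) :
    ∃ C : ℝ, 0 < C ∧ ∀ (K : ℕ) (m : Mesh a b K) (y : Coeff K N) (δ : ℝ), 0 ≤ δ →
      af hμ m y y ≤ δ ^ 2 * m.size ^ (-μ) →
      ∫ x in Ioo a b, pot μ (fn m y) x ^ 2 ≤ δ ^ 2 →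
      SmallDual μ (C * δ) m (invMinus m (invPlus m y)) := by
  obtain ⟨C1, hC1, h1⟩ := secondAnti_bound hμ hμ1 hab
  obtain ⟨C2, hC2, h2⟩ := inverse_estimate N hμ hμ1 hab
  obtain ⟨C3, hC3, h3⟩ := proj_error N
  obtain ⟨C4, hC4, h4⟩ := proj_smallDual N hμ hμ1 hab
  have hba : 0 < b - a := sub_pos.2 hab
  have hB := Real.rpow_pos_of_pos hba (2 - μ - μ)
  set D := (C3 * (N + 1)) ^ 2 * (C2 * (b - a) ^ (2 - μ - μ)) with hD
  refine ⟨C4 * (C1 + (1 + (b - a)) * (1 + D)), by positivity, fun K m y δ hδ hy hpot => ?_⟩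
  have hyA := adm_fn m y
  set Z : ℝ → ℝ := fun x => ∫ s in b..x, fn m y s with hZ
  have hZc : Continuous Z := hyA.continuous_primitive b
  set p := invPlus m y with hp
  have hpe : p = proj m N (some false) Z := rfl
  have hZlip : ∀ k, ∀ x ∈ Icc (m.lo k) (m.hi k), ∀ t ∈ Icc (m.lo k) (m.hi k),
      |Z x - Z t| ≤ (N + 1) * ‖y k‖ * |x - t| := fun k x hx t ht => by
    simp only [hZ]
    rw [intervalIntegral.integral_interval_sub_left (hyA.intervalIntegrable _ _)
      (hyA.intervalIntegrable _ _)]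
    wlog htx : t ≤ x generalizing x t
    · have := this t ht x hx (le_of_not_ge htx)
      rwa [intervalIntegral.integral_symm, abs_neg, abs_sub_comm] at this
    rw [intervalIntegral.integral_of_le htx, integral_Ioc_eq_integral_Ioo]
    have := norm_setIntegral_le_of_norm_le_const (μ := volume) (s := Ioo t x) (f := fn m y)
      (C := (N + 1) * ‖y k‖) (by simp) fun s hs => by
        have hs' : s ∈ Ioo (m.lo k) (m.hi k) := ⟨ht.1.trans_lt hs.1, hs.2.trans_le hx.2⟩
        rw [fn_of_mem m y hs']
        exact abs_pw_eval_le m y (Ioo_subset_Icc_self hs')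
    rw [abs_of_nonneg (sub_nonneg.2 htx)]
    simpa [max_eq_left (sub_nonneg.2 htx)] using this
  have hZA := adm_indicator (a := a) (b := b) hZc.continuousOn
  have hv := (adm_fn m p).sub hZA
  have hbd : ∀ k, ∀ x ∈ Ioo (m.lo k) (m.hi k), |fn m p x - (Ioo a b).indicator Z x|
      ≤ C3 * ((N + 1) * ‖y k‖ * (m.hi k - m.lo k)) := fun k x hx => by
    rw [fn_of_mem m p hx, indicator_of_mem (m.Ioo_subset k hx), hpe]
    refine (h3 m (some false) Z k (Polynomial.C (Z (m.lo k))) _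
      ((N + 1) * ‖y k‖ * √(m.hi k - m.lo k)) (by simp) hZc.continuousOn
      (fun t ht => ?_) (fun t ht t' ht' => ?_)).1 x (Ioo_subset_Icc_self hx)
    · rw [Polynomial.eval_C]
      refine (hZlip k t ht _ (left_mem_Icc.2 (m.lo_lt_hi k).le)).trans ?_
      gcongr
      rw [abs_of_nonneg (by linarith [ht.1])]
      linarith [ht.2]
    · simp only [Polynomial.eval_C, sub_sub_sub_cancel_right]
      refine (hZlip k t ht t' ht').trans ?_
      rw [mul_assoc _ (Real.sqrt _)]
      exact mul_le_mul_of_nonneg_left (abs_sub_le_sqrt_mul ht ht') (by positivity)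
  have hsq : ∫ x, (fn m p x - (Ioo a b).indicator Z x) ^ 2 ≤ ((1 + D) * δ) ^ 2 := by
    refine (integral_sq_le_of_cells hab hv hbd).trans ?_
    have e1 : ∀ k, (m.hi k - m.lo k) * (C3 * ((N + 1) * ‖y k‖ * (m.hi k - m.lo k))) ^ 2
        ≤ (C3 * (N + 1)) ^ 2 * m.size ^ (2 - μ) * ((m.hi k - m.lo k) ^ (μ + 1) * ‖y k‖ ^ 2) :=
        fun k => by
      have : (m.hi k - m.lo k) * (m.hi k - m.lo k) ^ 2
          = (m.hi k - m.lo k) ^ (2 - μ) * (m.hi k - m.lo k) ^ (μ + 1) := by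
        rw [← Real.rpow_add (m.len_pos k), show (2 - μ + (μ + 1) : ℝ) = ((3 : ℕ) : ℝ) by push_cast; ring,
          Real.rpow_natCast]
        ring
      calc _ = (C3 * (N + 1)) ^ 2 * ‖y k‖ ^ 2 * ((m.hi k - m.lo k) * (m.hi k - m.lo k) ^ 2) := by
            ring
        _ = (C3 * (N + 1)) ^ 2 * (m.hi k - m.lo k) ^ (2 - μ)
            * ((m.hi k - m.lo k) ^ (μ + 1) * ‖y k‖ ^ 2) := by rw [this]; ring
        _ ≤ _ := by
            have h5 := Real.rpow_le_rpow (m.len_pos k).le (m.len_le_size k)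
              (by linarith : (0:ℝ) ≤ 2 - μ)
            have h6 := Real.rpow_nonneg (m.len_pos k).le (μ + 1)
            gcongr
    have hs := m.size_pos hab
    have hs2 := Real.rpow_pos_of_pos hs (2 - μ)
    calc _ ≤ ∑ k, (C3 * (N + 1)) ^ 2 * m.size ^ (2 - μ)
            * ((m.hi k - m.lo k) ^ (μ + 1) * ‖y k‖ ^ 2) := Finset.sum_le_sum fun k _ => e1 k
      _ = (C3 * (N + 1)) ^ 2 * m.size ^ (2 - μ)
            * ∑ k, (m.hi k - m.lo k) ^ (μ + 1) * ‖y k‖ ^ 2 := by rw [Finset.mul_sum]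
      _ ≤ (C3 * (N + 1)) ^ 2 * m.size ^ (2 - μ) * (C2 * (δ ^ 2 * m.size ^ (-μ))) := by
          have := (h2 K m y).trans (mul_le_mul_of_nonneg_left hy hC2.le)
          gcongr
      _ = (C3 * (N + 1)) ^ 2 * (C2 * (m.size ^ (2 - μ - μ))) * δ ^ 2 := by
          rw [sub_eq_add_neg (2 - μ) μ, Real.rpow_add hs]; ring
      _ ≤ D * δ ^ 2 := by
          have := Real.rpow_le_rpow hs.le (m.size_le hab) (by linarith : (0:ℝ) ≤ 2 - μ - μ)
          rw [hD]
          gcongr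
      _ ≤ _ := by
          have : 0 ≤ D := by positivity
          rw [mul_pow]
          exact mul_le_mul_of_nonneg_right (by nlinarith) (sq_nonneg _)
  have hH1 := HolderHalf.primitive hab hv (δ := (1 + D) * δ) (by positivity) hsq
  have hY := h1 (fn m y) hyA δ hδ hpot
  have hH2 := HolderHalf.of_bounds (by positivity) hY.1 hY.2
  have hH := (hH2.add (by positivity) hH1 (by positivity)).congr
    (Φ := fun x => ∫ s in a..x, fn m p s) fun x hx => by
      rw [intervalIntegral.integral_sub ((adm_fn m p).intervalIntegrable _ _)
        (hZA.intervalIntegrable _ _), integral_indicator_of_le (left_mem_Icc.2 hab.le) hx,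
        secondAnti_eq_integral hyA hx]
      ring
  have := h4 K m (some true) _ _ (by positivity) hH
  rw [invMinus_apply]
  convert this using 1
  ring

end

section

variable {a b : ℝ} {K N : ℕ} {μ : ℝ} {m : Mesh a b K}

/-- The correction generated by the consistency error of the Ritz projection is small. -/
theorem correction_smallDual (N : ℕ) (hμ : 0 < μ) (hμ1 : μ < 1) (hab : a < b) :
    ∃ C : ℝ, 0 < C ∧ ∀ (K : ℕ) (m : Mesh a b K) (f : ℕ → ℝ → ℝ) (R : ℝ), 0 ≤ R →
      DerivChain (N + 2) a b f → (∀ x ∈ Icc a b, |f (N + 1) x| ≤ R) →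
      (∀ x ∈ Icc a b, |f (N + 2) x| ≤ R) → f 0 a = 0 → ∀ y : Coeff K N,
      (∀ w, af hμ m y w = ip m (ritz m N (f 1) - proj m N none (f 0)) w) →
      SmallDual μ (C * (R * m.size ^ (N + 1))) m (invMinus m (invPlus m y)) := by
  obtain ⟨C1, hC1, h1⟩ := defect_pairing N hμ hμ1 hab
  obtain ⟨C2, hC2, h2⟩ := defect_sup N hμ hμ1 hab
  obtain ⟨C3, hC3, h3⟩ := static_energy N hμ hμ1 hab
  obtain ⟨C4, hC4, h4⟩ := double_primitive_smallDual N hμ hμ1 hab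
  set D := 1 + C1 + C2 with hD
  have hD0 : 0 < D := by positivity
  refine ⟨C4 * ((1 + C3) * D), by positivity, fun K m f R hR hf hR1 hR2 h0 y hy => ?_⟩
  set δ := R * m.size ^ (N + 1) with hδ
  have hδ0 : 0 ≤ δ := mul_nonneg hR (pow_nonneg (m.size_pos hab).le _)
  have hs := Real.rpow_pos_of_pos (m.size_pos hab) (-μ)
  have e := h3 K m _ y (D * δ) (by positivity) hy
    (fun w hw => by
      refine (h1 K m f R hR hf hR1 hR2 h0 w hw).trans ?_
      have hen := en_nonneg hμ hμ1 hw
      have : C1 * δ ^ 2 ≤ (D * δ) ^ 2 := by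
        rw [mul_pow D δ]
        have h5 : C1 ≤ D ^ 2 := by rw [hD]; nlinarith [mul_pos hC1 hC2]
        exact mul_le_mul_of_nonneg_right h5 (sq_nonneg _)
      rw [← hδ]
      gcongr)
    (fun k x hx => by
      refine (h2 K m f R hR hf hR1 hR2 h0 k x hx).2.trans ?_
      exact mul_le_mul_of_nonneg_right (by rw [hD]; linarith) hδ0)
  have := h4 K m y ((1 + C3) * (D * δ)) (by positivity)
    (e.1.trans (by
      have : D * δ ≤ (1 + C3) * (D * δ) := by nlinarith [mul_nonneg hD0.le hδ0]
      gcongr))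
    (e.2.trans (by
      have : 0 ≤ D * δ := by positivity
      gcongr
      linarith))
  convert this using 1
  ring

/-- Functions of time and space, indexed by the orders of differentiation. -/
abbrev Jet : Type := ℕ → ℕ → ℝ → ℝ → ℝ

/-- A family of functions on a cylinder, where the indices count time and space derivatives. -/
structure SmoothFamily (n : ℕ) (a b T R : ℝ) (v : Jet) : Prop where
  dt : ∀ i j, i + j < n → ∀ t ∈ Icc 0 T, ∀ x ∈ Icc a b,
    HasDerivWithinAt (fun τ => v i j τ x) (v (i + 1) j t x) (Icc 0 T) t
  dx : ∀ i j, i + j < n → ∀ t ∈ Icc 0 T, ∀ x ∈ Icc a b,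
    HasDerivWithinAt (fun z => v i j t z) (v i (j + 1) t x) (Icc a b) x
  bound : ∀ i j, i + j ≤ n → ∀ t ∈ Icc 0 T, ∀ x ∈ Icc a b, |v i j t x| ≤ R

section DirectionalDerivatives

variable {F : Type*} [NormedAddCommGroup F] [NormedSpace ℝ F] {E : Type*} [NormedAddCommGroup E]
  [NormedSpace ℝ E] {S : Set E}

/-- The directional derivative along `e` within `S`. -/
def dirDeriv (S : Set E) (e : E) (f : E → F) (y : E) : F := fderivWithin ℝ f S y e

theorem dirDeriv_congr {e : E} {f g : E → F} (h : ∀ y ∈ S, f y = g y) :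
    ∀ y ∈ S, dirDeriv S e f y = dirDeriv S e g y := fun y hy => by
  rw [dirDeriv, dirDeriv, fderivWithin_congr h (h y hy)]

theorem contDiffOn_dirDeriv (hS : UniqueDiffOn ℝ S) {n : ℕ} {f : E → F} (e : E)
    (hf : ContDiffOn ℝ (n + 1 : ℕ) f S) : ContDiffOn ℝ n (dirDeriv S e f) S :=
  (hf.fderivWithin hS (by norm_cast)).clm_apply contDiffOn_const

theorem dirDeriv_comm (hS : UniqueDiffOn ℝ S) (hS' : S ⊆ closure (interior S)) {f : E → F}
    (hf : ContDiffOn ℝ 2 f S) (e e' : E) :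
    ∀ y ∈ S, dirDeriv S e (dirDeriv S e' f) y = dirDeriv S e' (dirDeriv S e f) y := by
  have key : ∀ e e' : E, ∀ y ∈ S, dirDeriv S e (dirDeriv S e' f) y
      = fderivWithin ℝ (fderivWithin ℝ f S) S y e e' := fun e e' y hy => by
    have hd : DifferentiableWithinAt ℝ (fderivWithin ℝ f S) S y :=
      (hf.fderivWithin hS (m := 1) (by norm_num)).differentiableOn (by norm_num) y hy
    have := (hd.hasFDerivWithinAt.clm_apply (hasFDerivWithinAt_const e' y S)).fderivWithin (hS y hy)
    unfold dirDeriv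
    rw [this]
    simp
  intro y hy
  rw [key e e' y hy, key e' e y hy]
  exact (hf y hy).isSymmSndFDerivWithinAt (by simp) hS (hS' hy) hy e e'

theorem dirDeriv_iterate_comm (hS : UniqueDiffOn ℝ S) (hS' : S ⊆ closure (interior S)) {n : ℕ}
    (e e' : E) (i : ℕ) {f : E → F} (hf : ContDiffOn ℝ n f S) (hi : i < n) :
    ∀ y ∈ S, dirDeriv S e' ((dirDeriv S e)^[i] f) y = (dirDeriv S e)^[i] (dirDeriv S e' f) y := by
  induction i generalizing f n with
  | zero => exact fun y _ => rfl
  | succ i ih =>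
    obtain ⟨n, rfl⟩ : ∃ k, n = k + 1 := ⟨n - 1, by omega⟩
    intro y hy
    rw [Function.iterate_succ_apply, Function.iterate_succ_apply,
      ih (contDiffOn_dirDeriv hS e hf) (by omega) y hy]
    have hcomm := dirDeriv_comm hS hS' (hf.of_le (by norm_cast; omega)) e' e
    have hgen : ∀ (j : ℕ) (g h : E → F), (∀ y ∈ S, g y = h y) →
        ∀ y ∈ S, (dirDeriv S e)^[j] g y = (dirDeriv S e)^[j] h y := fun j => by
      induction j with
      | zero => exact fun g h hgh => hgh
      | succ j ihj =>
        intro g h hgh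
        rw [Function.iterate_succ_apply, Function.iterate_succ_apply]
        exact ihj _ _ (dirDeriv_congr hgh)
    exact hgen i _ _ hcomm y hy

theorem contDiffOn_iterate_dirDeriv (hS : UniqueDiffOn ℝ S) (e : E) (i : ℕ) {n : ℕ} {f : E → F}
    (hf : ContDiffOn ℝ (n + i : ℕ) f S) : ContDiffOn ℝ n ((dirDeriv S e)^[i] f) S := by
  induction i generalizing f with
  | zero => exact hf
  | succ i ih =>
    rw [Function.iterate_succ_apply]
    exact ih (contDiffOn_dirDeriv hS e hf)

/-- `f` is a component of the derivative of order `n` of `u`, along directions in the unit ball. -/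
def IsComponent (u : E → F) (S : Set E) (n : ℕ) (f : E → F) : Prop :=
  ∃ vs : Fin n → E, (∀ i, ‖vs i‖ ≤ 1) ∧ ∀ y ∈ S, f y = iteratedFDerivWithin ℝ n u S y vs

theorem IsComponent.dirDeriv {u f : E → F} (hS : UniqueDiffOn ℝ S) {n M : ℕ}
    (hu : ContDiffOn ℝ M u S) (hn : n < M) (h : IsComponent u S n f) {e : E} (he : ‖e‖ ≤ 1) :
    IsComponent u S (n + 1) (dirDeriv S e f) := by
  obtain ⟨vs, hvs, hf⟩ := h
  refine ⟨Fin.cons e vs, fun i => Fin.cases he hvs i, fun y hy => ?_⟩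
  rw [dirDeriv_congr hf y hy, iteratedFDerivWithin_succ_apply_left]
  have hd := hu.differentiableOn_iteratedFDerivWithin (m := n) (by norm_cast) hS y hy
  have := (hd.hasFDerivWithinAt.continuousMultilinear_apply_const vs).fderivWithin (hS y hy)
  unfold FracLDG.dirDeriv
  rw [this]
  simp

theorem IsComponent.iterate {u f : E → F} (hS : UniqueDiffOn ℝ S) {n M : ℕ}
    (hu : ContDiffOn ℝ M u S) {e : E} (he : ‖e‖ ≤ 1) (i : ℕ) (hn : n + i ≤ M)
    (h : IsComponent u S n f) : IsComponent u S (n + i) ((FracLDG.dirDeriv S e)^[i] f) := by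
  induction i generalizing n f with
  | zero => exact h
  | succ i ih =>
    rw [Function.iterate_succ_apply, ← add_assoc, add_right_comm]
    exact ih (by omega) (h.dirDeriv hS hu (by omega) he)

theorem IsComponent.norm_le {u f : E → F} {n : ℕ} (h : IsComponent u S n f) {R : ℝ} {y : E}
    (hy : y ∈ S) (hR : ‖iteratedFDerivWithin ℝ n u S y‖ ≤ R) : ‖f y‖ ≤ R := by
  obtain ⟨vs, hvs, hf⟩ := h
  rw [hf y hy]
  refine ((iteratedFDerivWithin ℝ n u S y).le_opNorm vs).trans ?_
  refine (mul_le_of_le_one_right (norm_nonneg _) ?_).trans hR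
  exact Finset.prod_le_one (fun i _ => norm_nonneg _) fun i _ => hvs i

end DirectionalDerivatives

theorem cylinder_subset_closure_interior {T : ℝ} (hT : 0 < T) (hab : a < b) :
    Icc 0 T ×ˢ Icc a b ⊆ closure (interior (Icc 0 T ×ˢ Icc a b)) := by
  rw [interior_prod_eq, interior_Icc, interior_Icc, closure_prod_eq, closure_Ioo hT.ne,
    closure_Ioo hab.ne]

theorem uniqueDiffOn_cylinder {T : ℝ} (hT : 0 < T) (hab : a < b) :
    UniqueDiffOn ℝ (Icc 0 T ×ˢ Icc a b) :=
  (uniqueDiffOn_Icc hT).prod (uniqueDiffOn_Icc hab)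

/-- The mixed partial derivatives of a smooth function on a cylinder. -/
theorem exists_smoothFamily {n : ℕ} {T R : ℝ} (hT : 0 < T) (hab : a < b) {u : ℝ → ℝ → ℂ}
    (hu : BoundedSmooth n a b T R u) :
    ∃ v : ℕ → ℕ → ℝ → ℝ → ℂ, v 0 0 = u ∧
      (∀ i j, i + j < n → ∀ t ∈ Icc 0 T, ∀ x ∈ Icc a b,
        HasDerivWithinAt (fun τ => v i j τ x) (v (i + 1) j t x) (Icc 0 T) t) ∧
      (∀ i j, i + j < n → ∀ t ∈ Icc 0 T, ∀ x ∈ Icc a b,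
        HasDerivWithinAt (fun z => v i j t z) (v i (j + 1) t x) (Icc a b) x) ∧
      ∀ i j, i + j ≤ n → ∀ t ∈ Icc 0 T, ∀ x ∈ Icc a b, ‖v i j t x‖ ≤ R := by
  obtain ⟨hc, hR⟩ := hu
  set S := Icc 0 T ×ˢ Icc a b with hS
  have hSu := uniqueDiffOn_cylinder hT hab
  have hSc := cylinder_subset_closure_interior hT hab
  rw [← hS] at hSu hSc
  set U : ℝ × ℝ → ℂ := fun y => u y.1 y.2 with hU
  set e₁ : ℝ × ℝ := (1, 0) with he₁
  set e₂ : ℝ × ℝ := (0, 1) with he₂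
  have hn₁ : ‖e₁‖ ≤ 1 := by simp [he₁, Prod.norm_def]
  have hn₂ : ‖e₂‖ ≤ 1 := by simp [he₂, Prod.norm_def]
  set V : ℕ → ℕ → ℝ × ℝ → ℂ := fun i j => (dirDeriv S e₁)^[i] ((dirDeriv S e₂)^[j] U) with hV
  have hVc : ∀ i j, i + j ≤ n → ContDiffOn ℝ (n - i - j : ℕ) (V i j) S := fun i j hij =>
    contDiffOn_iterate_dirDeriv hSu e₁ i (contDiffOn_iterate_dirDeriv hSu e₂ j
      (hc.of_le (by norm_cast; omega)))
  have hVd : ∀ i j, i + j < n → DifferentiableOn ℝ (V i j) S := fun i j hij =>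
    (hVc i j hij.le).differentiableOn (by norm_cast; omega)
  have h1 : ∀ i j, ∀ y, dirDeriv S e₁ (V i j) y = V (i + 1) j y := fun i j y => by
    simp only [hV, Function.iterate_succ_apply']
  have h2 : ∀ i j, i + j < n → ∀ y ∈ S, dirDeriv S e₂ (V i j) y = V i (j + 1) y :=
      fun i j hij y hy => by
    simp only [hV]
    rw [dirDeriv_iterate_comm hSu hSc e₁ e₂ i (n := n - j)
      (contDiffOn_iterate_dirDeriv hSu e₂ j (hc.of_le (by norm_cast; omega))) (by omega) y hy,
      Function.iterate_succ_apply']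
  refine ⟨fun i j t x => V i j (t, x), rfl, fun i j hij t ht x hx => ?_, fun i j hij t ht x hx => ?_,
    fun i j hij t ht x hx => ?_⟩
  · have hd := (hVd i j hij (t, x) ⟨ht, hx⟩).hasFDerivWithinAt
    have hl : HasDerivWithinAt (fun τ : ℝ => (τ, x)) e₁ (Icc 0 T) t :=
      ((hasDerivAt_id t).prodMk (hasDerivAt_const t x)).hasDerivWithinAt
    have hm : MapsTo (fun τ : ℝ => (τ, x)) (Icc 0 T) S := fun τ hτ => ⟨hτ, hx⟩
    show HasDerivWithinAt _ (V (i + 1) j (t, x)) _ _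
    rw [← h1]
    exact HasFDerivWithinAt.comp_hasDerivWithinAt t hd hl hm
  · have hd := (hVd i j hij (t, x) ⟨ht, hx⟩).hasFDerivWithinAt
    have hl : HasDerivWithinAt (fun z : ℝ => (t, z)) e₂ (Icc a b) x :=
      ((hasDerivAt_const x t).prodMk (hasDerivAt_id x)).hasDerivWithinAt
    have hm : MapsTo (fun z : ℝ => (t, z)) (Icc a b) S := fun z hz => ⟨ht, hz⟩
    show HasDerivWithinAt _ (V i (j + 1) (t, x)) _ _
    rw [← h2 i j hij (t, x) ⟨ht, hx⟩]
    exact HasFDerivWithinAt.comp_hasDerivWithinAt x hd hl hm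
  · have h0 : IsComponent U S 0 U := ⟨Fin.elim0, fun i => i.elim0, fun y _ => by simp⟩
    have hj := h0.iterate hSu hc hn₂ j (by omega)
    have hi := hj.iterate hSu hc hn₁ i (by omega)
    exact hi.norm_le (y := (t, x)) ⟨ht, hx⟩ (hR _ (by omega) _ ⟨ht, hx⟩)

end

section

variable {a b T : ℝ} {K N n : ℕ} {m : Mesh a b K} {R : ℝ} {v w : Jet}

theorem SmoothFamily.mono (h : SmoothFamily n a b T R v) {n' : ℕ} (hn : n' ≤ n) {R' : ℝ}
    (hR : R ≤ R') : SmoothFamily n' a b T R' v where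
  dt i j hij := h.dt i j (by omega)
  dx i j hij := h.dx i j (by omega)
  bound i j hij t ht x hx := (h.bound i j (by omega) t ht x hx).trans hR

theorem SmoothFamily.shift (h : SmoothFamily (n + 1) a b T R v) :
    SmoothFamily n a b T R fun i j => v (i + 1) j where
  dt i j hij := h.dt (i + 1) j (by omega)
  dx i j hij := h.dx (i + 1) j (by omega)
  bound i j hij := h.bound (i + 1) j (by omega)

theorem SmoothFamily.add_mul (h : SmoothFamily n a b T R v) {R' : ℝ}
    (h' : SmoothFamily n a b T R' w) (c : ℝ) :
    SmoothFamily n a b T (R + |c| * R') fun i j t x => v i j t x + c * w i j t x where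
  dt i j hij t ht x hx := (h.dt i j hij t ht x hx).add ((h'.dt i j hij t ht x hx).const_mul c)
  dx i j hij t ht x hx := (h.dx i j hij t ht x hx).add ((h'.dx i j hij t ht x hx).const_mul c)
  bound i j hij t ht x hx := by
    refine (abs_add_le _ _).trans (add_le_add (h.bound i j hij t ht x hx) ?_)
    rw [abs_mul]
    exact mul_le_mul_of_nonneg_left (h'.bound i j hij t ht x hx) (abs_nonneg c)

theorem SmoothFamily.derivChain (h : SmoothFamily n a b T R v) {i j k : ℕ} (hij : i + j + k ≤ n)
    {t : ℝ} (ht : t ∈ Icc 0 T) : DerivChain k a b fun l => v i (j + l) t := fun l hl x hx =>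
  h.dx i (j + l) (by omega) t ht x hx

theorem SmoothFamily.continuousOn (h : SmoothFamily n a b T R v) {i j : ℕ} (hij : i + j < n)
    {t : ℝ} (ht : t ∈ Icc 0 T) : ContinuousOn (v i j t) (Icc a b) := fun x hx =>
  (h.dx i j hij t ht x hx).continuousWithinAt

theorem SmoothFamily.zero_of_zero (h : SmoothFamily n a b T R v) (hT : 0 < T) {x : ℝ}
    (hx : x ∈ Icc a b) (h0 : ∀ t ∈ Icc 0 T, v 0 0 t x = 0) {i : ℕ} (hi : i ≤ n) :
    ∀ t ∈ Icc 0 T, v i 0 t x = 0 := by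
  induction i with
  | zero => exact h0
  | succ i ih =>
    intro t ht
    have h1 := h.dt i 0 (by omega) t ht x hx
    have h2 : HasDerivWithinAt (fun τ => v i 0 τ x) 0 (Icc 0 T) t :=
      (hasDerivWithinAt_const t (Icc 0 T) (0:ℝ)).congr (fun s hs => ih (by omega) s hs)
        (ih (by omega) t ht)
    exact (uniqueDiffOn_Icc hT t ht).eq_deriv _ h1 h2

theorem SmoothFamily.taylor (h : SmoothFamily n a b T R v) {i j : ℕ} (hij : i + j + 2 ≤ n)
    {t s : ℝ} (ht : t ∈ Icc 0 T) (hs : s ∈ Icc 0 T) {x : ℝ} (hx : x ∈ Icc a b) :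
    |v i j s x - v i j t x - (s - t) * v (i + 1) j t x| ≤ R * (s - t) ^ 2 := by
  have hsub : uIcc t s ⊆ Icc 0 T := by
    rw [uIcc]
    exact Icc_subset_Icc (le_min ht.1 hs.1) (max_le ht.2 hs.2)
  have hR : 0 ≤ R := (abs_nonneg _).trans (h.bound i j (by omega) t ht x hx)
  have h1 : ∀ τ ∈ uIcc t s, |v (i + 1) j τ x - v (i + 1) j t x| ≤ R * |s - t| := fun τ hτ => by
    have := (convex_Icc (0:ℝ) T).norm_image_sub_le_of_norm_hasDerivWithin_le
      (f := fun τ => v (i + 1) j τ x) (fun r hr => h.dt (i + 1) j (by omega) r hr x hx)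
      (fun r hr => h.bound (i + 2) j (by omega) r hr x hx) ht (hsub hτ)
    refine this.trans (mul_le_mul_of_nonneg_left ?_ hR)
    exact abs_sub_left_of_mem_uIcc hτ
  have h2 := (convex_uIcc t s).norm_image_sub_le_of_norm_hasDerivWithin_le
    (f := fun τ => v i j τ x - τ * v (i + 1) j t x)
    (f' := fun τ => v (i + 1) j τ x - 1 * v (i + 1) j t x) (C := R * |s - t|)
    (fun τ hτ => ((h.dt i j (by omega) τ (hsub hτ) x hx).mono hsub).sub
      ((hasDerivWithinAt_id τ _).mul_const _))
    (fun τ hτ => by rw [one_mul]; exact h1 τ hτ) left_mem_uIcc right_mem_uIcc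
  rw [Real.norm_eq_abs, Real.norm_eq_abs, mul_assoc, ← sq, sq_abs] at h2
  convert h2 using 2
  ring

theorem SmoothFamily.hasDerivWithinAt_proj (h : SmoothFamily n a b T R v) {i j : ℕ}
    (hij : i + j + 2 ≤ n) (e : Option Bool) {t : ℝ} (ht : t ∈ Icc 0 T) :
    HasDerivWithinAt (fun τ => proj m N e (v i j τ)) (proj m N e (v (i + 1) j t)) (Icc 0 T) t := by
  obtain ⟨C, hC, hst⟩ := proj_stable N
  rw [hasDerivWithinAt_pi]
  intro k
  rw [hasDerivWithinAt_iff_isLittleO]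
  have hb : (fun s => proj m N e (v i j s) k - proj m N e (v i j t) k
      - (s - t) • proj m N e (v (i + 1) j t) k) =O[𝓝[Icc 0 T] t] fun s => (s - t) ^ 2 := by
    refine Asymptotics.IsBigO.of_bound (C * R) ?_
    filter_upwards [self_mem_nhdsWithin] with s hs
    have hc1 := h.continuousOn (i := i) (j := j) (by omega) hs
    have hc2 := h.continuousOn (i := i) (j := j) (by omega) ht
    have hc3 := h.continuousOn (i := i + 1) (j := j) (by omega) ht
    have e1 : proj m N e (fun x => v i j s x + (-1 * v i j t x + -(s - t) * v (i + 1) j t x))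
        = proj m N e (v i j s) + (-1 • proj m N e (v i j t)
          + -(s - t) • proj m N e (v (i + 1) j t)) := by
      rw [proj_add (g := fun x => -1 * v i j t x + -(s - t) * v (i + 1) j t x) e hc1
        ((continuousOn_const.mul hc2).add (continuousOn_const.mul hc3)),
        proj_add (f := fun x => -1 * v i j t x) (g := fun x => -(s - t) * v (i + 1) j t x) e
        (continuousOn_const.mul hc2) (continuousOn_const.mul hc3), proj_smul, proj_smul]
      simp
    have e2 := congrFun e1 k
    simp only [Pi.add_apply, Pi.smul_apply] at e2
    have e3 : proj m N e (v i j s) k - proj m N e (v i j t) k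
        - (s - t) • proj m N e (v (i + 1) j t) k = proj m N e
          (fun x => v i j s x + (-1 * v i j t x + -(s - t) * v (i + 1) j t x)) k := by
      rw [e2]; module
    rw [e3, Real.norm_of_nonneg (sq_nonneg _), mul_assoc]
    refine hst m e _ k _ fun x hx => ?_
    convert h.taylor hij ht hs (cell_subset k hx) using 2
    ring
  have hl := (Asymptotics.isLittleO_pow_sub_sub t one_lt_two).mono
    (nhdsWithin_le_nhds (s := Icc 0 T))
  simp only [Real.norm_eq_abs, sq_abs] at hl
  exact hb.trans_isLittleO hl

/-- Evaluation of polynomials of degree `N` at `N + 1` equidistant points. -/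
def evalNodes (N : ℕ) : (Fin (N + 1) → ℝ) →ₗ[ℝ] (Fin (N + 1) → ℝ) where
  toFun c i := (refPoly N c).eval (i : ℝ)
  map_add' c d := by ext i; simp
  map_smul' r c := by ext i; simp

theorem evalNodes_injective (N : ℕ) : Function.Injective (evalNodes N) := by
  rw [injective_iff_map_eq_zero]
  intro c hc
  have h0 : refPoly N c = 0 := by
    refine Polynomial.eq_zero_of_natDegree_lt_card_of_eval_eq_zero (refPoly N c)
      (f := fun i : Fin (N + 1) => (i : ℝ)) (fun i j hij => ?_) (fun i => congrFun hc i) ?_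
    · have h : ((i : ℕ) : ℝ) = (j : ℕ) := hij
      exact Fin.ext (by exact_mod_cast h)
    · rw [Fintype.card_fin]
      exact Nat.lt_succ_of_le (refPoly_natDegree_le c)
  exact refPoly_injective (by rw [h0, map_zero])

/-- A piecewise polynomial curve with differentiable point values has differentiable
coefficients. -/
theorem exists_coefficients {p : ℝ → PWPoly K} (hp : ∀ t ∈ Icc 0 T, (p t).DegLE N) (m : Mesh a b K)
    (hd : ∀ k x, DifferentiableOn ℝ (fun τ => (p τ k).eval x) (Icc 0 T)) (hT : 0 < T) :
    ∃ c c' : ℝ → Coeff K N, (∀ t ∈ Icc 0 T, pw m (c t) = p t) ∧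
      (∀ t ∈ Icc 0 T, HasDerivWithinAt c (c' t) (Icc 0 T) t) ∧
      ∀ t ∈ Icc 0 T, ∀ k x,
        derivWithin (fun τ => (p τ k).eval x) (Icc 0 T) t = (pw m (c' t) k).eval x := by
  let A := LinearEquiv.ofInjectiveEndo (evalNodes N) (evalNodes_injective N)
  have hA : ∀ c, A c = evalNodes N c := fun c => rfl
  let B : (Fin (N + 1) → ℝ) →L[ℝ] (Fin (N + 1) → ℝ) := LinearMap.toContinuousLinearMap A.symm.toLinearMap
  have hB : ∀ c, B (evalNodes N c) = c := fun c => A.symm_apply_apply c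
  set val : (Fin K → ℝ → ℝ) → Coeff K N :=
    fun f k i => f k (m.lo k + (m.hi k - m.lo k) * i) with hval
  set c : ℝ → Coeff K N := fun t k => B (val (fun k x => (p t k).eval x) k) with hc
  set c' : ℝ → Coeff K N := fun t k =>
    B (val (fun k x => derivWithin (fun τ => (p τ k).eval x) (Icc 0 T) t) k) with hc'
  have h1 : ∀ t ∈ Icc 0 T, pw m (c t) = p t := fun t ht => by
    obtain ⟨d, hdp⟩ := exists_pw m (hp t ht)
    have : c t = d := by
      ext1 k
      simp only [hc]
      rw [← hB (d k)]
      congr 1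
      ext i
      simp only [hval, ← hdp]
      exact pw_eval_local m d k i
    rw [this, hdp]
  have h2 : ∀ t ∈ Icc 0 T, HasDerivWithinAt c (c' t) (Icc 0 T) t := fun t ht => by
    rw [hasDerivWithinAt_pi]
    intro k
    refine B.hasFDerivAt.comp_hasDerivWithinAt t ?_
    rw [hasDerivWithinAt_pi]
    intro i
    exact (hd k _ t ht).hasDerivWithinAt
  refine ⟨c, c', h1, h2, fun t ht k x => ?_⟩
  let ev : Coeff K N →ₗ[ℝ] ℝ :=
    { toFun := fun c => (pw m c k).eval x
      map_add' := fun c d => by simp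
      map_smul' := fun r c => by simp }
  have h3 := (LinearMap.toContinuousLinearMap ev).hasFDerivAt.comp_hasDerivWithinAt t (h2 t ht)
  have h4 : HasDerivWithinAt (fun τ => (p τ k).eval x) ((pw m (c' t) k).eval x) (Icc 0 T) t := by
    refine HasDerivWithinAt.congr h3 (fun τ hτ => ?_) ?_
    · rw [← h1 τ hτ]; rfl
    · rw [← h1 t ht]; rfl
  exact h4.derivWithin (uniqueDiffOn_Icc hT t ht)

end

section

variable {a b T : ℝ} {K N : ℕ} {μ : ℝ} {m : Mesh a b K}

theorem le_exp_of_deriv_le {E E' : ℝ → ℝ} {c : ℝ} (hc : 0 ≤ c)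
    (hE : ∀ t ∈ Icc 0 T, HasDerivWithinAt E (E' t) (Icc 0 T) t)
    (hle : ∀ t ∈ Icc 0 T, E' t ≤ E t + c) (h0 : 0 ≤ E 0) :
    ∀ t ∈ Icc 0 T, E t ≤ Real.exp T * (E 0 + c) := fun t ht => by
  have hd : ∀ t ∈ Icc 0 T, HasDerivWithinAt (fun s => Real.exp (-s) * (E s + c))
      (Real.exp (-t) * (-1) * (E t + c) + Real.exp (-t) * E' t) (Icc 0 T) t := fun t ht =>
    ((hasDerivAt_neg t).exp.hasDerivWithinAt).mul ((hE t ht).add_const c)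
  have hanti : AntitoneOn (fun s => Real.exp (-s) * (E s + c)) (Icc 0 T) := by
    refine antitoneOn_of_deriv_nonpos (convex_Icc 0 T)
      (fun t ht => (hd t ht).continuousWithinAt) (fun t ht => ?_) fun t ht => ?_
    · exact ((hd t (interior_subset ht)).mono interior_subset).differentiableWithinAt
    · rw [((hd t (interior_subset ht)).hasDerivAt (mem_interior_iff_mem_nhds.1 ht)).deriv]
      nlinarith [hle t (interior_subset ht), Real.exp_pos (-t)]
  have h := hanti (left_mem_Icc.2 (ht.1.trans ht.2)) ht ht.1
  simp only [neg_zero, Real.exp_zero, one_mul] at h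
  have h1 : E t + c ≤ Real.exp t * (E 0 + c) := by
    have := mul_le_mul_of_nonneg_left h (Real.exp_pos t).le
    rwa [← mul_assoc, ← Real.exp_add, add_neg_cancel, Real.exp_zero, one_mul] at this
  have h2 : Real.exp t * (E 0 + c) ≤ Real.exp T * (E 0 + c) :=
    mul_le_mul_of_nonneg_right (Real.exp_le_exp.2 ht.2) (by positivity)
  linarith

theorem two_mul_le_of_sq_le {x δ A : ℝ} (hA : 0 ≤ A) (h : x ^ 2 ≤ δ ^ 2 * A) : 2 * x ≤ A + δ ^ 2 := by
  refine le_of_abs_le (abs_le_of_sq_le_sq ?_ (by positivity))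
  nlinarith [sq_nonneg (A - δ ^ 2)]

/-- Growth of the energy `(θ, Sθ)` along a perturbed discrete Schrödinger flow. -/
theorem energy_growth (S : Coeff K N →ₗ[ℝ] Coeff K N)
    (hsym : ∀ x y, ip m x (S y) = ip m y (S x)) (hpos : ∀ x, 0 ≤ ip m x (S x)) {δ c : ℝ}
    {θp θq θp' θq' : ℝ → Coeff K N} (X : ℝ → ℝ)
    (hp : ∀ t ∈ Icc 0 T, HasDerivWithinAt θp (θp' t) (Icc 0 T) t)
    (hq : ∀ t ∈ Icc 0 T, HasDerivWithinAt θq (θq' t) (Icc 0 T) t)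
    (hρp : ∀ t ∈ Icc 0 T, (ip m (θp' t) (S (θp t)) + X t + c * ip m (θq t) (S (θp t))) ^ 2
      ≤ δ ^ 2 * ip m (θp t) (S (θp t)))
    (hρq : ∀ t ∈ Icc 0 T, (ip m (θq' t) (S (θq t)) - X t - c * ip m (θp t) (S (θq t))) ^ 2
      ≤ δ ^ 2 * ip m (θq t) (S (θq t)))
    (h0p : ip m (θp 0) (S (θp 0)) ≤ δ ^ 2) (h0q : ip m (θq 0) (S (θq 0)) ≤ δ ^ 2) :
    ∀ t ∈ Icc 0 T, ip m (θp t) (S (θp t)) + ip m (θq t) (S (θq t)) ≤ Real.exp T * (4 * δ ^ 2) := by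
  have hder : ∀ θ θ' : ℝ → Coeff K N,
      (∀ t ∈ Icc 0 T, HasDerivWithinAt θ (θ' t) (Icc 0 T) t) → ∀ t ∈ Icc 0 T,
      HasDerivWithinAt (fun τ => ip m (θ τ) (S (θ τ))) (2 * ip m (θ' t) (S (θ t))) (Icc 0 T) t :=
      fun θ θ' h t ht => by
    have h1 := (ip m).toContinuousBilinearMap.hasFDerivAt.comp_hasDerivWithinAt t (h t ht)
    have h2 := (LinearMap.toContinuousLinearMap S).hasFDerivAt.comp_hasDerivWithinAt t (h t ht)
    have h3 := h1.clm_apply h2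
    have e : 2 * ip m (θ' t) (S (θ t)) = ip m (θ' t) (S (θ t)) + ip m (θ t) (S (θ' t)) := by
      rw [hsym (θ t)]; ring
    rw [e]
    exact h3
  intro t ht
  have h0 : (0:ℝ) ∈ Icc 0 T := ⟨le_rfl, ht.1.trans ht.2⟩
  have := le_exp_of_deriv_le (c := 2 * δ ^ 2) (by positivity)
    (fun t ht => (hder θp θp' hp t ht).add (hder θq θq' hq t ht)) (fun t ht => ?_)
    (add_nonneg (hpos (θp 0)) (hpos (θq 0))) t ht
  · refine this.trans (mul_le_mul_of_nonneg_left ?_ (Real.exp_pos T).le)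
    simp only [Pi.add_apply]
    linarith
  · have e1 := two_mul_le_of_sq_le (hpos _) (hρp t ht)
    have e2 := two_mul_le_of_sq_le (hpos _) (hρq t ht)
    have e3 := hsym (θp t) (θq t)
    simp only [Pi.add_apply]
    rw [e3] at e2
    linarith

theorem evolution_estimate (N : ℕ) (hμ : 0 < μ) (hμ1 : μ < 1) (hab : a < b) (T : ℝ) :
    ∃ C : ℝ, 0 < C ∧ ∀ (K : ℕ) (m : Mesh a b K) (κ c δ : ℝ)
      (θp θq θp' θq' rp rq : ℝ → Coeff K N),
      (∀ t ∈ Icc 0 T, HasDerivWithinAt θp (θp' t) (Icc 0 T) t) →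
      (∀ t ∈ Icc 0 T, HasDerivWithinAt θq (θq' t) (Icc 0 T) t) →
      (∀ t ∈ Icc 0 T, ip m (rq t) (θp t) = ip m (rp t) (θq t)) →
      (∀ t ∈ Icc 0 T, ∀ w, (ip m (θp' t) w + κ * af hμ m (rq t) w + c * ip m (θq t) w) ^ 2
        ≤ δ ^ 2 * af hμ m w w) →
      (∀ t ∈ Icc 0 T, ∀ w, (ip m (θq' t) w - κ * af hμ m (rp t) w - c * ip m (θp t) w) ^ 2
        ≤ δ ^ 2 * af hμ m w w) →
      (∀ w, ip m (θp 0) w ^ 2 ≤ δ ^ 2 * af hμ m w w) →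
      (∀ w, ip m (θq 0) w ^ 2 ≤ δ ^ 2 * af hμ m w w) →
      ∀ t ∈ Icc 0 T, ip m (θp t) (θp t) + ip m (θq t) (θq t) ≤ C * δ ^ 2 := by
  obtain ⟨C1, hC1, h1⟩ := en_le_integral_sq hμ hμ1 hab
  refine ⟨C1 * (Real.exp T * 4), by positivity, fun K m κ c δ θp θq θp' θq' rp rq hp hq hr hρp hρq
    h0p h0q t ht => ?_⟩
  obtain ⟨S, hS⟩ := exists_energy_inverse N hμ hμ1 hab m
  have hSS : ∀ x, ip m x (S x) = af hμ m (S x) (S x) := fun x => (hS x (S x)).symm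
  have hpos : ∀ x, 0 ≤ ip m x (S x) := fun x => by
    rw [hSS]; exact en_nonneg hμ hμ1 (adm_fn m _)
  have hrS : ∀ r x, af hμ m r (S x) = ip m r x := fun r x => by rw [af_comm, hS, ip_comm]
  have h0 : ∀ x, (∀ w, ip m x w ^ 2 ≤ δ ^ 2 * af hμ m w w) → ip m x (S x) ≤ δ ^ 2 := fun x hx => by
    have := hx (S x)
    rw [← hSS] at this
    rcases (hpos x).eq_or_lt with h | h
    · rw [← h]; positivity
    · rw [sq] at this; exact le_of_mul_le_mul_right this h
  have key := energy_growth (m := m) S (fun x y => by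
      rw [← hS, af_comm, hS]) hpos (δ := δ) (c := c) (fun t => κ * ip m (rq t) (θp t)) hp hq
    (fun t ht => by
      have := hρp t ht (S (θp t))
      rwa [hrS, ← hSS] at this)
    (fun t ht => by
      have := hρq t ht (S (θq t))
      rw [hr t ht]
      rwa [hrS, ← hSS] at this)
    (h0 _ h0p) (h0 _ h0q) t ht
  have hle : ∀ x, ip m x x ≤ C1 * ip m x (S x) := fun x => by
    have e1 := en_sq_le hμ hμ1 (adm_fn m (S x)) (adm_fn m x)
    rw [← af_apply hμ, ← af_apply hμ, ← af_apply hμ, hS, ← hSS] at e1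
    have e2 : af hμ m x x ≤ C1 * ip m x x := by
      have := h1 _ (adm_fn m x)
      simp_rw [sq] at this
      exact this
    rcases (ip_self_nonneg m x).eq_or_lt with h | h
    · rw [← h]; exact mul_nonneg hC1.le (hpos x)
    · have := e1.trans (mul_le_mul_of_nonneg_left e2 (hpos x))
      nlinarith
  have e1 := hle (θp t)
  have e2 := hle (θq t)
  nlinarith

end

section

variable {a b T : ℝ} {K N : ℕ} {μ : ℝ} {m : Mesh a b K}

/-- The normalizing constant of the fractional integral. -/
def fracConst (μ : ℝ) : ℝ := (2 * Real.cos (Real.pi * μ / 2))⁻¹ * (Real.Gamma μ)⁻¹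

theorem fracConst_pos (hμ : 0 < μ) (hμ1 : μ < 1) : 0 < fracConst μ := by
  have h1 : 0 < Real.cos (Real.pi * μ / 2) := Real.cos_pos_of_mem_Ioo
    ⟨by nlinarith [Real.pi_pos], by nlinarith [Real.pi_pos]⟩
  have h2 := Real.Gamma_pos_of_pos hμ
  unfold fracConst
  positivity

theorem integrable_ker_mul (hμ : 0 < μ) {v : ℝ → ℝ} (hv : Adm a b v) (x : ℝ) :
    Integrable fun s => ker μ (x - s) * v s := by
  obtain ⟨M, hM⟩ := hv.bdd
  set l := |x| + |a| + |b| with hl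
  have h1 : Integrable ((Icc (-l) l).indicator (ker μ)) :=
    (integrable_indicator_iff measurableSet_Icc).2 (integrableOn_ker hμ l)
  have h2 := (h1.comp_sub_left x).mul_bdd (c := M) hv.meas.aestronglyMeasurable
    (.of_forall fun s => hM s)
  refine h2.congr (.of_forall fun s => ?_)
  by_cases hs : s ∈ Icc a b
  · have : x - s ∈ Icc (-l) l := by
      constructor <;> rw [hl] <;>
      linarith [hs.1, hs.2, le_abs_self x, neg_abs_le x, le_abs_self a, neg_abs_le a,
        le_abs_self b, neg_abs_le b, abs_nonneg a, abs_nonneg b]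
    simp [indicator_of_mem this]
  · simp [hv.supp s hs]

section

variable {E : Type*} [NormedAddCommGroup E] [NormedSpace ℝ E]

theorem fracIntegral_congr_ae {f g : ℝ → E} (h : f =ᵐ[volume] g) (x : ℝ) :
    fracIntegral μ f x = fracIntegral μ g x := by
  have hs : ∀ s : Set ℝ, ∀ k : ℝ → ℝ, ∫ t in s, k t • f t = ∫ t in s, k t • g t := fun s k =>
    integral_congr_ae (ae_restrict_of_ae (h.mono fun t ht => by simp only [ht]))
  simp only [fracIntegral, leftRL, rightRL, hs]

theorem fracIntegral_map [CompleteSpace E] (L : E →L[ℝ] ℝ) {f : ℝ → E} {x : ℝ}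
    (hf : Integrable fun s => ker μ (x - s) • f s) :
    L (fracIntegral μ f x) = fracIntegral μ (fun s => L (f s)) x := by
  have h1 : ∀ s ∈ Iio x, ker μ (x - s) = (x - s) ^ (μ - 1) := fun s hs => by
    rw [ker, abs_of_pos (sub_pos.2 hs)]
  have h2 : ∀ s ∈ Ioi x, ker μ (x - s) = (s - x) ^ (μ - 1) := fun s hs => by
    rw [ker, abs_sub_comm, abs_of_pos (sub_pos.2 hs)]
  have e1 : L (∫ s in Iio x, (x - s) ^ (μ - 1) • f s) = ∫ s in Iio x, (x - s) ^ (μ - 1) • L (f s) := by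
    rw [← L.integral_comp_comm]
    · simp only [map_smul]
    · exact hf.integrableOn.congr_fun (fun s hs => by simp only [h1 s hs]) measurableSet_Iio
  have e2 : L (∫ s in Ioi x, (s - x) ^ (μ - 1) • f s) = ∫ s in Ioi x, (s - x) ^ (μ - 1) • L (f s) := by
    rw [← L.integral_comp_comm]
    · simp only [map_smul]
    · exact hf.integrableOn.congr_fun (fun s hs => by simp only [h2 s hs]) measurableSet_Ioi
  simp only [fracIntegral, leftRL, rightRL, map_smul, map_add, e1, e2]

end

theorem fracIntegral_eq_pot (hμ : 0 < μ) {v : ℝ → ℝ} (hv : Adm a b v) (x : ℝ) :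
    fracIntegral μ v x = fracConst μ * pot μ v x := by
  have hi := integrable_ker_mul hμ hv x
  have e : pot μ v x = (∫ s in Iio x, (x - s) ^ (μ - 1) * v s) + ∫ s in Ioi x, (s - x) ^ (μ - 1) * v s := by
    rw [pot, ← intervalIntegral.integral_Iic_add_Ioi (b := x) hi.integrableOn hi.integrableOn,
      integral_Iic_eq_integral_Iio]
    congr 1
    · exact setIntegral_congr_fun measurableSet_Iio fun s hs => by
        simp only [ker, abs_of_pos (sub_pos.2 (mem_Iio.1 hs))]
    · exact setIntegral_congr_fun measurableSet_Ioi fun s hs => by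
        simp only [ker, abs_sub_comm x s, abs_of_pos (sub_pos.2 (mem_Ioi.1 hs))]
  simp only [fracIntegral, leftRL, rightRL, smul_eq_mul, e, fracConst]
  ring

theorem fracLaplacian_eq {E : Type*} [NormedAddCommGroup E] [NormedSpace ℝ E] (α : ℝ) (f : ℝ → E)
    (x : ℝ) : fracLaplacian α f x = -fracIntegral (2 - α) (iteratedDeriv 2 f) x := by
  have : Real.cos (Real.pi * α / 2) = -Real.cos (Real.pi * (2 - α) / 2) := by
    rw [show Real.pi * (2 - α) / 2 = Real.pi - Real.pi * α / 2 by ring, Real.cos_pi_sub, neg_neg]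
  simp only [fracLaplacian, caputoLeft, caputoRight, fracIntegral, this, mul_neg, inv_neg, neg_smul]

/-- The real and imaginary parts of the fractional Laplacian of a function that vanishes outside
`(a, b)` and is twice differentiable inside. -/
theorem fracLaplacian_map {α : ℝ} (hα : α < 2) {u u₁ u₂ : ℝ → ℂ}
    (h0 : ∀ x ∉ Ioo a b, u x = 0) (h1 : ∀ x ∈ Ioo a b, HasDerivAt u (u₁ x) x)
    (h2 : ∀ x ∈ Ioo a b, HasDerivAt u₁ (u₂ x) x) (hc : ContinuousOn u₂ (Icc a b))
    (L : ℂ →L[ℝ] ℝ) (x : ℝ) :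
    L (fracLaplacian α u x)
      = -(fracConst (2 - α) * pot (2 - α) ((Ioo a b).indicator fun s => L (u₂ s)) x) := by
  have hμ : 0 < 2 - α := by linarith
  have hae : iteratedDeriv 2 u =ᵐ[volume] (Ioo a b).indicator u₂ := by
    have h : ∀ᵐ x : ℝ, x ∉ ({a, b} : Set ℝ) :=
      compl_mem_ae_iff.2 ((Set.toFinite {a, b}).measure_zero _)
    filter_upwards [h] with s hs
    by_cases hsI : s ∈ Ioo a b
    · rw [indicator_of_mem hsI, iteratedDeriv_succ, iteratedDeriv_one]
      have : deriv u =ᶠ[𝓝 s] u₁ := by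
        filter_upwards [isOpen_Ioo.mem_nhds hsI] with z hz using (h1 z hz).deriv
      rw [this.deriv_eq, (h2 s hsI).deriv]
    · have hsc : s ∈ (Icc a b)ᶜ := fun h => by
        simp only [mem_insert_iff, mem_singleton_iff, not_or] at hs
        exact hsI ⟨lt_of_le_of_ne h.1 (Ne.symm hs.1), lt_of_le_of_ne h.2 hs.2⟩
      have : u =ᶠ[𝓝 s] fun _ => (0:ℂ) := by
        filter_upwards [isClosed_Icc.isOpen_compl.mem_nhds hsc] with z hz
        exact h0 z fun h => hz (Ioo_subset_Icc_self h)
      rw [indicator_of_notMem hsI, this.iteratedDeriv_eq]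
      simp
  have hre : Adm a b ((Ioo a b).indicator fun s => (u₂ s).re) :=
    adm_indicator (Complex.continuous_re.comp_continuousOn hc)
  have him : Adm a b ((Ioo a b).indicator fun s => (u₂ s).im) :=
    adm_indicator (Complex.continuous_im.comp_continuousOn hc)
  have hL : Adm a b ((Ioo a b).indicator fun s => L (u₂ s)) :=
    adm_indicator (L.continuous.comp_continuousOn hc)
  have hint : Integrable fun s => ker (2 - α) (x - s) • (Ioo a b).indicator u₂ s := by
    have i1 := (integrable_ker_mul hμ hre x).ofReal (𝕜 := ℂ)
    have i2 := ((integrable_ker_mul hμ him x).ofReal (𝕜 := ℂ)).mul_const Complex.I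
    refine (i1.add i2).congr (.of_forall fun s => ?_)
    by_cases hsI : s ∈ Ioo a b
    · have := Complex.re_add_im (u₂ s)
      simp [hsI]
      linear_combination (ker (2 - α) (x - s) : ℂ) * this
    · simp [indicator_of_notMem hsI]
  rw [fracLaplacian_eq, fracIntegral_congr_ae hae, map_neg, fracIntegral_map L hint,
    ← fracIntegral_eq_pot hμ hL]
  congr 2
  ext s
  by_cases hsI : s ∈ Ioo a b <;> simp [hsI]

theorem sum_inner_pot (hμ : 0 < μ) (hab : a < b) {v : ℝ → ℝ} (hv : Adm a b v)
    (w : Coeff K N) :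
    ∑ k, m.inner k (pot μ v) (fun x => (pw m w k).eval x) = en μ v (fn m w) := by
  rw [en_symm, en_eq_integral_pot hμ (adm_fn m w) hv, ← integral_mul_indicator_Ioo (adm_fn m w),
    integral_fn_mul m hab w (adm_indicator_pot hμ hab hv)]
  refine Finset.sum_congr rfl fun k _ => ?_
  unfold Mesh.inner
  rw [intervalIntegral.integral_of_le (m.lo_lt_hi k).le, intervalIntegral.integral_of_le
    (m.lo_lt_hi k).le, integral_Ioc_eq_integral_Ioo, integral_Ioc_eq_integral_Ioo]
  exact setIntegral_congr_fun measurableSet_Ioo fun x hx => by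
    simp only [indicator_of_mem (m.Ioo_subset k hx), mul_comm]

theorem inner_add_const_mul {k : Fin K} {f g φ : ℝ → ℝ} (c : ℝ)
    (hf : IntervalIntegrable (fun x => f x * φ x) volume (m.lo k) (m.hi k))
    (hg : IntervalIntegrable (fun x => g x * φ x) volume (m.lo k) (m.hi k)) :
    m.inner k (fun x => f x + c * g x) φ = m.inner k f φ + c * m.inner k g φ := by
  unfold Mesh.inner
  rw [← intervalIntegral.integral_const_mul, ← intervalIntegral.integral_add hf (hg.const_mul c)]
  refine intervalIntegral.integral_congr fun x _ => ?_
  ring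

theorem intervalIntegrable_pot_mul (hμ : 0 < μ) (hab : a < b) {v : ℝ → ℝ} (hv : Adm a b v)
    (p : Polynomial ℝ) (k : Fin K) :
    IntervalIntegrable (fun x => pot μ v x * p.eval x) volume (m.lo k) (m.hi k) := by
  have h := (adm_indicator_pot hμ hab hv).continuousOn_mul (m.lo_lt_hi k).le
    (p.continuous.continuousOn (s := Icc (m.lo k) (m.hi k)))
  rw [intervalIntegrable_iff_integrableOn_Ioo_of_le (m.lo_lt_hi k).le] at h ⊢
  refine h.congr_fun (fun x hx => ?_) measurableSet_Ioo
  simp only [indicator_of_mem (m.Ioo_subset k hx), mul_comm]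

/-- The weak form, on the discrete space, of an equation that involves a potential. -/
theorem sum_inner_data (hμ : 0 < μ) (hab : a < b) {v F g : ℝ → ℝ} (hv : Adm a b v)
    (hF : ContinuousOn F (Icc a b)) (c : ℝ) (hg : ∀ x ∈ Ioo a b, F x + c * pot μ v x = g x)
    (w : Coeff K N) :
    ∑ k, m.inner k g (fun x => (pw m w k).eval x)
      = (∑ k, m.inner k F fun x => (pw m w k).eval x) + c * en μ v (fn m w) := by
  rw [← sum_inner_pot hμ hab hv w, Finset.mul_sum, ← Finset.sum_add_distrib]
  refine Finset.sum_congr rfl fun k _ => ?_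
  rw [← inner_add_const_mul]
  · unfold Mesh.inner
    rw [intervalIntegral.integral_of_le (m.lo_lt_hi k).le, intervalIntegral.integral_of_le
      (m.lo_lt_hi k).le, integral_Ioc_eq_integral_Ioo, integral_Ioc_eq_integral_Ioo]
    exact setIntegral_congr_fun measurableSet_Ioo fun x hx => by
      simp only [hg x (m.Ioo_subset k hx)]
  · refine ContinuousOn.intervalIntegrable ?_
    rw [uIcc_of_le (m.lo_lt_hi k).le]
    exact (hF.mono (cell_subset k)).mul (pw m w k).continuous.continuousOn
  · exact intervalIntegrable_pot_mul hμ hab hv _ k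

theorem sum_inner_pw (hab : a < b) (c w : Coeff K N) :
    ∑ k, m.inner k (fun x => (pw m c k).eval x) (fun x => (pw m w k).eval x) = ip m c w :=
  (integral_fn_mul_fn m hab c w).symm

end

section

variable {a b T : ℝ} {K N : ℕ} {m : Mesh a b K}

/-- Partial derivatives of the real and imaginary parts of the exact solution, with the two real
equations that they satisfy. -/
structure ExactFamily (n : ℕ) (α lam1 lam2 a b T R : ℝ) (g : ℝ → ℝ → ℂ)
    (P Q : Jet) : Prop where
  smooth_p : SmoothFamily n a b T R P
  smooth_q : SmoothFamily n a b T R Q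
  left_p : ∀ t ∈ Icc 0 T, P 0 0 t a = 0
  left_q : ∀ t ∈ Icc 0 T, Q 0 0 t a = 0
  right_p : ∀ t ∈ Icc 0 T, P 0 1 t b = 0
  right_q : ∀ t ∈ Icc 0 T, Q 0 1 t b = 0
  eq_p : ∀ t ∈ Icc 0 T, ∀ x ∈ Ioo a b, (P 1 0 t x + lam2 * Q 0 0 t x)
    + lam1 * fracConst (2 - α) * pot (2 - α) ((Ioo a b).indicator (Q 0 2 t)) x = (g t x).im
  eq_q : ∀ t ∈ Icc 0 T, ∀ x ∈ Ioo a b, (Q 1 0 t x + -lam2 * P 0 0 t x)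
    + -(lam1 * fracConst (2 - α)) * pot (2 - α) ((Ioo a b).indicator (P 0 2 t)) x = -(g t x).re

theorem exists_exactFamily {n : ℕ} (hn : 3 ≤ n) {α lam1 lam2 R : ℝ} (hα : α < 2) (hT : 0 < T)
    (hab : a < b) {g u : ℝ → ℝ → ℂ} (hu : IsExactSolution α lam1 lam2 a b T g u)
    (hs : BoundedSmooth n a b T R u) :
    ∃ P Q : Jet, ExactFamily n α lam1 lam2 a b T R g P Q ∧
      ∀ t x, P 0 0 t x = (u t x).re ∧ Q 0 0 t x = (u t x).im := by
  obtain ⟨v, hv0, hvt, hvx, hvb⟩ := exists_smoothFamily hT hab hs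
  have hv00 : ∀ t x, v 0 0 t x = u t x := fun t x => by rw [hv0]
  have hsm : ∀ L : ℂ →L[ℝ] ℝ, (∀ z, |L z| ≤ ‖z‖) →
      SmoothFamily n a b T R fun i j t x => L (v i j t x) := fun L hL =>
    ⟨fun i j hij t ht x hx => L.hasFDerivAt.comp_hasDerivWithinAt t (hvt i j hij t ht x hx),
      fun i j hij t ht x hx => L.hasFDerivAt.comp_hasDerivWithinAt x (hvx i j hij t ht x hx),
      fun i j hij t ht x hx => (hL _).trans (hvb i j hij t ht x hx)⟩
  have hleft : ∀ t ∈ Icc 0 T, v 0 0 t a = 0 := fun t ht => by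
    rw [hv00]; exact hu.zero_outside t ht a fun h => lt_irrefl _ h.1
  have hright : ∀ t ∈ Icc 0 T, v 0 1 t b = 0 := fun t ht => by
    have h1 := hvx 0 0 (by omega) t ht b (right_mem_Icc.2 hab.le)
    simp only [hv00] at h1
    have hd : HasDerivAt (u t) (deriv (u t) b) b :=
      ((hu.contDiff_one t ht).differentiable (by norm_num) b).hasDerivAt
    have h2 : HasDerivWithinAt (u t) 0 (Ici b) b :=
      (hasDerivWithinAt_const b (Ici b) (0:ℂ)).congr
        (fun x hx => hu.zero_outside t ht x fun h => not_lt.2 hx h.2)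
        (hu.zero_outside t ht b fun h => lt_irrefl _ h.2)
    have e1 := (uniqueDiffOn_Icc hab b (right_mem_Icc.2 hab.le)).eq_deriv _ h1 hd.hasDerivWithinAt
    have e2 := (uniqueDiffOn_Ici b b self_mem_Ici).eq_deriv _ h2 hd.hasDerivWithinAt
    rw [zero_add] at e1
    rw [e1, ← e2]
  have hx1 : ∀ t ∈ Icc 0 T, ∀ x ∈ Ioo a b, HasDerivAt (u t) (v 0 1 t x) x := fun t ht x hx => by
    have := hvx 0 0 (by omega) t ht x (Ioo_subset_Icc_self hx)
    simp only [hv00] at this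
    exact this.hasDerivAt (Icc_mem_nhds hx.1 hx.2)
  have hx2 : ∀ t ∈ Icc 0 T, ∀ x ∈ Ioo a b, HasDerivAt (v 0 1 t) (v 0 2 t x) x := fun t ht x hx =>
    (hvx 0 1 (by omega) t ht x (Ioo_subset_Icc_self hx)).hasDerivAt (Icc_mem_nhds hx.1 hx.2)
  have hx3 : ∀ t ∈ Icc 0 T, ContinuousOn (v 0 2 t) (Icc a b) := fun t ht x hx =>
    (hvx 0 2 (by omega) t ht x hx).continuousWithinAt
  have heq : ∀ t ∈ Icc 0 T, ∀ x ∈ Ioo a b,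
      Complex.I * v 1 0 t x - lam1 * fracLaplacian α (u t) x + lam2 * u t x = g t x :=
      fun t ht x hx => by
    have := hvt 0 0 (by omega) t ht x (Ioo_subset_Icc_self hx)
    simp only [hv00] at this
    rw [← hu.equation t ht x hx, this.derivWithin (uniqueDiffOn_Icc hT t ht)]
  have hFL := fun t ht L x => fracLaplacian_map hα (hu.zero_outside t ht) (hx1 t ht) (hx2 t ht)
    (hx3 t ht) L x
  refine ⟨fun i j t x => (v i j t x).re, fun i j t x => (v i j t x).im,
    ⟨hsm Complex.reCLM Complex.abs_re_le_norm, hsm Complex.imCLM Complex.abs_im_le_norm, ?_, ?_, ?_,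
      ?_, ?_, ?_⟩, fun t x => by simp [hv00]⟩
  · exact fun t ht => by simp [hleft t ht]
  · exact fun t ht => by simp [hleft t ht]
  · exact fun t ht => by simp [hright t ht]
  · exact fun t ht => by simp [hright t ht]
  · intro t ht x hx
    have e := congrArg Complex.im (heq t ht x hx)
    have e2 := hFL t ht Complex.imCLM x
    simp only [Complex.imCLM_apply] at e2
    simp at e
    rw [e2] at e
    simp only [hv00]
    linarith
  · intro t ht x hx
    have e := congrArg Complex.re (heq t ht x hx)
    have e2 := hFL t ht Complex.reCLM x
    simp only [Complex.reCLM_apply] at e2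
    simp at e
    rw [e2] at e
    simp only [hv00]
    linarith

/-- Coefficients of a discrete solution, and the equations for them with the data expressed through
the exact solution. -/
structure DiscreteFamily (N : ℕ) (m : Mesh a b K) (T : ℝ)
    (p q p' q' rp rq : ℝ → Coeff K N) : Prop where
  deriv_p : ∀ t ∈ Icc 0 T, HasDerivWithinAt p (p' t) (Icc 0 T) t
  deriv_q : ∀ t ∈ Icc 0 T, HasDerivWithinAt q (q' t) (Icc 0 T) t
  second_p : ∀ t ∈ Icc 0 T, ∃ s : PWPoly K, s.DegLE N ∧ IsDerivMinus m N (pw m (p t)) s ∧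
    IsDerivPlus m N s (pw m (rp t))
  second_q : ∀ t ∈ Icc 0 T, ∃ s : PWPoly K, s.DegLE N ∧ IsDerivMinus m N (pw m (q t)) s ∧
    IsDerivPlus m N s (pw m (rq t))

theorem exists_discreteFamily {n : ℕ} (hn : 3 ≤ n) {α lam1 lam2 R : ℝ} (hα : α < 2) (hT : 0 < T)
    (hab : a < b) {g : ℝ → ℝ → ℂ} {P Q : Jet}
    (hE : ExactFamily n α lam1 lam2 a b T R g P Q) {U : ℝ → State K}
    (hU : IsLDGSolution α lam1 lam2 T N m g U) :
    ∃ p q p' q' rp rq : ℝ → Coeff K N, DiscreteFamily N m T p q p' q' rp rq ∧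
      (∀ t ∈ Icc 0 T, pw m (p t) = (U t).p ∧ pw m (q t) = (U t).q) ∧
      (∀ t ∈ Icc 0 T, ∀ w : Coeff K N, ip m (p' t) w
        + lam1 * fracConst (2 - α) * en (2 - α) (fn m (rq t)) (fn m w) + lam2 * ip m (q t) w
        = (∑ k, m.inner k (fun x => P 1 0 t x + lam2 * Q 0 0 t x) fun x => (pw m w k).eval x)
          + lam1 * fracConst (2 - α) * en (2 - α) ((Ioo a b).indicator (Q 0 2 t)) (fn m w)) ∧
      ∀ t ∈ Icc 0 T, ∀ w : Coeff K N, ip m (q' t) w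
        - lam1 * fracConst (2 - α) * en (2 - α) (fn m (rp t)) (fn m w) - lam2 * ip m (p t) w
        = (∑ k, m.inner k (fun x => Q 1 0 t x + -lam2 * P 0 0 t x) fun x => (pw m w k).eval x)
          + -(lam1 * fracConst (2 - α)) * en (2 - α) ((Ioo a b).indicator (P 0 2 t)) (fn m w) := by
  have hμ : 0 < 2 - α := by linarith
  obtain ⟨p, p', hp, hpd, hpe⟩ := exists_coefficients (fun t ht => (hU.degLE t ht).1) m hU.diff_p hT
  obtain ⟨q, q', hq, hqd, hqe⟩ := exists_coefficients (fun t ht => (hU.degLE t ht).2.1) m hU.diff_q hT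
  have hr : ∀ t, ∃ c : Coeff K N, t ∈ Icc 0 T → pw m c = (U t).r := fun t => by
    by_cases ht : t ∈ Icc 0 T
    · obtain ⟨c, hc⟩ := exists_pw m (hU.degLE t ht).2.2.2.2.1
      exact ⟨c, fun _ => hc⟩
    · exact ⟨0, fun h => absurd h ht⟩
  have hw : ∀ t, ∃ c : Coeff K N, t ∈ Icc 0 T → pw m c = (U t).w := fun t => by
    by_cases ht : t ∈ Icc 0 T
    · obtain ⟨c, hc⟩ := exists_pw m (hU.degLE t ht).2.2.2.2.2.2.1
      exact ⟨c, fun _ => hc⟩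
    · exact ⟨0, fun h => absurd h ht⟩
  choose rq hrq using hr
  choose rp hrp using hw
  have hpot : ∀ (e : PWPoly K) (c w : Coeff K N) (r : PWPoly K), pw m c = r →
      (∀ k, ∀ β : Polynomial ℝ, β.natDegree ≤ N → m.inner k (fun x => (e k).eval x)
        (fun x => β.eval x) = m.inner k (fracIntegral (2 - α) (m.toFun r)) fun x => β.eval x) →
      ∑ k, m.inner k (fun x => (e k).eval x) (fun x => (pw m w k).eval x)
        = fracConst (2 - α) * en (2 - α) (fn m c) (fn m w) := fun e c w r hc he => by
    rw [← sum_inner_pot hμ hab (adm_fn m c) w, Finset.mul_sum]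
    refine Finset.sum_congr rfl fun k _ => ?_
    rw [he k _ (pw_natDegree_le m w k), ← hc]
    unfold Mesh.inner
    rw [← intervalIntegral.integral_const_mul]
    refine intervalIntegral.integral_congr fun x _ => ?_
    have := fracIntegral_eq_pot hμ (adm_fn m c) x
    simp only [fn] at this ⊢
    rw [this]
    ring
  refine ⟨p, q, p', q', rp, rq, ⟨hpd, hqd, fun t ht => ⟨(U t).z, (hU.degLE t ht).2.2.2.2.2.2.2, ?_, ?_⟩,
    fun t ht => ⟨(U t).s, (hU.degLE t ht).2.2.2.2.2.1, ?_, ?_⟩⟩, fun t ht => ⟨hp t ht, hq t ht⟩,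
    fun t ht w => ?_, fun t ht w => ?_⟩
  · rw [hp t ht]; exact (hU.aux t ht).z_eq
  · rw [hrp t ht]; exact (hU.aux t ht).w_eq
  · rw [hq t ht]; exact (hU.aux t ht).s_eq
  · rw [hrq t ht]; exact (hU.aux t ht).r_eq
  · have hA := adm_indicator (hE.smooth_q.continuousOn (i := 0) (j := 2) (by omega) ht)
    have hF : ContinuousOn (fun x => P 1 0 t x + lam2 * Q 0 0 t x) (Icc a b) :=
      (hE.smooth_p.continuousOn (by omega) ht).add
        (continuousOn_const.mul (hE.smooth_q.continuousOn (by omega) ht))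
    rw [← sum_inner_data (m := m) hμ hab hA hF _ (hE.eq_p t ht) w, ← sum_inner_pw hab (p' t) w,
      ← sum_inner_pw hab (q t) w, mul_assoc lam1, ← hpot _ _ _ _ (hrq t ht) (hU.aux t ht).e_eq,
      Finset.mul_sum, Finset.mul_sum, ← Finset.sum_add_distrib, ← Finset.sum_add_distrib]
    refine Finset.sum_congr rfl fun k _ => ?_
    rw [← hU.p_eq t ht k _ (pw_natDegree_le m w k)]
    simp only [hpe t ht, hq t ht]
  · have hA := adm_indicator (hE.smooth_p.continuousOn (i := 0) (j := 2) (by omega) ht)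
    have hF : ContinuousOn (fun x => Q 1 0 t x + -lam2 * P 0 0 t x) (Icc a b) :=
      (hE.smooth_q.continuousOn (by omega) ht).add
        (continuousOn_const.mul (hE.smooth_p.continuousOn (by omega) ht))
    rw [← sum_inner_data (m := m) hμ hab hA hF _ (hE.eq_q t ht) w, ← sum_inner_pw hab (q' t) w,
      ← sum_inner_pw hab (p t) w, mul_assoc lam1, ← hpot _ _ _ _ (hrp t ht) (hU.aux t ht).l_eq,
      Finset.mul_sum, Finset.mul_sum, ← Finset.sum_sub_distrib, ← Finset.sum_sub_distrib]
    refine Finset.sum_congr rfl fun k _ => ?_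
    have e := hU.q_eq t ht k _ (pw_natDegree_le m w k)
    have e2 : m.inner k (fun x => -(g t x).re) (fun x => (pw m w k).eval x)
        = -m.inner k (fun x => (g t x).re) fun x => (pw m w k).eval x := by
      unfold Mesh.inner
      rw [← intervalIntegral.integral_neg]
      simp only [neg_mul]
    rw [e2, ← e]
    simp only [hqe t ht, hp t ht]

end

section

variable {a b T : ℝ} {K N : ℕ} {μ : ℝ} {m : Mesh a b K}

theorem proj_unique {f : ℝ → ℝ} {k : Fin K} (hf : ContinuousOn f (Icc (m.lo k) (m.hi k)))
    {c : Coeff K N}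
    (h1 : ∀ φ : Polynomial ℝ, φ.degree < N →
      m.inner k (fun x => (pw m c k).eval x - f x) (fun x => φ.eval x) = 0)
    (h2 : (pw m c k).eval (m.hi k) = f (m.hi k)) : proj m N (some true) f k = c k := by
  have hh : m.hi k - m.lo k ≠ 0 := (m.len_pos k).ne'
  have hd : refData N (some true) (fun σ => f (m.lo k + (m.hi k - m.lo k) * σ))
      = refData N (some true) fun σ => (refPoly N (c k)).eval σ := by
    ext j
    simp only [refData, Option.elim_some, cond_true]
    split_ifs with hj
    · have := pw_eval_local m c k 1
      rw [mul_one, add_sub_cancel] at this ⊢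
      rw [← this, h2]
    · set φ : Polynomial ℝ := (Polynomial.C (m.hi k - m.lo k)⁻¹ *
        (Polynomial.X - Polynomial.C (m.lo k))) ^ (j : ℕ) with hφ
      have hjN : (j : ℕ) < N := by
        have := j.2
        rw [Fin.ext_iff, Fin.val_last] at hj
        omega
      have hdeg : φ.degree < N := by
        refine (Polynomial.degree_le_natDegree).trans_lt ?_
        have : φ.natDegree ≤ j := by
          refine (Polynomial.natDegree_pow_le).trans ?_
          have : (Polynomial.C (m.hi k - m.lo k)⁻¹ *
              (Polynomial.X - Polynomial.C (m.lo k))).natDegree ≤ 1 :=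
            (Polynomial.natDegree_C_mul_le _ _).trans (Polynomial.natDegree_X_sub_C_le _)
          nlinarith
        exact_mod_cast this.trans_lt hjN
      have h := h1 φ hdeg
      unfold Mesh.inner at h
      rw [integral_cell, mul_eq_zero, or_iff_right hh] at h
      have e : ∀ σ, φ.eval (m.lo k + (m.hi k - m.lo k) * σ) = σ ^ (j : ℕ) := fun σ => by
        simp only [hφ, Polynomial.eval_pow, Polynomial.eval_mul, Polynomial.eval_C,
          Polynomial.eval_sub, Polynomial.eval_X, add_sub_cancel_left]
        rw [inv_mul_cancel_left₀ hh]
      simp_rw [e, pw_eval_local, sub_mul (Polynomial.eval _ _)] at h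
      rw [intervalIntegral.integral_sub (intervalIntegrable_mul_pow
        (refPoly N (c k)).continuous.continuousOn _)
        (intervalIntegrable_mul_pow (continuousOn_local hf) _), sub_eq_zero] at h
      exact h.symm
  unfold proj refProj
  rw [hd]
  exact refProj_refPoly _ _

theorem eq_proj_of_isProjMinus {f : ℝ → ℝ} (hf : ContinuousOn f (Icc a b))
    {c : Coeff K N} (h : m.IsProjMinus N f (pw m c)) :
    c = proj m N (some true) f :=
  funext fun k => (proj_unique (hf.mono (cell_subset k)) (h.2.1 k) (h.2.2 k)).symm

theorem SmallDual.add {δ δ' : ℝ} {c d : Coeff K N} (hμ : 0 < μ) (hμ1 : μ < 1)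
    (h : SmallDual μ δ m c) (h' : SmallDual μ δ' m d) (hδ : 0 ≤ δ) (hδ' : 0 ≤ δ') :
    SmallDual μ (δ + δ') m (c + d) where
  dual w hw := by
    have e : ∫ x, fn m (c + d) x * w x = (∫ x, fn m c x * w x) + ∫ x, fn m d x * w x := by
      rw [fn_add, ← integral_add ((adm_fn m c).mul hw).integrable ((adm_fn m d).mul hw).integrable]
      simp only [Pi.add_apply, add_mul]
    have hen := en_nonneg hμ hμ1 hw
    have h3 : ∀ (x δ : ℝ), 0 ≤ δ → x ^ 2 ≤ δ ^ 2 * en μ w w → |x| ≤ δ * √(en μ w w) :=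
      fun x δ hδ hx => abs_le_of_sq_le_sq (by rwa [mul_pow, Real.sq_sqrt hen]) (by positivity)
    rw [e]
    calc _ ≤ (δ * √(en μ w w) + δ' * √(en μ w w)) ^ 2 := by
          refine sq_le_sq' ?_ ?_
          · have := abs_le.1 (h3 _ _ hδ (h.dual w hw))
            have := abs_le.1 (h3 _ _ hδ' (h'.dual w hw))
            linarith
          · have := abs_le.1 (h3 _ _ hδ (h.dual w hw))
            have := abs_le.1 (h3 _ _ hδ' (h'.dual w hw))
            linarith
      _ = (δ + δ') ^ 2 * en μ w w := by rw [← add_mul, mul_pow, Real.sq_sqrt hen]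
  sup k := (norm_add_le _ _).trans (add_le_add (h.sup k) (h'.sup k))

theorem SmallDual.smul {δ : ℝ} {c : Coeff K N} (h : SmallDual μ δ m c) (r : ℝ) :
    SmallDual μ (|r| * δ) m (r • c) where
  dual w hw := by
    have e : ∫ x, fn m (r • c) x * w x = r * ∫ x, fn m c x * w x := by
      rw [fn_smul, ← integral_const_mul]
      simp only [Pi.smul_apply, smul_eq_mul, mul_assoc]
    rw [e, mul_pow, mul_pow, sq_abs, mul_assoc]
    exact mul_le_mul_of_nonneg_left (h.dual w hw) (sq_nonneg r)
  sup k := by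
    rw [Pi.smul_apply, norm_smul, Real.norm_eq_abs]
    exact mul_le_mul_of_nonneg_left (h.sup k) (abs_nonneg r)

theorem SmallDual.ip_sq_le {δ : ℝ} {c : Coeff K N} (hμ : 0 < μ)
    (h : SmallDual μ δ m c) (w : Coeff K N) :
    ip m c w ^ 2 ≤ δ ^ 2 * af hμ m w w := h.dual _ (adm_fn m w)

/-- The consistency error of the `L²` projection in the energy form. -/
theorem energy_proj_error (N : ℕ) (hμ : 0 < μ) (hμ1 : μ < 1) (hab : a < b) :
    ∃ C : ℝ, 0 < C ∧ ∀ (K : ℕ) (m : Mesh a b K) (f : ℕ → ℝ → ℝ) (R : ℝ), 0 ≤ R →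
      DerivChain (N + 1) a b f → (∀ x ∈ Icc a b, |f (N + 1) x| ≤ R) →
      ∀ w : Coeff K N, (en μ ((Ioo a b).indicator (f 0)) (fn m w)
        - af hμ m (proj m N none (f 0)) w) ^ 2 ≤ (C * (R * m.size ^ (N + 1))) ^ 2 * af hμ m w w := by
  obtain ⟨C1, hC1, h1⟩ := abs_proj_sub_le N
  obtain ⟨C2, hC2, h2⟩ := en_le_integral_sq hμ hμ1 hab
  have hba : 0 < b - a := sub_pos.2 hab
  refine ⟨1 + C2 * ((b - a) * C1 ^ 2), by positivity, fun K m f R hR hf hfR w => ?_⟩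
  set δ := R * m.size ^ (N + 1) with hδ
  have hδ0 : 0 ≤ δ := mul_nonneg hR (pow_nonneg (m.size_pos hab).le _)
  set c := proj m N none (f 0) with hc
  have hA := adm_indicator (hf.continuousOn (Nat.succ_pos N))
  have hv := hA.add ((adm_fn m c).const_mul (-1))
  have hw := adm_fn m w
  have e1 : en μ ((Ioo a b).indicator (f 0)) (fn m w) - af hμ m c w
      = en μ (fun x => (Ioo a b).indicator (f 0) x + -1 * fn m c x) (fn m w) := by
    rw [en_add_left hμ hA ((adm_fn m c).const_mul (-1)) hw, en_const_mul_left, af_apply]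
    ring
  have e2 : ∫ x, ((Ioo a b).indicator (f 0) x + -1 * fn m c x) ^ 2 ≤ (b - a) * (C1 * δ) ^ 2 := by
    refine integral_sq_le_of_bound hab hv (m := m) fun k x hx => ?_
    rw [fn_of_mem m c hx, indicator_of_mem (m.Ioo_subset k hx), neg_one_mul, ← sub_eq_add_neg,
      abs_sub_comm]
    exact h1 m none f R hf hfR k x (Ioo_subset_Icc_self hx)
  rw [e1]
  refine (en_sq_le hμ hμ1 hv hw).trans
    (mul_le_mul_of_nonneg_right ?_ (en_nonneg hμ hμ1 hw))
  refine (h2 _ hv).trans ((mul_le_mul_of_nonneg_left e2 hC2.le).trans ?_)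
  have h0 : 0 ≤ C2 * ((b - a) * C1 ^ 2) := by positivity
  calc _ = C2 * ((b - a) * C1 ^ 2) * δ ^ 2 := by ring
    _ ≤ (1 + C2 * ((b - a) * C1 ^ 2)) ^ 2 * δ ^ 2 :=
      mul_le_mul_of_nonneg_right (by nlinarith) (sq_nonneg _)
    _ = _ := by ring

theorem sum_inner_proj_none (hab : a < b) {f : ℝ → ℝ} (hf : ContinuousOn f (Icc a b))
    (w : Coeff K N) :
    ∑ k, m.inner k f (fun x => (pw m w k).eval x) = ip m (proj m N none f) w := by
  rw [← sum_inner_pw hab]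
  exact Finset.sum_congr rfl fun k _ => (inner_proj_eq none (hf.mono (cell_subset k))
    (Or.inr ⟨rfl, pw_natDegree_le m w k⟩)).symm

theorem ritz_add_mul {f g : ℝ → ℝ} (hf : ContinuousOn f (Icc a b)) (hg : ContinuousOn g (Icc a b))
    (c : ℝ) : ritz m N (fun x => f x + c * g x) = ritz m N f + c • ritz m N g := by
  unfold ritz
  rw [proj_add (g := fun x => c * g x) _ hf (continuousOn_const.mul hg), proj_smul, map_add, map_smul]

/-- `r` is the second discrete derivative of `c`. -/
def IsSecondDeriv (m : Mesh a b K) (c r : Coeff K N) : Prop :=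
  ∃ s : PWPoly K, s.DegLE N ∧ IsDerivMinus m N (pw m c) s ∧ IsDerivPlus m N s (pw m r)

theorem IsSecondDeriv.sub {c r c' r' : Coeff K N} (h : IsSecondDeriv m c r)
    (h' : IsSecondDeriv m c' r') : IsSecondDeriv m (c - c') (r - r') := by
  obtain ⟨s, hs, h1, h2⟩ := h
  obtain ⟨s', hs', h1', h2'⟩ := h'
  refine ⟨s - s', fun k => (Polynomial.natDegree_sub_le _ _).trans (max_le (hs k) (hs' k)), ?_, ?_⟩
  · rw [map_sub]; exact h1.sub h1'
  · rw [map_sub]; exact h2.sub h2'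

theorem isSecondDeriv_inv (y : Coeff K N) :
    IsSecondDeriv m (invMinus m (invPlus m y)) y :=
  ⟨pw m (invPlus m y), pw_natDegree_le m _, isDerivMinus_invMinus m _, isDerivPlus_invPlus m _⟩

theorem isSecondDeriv_ritz {f f' : ℝ → ℝ} (hf : ContinuousOn f (Icc a b))
    (hf' : ContinuousOn f' (Icc a b))
    (hd : ∀ x ∈ Icc a b, HasDerivWithinAt f (f' x) (Icc a b) x) (hb : f b = 0) :
    IsSecondDeriv m (ritz m N f) (proj m N none f') := by
  refine ⟨pw m (proj m N (some false) f), pw_natDegree_le m _, isDerivMinus_invMinus m _,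
    isDerivPlus_proj hf (ψ := fun _ => f') (fun k => hf'.mono (cell_subset k)) (fun k x hx => ?_) hb
      fun k φ hφ => inner_proj_eq none (hf'.mono (cell_subset k)) (Or.inr ⟨rfl, hφ⟩)⟩
  have hx' := m.Ioo_subset k hx
  exact (hd x (Ioo_subset_Icc_self hx')).hasDerivAt (Icc_mem_nhds hx'.1 hx'.2)

theorem IsSecondDeriv.ip_symm (hab : a < b) {c r c' r' : Coeff K N}
    (h : IsSecondDeriv m c r) (h' : IsSecondDeriv m c' r') : ip m r' c = ip m r c' := by
  obtain ⟨s, hs, h1, h2⟩ := h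
  obtain ⟨s', hs', h1', h2'⟩ := h'
  rw [← sum_inner_pw hab, ← sum_inner_pw hab,
    sum_inner_adjoint hs' (pw_natDegree_le m c) h2' h1,
    sum_inner_adjoint hs (pw_natDegree_le m c') h2 h1']
  unfold Mesh.inner
  simp only [mul_comm]

/-- The error in the broken norm, from the distance to a comparison function. -/
theorem sum_integral_error_le (hab : a < b) {F : ℝ → ℝ} (hF : ContinuousOn F (Icc a b))
    {p c : Coeff K N} {M : ℝ}
    (hM : ∀ k, ∀ x ∈ Icc (m.lo k) (m.hi k), |(pw m c k).eval x - F x| ≤ M) :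
    ∑ k, ∫ x in (m.lo k)..(m.hi k), (F x - (pw m p k).eval x) ^ 2
      ≤ 2 * ((b - a) * M ^ 2) + 2 * ip m (p - c) (p - c) := by
  rw [← m.sum_len, ← sum_inner_pw hab, Finset.sum_mul, Finset.mul_sum, Finset.mul_sum,
    ← Finset.sum_add_distrib]
  refine Finset.sum_le_sum fun k _ => ?_
  have hle := (m.lo_lt_hi k).le
  have hc1 : ContinuousOn (fun x => (F x - (pw m p k).eval x) ^ 2) (uIcc (m.lo k) (m.hi k)) := by
    rw [uIcc_of_le hle]
    exact ((hF.mono (cell_subset k)).sub (pw m p k).continuous.continuousOn).pow 2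
  have hc2 : Continuous fun x => (pw m (p - c) k).eval x * (pw m (p - c) k).eval x :=
    (pw m (p - c) k).continuous.mul (pw m (p - c) k).continuous
  calc ∫ x in (m.lo k)..(m.hi k), (F x - (pw m p k).eval x) ^ 2
      ≤ ∫ x in (m.lo k)..(m.hi k),
          (2 * M ^ 2 + 2 * ((pw m (p - c) k).eval x * (pw m (p - c) k).eval x)) := by
        refine intervalIntegral.integral_mono_on hle hc1.intervalIntegrable
          ((continuous_const.add (continuous_const.mul hc2)).intervalIntegrable _ _)
          fun x hx => ?_
        have e : F x - (pw m p k).eval x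
            = -((pw m c k).eval x - F x) - (pw m (p - c) k).eval x := by
          simp only [map_sub, Pi.sub_apply, Polynomial.eval_sub]; ring
        have h2 : ((pw m c k).eval x - F x) ^ 2 ≤ M ^ 2 :=
          sq_le_sq.2 ((hM k x hx).trans (le_abs_self M))
        rw [e]
        nlinarith [sq_nonneg ((pw m c k).eval x - F x - (pw m (p - c) k).eval x)]
    _ = _ := by
        rw [intervalIntegral.integral_add (f := fun _ => 2 * M ^ 2)
          (g := fun x => 2 * ((pw m (p - c) k).eval x * (pw m (p - c) k).eval x))
          (continuous_const.intervalIntegrable _ _)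
          ((continuous_const.mul hc2).intervalIntegrable _ _), intervalIntegral.integral_const,
          intervalIntegral.integral_const_mul, smul_eq_mul, Mesh.inner]
        ring

end

section

variable {a b T : ℝ} {K N : ℕ} {μ : ℝ} {m : Mesh a b K}

theorem HasDerivWithinAt.linearMap_comp {V W : Type*} [NormedAddCommGroup V] [NormedSpace ℝ V]
    [FiniteDimensional ℝ V] [NormedAddCommGroup W] [NormedSpace ℝ W] (L : V →ₗ[ℝ] W) {f : ℝ → V}
    {f' : V} {s : Set ℝ} {t : ℝ} (h : HasDerivWithinAt f f' s t) :
    HasDerivWithinAt (fun τ => L (f τ)) (L f') s t :=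
  (LinearMap.toContinuousLinearMap L).hasFDerivAt.comp_hasDerivWithinAt t h

theorem SmoothFamily.hasDerivWithinAt_ritz {n : ℕ} {R : ℝ} {v : Jet}
    (h : SmoothFamily n a b T R v) {i j : ℕ} (hij : i + j + 2 ≤ n) {t : ℝ} (ht : t ∈ Icc 0 T) :
    HasDerivWithinAt (fun τ => ritz m N (v i j τ)) (ritz m N (v (i + 1) j t)) (Icc 0 T) t :=
  HasDerivWithinAt.linearMap_comp (invMinus m) (h.hasDerivWithinAt_proj hij _ ht)

theorem exists_correction (N : ℕ) (hμ : 0 < μ) (hμ1 : μ < 1) (hab : a < b) (hT : 0 < T) :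
    ∃ C : ℝ, 0 < C ∧ ∀ (K : ℕ) (m : Mesh a b K) (κ R : ℝ) (G : Jet), κ ≠ 0 → 0 ≤ R →
      SmoothFamily (N + 3) a b T R G → (∀ t ∈ Icc 0 T, G 0 0 t a = 0) →
      ∃ y y' : ℝ → Coeff K N, ∀ t ∈ Icc 0 T,
        HasDerivWithinAt (fun τ => invMinus m (invPlus m (y τ))) (invMinus m (invPlus m (y' t)))
          (Icc 0 T) t ∧
        SmallDual μ (|κ⁻¹| * (C * (R * m.size ^ (N + 1)))) m (invMinus m (invPlus m (y t))) ∧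
        SmallDual μ (|κ⁻¹| * (C * (R * m.size ^ (N + 1)))) m (invMinus m (invPlus m (y' t))) ∧
        ∀ w, κ * af hμ m (y t) w = -ip m (ritz m N (G 0 1 t) - proj m N none (G 0 0 t)) w := by
  obtain ⟨C, hC, h⟩ := correction_smallDual N hμ hμ1 hab
  refine ⟨C, hC, fun K m κ R G hκ hR hG hG0 => ?_⟩
  obtain ⟨S, hS⟩ := exists_energy_inverse N hμ hμ1 hab m
  set d : ℕ → ℝ → Coeff K N :=
    fun i t => ritz m N (G i 1 t) - proj m N none (G i 0 t) with hd
  have hsm : ∀ i ≤ 1, ∀ t ∈ Icc 0 T, SmallDual μ (|κ⁻¹| * (C * (R * m.size ^ (N + 1)))) m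
      (invMinus m (invPlus m (-κ⁻¹ • S (d i t)))) := fun i hi t ht => by
    have hc : DerivChain (N + 2) a b fun l => G i (0 + l) t :=
      hG.derivChain (i := i) (j := 0) (k := N + 2) (by omega) ht
    simp only [zero_add] at hc
    have := h K m (G i · t) R hR hc (fun x hx => hG.bound i (N + 1) (by omega) t ht x hx)
      (fun x hx => hG.bound i (N + 2) (by omega) t ht x hx)
      (hG.zero_of_zero hT (left_mem_Icc.2 hab.le) hG0 (by omega) t ht) (S (d i t)) (hS _)
    have h2 := this.smul (-κ⁻¹)
    rwa [abs_neg, ← map_smul, ← map_smul] at h2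
  refine ⟨fun t => -κ⁻¹ • S (d 0 t), fun t => -κ⁻¹ • S (d 1 t), fun t ht =>
    ⟨?_, hsm 0 zero_le_one t ht, hsm 1 le_rfl t ht, fun w => ?_⟩⟩
  · have hdd : HasDerivWithinAt (d 0) (d 1 t) (Icc 0 T) t :=
      (hG.hasDerivWithinAt_ritz (i := 0) (j := 1) (by omega) ht).sub
        (hG.hasDerivWithinAt_proj (i := 0) (j := 0) (by omega) none ht)
    exact HasDerivWithinAt.linearMap_comp (invMinus m) (HasDerivWithinAt.linearMap_comp (invPlus m)
      ((HasDerivWithinAt.linearMap_comp S hdd).const_smul (-κ⁻¹)))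
  · rw [map_smul, LinearMap.smul_apply, hS, smul_eq_mul, ← mul_assoc, mul_neg,
      mul_inv_cancel₀ hκ, neg_one_mul]

/-- The residual of the corrected Ritz projection in one of the two real equations. -/
theorem residual_le (hμ : 0 < μ) (hμ1 : μ < 1) (hab : a < b) {n : ℕ} (hn : 3 ≤ n)
    {R κ c δ t : ℝ} {P Q : Jet} (hP : SmoothFamily n a b T R P)
    (hQ : SmoothFamily n a b T R Q) (ht : t ∈ Icc 0 T)
    {p' q r y d₁ d₂ w : Coeff K N}
    (heq : ip m p' w + κ * af hμ m r w + c * ip m q w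
      = (∑ k, m.inner k (fun x => P 1 0 t x + c * Q 0 0 t x) fun x => (pw m w k).eval x)
        + κ * en μ ((Ioo a b).indicator (Q 0 2 t)) (fn m w))
    (hy : κ * af hμ m y w = -ip m (ritz m N (fun x => P 1 1 t x + c * Q 0 1 t x)
      - proj m N none fun x => P 1 0 t x + c * Q 0 0 t x) w)
    (h₁ : SmallDual μ δ m d₁) (h₂ : SmallDual μ δ m d₂)
    (he : (en μ ((Ioo a b).indicator (Q 0 2 t)) (fn m w) - af hμ m (proj m N none (Q 0 2 t)) w) ^ 2
      ≤ δ ^ 2 * af hμ m w w) :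
    (ip m (p' - ritz m N (P 1 1 t) - d₁) w + κ * af hμ m (r - proj m N none (Q 0 2 t) - y) w
      + c * ip m (q - ritz m N (Q 0 1 t) - d₂) w) ^ 2
      ≤ (2 * (1 + |κ| + |c|) * δ) ^ 2 * af hμ m w w := by
  have hF : ContinuousOn (fun x => P 1 0 t x + c * Q 0 0 t x) (Icc a b) :=
    (hP.continuousOn (by omega) ht).add (continuousOn_const.mul (hQ.continuousOn (by omega) ht))
  rw [sum_inner_proj_none hab hF] at heq
  rw [ritz_add_mul (hP.continuousOn (by omega) ht) (hQ.continuousOn (by omega) ht)] at hy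
  have e1 := h₁.ip_sq_le hμ w
  have e2 := h₂.ip_sq_le hμ w
  have hen : 0 ≤ af hμ m w w := en_nonneg hμ hμ1 (adm_fn m w)
  simp only [map_sub, map_add, map_smul, LinearMap.sub_apply, LinearMap.add_apply,
    LinearMap.smul_apply, smul_eq_mul] at hy ⊢
  generalize en μ ((Ioo a b).indicator (Q 0 2 t)) (fn m w) = X at *
  set Y := af hμ m (proj m N none (Q 0 2 t)) w
  set d := ip m d₁ w
  set d' := ip m d₂ w
  set A := af hμ m w w
  have hsum : ip m p' w - ip m (ritz m N (P 1 1 t)) w - d + κ * (af hμ m r w - Y - af hμ m y w)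
      + c * (ip m q w - ip m (ritz m N (Q 0 1 t)) w - d') = κ * (X - Y) - d - c * d' := by
    linear_combination heq - hy
  rw [hsum]
  have h0 : 0 ≤ δ ^ 2 * A := by positivity
  have e3 := mul_le_mul_of_nonneg_left he (sq_nonneg κ)
  have e4 := mul_le_mul_of_nonneg_left e2 (sq_nonneg c)
  calc (κ * (X - Y) - d - c * d') ^ 2
      ≤ 3 * (κ ^ 2 * (X - Y) ^ 2 + d ^ 2 + c ^ 2 * d' ^ 2) := by
        nlinarith [sq_nonneg (κ * (X - Y) + d), sq_nonneg (κ * (X - Y) + c * d'),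
          sq_nonneg (d - c * d')]
    _ ≤ 3 * (κ ^ 2 + 1 + c ^ 2) * (δ ^ 2 * A) := by linarith
    _ ≤ (2 * (1 + |κ| + |c|)) ^ 2 * (δ ^ 2 * A) := by
        refine mul_le_mul_of_nonneg_right ?_ h0
        rw [← sq_abs κ, ← sq_abs c]
        nlinarith [abs_nonneg κ, abs_nonneg c, mul_nonneg (abs_nonneg κ) (abs_nonneg c)]
    _ = _ := by ring

/-- The error estimate of order `N + 1` for the discrete coefficients. -/
def ErrorEstimate (N : ℕ) (α lam1 lam2 a b T R : ℝ) : Prop :=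
  ∃ C : ℝ, 0 < C ∧ ∀ (g : ℝ → ℝ → ℂ) (P Q : Jet),
    ExactFamily (N + 4) α lam1 lam2 a b T R g P Q → ∀ (K : ℕ) (m : Mesh a b K)
    (p q p' q' rp rq : ℝ → Coeff K N), DiscreteFamily N m T p q p' q' rp rq →
    (∀ t ∈ Icc 0 T, ∀ w : Coeff K N, ip m (p' t) w
      + lam1 * fracConst (2 - α) * en (2 - α) (fn m (rq t)) (fn m w) + lam2 * ip m (q t) w
      = (∑ k, m.inner k (fun x => P 1 0 t x + lam2 * Q 0 0 t x) fun x => (pw m w k).eval x)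
        + lam1 * fracConst (2 - α) * en (2 - α) ((Ioo a b).indicator (Q 0 2 t)) (fn m w)) →
    (∀ t ∈ Icc 0 T, ∀ w : Coeff K N, ip m (q' t) w
      - lam1 * fracConst (2 - α) * en (2 - α) (fn m (rp t)) (fn m w) - lam2 * ip m (p t) w
      = (∑ k, m.inner k (fun x => Q 1 0 t x + -lam2 * P 0 0 t x) fun x => (pw m w k).eval x)
        + -(lam1 * fracConst (2 - α)) * en (2 - α) ((Ioo a b).indicator (P 0 2 t)) (fn m w)) →
    p 0 = proj m N (some true) (P 0 0 0) → q 0 = proj m N (some true) (Q 0 0 0) →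
    ∀ t ∈ Icc 0 T, (∑ k, ∫ x in (m.lo k)..(m.hi k), (P 0 0 t x - (pw m (p t) k).eval x) ^ 2)
      + (∑ k, ∫ x in (m.lo k)..(m.hi k), (Q 0 0 t x - (pw m (q t) k).eval x) ^ 2)
      ≤ C * (m.size ^ (N + 1)) ^ 2

set_option maxHeartbeats 400000 in
/-- Error estimate for the discrete coefficients when the fractional term is present. -/
theorem error_estimate_of_ne_zero (N : ℕ) {α lam1 : ℝ} (lam2 R : ℝ) (hα1 : 1 < α) (hα2 : α < 2)
    (hlam : lam1 ≠ 0) (hab : a < b) (hT : 0 < T) (hR : 0 ≤ R) :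
    ErrorEstimate N α lam1 lam2 a b T R := by
  unfold ErrorEstimate
  have hμ : 0 < 2 - α := by linarith
  have hμ1 : 2 - α < 1 := by linarith
  set μ := 2 - α with hμdef
  set κ := lam1 * fracConst μ with hκdef
  have hκ : κ ≠ 0 := mul_ne_zero hlam (fracConst_pos hμ hμ1).ne'
  obtain ⟨C1, hC1, h1⟩ := ritz_defect N hμ hμ1 hab
  obtain ⟨C2, hC2, h2⟩ := defect_sup N hμ hμ1 hab
  obtain ⟨C3, hC3, h3⟩ := exists_correction N hμ hμ1 hab hT
  obtain ⟨C4, hC4, h4⟩ := energy_proj_error N hμ hμ1 hab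
  obtain ⟨C5, hC5, h5⟩ := evolution_estimate N hμ hμ1 hab T
  set R1 := R + |lam2| * R with hR1
  have hR10 : 0 ≤ R1 := by positivity
  set D1 := |κ⁻¹| * (C3 * R1) with hD1
  set D0 := C1 * R + D1 + C4 * R with hD0
  set M0 := C2 * R + (N + 1) * D1 with hM0
  set D2 := 2 * (1 + |κ| + |lam2|) * D0 with hD2
  have hba : 0 < b - a := sub_pos.2 hab
  have hD10 : 0 ≤ D1 := by positivity
  have hD00 : 0 ≤ D0 := by positivity
  have hD02 : D0 ≤ D2 := by
    rw [hD2]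
    exact le_mul_of_one_le_left hD00 (by linarith [abs_nonneg κ, abs_nonneg lam2])
  refine ⟨1 + (4 * ((b - a) * M0 ^ 2) + 2 * (C5 * D2 ^ 2)), by positivity,
    fun g P Q hE K m p q p' q' rp rq hD hp hq hp0 hq0 t ht => ?_⟩
  set H := m.size ^ (N + 1) with hH
  have hH0 : 0 ≤ H := pow_nonneg (m.size_pos hab).le _
  have hP := hE.smooth_p
  have hQ := hE.smooth_q
  have h0T : (0:ℝ) ∈ Icc 0 T := left_mem_Icc.2 hT.le
  have hGp : SmoothFamily (N + 3) a b T R1 fun i j t x => P (i + 1) j t x + lam2 * Q i j t x :=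
    hP.shift.add_mul (hQ.mono (by omega) le_rfl) lam2
  have hGq : SmoothFamily (N + 3) a b T R1 fun i j t x => Q (i + 1) j t x + -lam2 * P i j t x := by
    have := hQ.shift.add_mul (hP.mono (by omega : N + 3 ≤ N + 4) le_rfl) (-lam2)
    rwa [abs_neg] at this
  have hzero : ∀ v : Jet, SmoothFamily (N + 4) a b T R v →
      (∀ t ∈ Icc 0 T, v 0 0 t a = 0) → ∀ t ∈ Icc 0 T, v 1 0 t a = 0 := fun v hv hv0 =>
    hv.zero_of_zero hT (left_mem_Icc.2 hab.le) hv0 (by omega)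
  obtain ⟨yq, yq', hyq⟩ := h3 K m κ R1 _ hκ hR10 hGp fun t ht => by
    simp only [zero_add, hzero P hP hE.left_p t ht, hE.left_q t ht, mul_zero]
  obtain ⟨yp, yp', hyp⟩ := h3 K m (-κ) R1 _ (neg_ne_zero.2 hκ) hR10 hGq fun t ht => by
    simp only [zero_add, hzero Q hQ hE.left_q t ht, hE.left_p t ht, mul_zero, add_zero]
  have hδ1 : |κ⁻¹| * (C3 * (R1 * H)) = D1 * H := by rw [hD1]; ring
  simp only [inv_neg, abs_neg, ← hH, hδ1] at hyq hyp
  have hD1H : D1 * H ≤ D0 * H := mul_le_mul_of_nonneg_right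
    (by rw [hD0]; nlinarith [mul_nonneg hC1.le hR, mul_nonneg hC4.le hR]) hH0
  have hchain : ∀ v : Jet, SmoothFamily (N + 4) a b T R v → ∀ t ∈ Icc 0 T,
      DerivChain (N + 2) a b fun l => v 0 l t := fun v hv t ht => by
    have := hv.derivChain (i := 0) (j := 0) (k := N + 2) (by omega) ht
    simpa only [zero_add] using this
  have hen : ∀ v : Jet, SmoothFamily (N + 4) a b T R v → ∀ t ∈ Icc 0 T,
      ∀ w : Coeff K N, (en μ ((Ioo a b).indicator (v 0 2 t)) (fn m w)
        - af hμ m (proj m N none (v 0 2 t)) w) ^ 2 ≤ (D0 * H) ^ 2 * af hμ m w w :=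
      fun v hv t ht w => by
    have hle : C4 * (R * H) ≤ D0 * H := by
      rw [← mul_assoc]
      exact mul_le_mul_of_nonneg_right (by rw [hD0]; nlinarith [mul_nonneg hC1.le hR]) hH0
    refine (h4 K m (fun l => v 0 (2 + l) t) R hR (hv.derivChain (by omega) ht)
      (fun x hx => hv.bound 0 (2 + (N + 1)) (by omega) t ht x hx) w).trans ?_
    rw [← hH]
    exact mul_le_mul_of_nonneg_right (pow_le_pow_left₀ (by positivity) hle 2)
      (en_nonneg hμ hμ1 (adm_fn m w))
  have hinit : ∀ v : Jet, SmoothFamily (N + 4) a b T R v →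
      (∀ t ∈ Icc 0 T, v 0 0 t a = 0) → ∀ d : Coeff K N, SmallDual μ (D1 * H) m d →
      ∀ w, ip m (proj m N (some true) (v 0 0 0) - ritz m N (v 0 1 0) - d) w ^ 2
        ≤ (D2 * H) ^ 2 * af hμ m w w := fun v hv hv0 d hd w => by
    have e1 := h1 K m (v 0 · 0) R hR (hchain v hv 0 h0T)
      (fun x hx => hv.bound 0 (N + 2) (by omega) 0 h0T x hx) (hv0 0 h0T)
    rw [← hH] at e1
    have e2 := ((e1.add hμ hμ1 hd (by positivity) (by positivity)).smul (-1)).mono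
      (by positivity) (δ' := D2 * H) (by
        rw [abs_neg, abs_one, one_mul]
        have : D0 * H ≤ D2 * H := mul_le_mul_of_nonneg_right hD02 hH0
        have : 0 ≤ C4 * R * H := by positivity
        have : D0 * H = C1 * R * H + D1 * H + C4 * R * H := by rw [hD0]; ring
        linarith) hμ hμ1
    have e3 := e2.ip_sq_le hμ w
    convert e3 using 4
    rw [neg_one_smul]
    abel
  have hcont : ∀ v : Jet, SmoothFamily (N + 4) a b T R v → ∀ t ∈ Icc 0 T, ∀ j ≤ 3,
      ContinuousOn (v 0 j t) (Icc a b) := fun v hv t ht j hj => hv.continuousOn (by omega) ht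
  have hsec : ∀ v : Jet, SmoothFamily (N + 4) a b T R v →
      (∀ t ∈ Icc 0 T, v 0 1 t b = 0) → ∀ t ∈ Icc 0 T,
      IsSecondDeriv m (ritz m N (v 0 1 t)) (proj m N none (v 0 2 t)) := fun v hv hvb t ht =>
    isSecondDeriv_ritz (hcont v hv t ht 1 (by omega)) (hcont v hv t ht 2 (by omega))
      (fun x hx => hv.dx 0 1 (by omega) t ht x hx) (hvb t ht)
  have key := h5 K m κ lam2 (D2 * H)
    (fun t => p t - ritz m N (P 0 1 t) - invMinus m (invPlus m (yp t)))
    (fun t => q t - ritz m N (Q 0 1 t) - invMinus m (invPlus m (yq t)))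
    (fun t => p' t - ritz m N (P 1 1 t) - invMinus m (invPlus m (yp' t)))
    (fun t => q' t - ritz m N (Q 1 1 t) - invMinus m (invPlus m (yq' t)))
    (fun t => rp t - proj m N none (P 0 2 t) - yp t)
    (fun t => rq t - proj m N none (Q 0 2 t) - yq t)
    (fun t ht => ((hD.deriv_p t ht).sub (hP.hasDerivWithinAt_ritz (by omega) ht)).sub (hyp t ht).1)
    (fun t ht => ((hD.deriv_q t ht).sub (hQ.hasDerivWithinAt_ritz (by omega) ht)).sub (hyq t ht).1)
    (fun t ht => IsSecondDeriv.ip_symm hab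
      ((IsSecondDeriv.sub (hD.second_p t ht) (hsec P hP hE.right_p t ht)).sub (isSecondDeriv_inv _))
      ((IsSecondDeriv.sub (hD.second_q t ht) (hsec Q hQ hE.right_q t ht)).sub (isSecondDeriv_inv _)))
    (fun t ht w => by
      have := residual_le (m := m) hμ hμ1 hab (by omega) hP hQ ht (hp t ht w) ((hyq t ht).2.2.2 w)
        ((hyp t ht).2.2.1.mono (by positivity) hD1H hμ hμ1)
        ((hyq t ht).2.1.mono (by positivity) hD1H hμ hμ1) (hen Q hQ t ht w)
      rwa [← mul_assoc, ← hD2] at this)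
    (fun t ht w => by
      have hq' : ip m (q' t) w + -κ * af hμ m (rp t) w + -lam2 * ip m (p t) w = _ :=
        (by rw [neg_mul, neg_mul, ← sub_eq_add_neg, ← sub_eq_add_neg]; rfl :
          ip m (q' t) w + -κ * af hμ m (rp t) w + -lam2 * ip m (p t) w = _).trans (hq t ht w)
      have := residual_le (m := m) hμ hμ1 hab (by omega) hQ hP ht hq' ((hyp t ht).2.2.2 w)
        ((hyq t ht).2.2.1.mono (by positivity) hD1H hμ hμ1)
        ((hyp t ht).2.1.mono (by positivity) hD1H hμ hμ1) (hen P hP t ht w)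
      rw [abs_neg, abs_neg, ← mul_assoc, ← hD2] at this
      refine le_trans (le_of_eq ?_) this
      ring)
    (by
      rw [hp0]
      exact hinit P hP hE.left_p _ (hyp 0 h0T).2.1)
    (by
      rw [hq0]
      exact hinit Q hQ hE.left_q _ (hyq 0 h0T).2.1) t ht
  have hsup : ∀ v : Jet, SmoothFamily (N + 4) a b T R v →
      (∀ t ∈ Icc 0 T, v 0 0 t a = 0) → ∀ d : Coeff K N, SmallDual μ (D1 * H) m d →
      ∀ k, ∀ x ∈ Icc (m.lo k) (m.hi k),
        |(pw m (ritz m N (v 0 1 t) + d) k).eval x - v 0 0 t x| ≤ M0 * H :=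
      fun v hv hv0 d hd k x hx => by
    have e1 := (h2 K m (v 0 · t) R hR (hchain v hv t ht)
      (fun x hx => hv.bound 0 (N + 1) (by omega) t ht x hx)
      (fun x hx => hv.bound 0 (N + 2) (by omega) t ht x hx) (hv0 t ht) k x hx).1
    rw [← hH] at e1
    have e2 := (abs_pw_eval_le m d hx).trans
      (mul_le_mul_of_nonneg_left (hd.sup k) (by positivity : (0:ℝ) ≤ N + 1))
    have e3 : (pw m (ritz m N (v 0 1 t) + d) k).eval x - v 0 0 t x
        = ((pw m (ritz m N (v 0 1 t)) k).eval x - v 0 0 t x) + (pw m d k).eval x := by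
      rw [map_add, Pi.add_apply, Polynomial.eval_add, add_sub_right_comm]
    rw [e3]
    refine (abs_add_le _ _).trans ((add_le_add e1 e2).trans (le_of_eq ?_))
    rw [hM0]; ring
  have f1 := sum_integral_error_le (m := m) (p := p t) hab (hcont P hP t ht 0 (by omega))
    (hsup P hP hE.left_p _ (hyp t ht).2.1)
  have f2 := sum_integral_error_le (m := m) (p := q t) hab (hcont Q hQ t ht 0 (by omega))
    (hsup Q hQ hE.left_q _ (hyq t ht).2.1)
  rw [← sub_sub] at f1 f2
  have hH2 : 0 ≤ H ^ 2 := sq_nonneg H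
  calc _ ≤ (2 * ((b - a) * (M0 * H) ^ 2) + 2 * ((b - a) * (M0 * H) ^ 2)) + 2 * (C5 * (D2 * H) ^ 2) := by
        linarith
    _ = (4 * ((b - a) * M0 ^ 2) + 2 * (C5 * D2 ^ 2)) * H ^ 2 := by ring
    _ ≤ _ := mul_le_mul_of_nonneg_right (by linarith) hH2

end

section

variable {a b T : ℝ} {K N : ℕ} {m : Mesh a b K}

theorem ip_self_le_of_bound (hab : a < b) {c : Coeff K N} {M : ℝ}
    (hM : ∀ k, ∀ x ∈ Ioo (m.lo k) (m.hi k), |(pw m c k).eval x| ≤ M) :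
    ip m c c ≤ (b - a) * M ^ 2 := by
  have := integral_sq_le_of_bound hab (adm_fn m c) (m := m) (M := M) fun k x hx => by
    rw [fn_of_mem m c hx]
    exact hM k x hx
  rw [ip_apply]
  simpa only [pow_two] using this

/-- Error estimate for the discrete coefficients when the fractional term is absent. -/
theorem error_estimate_of_eq_zero (N : ℕ) {α lam1 : ℝ} (lam2 R : ℝ) (hlam : lam1 = 0)
    (hab : a < b) (hT : 0 < T) :
    ErrorEstimate N α lam1 lam2 a b T R := by
  unfold ErrorEstimate
  subst hlam
  obtain ⟨C1, hC1, h1⟩ := abs_proj_sub_le N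
  have hba : 0 < b - a := sub_pos.2 hab
  set D := (1 + (b - a)) * (2 * (C1 * R)) with hDdef
  refine ⟨1 + (4 * ((b - a) * (C1 * R) ^ 2) + 2 * (Real.exp T * (4 * D ^ 2))), by positivity,
    fun g P Q hE K m p q p' q' rp rq hD hp hq hp0 hq0 t ht => ?_⟩
  set H := m.size ^ (N + 1) with hH
  have hH0 : 0 ≤ H := pow_nonneg (m.size_pos hab).le _
  have hP := hE.smooth_p
  have hQ := hE.smooth_q
  have h0T : (0:ℝ) ∈ Icc 0 T := left_mem_Icc.2 hT.le
  have hcont : ∀ v : Jet, SmoothFamily (N + 4) a b T R v → ∀ i ≤ 1, ∀ t ∈ Icc 0 T,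
      ContinuousOn (v i 0 t) (Icc a b) := fun v hv i hi t ht => hv.continuousOn (by omega) ht
  have hproj : ∀ v : Jet, SmoothFamily (N + 4) a b T R v → ∀ t ∈ Icc 0 T, ∀ e k,
      ∀ x ∈ Icc (m.lo k) (m.hi k),
        |(pw m (proj m N e (v 0 0 t)) k).eval x - v 0 0 t x| ≤ C1 * R * H :=
      fun v hv t ht e k x hx => by
    have hc : DerivChain (N + 1) a b fun l => v 0 (0 + l) t := hv.derivChain (by omega) ht
    simp only [zero_add] at hc
    rw [mul_assoc]
    exact h1 m e _ R hc (fun x hx => hv.bound 0 (N + 1) (by omega) t ht x hx) k x hx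
  have hinit : ∀ v : Jet, SmoothFamily (N + 4) a b T R v →
      ∀ c, c = proj m N (some true) (v 0 0 0) →
      ip m (c - proj m N none (v 0 0 0)) (LinearMap.id (R := ℝ) (c - proj m N none (v 0 0 0)))
        ≤ (D * H) ^ 2 := fun v hv c hc => by
    rw [LinearMap.id_apply, hc]
    refine (ip_self_le_of_bound (M := 2 * (C1 * R) * H) hab fun k x hx => ?_).trans ?_
    · have e1 := hproj v hv 0 h0T (some true) k x (Ioo_subset_Icc_self hx)
      have e2 := hproj v hv 0 h0T none k x (Ioo_subset_Icc_self hx)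
      rw [map_sub, Pi.sub_apply, Polynomial.eval_sub]
      rw [abs_le] at e1 e2 ⊢
      constructor <;> linarith
    · rw [hDdef]
      have h0 : 0 ≤ (2 * (C1 * R) * H) ^ 2 := sq_nonneg _
      calc _ ≤ (1 + (b - a)) ^ 2 * (2 * (C1 * R) * H) ^ 2 :=
            mul_le_mul_of_nonneg_right (by nlinarith) h0
        _ = _ := by ring
  have hres : ∀ (p' q w : Coeff K N) (F G : ℝ → ℝ) (c : ℝ), ContinuousOn F (Icc a b) →
      ContinuousOn G (Icc a b) → ip m p' w + c * ip m q w
        = (∑ k, m.inner k (fun x => F x + c * G x) fun x => (pw m w k).eval x) →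
      ip m (p' - proj m N none F) w + c * ip m (q - proj m N none G) w = 0 :=
      fun p' q w F G c hF hG h => by
    have hFG : ContinuousOn (fun x => F x + c * G x) (Icc a b) :=
      hF.add (continuousOn_const.mul hG)
    rw [sum_inner_proj_none hab hFG,
      proj_add (g := fun x => c * G x) _ hF (continuousOn_const.mul hG), proj_smul] at h
    simp only [map_sub, map_add, map_smul, LinearMap.sub_apply, LinearMap.add_apply,
      LinearMap.smul_apply, smul_eq_mul] at h ⊢
    linear_combination h
  have hnn : ∀ x : Coeff K N, 0 ≤ (D * H) ^ 2 * ip m x (LinearMap.id (R := ℝ) x) :=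
    fun x => mul_nonneg (sq_nonneg _) (ip_self_nonneg m x)
  have key := energy_growth (m := m) LinearMap.id (fun x y => ip_comm m x y) (ip_self_nonneg m)
    (δ := D * H) (c := lam2) (θp := fun t => p t - proj m N none (P 0 0 t))
    (θq := fun t => q t - proj m N none (Q 0 0 t)) (θp' := fun t => p' t - proj m N none (P 1 0 t))
    (θq' := fun t => q' t - proj m N none (Q 1 0 t)) (fun _ => 0)
    (fun t ht => (hD.deriv_p t ht).sub (hP.hasDerivWithinAt_proj (by omega) none ht))
    (fun t ht => (hD.deriv_q t ht).sub (hQ.hasDerivWithinAt_proj (by omega) none ht))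
    (fun t ht => by
      have := hres (p' t) (q t) (p t - proj m N none (P 0 0 t)) (P 1 0 t) (Q 0 0 t) lam2
        (hcont P hP 1 le_rfl t ht) (hcont Q hQ 0 zero_le_one t ht)
        (by simpa only [zero_mul, add_zero] using hp t ht _)
      rw [add_zero, LinearMap.id_apply, this, sq, zero_mul]
      exact hnn _)
    (fun t ht => by
      have := hres (q' t) (p t) (q t - proj m N none (Q 0 0 t)) (Q 1 0 t) (P 0 0 t) (-lam2)
        (hcont Q hQ 1 le_rfl t ht) (hcont P hP 0 zero_le_one t ht)
        (by simpa only [zero_mul, neg_zero, add_zero, sub_zero, neg_mul, ← sub_eq_add_neg]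
          using hq t ht _)
      rw [sub_zero, LinearMap.id_apply, sub_eq_add_neg, ← neg_mul, this, sq, zero_mul]
      exact hnn _)
    (hinit P hP _ hp0) (hinit Q hQ _ hq0) t ht
  have f1 := sum_integral_error_le (m := m) (p := p t) hab (hcont P hP 0 zero_le_one t ht)
    (hproj P hP t ht none)
  have f2 := sum_integral_error_le (m := m) (p := q t) hab (hcont Q hQ 0 zero_le_one t ht)
    (hproj Q hQ t ht none)
  have hH2 : 0 ≤ H ^ 2 := sq_nonneg H
  rw [LinearMap.id_apply, LinearMap.id_apply] at key
  calc _ ≤ (2 * ((b - a) * (C1 * R * H) ^ 2) + 2 * ((b - a) * (C1 * R * H) ^ 2))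
        + 2 * (Real.exp T * (4 * (D * H) ^ 2)) := by linarith
    _ = (4 * ((b - a) * (C1 * R) ^ 2) + 2 * (Real.exp T * (4 * D ^ 2))) * H ^ 2 := by ring
    _ ≤ _ := mul_le_mul_of_nonneg_right (by linarith) hH2

/-- The squared broken norm of a complex error, split into real and imaginary parts. -/
theorem normL2_sq_eq {u : ℝ → ℂ} {F G : ℝ → ℝ} (hF : ContinuousOn F (Icc a b))
    (hG : ContinuousOn G (Icc a b)) (hu : ∀ x, F x = (u x).re ∧ G x = (u x).im) (v w : PWPoly K) :
    m.normL2 (fun k x => u x - (((v k).eval x : ℝ) + ((w k).eval x : ℝ) * Complex.I : ℂ))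
      = √((∑ k, ∫ x in (m.lo k)..(m.hi k), (F x - (v k).eval x) ^ 2)
        + ∑ k, ∫ x in (m.lo k)..(m.hi k), (G x - (w k).eval x) ^ 2) := by
  unfold Mesh.normL2
  rw [← Finset.sum_add_distrib]
  congr 1
  refine Finset.sum_congr rfl fun k _ => ?_
  have hle := (m.lo_lt_hi k).le
  have hi : ∀ {F : ℝ → ℝ} (f : Polynomial ℝ), ContinuousOn F (Icc a b) →
      IntervalIntegrable (fun x => (F x - f.eval x) ^ 2) volume (m.lo k) (m.hi k) := fun f hF => by
    refine ContinuousOn.intervalIntegrable ?_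
    rw [uIcc_of_le hle]
    exact ((hF.mono (cell_subset k)).sub f.continuous.continuousOn).pow 2
  rw [← intervalIntegral.integral_add (hi _ hF) (hi _ hG)]
  refine intervalIntegral.integral_congr fun x _ => ?_
  simp only [← Complex.normSq_eq_norm_sq, Complex.normSq_apply, (hu x).1, (hu x).2]
  simp
  ring

end

end FracLDG

end

theorem mainTheorem2
    (N : ℕ) (α lam1 lam2 a b T R : ℝ)
    (hα1 : 1 < α) (hα2 : α < 2) (hab : a < b) (hT : 0 < T) :
    ∃ C : ℝ, 0 < C ∧ ∃ h₀ : ℝ, 0 < h₀ ∧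
      ∀ g u : ℝ → ℝ → ℂ,
        FracLDG.IsExactSolution α lam1 lam2 a b T g u →
        FracLDG.BoundedSmooth (N + 4) a b T R u →
        ∀ (K : ℕ) (m : FracLDG.Mesh a b K), m.size ≤ h₀ →
          ∀ U : ℝ → FracLDG.State K,
            FracLDG.IsLDGSolution α lam1 lam2 T N m g U →
            m.IsProjMinus N (fun x => (u 0 x).re) (U 0).p →
            m.IsProjMinus N (fun x => (u 0 x).im) (U 0).q →
            ∀ t ∈ Set.Icc 0 T,
              m.normL2 (fun k x => u t x -
                ((((U t).p k).eval x : ℝ) + (((U t).q k).eval x : ℝ) * Complex.I : ℂ))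
                ≤ C * m.size ^ (N + 1) := by
  have h0T : (0:ℝ) ∈ Icc 0 T := left_mem_Icc.2 hT.le
  rcases lt_or_ge R 0 with hR | hR
  · refine ⟨1, one_pos, 1, one_pos, fun g u _ hs => absurd hR (not_lt.2 ?_)⟩
    exact (norm_nonneg _).trans (hs.2 0 (Nat.zero_le _) (0, a) ⟨h0T, left_mem_Icc.2 hab.le⟩)
  obtain ⟨C, hC, h⟩ : ∃ C : ℝ, 0 < C ∧ ∀ (g : ℝ → ℝ → ℂ) (P Q : FracLDG.Jet),
      FracLDG.ExactFamily (N + 4) α lam1 lam2 a b T R g P Q → ∀ (K : ℕ) (m : FracLDG.Mesh a b K)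
      (U : ℝ → FracLDG.State K), FracLDG.IsLDGSolution α lam1 lam2 T N m g U →
      m.IsProjMinus N (P 0 0 0) (U 0).p → m.IsProjMinus N (Q 0 0 0) (U 0).q →
      ∀ t ∈ Icc 0 T, (∑ k, ∫ x in (m.lo k)..(m.hi k), (P 0 0 t x - ((U t).p k).eval x) ^ 2)
        + (∑ k, ∫ x in (m.lo k)..(m.hi k), (Q 0 0 t x - ((U t).q k).eval x) ^ 2)
        ≤ C * (m.size ^ (N + 1)) ^ 2 := by
    obtain ⟨C, hC, h⟩ := (em (lam1 = 0)).elim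
      (fun hlam => FracLDG.error_estimate_of_eq_zero N (α := α) lam2 R hlam hab hT)
      (fun hlam => FracLDG.error_estimate_of_ne_zero N lam2 R hα1 hα2 hlam hab hT hR)
    refine ⟨C, hC, fun g P Q hE K m U hU hp0 hq0 t ht => ?_⟩
    obtain ⟨p, q, p', q', rp, rq, hD, hpq, hp, hq⟩ :=
      FracLDG.exists_discreteFamily (by omega) hα2 hT hab hE hU
    rw [← (hpq 0 h0T).1] at hp0
    rw [← (hpq 0 h0T).2] at hq0
    rw [← (hpq t ht).1, ← (hpq t ht).2]
    exact h g P Q hE K m p q p' q' rp rq hD hp hq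
      (FracLDG.eq_proj_of_isProjMinus (hE.smooth_p.continuousOn (by omega) h0T) hp0)
      (FracLDG.eq_proj_of_isProjMinus (hE.smooth_q.continuousOn (by omega) h0T) hq0) t ht
  refine ⟨√C, Real.sqrt_pos.2 hC, 1, one_pos, fun g u hu hs K m _ U hU hp0 hq0 t ht => ?_⟩
  obtain ⟨P, Q, hE, hPQ⟩ := FracLDG.exists_exactFamily (by omega) hα2 hT hab hu hs
  rw [← show P 0 0 0 = fun x => (u 0 x).re from funext fun x => (hPQ 0 x).1] at hp0
  rw [← show Q 0 0 0 = fun x => (u 0 x).im from funext fun x => (hPQ 0 x).2] at hq0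
  rw [FracLDG.normL2_sq_eq (hE.smooth_p.continuousOn (by omega) ht)
    (hE.smooth_q.continuousOn (by omega) ht) (hPQ t)]
  refine (Real.sqrt_le_sqrt (h g P Q hE K m U hU hp0 hq0 t ht)).trans ?_
  rw [Real.sqrt_mul hC.le, Real.sqrt_sq (pow_nonneg (FracLDG.Mesh.size_pos m hab).le _)]
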